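/- **Setting.** Let $d\in\{2,3\}$ and let $D\subset\mathbb R^d$ be a bounded open set with Lipschitz boundary (for instance a $C^1$ domain, or a Lipschitz polytope). $\|\cdot\|$ and $(\cdot,\cdot)$ are the norm and inner product of $L^2(D;\mathbb R^d)$, $W=H^2(D;\mathbb R^d)\cap H^1_0(D;\mathbb R^d)$ with the $H^2$ norm $\|\cdot\|_2$, and fields are extended by $0$ outside $D$. Let $\varepsilon\in(0,1)$ and let $\omega_d$ be the volume of the unit ball. The data are: * $f:[0,\infty)\to\mathbb R$, smooth, concave, positive on $(0,\infty)$, with $\lim_{r\to0^+}f(r)/r=f'(0)$ and $\lim_{r\to\infty}f(r)<\infty$, such that the derivatives of orders $1$ to $4$ of $F_1(r)=f(r^2)$ are bounded; $C_2=\sup_r|F_1''(r)|$; * a measurable $J$ with $0\le J\le M$ on $[0,1)$ and $J=0$ on $[1,\infty)$; * a continuous $\omega:\mathbb R^d\to[0,1]$, equal to $1$ at the points of $D$ whose distance from $\partial D$ is at least $\varepsilon$, and to $0$ on $\partial D$. With $S(u)=\frac{u(y)-u(x)}{|y-x|}\cdot\frac{y-x}{|y-x|}$ the peridynamic force is $$P(u)(x)=\frac{4}{\varepsilon^{d+1}\omega_d}\int_{|y-x|<\varepsilon}\omega(x)\omega(y)J\!\left(\tfrac{|y-x|}{\varepsilon}\right)f'\!\left(|y-x|S(u)^2\right)S(u)\,\frac{y-x}{|y-x|}\,dy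 ,$$ and $L_1=4C_2\,\frac1{\omega_d}\int_{|\xi|<1}\frac{J(|\xi|)}{|\xi|}d\xi$. Let $T>0$ and let $u,v\in C^2([0,T];W)$ satisfy $\partial_t u=v$, $\partial_t v=P(u)+b$ on $[0,T]$, where $b(t)\in L^2(D;\mathbb R^d)$. **Meshes.** Fix $\sigma>0$, $\kappa\ge0$. The admissible meshes of size $h>0$ are the finite conforming simplicial meshes whose elements $\mathcal T$ lie in $\overline D$, have diameter at most $h$ and contain a ball of radius $\operatorname{diam}(\mathcal T)/\sigma$. In addition, the vertices on the boundary of the meshed region lie on $\partial D$, and every point of $D$ outside the meshed region has distance at most $\kappa h^2$ from $\partial D$ (for polytopes one can mesh $\overline D$ exactly). $V_h$ is the space of continuous $\mathbb R^d$-valued fields that are affine on each element and vanish outside the meshed region; $r_h$ is the $L^2$ projection onto $V_h$. Write $t^k=k\Delta t$, $u^k=u(t^k)$, $v^k=v(t^k)$, $b^k=b(t^k)$. **Schemes**, with $u_h^k,v_h^k\in V_h$, arbitrary initial $u_h^0,v_h^0\in V_h$, and steps taken while $t^{k+1}\le T$: * *(A) Weak form, first-order system.* For $k\ge0$ and all $w\in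 V_h$: $\big(\frac{u_h^{k+1}-u_h^k}{\Delta t},w\big)=(v_h^{k+1},w)$ and $\big(\frac{v_h^{k+1}-v_h^k}{\Delta t},w\big)=(P(u_h^k),w)+(r_hb^k,w)$. * *(B) Weak form, central difference.* For all $w\in V_h$: $\big(\frac{u_h^{k+1}-2u_h^k+u_h^{k-1}}{\Delta t^2},w\big)=(P(u_h^k),w)+(r_hb^k,w)$ for $k\ge1$, and $\big(\frac{u_h^1-u_h^0}{\Delta t^2},w\big)=\frac12(P(u_h^0),w)+\frac1{\Delta t}(v_h^0,w)+\frac12(r_hb^0,w)$; here $v_h^{k+1}=(u_h^{k+1}-u_h^k)/\Delta t$ for $k\ge0$. * *(C) Strong form, central difference.* As (B), but with the equations $\frac{u_h^{k+1}-2u_h^k+u_h^{k-1}}{\Delta t^2}=P(u_h^k)+b^k$ for $k\ge1$ and $\frac{u_h^1-u_h^0}{\Delta t^2}=\frac12P(u_h^0)+\frac1{\Delta t}v_h^0+\frac12b^0$ imposed at the mesh vertices in $D$, where $b(t)$ denotes a representative continuous on $D$ (that is, force and load are replaced by their piecewise linear nodal interpolants). Put $E^k=\|u_h^k-u^k\|+\|v_h^k-v^k\|$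 and $e^0=\|u_h^0-r_hu^0\|+\|v_h^0-r_hv^0\|$. **Theorem (convergence of the central difference approximation in $L^2$).** There is a constant $c>0$ depending only on $d,D,\sigma,\kappa$ such that the following holds with (all suprema over $t\in[0,T]$) $$C_p=c\big(\sup\|u\|_2+\sup\|v\|_2\big),\qquad C_t=\sup\|\partial_t^2u\|+\sup\|\partial_t^2v\|,\qquad C_s=L_1\,c\,\sup\|u\|_2 .$$ 1. *Consistency.* For every admissible mesh, $\Delta t>0$ and $k$ with $t^{k+1}\le T$, the field $P(r_hu^k)-P(u^k)$ is in $L^2$ and $$\Big\|\partial_tu(t^{k+1})-\tfrac{u^{k+1}-u^k}{\Delta t}\Big\|+\Big\|\partial_tv(t^k)-\tfrac{v^{k+1}-v^k}{\Delta t}\Big\|+\|P(r_hu^k)-P(u^k)\|\le C_t\Delta t+C_s\tfrac{h^2}{\varepsilon^2}.$$ 2. *Scheme (A).* If $0<\Delta t<1$, then $$\sup_{k\le T/\Delta t}E^k\le C_ph^2+\exp\!\Big[\tfrac{T(1+L_1/\varepsilon^2)}{1-\Delta t}\Big]\Big(e^0+\tfrac{T}{1-\Delta t}\big(C_t\Delta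 t+C_s\tfrac{h^2}{\varepsilon^2}\big)\Big).$$ 3. *Scheme (B).* If $0<\Delta t<1$, then $$\sup_{k\le T/\Delta t}E^k\le C_ph^2+\exp\!\Big[\tfrac{T(1+L_1/\varepsilon^2)}{1-\Delta t}\Big]\Big(e^0+\tfrac{1}{1-\Delta t}\big(\max\{T,1\}\,C_t\Delta t+T\,C_s\tfrac{h^2}{\varepsilon^2}\big)\Big),$$ which is the bound of part 2 if $T\ge1$. 4. *Scheme (C), same rate.* If $0<\Delta t<1$, then, with $R=\sup\|u\|_2+\sup\|v\|_2+\sup\|\partial_t^2u\|_2+\sup\|\partial_t^2v\|_2$, $$\sup_{k\le T/\Delta t}E^k\le c\,\exp\!\Big[\tfrac{T(1+c\,MC_2/\varepsilon^2)}{1-\Delta t}\Big]\Big(e^0+\tfrac{1+T}{1-\Delta t}\big(C_t\Delta t+(1+MC_2)R\,\tfrac{h^2}{\varepsilon^2}\big)\Big).$$ 5. *Order.* Suppose $L_1>0$. For every $\delta<1$ there is a $K$, independent of $h$, $\Delta t$ and the mesh, such that for each of the three schemes $e^0=0$ and $0<\Delta t\le\delta$ imply $\sup_{k\le T/\Delta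 t}E^k\le K\big(C_t\Delta t+C_s\frac{h^2}{\varepsilon^2}\big)$. -/

import Mathlib

open MeasureTheory Set Filter Topology

namespace Peridynamics

noncomputable section

/-! ## The spaces `L²(D; ℝᵈ)` and `W = H²(D; ℝᵈ) ∩ H¹₀(D; ℝᵈ)` -/

/-- Euclidean space `ℝᵈ`. -/
abbrev E (d : ℕ) := EuclideanSpace ℝ (Fin d)

/-- `L²(D; ℝᵈ)` with its inner product. -/
abbrev L2 {d : ℕ} (D : Set (E d)) := Lp (E d) 2 (volume.restrict D)

/-- The vector fields in `C_c^∞(D; ℝᵈ)`. -/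
def TestFun {d : ℕ} (D : Set (E d)) : Submodule ℝ (E d → E d) where
  carrier := {φ | ContDiff ℝ (⊤ : ℕ∞) φ ∧ HasCompactSupport φ ∧ tsupport φ ⊆ D}
  add_mem' := by
    rintro φ ψ ⟨h1, h2, h3⟩ ⟨k1, k2, k3⟩
    exact ⟨h1.add k1, h2.add k2, (tsupport_add φ ψ).trans (union_subset h3 k3)⟩
  zero_mem' := by
    refine ⟨contDiff_const, HasCompactSupport.zero, ?_⟩
    simp [tsupport]
  smul_mem' := by
    rintro c φ ⟨h1, h2, h3⟩
    refine ⟨contDiff_const.smul h1, h2.smul_left (f := fun _ => c), ?_⟩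
    exact (closure_mono (Function.support_const_smul_subset c φ)).trans h3

/-- The partial derivative `∂ᵢ φ`. -/
def partialDeriv {d : ℕ} (i : Fin d) (φ : E d → E d) (x : E d) : E d :=
  fderiv ℝ φ x (EuclideanSpace.single i 1)

theorem TestFun.memLp {d : ℕ} {D : Set (E d)} (φ : TestFun D) :
    MemLp (φ : E d → E d) 2 (volume.restrict D) :=
  (φ.2.1.continuous.memLp_of_hasCompactSupport φ.2.2.1).restrict D

theorem TestFun.memLp_partialDeriv {d : ℕ} {D : Set (E d)} (i : Fin d) (φ : TestFun D) :
    MemLp (partialDeriv i (φ : E d → E d)) 2 (volume.restrict D) := by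
  have hc : Continuous (partialDeriv i (φ : E d → E d)) :=
    (φ.2.1.continuous_fderiv (by simp)).clm_apply continuous_const
  have hs : HasCompactSupport (partialDeriv i (φ : E d → E d)) :=
    φ.2.2.1.fderiv_apply ℝ (EuclideanSpace.single i 1)
  exact (hc.memLp_of_hasCompactSupport hs).restrict D

/-- The class of a test field in `L²(D; ℝᵈ)`. -/
def TestFun.toL2 {d : ℕ} (D : Set (E d)) : TestFun D →ₗ[ℝ] L2 D where
  toFun φ := (TestFun.memLp φ).toLp _
  map_add' _ _ := rfl
  map_smul' _ _ := rfl

/-- The class of `∂ᵢ φ` in `L²(D; ℝᵈ)` for a test field `φ`. -/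
def TestFun.partialL2 {d : ℕ} (D : Set (E d)) (i : Fin d) : TestFun D →ₗ[ℝ] L2 D where
  toFun φ := (TestFun.memLp_partialDeriv i φ).toLp _
  map_add' φ ψ := by
    rw [← MemLp.toLp_add]
    congr 1
    funext x
    have h1 := (φ.2.1.differentiable (by simp)) x
    have h2 := (ψ.2.1.differentiable (by simp)) x
    simp [partialDeriv, fderiv_add h1 h2]
  map_smul' c φ := by
    rw [← MemLp.toLp_const_smul]
    congr 1
    funext x
    have h1 := (φ.2.1.differentiable (by simp)) x
    simp [partialDeriv, fderiv_const_smul h1 c]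

/-- `g` is the weak partial derivative `∂ᵢ f` on `D`. -/
def IsWeakPartial {d : ℕ} {D : Set (E d)} (i : Fin d) (f g : L2 D) : Prop :=
  ∀ φ : TestFun D, inner ℝ (TestFun.partialL2 D i φ) f = - inner ℝ (TestFun.toL2 D φ) g

/-- `H¹₀(D; ℝᵈ)`, each element being recorded together with its gradient: the closure in the
`H¹` norm `(‖φ‖² + ∑ᵢ ‖∂ᵢ φ‖²)^{1/2}` of the test fields. -/
def H10 {d : ℕ} (D : Set (E d)) : Submodule ℝ (PiLp 2 (fun _ : Unit ⊕ Fin d => L2 D)) :=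
  (LinearMap.range ((WithLp.linearEquiv 2 ℝ (Unit ⊕ Fin d → L2 D)).symm.toLinearMap ∘ₗ
    LinearMap.pi (Sum.elim (fun _ => TestFun.toL2 D) (TestFun.partialL2 D)))).topologicalClosure

/-- A field together with its first and second partial derivatives, with the `H²` norm
`(‖u‖² + ∑ᵢ ‖∂ᵢ u‖² + ∑ᵢⱼ ‖∂ⱼ ∂ᵢ u‖²)^{1/2}`. -/
abbrev Jet {d : ℕ} (D : Set (E d)) :=
  PiLp 2 (fun _ : Unit ⊕ Fin d ⊕ Fin d × Fin d => L2 D)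

namespace Jet
variable {d : ℕ} {D : Set (E d)}

def val (z : Jet D) : L2 D := z (Sum.inl ())
def grad (z : Jet D) (i : Fin d) : L2 D := z (Sum.inr (Sum.inl i))
def hess (z : Jet D) (i j : Fin d) : L2 D := z (Sum.inr (Sum.inr (i, j)))
/-- The field with its first derivatives only. -/
def firstOrder (z : Jet D) : PiLp 2 (fun _ : Unit ⊕ Fin d => L2 D) :=
  WithLp.toLp 2 (Sum.elim (fun _ => z.val) z.grad)

end Jet

/-- `W = H²(D; ℝᵈ) ∩ H¹₀(D; ℝᵈ)`, normed by the `H²` norm. -/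
def W {d : ℕ} (D : Set (E d)) : Submodule ℝ (Jet D) where
  carrier := {z | (∀ i, IsWeakPartial i z.val (z.grad i)) ∧
    (∀ i j, IsWeakPartial j (z.grad i) (z.hess i j)) ∧ z.firstOrder ∈ H10 D}
  add_mem' := by
    rintro y z ⟨h1, h2, h3⟩ ⟨k1, k2, k3⟩
    refine ⟨fun i φ => ?_, fun i j φ => ?_, ?_⟩
    · have := h1 i φ
      have := k1 i φ
      simp only [Jet.val, Jet.grad, PiLp.add_apply, inner_add_right] at *
      linarith
    · have := h2 i j φ
      have := k2 i j φ
      simp only [Jet.hess, Jet.grad, PiLp.add_apply, inner_add_right] at *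
      linarith
    · have e : (y + z).firstOrder = y.firstOrder + z.firstOrder := by
        ext1 i
        rcases i with i | i <;> rfl
      rw [e]
      exact (H10 D).add_mem h3 k3
  zero_mem' := by
    refine ⟨fun i φ => ?_, fun i j φ => ?_, ?_⟩
    · simp [Jet.val, Jet.grad]
    · simp [Jet.hess, Jet.grad]
    · have e : (0 : Jet D).firstOrder = 0 := by
        ext1 i
        rcases i with i | i <;> rfl
      rw [e]
      exact (H10 D).zero_mem
  smul_mem' := by
    rintro c z ⟨h1, h2, h3⟩
    refine ⟨fun i φ => ?_, fun i j φ => ?_, ?_⟩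
    · have := h1 i φ
      simp only [Jet.val, Jet.grad, PiLp.smul_apply, inner_smul_right] at *
      rw [this]
      ring
    · have := h2 i j φ
      simp only [Jet.hess, Jet.grad, PiLp.smul_apply, inner_smul_right] at *
      rw [this]
      ring
    · have e : (c • z).firstOrder = c • z.firstOrder := by
        ext1 i
        rcases i with i | i <;> rfl
      rw [e]
      exact (H10 D).smul_mem c h3

/-- The element of `L²(D; ℝᵈ)` underlying an element of `W`. -/
def W.toL2 {d : ℕ} {D : Set (E d)} (w : W D) : L2 D := (w : Jet D).val

/-- The extension by zero outside `D`. -/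
def extend {d : ℕ} {D : Set (E d)} (w : L2 D) : E d → E d := D.indicator w

/-! ## The material domain and the peridynamic force -/

/-- `D` has a Lipschitz boundary (in particular, a `C¹` boundary is allowed): near each boundary
point, `D` is the region strictly above the graph of a Lipschitz function over a hyperplane. -/
def HasLipschitzBoundary {d : ℕ} (D : Set (E d)) : Prop :=
  ∀ p ∈ frontier D, ∃ n : E d, ‖n‖ = 1 ∧ ∃ (K : NNReal) (γ : (ℝ ∙ n)ᗮ → ℝ), LipschitzWith K γ ∧
    ∃ r > 0, ∀ x ∈ Metric.ball p r,
      (x ∈ D ↔ γ ((ℝ ∙ n)ᗮ.orthogonalProjectionOnto x) < inner ℝ n x)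

/-- The function `F₁(r) = f(r²)`. -/
def F1 (f : ℝ → ℝ) (r : ℝ) : ℝ := f (r ^ 2)

/-- The admissible potential functions `f : [0, ∞) → ℝ`; `f'` is the derivative on `[0, ∞)`. -/
structure IsPotential (f : ℝ → ℝ) : Prop where
  pos : ∀ r, 0 < r → 0 < f r
  smooth : ContDiffOn ℝ (⊤ : ℕ∞) f (Ici 0)
  concave : ConcaveOn ℝ (Ici 0) f
  slope : Tendsto (fun r => f r / r) (𝓝[>] 0) (𝓝 (derivWithin f (Ici 0) 0))
  limit : ∃ fInf : ℝ, Tendsto f atTop (𝓝 fInf)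
  bounded : ∀ n : ℕ, 1 ≤ n → n ≤ 4 → BddAbove (range fun r : ℝ => |iteratedDeriv n (F1 f) r|)

/-- The admissible influence functions `J`, bounded by `M`. -/
structure IsInfluence (J : ℝ → ℝ) (M : ℝ) : Prop where
  measurable : Measurable J
  nonneg : ∀ r, 0 ≤ r → r < 1 → 0 ≤ J r
  le : ∀ r, 0 ≤ r → r < 1 → J r ≤ M
  support : ∀ r, 1 ≤ r → J r = 0

/-- The boundary functions `ω`: between `0` and `1`, equal to `1` in `D` at distance at least `ε`
from the boundary, and equal to `0` on the boundary. -/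
structure IsBoundaryFunction {d : ℕ} (D : Set (E d)) (ε : ℝ) (ω : E d → ℝ) : Prop where
  continuous : Continuous ω
  nonneg : ∀ x, 0 ≤ ω x
  le_one : ∀ x, ω x ≤ 1
  eq_one : ∀ x ∈ D, ε ≤ Metric.infDist x (frontier D) → ω x = 1
  eq_zero : ∀ x ∈ frontier D, ω x = 0

/-- The volume of the unit ball of `ℝᵈ`. -/
def unitBallVolume (d : ℕ) : ℝ := (volume (Metric.ball (0 : E d) 1)).toReal

/-- The linearized strain `S(y, x; u) = (u(y) - u(x)) / |y - x| · (y - x) / |y - x|`. -/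
def strain {d : ℕ} (u : E d → E d) (y x : E d) : ℝ :=
  inner ℝ (‖y - x‖⁻¹ • (u y - u x)) (‖y - x‖⁻¹ • (y - x))

/-- The peridynamic force `-∇PD^ε(u)(x)` of a field `u` on `ℝᵈ`. -/
def force {d : ℕ} (ε : ℝ) (f J : ℝ → ℝ) (ω : E d → ℝ) (u : E d → E d) (x : E d) : E d :=
  (4 / (ε ^ (d + 1) * unitBallVolume d)) • ∫ y in Metric.ball x ε,
    (ω x * ω y * J (‖y - x‖ / ε) * derivWithin f (Ici 0) (‖y - x‖ * strain u y x ^ 2)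
      * strain u y x) • (‖y - x‖⁻¹ • (y - x))

/-- `C₂ = sup_r |F₁''(r)|`. -/
def C2 (f : ℝ → ℝ) : ℝ := ⨆ r : ℝ, |iteratedDeriv 2 (F1 f) r|

/-- `L₁ = 4 C₂ J̄₁`, where `J̄₁` is `1 / ω_d` times the integral of `J(|ξ|) / |ξ|` over the unit
ball. -/
def L1 (d : ℕ) (f J : ℝ → ℝ) : ℝ :=
  4 * C2 f * ((unitBallVolume d)⁻¹ * ∫ ξ in Metric.ball (0 : E d) 1, J ‖ξ‖ / ‖ξ‖)

/-- `(u, v)` is a solution of `u̇ = v`, `v̇ = -∇PD^ε(u) + b` on `[0, T]` with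
`u, v ∈ C²([0, T]; W)`. Derivatives in time are taken in the norm of `W`. -/
structure IsExactSolution {d : ℕ} (D : Set (E d)) (ε : ℝ) (f J : ℝ → ℝ) (ω : E d → ℝ) (T : ℝ)
    (b : ℝ → L2 D) (u v : ℝ → W D) : Prop where
  smooth_u : ContDiffOn ℝ 2 u (Icc 0 T)
  smooth_v : ContDiffOn ℝ 2 v (Icc 0 T)
  velocity : ∀ t ∈ Icc 0 T, HasDerivWithinAt u (v t) (Icc 0 T) t
  motion : ∀ t ∈ Icc 0 T, ∀ᵐ x ∂(volume.restrict D),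
    W.toL2 (derivWithin v (Icc 0 T) t) x = force ε f J ω (extend (W.toL2 (u t))) x + b t x

/-! ## Linear conforming finite elements -/

/-- A finite conforming mesh of `d`-simplices, each given by its set of vertices. -/
structure Mesh (d : ℕ) where
  elems : Finset (Finset (E d))
  card_eq : ∀ s ∈ elems, s.card = d + 1
  indep : ∀ s ∈ elems, AffineIndependent ℝ ((↑) : s → E d)
  conforming : ∀ s ∈ elems, ∀ t ∈ elems,
    convexHull ℝ (s : Set (E d)) ∩ convexHull ℝ (t : Set (E d)) =
      convexHull ℝ ((s : Set (E d)) ∩ (t : Set (E d)))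

namespace Mesh
variable {d : ℕ}

/-- The closed region covered by the mesh. -/
def region (m : Mesh d) : Set (E d) := ⋃ s ∈ m.elems, convexHull ℝ (s : Set (E d))

/-- The vertices of the mesh. -/
def vertices (m : Mesh d) : Set (E d) := ⋃ s ∈ m.elems, (s : Set (E d))

/-- `m` is a mesh of `D` of size `h` that is shape regular with parameter `σ`. The elements lie in
the closure of `D`; where `D` is curved the mesh may leave out a layer at the boundary, of width at
most `κ h²`, but its outermost vertices are on the boundary of `D`. -/
structure Fits (m : Mesh d) (D : Set (E d)) (σ κ h : ℝ) : Prop where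
  size : ∀ s ∈ m.elems, Metric.diam (convexHull ℝ (s : Set (E d))) ≤ h
  shape : ∀ s ∈ m.elems, ∃ z : E d,
    Metric.closedBall z (Metric.diam (convexHull ℝ (s : Set (E d))) / σ) ⊆
      convexHull ℝ (s : Set (E d))
  subset : m.region ⊆ closure D
  vertex : m.vertices ∩ frontier m.region ⊆ frontier D
  layer : ∀ x ∈ D \ m.region, Metric.infDist x (frontier D) ≤ κ * h ^ 2

/-- The fields of `V_h`: continuous, affine on each element, zero outside the mesh (and therefore
on its boundary). -/
def FE (m : Mesh d) : Submodule ℝ (E d → E d) where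
  carrier := {w | Continuous w ∧
    (∀ s ∈ m.elems, ∃ A : E d →ᵃ[ℝ] E d, ∀ x ∈ convexHull ℝ (s : Set (E d)), w x = A x) ∧
    ∀ x ∉ m.region, w x = 0}
  add_mem' := by
    rintro w z ⟨h1, h2, h3⟩ ⟨k1, k2, k3⟩
    refine ⟨h1.add k1, fun s hs => ?_, fun x hx => by simp [h3 x hx, k3 x hx]⟩
    obtain ⟨A, hA⟩ := h2 s hs
    obtain ⟨B, hB⟩ := k2 s hs
    exact ⟨A + B, fun x hx => by simp [hA x hx, hB x hx]⟩
  zero_mem' := ⟨continuous_const, fun s hs => ⟨0, fun x hx => by simp⟩, fun x hx => rfl⟩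
  smul_mem' := by
    rintro c w ⟨h1, h2, h3⟩
    refine ⟨h1.const_smul c, fun s hs => ?_, fun x hx => by simp [h3 x hx]⟩
    obtain ⟨A, hA⟩ := h2 s hs
    exact ⟨c • A, fun x hx => by simp [hA x hx]⟩

theorem isCompact_region (m : Mesh d) : IsCompact m.region :=
  m.elems.isCompact_biUnion fun s _ => s.finite_toSet.isCompact_convexHull ℝ

theorem finite_vertices (m : Mesh d) : m.vertices.Finite :=
  m.elems.finite_toSet.biUnion fun s _ => s.finite_toSet

theorem FE_memLp (m : Mesh d) (D : Set (E d)) (w : m.FE) :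
    MemLp (w : E d → E d) 2 (volume.restrict D) :=
  (w.2.1.memLp_of_hasCompactSupport
    (HasCompactSupport.intro m.isCompact_region w.2.2.2)).restrict D

/-- A finite element field is determined by its values at the vertices. -/
theorem FE_eq_zero (m : Mesh d) (w : m.FE) (hw : ∀ p ∈ m.vertices, (w : E d → E d) p = 0) :
    w = 0 := by
  apply Subtype.ext
  funext x
  by_cases hx : x ∈ m.region
  · simp only [region, mem_iUnion] at hx
    obtain ⟨s, hs, hx⟩ := hx
    obtain ⟨A, hA⟩ := w.2.2.1 s hs
    have hsub : convexHull ℝ (s : Set (E d)) ⊆ A ⁻¹' {0} := by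
      refine convexHull_min (fun p hp => ?_) ((convex_singleton (𝕜 := ℝ) (0 : E d)).affine_preimage A)
      have hv : p ∈ m.vertices := by
        simp only [vertices, mem_iUnion]
        exact ⟨s, hs, hp⟩
      have := hA p (subset_convexHull ℝ _ hp)
      rw [hw p hv] at this
      exact this.symm
    have := hsub hx
    simp only [mem_preimage, mem_singleton_iff] at this
    simp [hA x hx, this]
  · simp [w.2.2.2 x hx]

instance (m : Mesh d) : FiniteDimensional ℝ m.FE := by
  have : Finite m.vertices := m.finite_vertices.to_subtype
  let g : m.FE →ₗ[ℝ] (m.vertices → E d) :=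
    { toFun := fun w p => (w : E d → E d) p
      map_add' := fun _ _ => rfl
      map_smul' := fun _ _ => rfl }
  refine FiniteDimensional.of_injective g ((injective_iff_map_eq_zero g).2 fun w hw => ?_)
  exact m.FE_eq_zero w fun p hp => congrFun hw ⟨p, hp⟩

/-- The class of a finite element field in `L²(D; ℝᵈ)`. -/
def toL2 (m : Mesh d) (D : Set (E d)) : m.FE →ₗ[ℝ] L2 D where
  toFun w := (m.FE_memLp D w).toLp _
  map_add' _ _ := rfl
  map_smul' _ _ := rfl

/-- The projection `r_h` of `L²(D; ℝᵈ)` onto `V_h`, orthogonal in `L²`. -/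
def proj (m : Mesh d) (D : Set (E d)) : L2 D →L[ℝ] L2 D :=
  (LinearMap.range (m.toL2 D)).starProjection

end Mesh

/-! ## The fully discrete schemes

The time levels are `t_k = k Δt`, and a step from `t_k` to `t_{k+1}` is taken when `t_{k+1} ≤ T`. -/

section Schemes
variable {d : ℕ} (D : Set (E d)) (ε : ℝ) (f J : ℝ → ℝ) (ω : E d → ℝ) (T Δt : ℝ) (m : Mesh d)

/-- The weak scheme as a system for `(u_h^k, v_h^k)`, from `k = 0` on. -/
structure IsWeakSystemScheme (b : ℝ → L2 D) (U V : ℕ → m.FE) : Prop where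
  displacement : ∀ k : ℕ, (k + 1) * Δt ≤ T → ∀ w : m.FE,
    inner ℝ (m.toL2 D (Δt⁻¹ • (U (k + 1) - U k))) (m.toL2 D w) =
      inner ℝ (m.toL2 D (V (k + 1))) (m.toL2 D w)
  velocity : ∀ k : ℕ, (k + 1) * Δt ≤ T → ∀ w : m.FE,
    inner ℝ (m.toL2 D (Δt⁻¹ • (V (k + 1) - V k))) (m.toL2 D w) =
      (∫ x in D, inner ℝ (force ε f J ω (U k : E d → E d) x) ((w : E d → E d) x)) +
        inner ℝ (m.proj D (b (k * Δt))) (m.toL2 D w)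

/-- The weak central difference scheme with its own first step. The velocities after the
initial one are the difference quotients of the displacements. -/
structure IsWeakCentralScheme (b : ℝ → L2 D) (U V : ℕ → m.FE) : Prop where
  first : Δt ≤ T → ∀ w : m.FE,
    inner ℝ (m.toL2 D ((Δt ^ 2)⁻¹ • (U 1 - U 0))) (m.toL2 D w) =
      1 / 2 * (∫ x in D, inner ℝ (force ε f J ω (U 0 : E d → E d) x) ((w : E d → E d) x)) +
        1 / Δt * inner ℝ (m.toL2 D (V 0)) (m.toL2 D w) +
        1 / 2 * inner ℝ (m.proj D (b 0)) (m.toL2 D w)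
  step : ∀ k : ℕ, 1 ≤ k → (k + 1) * Δt ≤ T → ∀ w : m.FE,
    inner ℝ (m.toL2 D ((Δt ^ 2)⁻¹ • (U (k + 1) - (2 : ℝ) • U k + U (k - 1)))) (m.toL2 D w) =
      (∫ x in D, inner ℝ (force ε f J ω (U k : E d → E d) x) ((w : E d → E d) x)) +
        inner ℝ (m.proj D (b (k * Δt))) (m.toL2 D w)
  velocity : ∀ k : ℕ, (k + 1) * Δt ≤ T → V (k + 1) = Δt⁻¹ • (U (k + 1) - U k)

/-- The strong central difference scheme, where force and load are replaced by their continuous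
piecewise linear interpolants, that is, where the equations hold at the nodes. The load enters
through the representative `b t` that is continuous on `D`. At the vertices on the boundary
of `D` all fields vanish. -/
structure IsStrongCentralScheme (b : ℝ → E d → E d) (U V : ℕ → m.FE) : Prop where
  first : Δt ≤ T → ∀ p ∈ m.vertices ∩ D,
    (Δt ^ 2)⁻¹ • ((U 1 : E d → E d) p - (U 0 : E d → E d) p) =
      (1 / 2 : ℝ) • force ε f J ω (U 0 : E d → E d) p + (1 / Δt) • (V 0 : E d → E d) p +
        (1 / 2 : ℝ) • b 0 p
  step : ∀ k : ℕ, 1 ≤ k → (k + 1) * Δt ≤ T → ∀ p ∈ m.vertices ∩ D,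
    (Δt ^ 2)⁻¹ • ((U (k + 1) : E d → E d) p - (2 : ℝ) • (U k : E d → E d) p +
        (U (k - 1) : E d → E d) p) =
      force ε f J ω (U k : E d → E d) p + b (k * Δt) p
  velocity : ∀ k : ℕ, (k + 1) * Δt ≤ T → V (k + 1) = Δt⁻¹ • (U (k + 1) - U k)

/-- `b'` consists of representatives of the loads `b t` that are continuous on `D`. -/
def IsContinuousLoad (b : ℝ → L2 D) (b' : ℝ → E d → E d) : Prop :=
  ∀ t ∈ Icc 0 T, ContinuousOn (b' t) D ∧ b t =ᵐ[volume.restrict D] b' t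

end Schemes

section Errors
variable {d : ℕ} {D : Set (E d)}

/-- The error `E^k = ‖u_h^k - u(t_k)‖ + ‖v_h^k - v(t_k)‖`. -/
def err (m : Mesh d) (Δt : ℝ) (u v : ℝ → W D) (U V : ℕ → m.FE) (k : ℕ) : ℝ :=
  ‖m.toL2 D (U k) - W.toL2 (u (k * Δt))‖ + ‖m.toL2 D (V k) - W.toL2 (v (k * Δt))‖

/-- The initial error `e⁰ = ‖u_h^0 - r_h(u(0))‖ + ‖v_h^0 - r_h(v(0))‖`. -/
def initErr (m : Mesh d) (u v : ℝ → W D) (U V : ℕ → m.FE) : ℝ :=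
  ‖m.toL2 D (U 0) - m.proj D (W.toL2 (u 0))‖ + ‖m.toL2 D (V 0) - m.proj D (W.toL2 (v 0))‖

/-- `sup_{0 ≤ t ≤ T} ‖w(t)‖₂`, with the `H²` norm. -/
def supH2 (T : ℝ) (w : ℝ → W D) : ℝ := ⨆ t : Icc (0 : ℝ) T, ‖w t‖

/-- `sup_{0 ≤ t ≤ T} ‖w(t)‖`, with the `L²` norm. -/
def supL2 (T : ℝ) (w : ℝ → W D) : ℝ := ⨆ t : Icc (0 : ℝ) T, ‖W.toL2 (w t)‖

/-- The second time derivative on `[0, T]`. -/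
def secondDeriv (T : ℝ) (w : ℝ → W D) : ℝ → W D := iteratedDerivWithin 2 w (Icc 0 T)

/-- `C_p = c (sup ‖u‖₂ + sup ‖∂ₜu‖₂)`, where `v = ∂ₜu`. -/
def Cp (c T : ℝ) (u v : ℝ → W D) : ℝ := c * (supH2 T u + supH2 T v)

/-- `C_t = sup ‖∂ₜₜu‖ + sup ‖∂ₜₜv‖`. -/
def Ct (T : ℝ) (u v : ℝ → W D) : ℝ := supL2 T (secondDeriv T u) + supL2 T (secondDeriv T v)

/-- `C_s = L₁ c sup ‖u‖₂`. -/
def Cs (c T : ℝ) (f J : ℝ → ℝ) (u : ℝ → W D) : ℝ := L1 d f J * c * supH2 T u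

/-- The sum of the `H²` norms of the solution and of its second time derivatives. -/
def solutionH2 (T : ℝ) (u v : ℝ → W D) : ℝ :=
  supH2 T u + supH2 T v + supH2 T (secondDeriv T u) + supH2 T (secondDeriv T v)

/-- The spatial truncation error `σ^k = -∇PD^ε(r_h(u(t_k))) + ∇PD^ε(u(t_k))`. -/
def spaceTruncation (m : Mesh d) (ε : ℝ) (f J : ℝ → ℝ) (ω : E d → ℝ) (Δt : ℝ) (u : ℝ → W D)
    (k : ℕ) (x : E d) : E d :=
  force ε f J ω (extend (m.proj D (W.toL2 (u (k * Δt))))) x -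
    force ε f J ω (extend (W.toL2 (u (k * Δt)))) x

/-- The truncation error of the step from `t_k` to `t_{k+1}`:
`‖∂ₜu(t_{k+1}) - (u(t_{k+1}) - u(t_k)) / Δt‖ + ‖∂ₜv(t_k) - (v(t_{k+1}) - v(t_k)) / Δt‖ + ‖σ^k‖`. -/
def truncation (m : Mesh d) (ε : ℝ) (f J : ℝ → ℝ) (ω : E d → ℝ) (T Δt : ℝ) (u v : ℝ → W D)
    (k : ℕ) : ℝ :=
  ‖W.toL2 (derivWithin u (Icc 0 T) ((k + 1) * Δt) -
      Δt⁻¹ • (u ((k + 1) * Δt) - u (k * Δt)))‖ +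
    ‖W.toL2 (derivWithin v (Icc 0 T) (k * Δt) - Δt⁻¹ • (v ((k + 1) * Δt) - v (k * Δt)))‖ +
    (eLpNorm (spaceTruncation m ε f J ω Δt u k) 2 (volume.restrict D)).toReal

end Errors

end

end Peridynamics

open Peridynamics

open scoped ENNReal

namespace Peridynamics

/-! ### Cauchy–Schwarz and Schur's test in `L²`. -/

section L2Inequalities

variable {α ε : Type*} [MeasurableSpace α] {μ : Measure α}

/-! The theorem combines stability of the force, consistency in time, and second order approximation
in space.

Stability. Since `f'(r S²) S = F₁'(√r S) / (2 √r)`, a bond force is Lipschitz in the strain with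
constant `C₂/2`, whatever the bond length (`IsPotential.abs_bond_sub_le`). The strain costs a factor
`1/|ξ|`, so a difference of forces is dominated by integrals against the kernel `J(|ξ|/ε)/|ξ|`.
Schur's test and scaling then show that the force is Lipschitz in `L²` with constant `L₁/ε²`
(`eLpNorm_force_sub_le`). Measured against `r_h u` and `r_h v`, the errors of schemes (A) and (B)
obey the same recursion, because the first step of (B) is a step of (A) with half the force.
Taylor's formula bounds the time defects, the projection error of `u` gives the space defect, and a
discrete Gronwall inequality (`add_le_exp_mul_of_step`) adds them up in
`norm_add_norm_le_of_velocity_eq`.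

Approximation. What is needed is `‖w - r_h w‖ ≤ c h² ‖w‖₂` on `W`; the projection is a best
approximation, so the nodal interpolant may take its place. Point values first have to be given a
meaning. One mean value estimate for Taylor remainders on convex sets, `lintegral_taylorRem_le`,
valid for `d ≤ 3`, yields both a Sobolev inequality and the interpolation error for smooth
functions. The Sobolev inequality, applied on a cone of translations that preserve the Lipschitz
domain, makes mollifications converge at every point of `D`; the limit is `rep w`. At the boundary
two facts meet: fields in `H¹₀`, extended by zero, change by `O(|y|)` in `L²` under a translation by
`y`, and a Lipschitz domain can be left locally in one fixed direction. Hence `rep w` tends to zero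
at the boundary (`tendsto_rep_boundary`) and is `O(δ)` in `L²` on a boundary layer of width `δ`
(`exists_layer_bound`), which covers the layer of width `κ h²` left out by the mesh. On the elements
the error bound is obtained on shrunken simplices and passed to the limit
(`enorm_rep_sub_interp_le`). That the interpolant belongs to `V_h` is a combinatorial consequence of
conformity (`nodal_frontier`).

Strong form. Here the force is sampled at vertices, and point values are not controlled by the `L²`
norm. The remedy is `exists_norm_nodal_forceError_le`: the star of an interior vertex contains a
ball of comparable volume (`exists_star_ball`). Bonds shorter than its radius see only the star,
where an inverse estimate for affine functions applies; longer bonds are compared with the bonds of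
all points of the ball and averaged. The equation of motion holds at every point of `D` by
continuity, so the discrete solution can be compared with the interpolants of `u` and `v`, and the
same Gronwall argument concludes.

Order. For `L₁ > 0` every `h²` term is a multiple of `C_s h²/ε²`, with a factor depending on the
solution: if `sup ‖u‖₂ = 0`, then `v` and all time derivatives vanish too. -/

theorem eLpNorm_two_sq [TopologicalSpace ε] [ContinuousENorm ε] (f : α → ε) (μ : Measure α) :
    eLpNorm f 2 μ ^ 2 = ∫⁻ x, ‖f x‖ₑ ^ 2 ∂μ := by
  rw [eLpNorm_eq_lintegral_rpow_enorm_toReal (by norm_num) (by norm_num)]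
  simp only [ENNReal.toReal_ofNat, ENNReal.rpow_ofNat]
  rw [← ENNReal.rpow_natCast, ← ENNReal.rpow_mul]
  norm_num

theorem lintegral_mul_le_eLpNorm_two {f g : α → ℝ≥0∞} (hf : AEMeasurable f μ)
    (hg : AEMeasurable g μ) : ∫⁻ x, f x * g x ∂μ ≤ eLpNorm f 2 μ * eLpNorm g 2 μ := by
  have := ENNReal.lintegral_mul_le_Lp_mul_Lq μ Real.HolderConjugate.two_two hf hg
  rw [eLpNorm_eq_lintegral_rpow_enorm_toReal (by norm_num) (by norm_num),
    eLpNorm_eq_lintegral_rpow_enorm_toReal (by norm_num) (by norm_num)]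
  simpa using this

/-- Cauchy–Schwarz for the splitting `k f = √k · (√k f)`, that is, with respect to the measure of
density `k`. -/
theorem sq_lintegral_mul_le {k f : α → ℝ≥0∞} (hk : AEMeasurable k μ) (hf : AEMeasurable f μ) :
    (∫⁻ x, k x * f x ∂μ) ^ 2 ≤ (∫⁻ x, k x ∂μ) * ∫⁻ x, k x * f x ^ 2 ∂μ := by
  have hsq : ∀ a : ℝ≥0∞, (a ^ (1 / 2 : ℝ)) ^ 2 = a := fun a => by
    rw [← ENNReal.rpow_natCast, ← ENNReal.rpow_mul]; norm_num
  have h := lintegral_mul_le_eLpNorm_two (μ := μ) (f := fun x => k x ^ (1 / 2 : ℝ))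
    (g := fun x => k x ^ (1 / 2 : ℝ) * f x) (hk.pow_const _) ((hk.pow_const _).mul hf)
  have e1 : ∀ x, k x ^ (1 / 2 : ℝ) * (k x ^ (1 / 2 : ℝ) * f x) = k x * f x := fun x => by
    rw [← mul_assoc, ← sq, hsq]
  simp only [e1] at h
  have h2 := pow_le_pow_left' h 2
  rw [mul_pow, eLpNorm_two_sq, eLpNorm_two_sq] at h2
  simpa only [enorm_eq_self, mul_pow, hsq] using h2

/-- Schur's test for translation invariant kernels. -/
theorem eLpNorm_lintegral_translate_le {d : ℕ} {k f : E d → ℝ≥0∞} (hk : Measurable k)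
    (hf : Measurable f) :
    eLpNorm (fun x => ∫⁻ ξ, k ξ * f (x + ξ)) 2 volume ≤ (∫⁻ ξ, k ξ) * eLpNorm f 2 volume := by
  have hm : Measurable fun p : E d × E d => k p.2 * f (p.1 + p.2) ^ 2 := by fun_prop
  have key : eLpNorm (fun x => ∫⁻ ξ, k ξ * f (x + ξ)) 2 volume ^ 2 ≤
      ((∫⁻ ξ, k ξ) * eLpNorm f 2 volume) ^ 2 := by
    -- After squaring: Cauchy–Schwarz with weight `k`, Tonelli, and translation invariance of the
    -- inner integral.
    rw [eLpNorm_two_sq, mul_pow, eLpNorm_two_sq]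
    simp only [enorm_eq_self]
    calc ∫⁻ x, (∫⁻ ξ, k ξ * f (x + ξ)) ^ 2
        ≤ ∫⁻ x, (∫⁻ ξ, k ξ) * ∫⁻ ξ, k ξ * f (x + ξ) ^ 2 :=
          lintegral_mono fun x => sq_lintegral_mul_le (by fun_prop) (by fun_prop)
      _ = (∫⁻ ξ, k ξ) * ∫⁻ x, ∫⁻ ξ, k ξ * f (x + ξ) ^ 2 :=
          lintegral_const_mul _ hm.lintegral_prod_right'
      _ = (∫⁻ ξ, k ξ) * ∫⁻ ξ, ∫⁻ x, k ξ * f (x + ξ) ^ 2 := by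
          rw [lintegral_lintegral_swap hm.aemeasurable]
      _ = (∫⁻ ξ, k ξ) * ∫⁻ ξ, k ξ * ∫⁻ x, f x ^ 2 := by
          congr 1
          refine lintegral_congr fun ξ => ?_
          rw [lintegral_const_mul _ (by fun_prop)]
          rw [lintegral_add_right_eq_self (fun x => f x ^ 2) ξ]
      _ = (∫⁻ ξ, k ξ) ^ 2 * ∫⁻ x, f x ^ 2 := by
          rw [lintegral_mul_const _ hk, ← mul_assoc, ← sq]
  exact (ENNReal.pow_le_pow_left_iff (by norm_num)).1 key

end L2Inequalities

/-! ### Change of variables under homotheties. -/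

section Homothety

variable {d : ℕ}

theorem lintegral_comp_homothety (p : E d) {r : ℝ} (hr : r ≠ 0) {f : E d → ℝ≥0∞}
    (hf : Measurable f) :
    ∫⁻ x, f (AffineMap.homothety p r x) = ENNReal.ofReal |(r ^ d)⁻¹| * ∫⁻ x, f x := by
  have h1 : ∀ x, f (AffineMap.homothety p r x) = (fun y => f (y + (p - r • p))) (r • x) := by
    intro x
    congr 1
    simp only [AffineMap.homothety_apply, vsub_eq_sub, vadd_eq_add, smul_sub]
    abel
  simp only [h1]
  have h2 := lintegral_map (μ := (volume : Measure (E d))) (f := fun y => f (y + (p - r • p)))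
    (g := fun x => r • x) (by fun_prop) (by fun_prop)
  rw [← h2, Measure.map_addHaar_smul _ hr, lintegral_smul_measure, finrank_euclideanSpace_fin,
    lintegral_add_right_eq_self, smul_eq_mul]

end Homothety

/-! ### Taylor remainders, averaged over the centre of expansion. -/

section Taylor

variable {d : ℕ} {F : Type*} [NormedAddCommGroup F] [NormedSpace ℝ F] [CompleteSpace F]

/-- The first order Taylor remainder at `p` of the expansion about `x`. -/
noncomputable def taylorRem (φ : E d → F) (x p : E d) : F := φ p - φ x - fderiv ℝ φ x (p - x)

/-- This is the integral form of the remainder. The point `x + t (p - x)` is written as the image of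
`x` under the homothety about `p` with ratio `1 - t`: later `p` is fixed and the bound is integrated
in `x`, which becomes a linear change of variables. -/
theorem enorm_taylorRem_le {φ : E d → F} (hφ : ContDiff ℝ 2 φ) (x p : E d) {h : ℝ}
    (hh : ‖p - x‖ ≤ h) :
    ‖taylorRem φ x p‖ₑ ≤ ∫⁻ t in Ioo (0 : ℝ) 1, ENNReal.ofReal ((1 - t) * h ^ 2) *
      ‖fderiv ℝ (fderiv ℝ φ) (AffineMap.homothety p (1 - t) x)‖ₑ := by
  set v := p - x
  have hφ1 : ContDiff ℝ 1 (fderiv ℝ φ) := hφ.fderiv_right (by norm_num)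
  have hd0 : ∀ y, HasFDerivAt φ (fderiv ℝ φ y) y := fun y =>
    (hφ.differentiable (by norm_num) y).hasFDerivAt
  have hd1 : ∀ y, HasFDerivAt (fderiv ℝ φ) (fderiv ℝ (fderiv ℝ φ) y) y := fun y =>
    (hφ1.differentiable (by norm_num) y).hasFDerivAt
  have hl : ∀ t : ℝ, HasDerivAt (fun t : ℝ => x + t • v) v t := fun t => by
    simpa using ((hasDerivAt_id t).smul_const v).const_add x
  have hg0 : ∀ t : ℝ, HasDerivAt (fun t : ℝ => φ (x + t • v)) (fderiv ℝ φ (x + t • v) v) t :=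
    fun t => (hd0 _).comp_hasDerivAt t (hl t)
  have hg1 : ∀ t : ℝ, HasDerivAt (fun t : ℝ => fderiv ℝ φ (x + t • v) v)
      (fderiv ℝ (fderiv ℝ φ) (x + t • v) v v) t := fun t =>
    ((hd1 _).comp_hasDerivAt t (hl t)).clm_apply (hasDerivAt_const t v) |>.congr_deriv (by simp)
  -- The first derivative terms cancel in this combination, and its increment over `[0, 1]` is
  -- exactly the remainder.
  have hG : ∀ t : ℝ, HasDerivAt
      (fun t : ℝ => φ (x + t • v) + (1 - t) • fderiv ℝ φ (x + t • v) v)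
      ((1 - t) • fderiv ℝ (fderiv ℝ φ) (x + t • v) v v) t := fun t =>
    ((hg0 t).add (((hasDerivAt_id t).const_sub 1).smul (hg1 t))).congr_deriv (by simp)
  have hcont : Continuous fun t : ℝ => (1 - t) • fderiv ℝ (fderiv ℝ φ) (x + t • v) v v := by
    have : Continuous (fderiv ℝ (fderiv ℝ φ)) := hφ1.continuous_fderiv (by norm_num)
    fun_prop
  have hint := intervalIntegral.integral_eq_sub_of_hasDerivAt (a := 0) (b := 1)
    (fun t _ => hG t) (hcont.intervalIntegrable 0 1)
  have e : taylorRem φ x p = ∫ t in (0:ℝ)..1, (1 - t) • fderiv ℝ (fderiv ℝ φ) (x + t • v) v v := by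
    rw [hint]
    simp [taylorRem, v]
    abel
  rw [e, intervalIntegral.integral_of_le zero_le_one]
  refine (enorm_integral_le_lintegral_enorm _).trans ?_
  rw [restrict_Ioo_eq_restrict_Ioc]
  refine setLIntegral_mono_ae' measurableSet_Ioc (.of_forall fun t ht => ?_)
  have hpt : AffineMap.homothety p (1 - t) x = x + t • v := by
    simp only [AffineMap.homothety_apply, vsub_eq_sub, vadd_eq_add, v]
    module
  rw [hpt, ← ofReal_norm, ← ofReal_norm, ← ENNReal.ofReal_mul
    (mul_nonneg (by linarith [ht.2]) (sq_nonneg h))]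
  refine ENNReal.ofReal_le_ofReal ?_
  rw [norm_smul, Real.norm_eq_abs, abs_of_nonneg (by linarith [ht.2] : (0:ℝ) ≤ 1 - t)]
  rw [mul_assoc]
  refine mul_le_mul_of_nonneg_left ?_ (by linarith [ht.2])
  have h1 := (fderiv ℝ (fderiv ℝ φ) (x + t • v)).le_opNorm₂ v v
  have h2 : ‖v‖ * ‖v‖ ≤ h ^ 2 := by nlinarith [norm_nonneg v]
  calc _ ≤ _ := h1
    _ = ‖fderiv ℝ (fderiv ℝ φ) (x + t • v)‖ * (‖v‖ * ‖v‖) := by ring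
    _ ≤ _ := by rw [mul_comm (h ^ 2)]; gcongr

/-- The weight `1 - t` of Taylor's formula competes with the factor `(1 - t)^(-d/2)` that a
homothety of ratio `1 - t` produces in `L²`. For `d ≤ 3` the product is at most `(1 - t)^(-1/2)`,
whose integral is `2`; for `d = 4` the integral would diverge. -/
theorem lintegral_one_sub_rpow_le (hd : d ≤ 3) :
    ∫⁻ t in Ioo (0 : ℝ) 1, ENNReal.ofReal ((1 - t) * ((1 - t) ^ (-(d : ℝ) / 2))) ≤ 2 := by
  have h1 : ∀ t ∈ Ioo (0 : ℝ) 1, (1 - t) * ((1 - t) ^ (-(d : ℝ) / 2)) ≤ (1 - t) ^ (-(1 : ℝ) / 2) := by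
    intro t ht
    have h0 : 0 < 1 - t := by linarith [ht.2]
    nth_rewrite 1 [← Real.rpow_one (1 - t)]
    rw [← Real.rpow_add h0]
    refine Real.rpow_le_rpow_of_exponent_ge h0 (by linarith [ht.1]) ?_
    have : (d : ℝ) ≤ 3 := by exact_mod_cast hd
    linarith
  have hi : IntervalIntegrable (fun t : ℝ => t ^ (-(1 : ℝ) / 2)) volume 0 1 :=
    intervalIntegral.intervalIntegrable_rpow' (by norm_num)
  have hi' : IntervalIntegrable (fun t : ℝ => (1 - t) ^ (-(1 : ℝ) / 2)) volume 0 1 := by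
    simpa using (hi.comp_sub_left 1).symm
  calc _ ≤ ∫⁻ t in Ioo (0 : ℝ) 1, ENNReal.ofReal ((1 - t) ^ (-(1 : ℝ) / 2)) :=
        setLIntegral_mono' measurableSet_Ioo fun t ht => ENNReal.ofReal_le_ofReal (h1 t ht)
    _ = ∫⁻ t in Ioc (0 : ℝ) 1, ENNReal.ofReal ((1 - t) ^ (-(1 : ℝ) / 2)) := by
        rw [restrict_Ioo_eq_restrict_Ioc]
    _ = ENNReal.ofReal (∫ t in (0:ℝ)..1, (1 - t) ^ (-(1 : ℝ) / 2)) := by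
        rw [intervalIntegral.integral_of_le zero_le_one, ofReal_integral_eq_lintegral_ofReal]
        · exact (intervalIntegrable_iff_integrableOn_Ioc_of_le zero_le_one).1 hi'
        · refine (ae_restrict_iff' measurableSet_Ioc).2 (.of_forall fun t ht => ?_)
          exact Real.rpow_nonneg (by linarith [ht.2]) _
    _ ≤ 2 := by
        rw [intervalIntegral.integral_comp_sub_left (fun t : ℝ => t ^ (-(1 : ℝ) / 2)) 1,
          integral_rpow (by norm_num)]
        norm_num

/-- On a convex set the first order Taylor remainders at a fixed point are controlled in the mean
by the second derivatives in `L²`. This is where `d ≤ 3` enters. -/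
theorem lintegral_taylorRem_le (hd : d ≤ 3) {φ : E d → F} (hφ : ContDiff ℝ 2 φ) {K : Set (E d)}
    (hK : Convex ℝ K) (hKm : MeasurableSet K) {h : ℝ} (hh : ∀ x ∈ K, ∀ y ∈ K, ‖x - y‖ ≤ h)
    {p : E d} (hp : p ∈ K) :
    ∫⁻ x in K, ‖taylorRem φ x p‖ₑ ≤ ENNReal.ofReal (2 * h ^ 2) *
      (volume K ^ (1 / 2 : ℝ) * eLpNorm (fun x => ‖fderiv ℝ (fderiv ℝ φ) x‖ₑ) 2 (volume.restrict K)) := by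
  set N : E d → ℝ≥0∞ := K.indicator fun x => ‖fderiv ℝ (fderiv ℝ φ) x‖ₑ
  have hφ1 : ContDiff ℝ 1 (fderiv ℝ φ) := hφ.fderiv_right (by norm_num)
  have hc2 : Continuous (fderiv ℝ (fderiv ℝ φ)) := hφ1.continuous_fderiv (by norm_num)
  have hN : Measurable N := by
    refine Measurable.indicator ?_ hKm
    simpa only [ofReal_norm] using hc2.norm.measurable.ennreal_ofReal
  have hmem : ∀ x ∈ K, ∀ t ∈ Ioo (0 : ℝ) 1, AffineMap.homothety p (1 - t) x ∈ K := by
    intro x hx t ht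
    rw [AffineMap.homothety_apply]
    have := hK hp hx (a := t) (b := 1 - t) ht.1.le (by linarith [ht.2]) (by ring)
    convert this using 1
    simp only [vsub_eq_sub, vadd_eq_add]
    module
  have hN2 : eLpNorm N 2 volume = eLpNorm (fun x => ‖fderiv ℝ (fderiv ℝ φ) x‖ₑ) 2 (volume.restrict K) :=
    eLpNorm_indicator_eq_eLpNorm_restrict hKm
  -- Cauchy–Schwarz on `K` gives `|K|^(1/2)`, and the homothety is then undone on the whole space;
  -- this loses nothing because `N` vanishes off `K`.
  have hscale : ∀ t ∈ Ioo (0 : ℝ) 1, ∫⁻ x in K, N (AffineMap.homothety p (1 - t) x) ≤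
      ENNReal.ofReal ((1 - t) ^ (-(d : ℝ) / 2)) * (volume K ^ (1 / 2 : ℝ) * eLpNorm N 2 volume) := by
    intro t ht
    have h0 : 0 < 1 - t := by linarith [ht.2]
    have hmt : Measurable fun x => N (AffineMap.homothety p (1 - t) x) :=
      hN.comp (AffineMap.continuous_of_finiteDimensional _).measurable
    have h1 := lintegral_mul_le_eLpNorm_two (μ := volume.restrict K) (f := fun _ => 1)
      (g := fun x => N (AffineMap.homothety p (1 - t) x)) aemeasurable_const hmt.aemeasurable
    simp only [one_mul] at h1
    have h2 : eLpNorm (fun _ : E d => (1 : ℝ≥0∞)) 2 (volume.restrict K) =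
        volume K ^ (1 / 2 : ℝ) := by
      rw [eLpNorm_eq_lintegral_rpow_enorm_toReal (by norm_num) (by norm_num)]
      simp
    have h3 : eLpNorm (fun x => N (AffineMap.homothety p (1 - t) x)) 2 volume =
        ENNReal.ofReal ((1 - t) ^ (-(d : ℝ) / 2)) * eLpNorm N 2 volume := by
      rw [eLpNorm_eq_lintegral_rpow_enorm_toReal (by norm_num) (by norm_num),
        eLpNorm_eq_lintegral_rpow_enorm_toReal (by norm_num) (by norm_num)]
      simp only [enorm_eq_self, ENNReal.toReal_ofNat]
      rw [lintegral_comp_homothety p h0.ne' (f := fun x => N x ^ (2 : ℝ)) (by fun_prop),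
        ENNReal.mul_rpow_of_nonneg _ _ (by norm_num), abs_of_pos (by positivity),
        ENNReal.ofReal_rpow_of_nonneg (by positivity) (by norm_num)]
      congr 2
      rw [← Real.rpow_natCast, ← Real.rpow_neg h0.le, ← Real.rpow_mul h0.le]
      congr 1
      ring
    calc _ ≤ _ := h1
      _ ≤ volume K ^ (1 / 2 : ℝ) * (ENNReal.ofReal ((1 - t) ^ (-(d : ℝ) / 2)) * eLpNorm N 2 volume) := by
          rw [h2, ← h3]
          gcongr
          exact Measure.restrict_le_self
      _ = _ := by ring
  have hjm : Measurable fun q : E d × ℝ => ENNReal.ofReal ((1 - q.2) * h ^ 2) *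
      N (AffineMap.homothety p (1 - q.2) q.1) := by
    have : Measurable fun q : E d × ℝ => AffineMap.homothety p (1 - q.2) q.1 := by
      simp only [AffineMap.homothety_apply, vsub_eq_sub, vadd_eq_add]
      fun_prop
    exact (by fun_prop : Measurable fun q : E d × ℝ => ENNReal.ofReal ((1 - q.2) * h ^ 2)).mul
      (hN.comp this)
  calc ∫⁻ x in K, ‖taylorRem φ x p‖ₑ
      ≤ ∫⁻ x in K, ∫⁻ t in Ioo (0 : ℝ) 1, ENNReal.ofReal ((1 - t) * h ^ 2) *
          N (AffineMap.homothety p (1 - t) x) := by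
        refine setLIntegral_mono' hKm fun x hx => ?_
        refine (enorm_taylorRem_le hφ x p (hh p hp x hx)).trans ?_
        refine setLIntegral_mono' measurableSet_Ioo fun t ht => ?_
        simp [N, hmem x hx t ht]
    _ = ∫⁻ t in Ioo (0 : ℝ) 1, ∫⁻ x in K, ENNReal.ofReal ((1 - t) * h ^ 2) *
          N (AffineMap.homothety p (1 - t) x) := lintegral_lintegral_swap hjm.aemeasurable
    _ ≤ ∫⁻ t in Ioo (0 : ℝ) 1, ENNReal.ofReal ((1 - t) * ((1 - t) ^ (-(d : ℝ) / 2))) *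
          (ENNReal.ofReal (h ^ 2) * (volume K ^ (1 / 2 : ℝ) * eLpNorm N 2 volume)) := by
        refine setLIntegral_mono' measurableSet_Ioo fun t ht => ?_
        have h0 : 0 ≤ 1 - t := by linarith [ht.2]
        have hmt : Measurable fun x => N (AffineMap.homothety p (1 - t) x) :=
          hN.comp (AffineMap.continuous_of_finiteDimensional _).measurable
        rw [lintegral_const_mul _ hmt]
        refine (mul_le_mul_right (hscale t ht) _).trans (le_of_eq ?_)
        rw [ENNReal.ofReal_mul h0, ENNReal.ofReal_mul h0]
        ring
    _ = (∫⁻ t in Ioo (0 : ℝ) 1, ENNReal.ofReal ((1 - t) * ((1 - t) ^ (-(d : ℝ) / 2)))) *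
          (ENNReal.ofReal (h ^ 2) * (volume K ^ (1 / 2 : ℝ) * eLpNorm N 2 volume)) :=
        lintegral_mul_const _ (by fun_prop)
    _ ≤ 2 * (ENNReal.ofReal (h ^ 2) * (volume K ^ (1 / 2 : ℝ) * eLpNorm N 2 volume)) := by
        gcongr
        exact lintegral_one_sub_rpow_le hd
    _ = _ := by
        rw [hN2, ENNReal.ofReal_mul (by norm_num : (0:ℝ) ≤ 2)]
        simp [mul_assoc]

end Taylor

end Peridynamics

namespace Peridynamics

/-! ### Interpolation error and Sobolev inequality for smooth functions on convex sets. -/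

section SmoothEstimates

variable {d : ℕ} {F : Type*} [NormedAddCommGroup F] [NormedSpace ℝ F] [CompleteSpace F]

/-- Integrating a constant over `K` produces `|K|`, Cauchy–Schwarz on the other side only
`|K|^(1/2)`; this cancels the common half power. -/
theorem volume_mul_enorm_le_of_rpow {a b v : ℝ≥0∞} (hv0 : v ≠ 0) (hv : v ≠ ⊤)
    (h : v * a ≤ v ^ (1 / 2 : ℝ) * b) : v ^ (1 / 2 : ℝ) * a ≤ b := by
  have e : v = v ^ (1 / 2 : ℝ) * v ^ (1 / 2 : ℝ) := by
    rw [← ENNReal.rpow_add _ _ hv0 hv]; norm_num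
  have h0 : v ^ (1 / 2 : ℝ) ≠ 0 := by simp [hv0, hv]
  have h1 : v ^ (1 / 2 : ℝ) ≠ ⊤ := by simp [hv0, hv]
  rw [e, mul_assoc, ← e] at h
  exact (ENNReal.mul_le_mul_iff_right h0 h1).1 h

theorem eLpNorm_const_one (K : Set (E d)) :
    eLpNorm (fun _ : E d => (1 : ℝ≥0∞)) 2 (volume.restrict K) = volume K ^ (1 / 2 : ℝ) := by
  rw [eLpNorm_eq_lintegral_rpow_enorm_toReal (by norm_num) (by norm_num)]
  simp

theorem setLIntegral_le_eLpNorm {K : Set (E d)} {N : E d → ℝ≥0∞} (hN : Measurable N) :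
    ∫⁻ x in K, N x ≤ volume K ^ (1 / 2 : ℝ) * eLpNorm N 2 (volume.restrict K) := by
  have := lintegral_mul_le_eLpNorm_two (μ := volume.restrict K) (f := fun _ => 1)
    (g := N) aemeasurable_const hN.aemeasurable
  simpa only [one_mul, eLpNorm_const_one] using this

/-- Linear interpolation error of a smooth function on a convex set. -/
theorem enorm_sub_interp_le (hd : d ≤ 3) {φ : E d → F} (hφ : ContDiff ℝ 2 φ) {K : Set (E d)}
    (hK : Convex ℝ K) (hKm : MeasurableSet K) (hK0 : volume K ≠ 0) (hKt : volume K ≠ ⊤) {h : ℝ}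
    (hh : ∀ x ∈ K, ∀ y ∈ K, ‖x - y‖ ≤ h) {ι : Type*} (s : Finset ι) (w : ι → ℝ) (v : ι → E d)
    (hw : ∀ i ∈ s, 0 ≤ w i) (hw1 : ∑ i ∈ s, w i = 1) (hv : ∀ i ∈ s, v i ∈ K) :
    volume K ^ (1 / 2 : ℝ) * ‖φ (∑ i ∈ s, w i • v i) - ∑ i ∈ s, w i • φ (v i)‖ₑ ≤
      ENNReal.ofReal (4 * h ^ 2) *
        eLpNorm (fun x => ‖fderiv ℝ (fderiv ℝ φ) x‖ₑ) 2 (volume.restrict K) := by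
  set q := ∑ i ∈ s, w i • v i
  set N := eLpNorm (fun x => ‖fderiv ℝ (fderiv ℝ φ) x‖ₑ) 2 (volume.restrict K)
  have hq : q ∈ K := hK.sum_mem hw hw1 hv
  have hcf : Continuous (fderiv ℝ φ) := hφ.continuous_fderiv (by norm_num)
  have hct : ∀ p, Continuous fun x => taylorRem φ x p := fun p => by
    have := hφ.continuous
    unfold taylorRem
    fun_prop
  have hm : ∀ p, Measurable fun x => ‖taylorRem φ x p‖ₑ := fun p => (hct p).enorm.measurable
  -- Convex combinations reproduce affine functions, so the Taylor polynomial about `x` drops out of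
  -- the interpolation error and only remainders are left. As `x` is arbitrary, the bound can be
  -- averaged over `K`.
  have hpt : ∀ x, ‖φ q - ∑ i ∈ s, w i • φ (v i)‖ₑ ≤
      ‖taylorRem φ x q‖ₑ + ∑ i ∈ s, ENNReal.ofReal (w i) * ‖taylorRem φ x (v i)‖ₑ := by
    intro x
    have e : φ q - ∑ i ∈ s, w i • φ (v i) =
        taylorRem φ x q - ∑ i ∈ s, w i • taylorRem φ x (v i) := by
      have h1 : q - x = ∑ i ∈ s, w i • (v i - x) := by
        simp only [smul_sub, Finset.sum_sub_distrib, ← Finset.sum_smul, hw1, one_smul, q]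
      have h2 : φ x = ∑ i ∈ s, w i • φ x := by rw [← Finset.sum_smul, hw1, one_smul]
      have h3 : ∑ i ∈ s, w i • taylorRem φ x (v i) =
          ∑ i ∈ s, w i • φ (v i) - φ x - fderiv ℝ φ x (q - x) := by
        rw [h1, map_sum]
        conv_rhs => rw [h2]
        rw [← Finset.sum_sub_distrib, ← Finset.sum_sub_distrib]
        simp [taylorRem, smul_sub]
      rw [h3, taylorRem]
      abel
    rw [e]
    refine (enorm_sub_le).trans ?_
    gcongr
    refine (enorm_sum_le _ _).trans (Finset.sum_le_sum fun i hi => ?_)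
    rw [enorm_smul, Real.enorm_eq_ofReal (hw i hi)]
  refine volume_mul_enorm_le_of_rpow hK0 hKt ?_
  calc volume K * ‖φ q - ∑ i ∈ s, w i • φ (v i)‖ₑ
      = ∫⁻ _ in K, ‖φ q - ∑ i ∈ s, w i • φ (v i)‖ₑ := by simp [mul_comm]
    _ ≤ ∫⁻ x in K, (‖taylorRem φ x q‖ₑ +
          ∑ i ∈ s, ENNReal.ofReal (w i) * ‖taylorRem φ x (v i)‖ₑ) := lintegral_mono fun x => hpt x
    _ = (∫⁻ x in K, ‖taylorRem φ x q‖ₑ) +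
          ∑ i ∈ s, ENNReal.ofReal (w i) * ∫⁻ x in K, ‖taylorRem φ x (v i)‖ₑ := by
        rw [lintegral_add_left (hm q), lintegral_finsetSum _ fun i _ => (hm _).const_mul _]
        congr 1
        exact Finset.sum_congr rfl fun i _ => lintegral_const_mul _ (hm _)
    _ ≤ ENNReal.ofReal (2 * h ^ 2) * (volume K ^ (1 / 2 : ℝ) * N) + ∑ i ∈ s,
          ENNReal.ofReal (w i) * (ENNReal.ofReal (2 * h ^ 2) * (volume K ^ (1 / 2 : ℝ) * N)) := by
        gcongr with i hi
        · exact lintegral_taylorRem_le hd hφ hK hKm hh hq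
        · exact lintegral_taylorRem_le hd hφ hK hKm hh (hv i hi)
    _ = volume K ^ (1 / 2 : ℝ) * (ENNReal.ofReal (4 * h ^ 2) * N) := by
        rw [← Finset.sum_mul, ← ENNReal.ofReal_sum_of_nonneg hw, hw1, ENNReal.ofReal_one, one_mul,
          show 4 * h ^ 2 = 2 * h ^ 2 + 2 * h ^ 2 by ring,
          ENNReal.ofReal_add (by positivity) (by positivity)]
        ring

/-- Sobolev's inequality for smooth functions on a convex set. -/
theorem enorm_le_of_convex (hd : d ≤ 3) {φ : E d → F} (hφ : ContDiff ℝ 2 φ) {K : Set (E d)}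
    (hK : Convex ℝ K) (hKm : MeasurableSet K) (hK0 : volume K ≠ 0) (hKt : volume K ≠ ⊤) {h : ℝ}
    (hh : ∀ x ∈ K, ∀ y ∈ K, ‖x - y‖ ≤ h) {p : E d} (hp : p ∈ K) :
    volume K ^ (1 / 2 : ℝ) * ‖φ p‖ₑ ≤
      eLpNorm (fun x => ‖φ x‖ₑ) 2 (volume.restrict K) +
      ENNReal.ofReal h * eLpNorm (fun x => ‖fderiv ℝ φ x‖ₑ) 2 (volume.restrict K) +
      ENNReal.ofReal (2 * h ^ 2) *
        eLpNorm (fun x => ‖fderiv ℝ (fderiv ℝ φ) x‖ₑ) 2 (volume.restrict K) := by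
  have hcf : Continuous (fderiv ℝ φ) := hφ.continuous_fderiv (by norm_num)
  have hm0 : Measurable fun x => ‖φ x‖ₑ := hφ.continuous.enorm.measurable
  have hm1 : Measurable fun x => ‖fderiv ℝ φ x‖ₑ := by
    simpa only [ofReal_norm] using hcf.norm.measurable.ennreal_ofReal
  refine volume_mul_enorm_le_of_rpow hK0 hKt ?_
  calc volume K * ‖φ p‖ₑ = ∫⁻ _ in K, ‖φ p‖ₑ := by simp [mul_comm]
    _ ≤ ∫⁻ x in K, (‖φ x‖ₑ + ENNReal.ofReal h * ‖fderiv ℝ φ x‖ₑ + ‖taylorRem φ x p‖ₑ) := by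
        -- The value at `p` is expanded about each `x` in `K`, and the three terms are averaged over
        -- `x`.
        refine setLIntegral_mono' hKm fun x hx => ?_
        have e : φ p = φ x + fderiv ℝ φ x (p - x) + taylorRem φ x p := by
          simp [taylorRem]
        rw [e]
        refine (enorm_add_le _ _).trans ?_
        gcongr
        refine (enorm_add_le _ _).trans ?_
        gcongr
        rw [mul_comm, ← ofReal_norm, ← ofReal_norm (fderiv ℝ φ x),
          ← ENNReal.ofReal_mul (norm_nonneg _)]
        exact ENNReal.ofReal_le_ofReal (((fderiv ℝ φ x).le_opNorm _).trans
          (mul_le_mul_of_nonneg_left (hh p hp x hx) (norm_nonneg _)))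
    _ = (∫⁻ x in K, ‖φ x‖ₑ) + ENNReal.ofReal h * (∫⁻ x in K, ‖fderiv ℝ φ x‖ₑ) +
          ∫⁻ x in K, ‖taylorRem φ x p‖ₑ := by
        rw [lintegral_add_left (f := fun x => ‖φ x‖ₑ + ENNReal.ofReal h * ‖fderiv ℝ φ x‖ₑ)
          (hm0.add (hm1.const_mul _)), lintegral_add_left hm0,
          lintegral_const_mul _ hm1]
    _ ≤ volume K ^ (1 / 2 : ℝ) * eLpNorm (fun x => ‖φ x‖ₑ) 2 (volume.restrict K) +
        ENNReal.ofReal h * (volume K ^ (1 / 2 : ℝ) *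
          eLpNorm (fun x => ‖fderiv ℝ φ x‖ₑ) 2 (volume.restrict K)) +
        ENNReal.ofReal (2 * h ^ 2) * (volume K ^ (1 / 2 : ℝ) *
          eLpNorm (fun x => ‖fderiv ℝ (fderiv ℝ φ) x‖ₑ) 2 (volume.restrict K)) := by
        gcongr
        · exact setLIntegral_le_eLpNorm hm0
        · exact setLIntegral_le_eLpNorm hm1
        · exact lintegral_taylorRem_le hd hφ hK hKm hh hp
    _ = _ := by ring

theorem norm_le_sum_norm_single {G : Type*} [NormedAddCommGroup G] [NormedSpace ℝ G]
    (A : E d →L[ℝ] G) :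
    ‖A‖ ≤ ∑ i, ‖A (EuclideanSpace.single i 1)‖ := by
  refine A.opNorm_le_bound (Finset.sum_nonneg fun i _ => norm_nonneg _) fun x => ?_
  have hx : x = ∑ i, x i • EuclideanSpace.single i (1 : ℝ) := by
    ext j
    simp [Finset.sum_apply, Pi.single_apply]
  conv_lhs => rw [hx]
  rw [map_sum, Finset.sum_mul]
  refine (norm_sum_le _ _).trans (Finset.sum_le_sum fun i _ => ?_)
  rw [map_smul, norm_smul, mul_comm]
  exact mul_le_mul_of_nonneg_left (PiLp.norm_apply_le x i) (norm_nonneg _)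

theorem enorm_le_sum_enorm_single {G : Type*} [NormedAddCommGroup G] [NormedSpace ℝ G]
    (A : E d →L[ℝ] G) :
    ‖A‖ₑ ≤ ∑ i, ‖A (EuclideanSpace.single i 1)‖ₑ := by
  simp only [← ofReal_norm]
  rw [← ENNReal.ofReal_sum_of_nonneg fun i _ => norm_nonneg _]
  exact ENNReal.ofReal_le_ofReal (norm_le_sum_norm_single A)

theorem enorm_le_sum_enorm_single₂ (A : E d →L[ℝ] E d →L[ℝ] F) :
    ‖A‖ₑ ≤ ∑ i, ∑ j, ‖A (EuclideanSpace.single j 1) (EuclideanSpace.single i 1)‖ₑ := by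
  rw [Finset.sum_comm]
  exact (enorm_le_sum_enorm_single A).trans
    (Finset.sum_le_sum fun j _ => enorm_le_sum_enorm_single _)

end SmoothEstimates

/-! ### Extension by zero. -/

section Extension

variable {d : ℕ} {D : Set (E d)}

theorem measurable_extend (hD : IsOpen D) (f : L2 D) : Measurable (extend f) :=
  (Lp.stronglyMeasurable f).measurable.indicator hD.measurableSet

theorem memLp_extend (hD : IsOpen D) (f : L2 D) : MemLp (extend f) 2 volume :=
  (memLp_indicator_iff_restrict hD.measurableSet).2 (Lp.memLp f)

theorem locallyIntegrable_extend (hD : IsOpen D) (f : L2 D) :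
    LocallyIntegrable (extend f) volume :=
  (memLp_extend hD f).locallyIntegrable (by norm_num)

theorem extend_ae_eq (hD : IsOpen D) (f : L2 D) : extend f =ᵐ[volume.restrict D] f := by
  filter_upwards [ae_restrict_mem hD.measurableSet] with x hx
  simp [extend, hx]

theorem extend_of_notMem (f : L2 D) {x : E d} (hx : x ∉ D) : extend f x = 0 :=
  indicator_of_notMem hx _

theorem eLpNorm_extend (hD : IsOpen D) (f : L2 D) :
    eLpNorm (extend f) 2 volume = ENNReal.ofReal ‖f‖ := by
  rw [extend, eLpNorm_indicator_eq_eLpNorm_restrict hD.measurableSet, Lp.norm_def,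
    ENNReal.ofReal_toReal (Lp.eLpNorm_ne_top f)]

end Extension

/-! ### Mollification and weak derivatives. -/

section Mollifier

variable {d : ℕ} {D : Set (E d)} (ρ : ContDiffBump (0 : E d))

/-- Mollification of a vector field. -/
noncomputable def moll (ρ : ContDiffBump (0 : E d)) (f : E d → E d) : E d → E d :=
  convolution (ρ.normed volume) f (ContinuousLinearMap.lsmul ℝ ℝ) volume

/-- The kernel of the mollification, acting by translations. -/
noncomputable def mollKernel (ρ : ContDiffBump (0 : E d)) (ξ : E d) : ℝ≥0∞ :=
  ENNReal.ofReal (ρ.normed volume ξ)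

theorem measurable_mollKernel : Measurable (mollKernel ρ) :=
  (ρ.continuous_normed).measurable.ennreal_ofReal

theorem lintegral_mollKernel : ∫⁻ ξ, mollKernel ρ ξ = 1 := by
  unfold mollKernel
  rw [← ofReal_integral_eq_lintegral_ofReal ρ.integrable_normed
    (.of_forall fun x => ρ.nonneg_normed x), ρ.integral_normed, ENNReal.ofReal_one]

theorem mollKernel_eq_zero {ξ : E d} (h : ρ.rOut ≤ ‖ξ‖) : mollKernel ρ ξ = 0 := by
  have : ξ ∉ Function.support (ρ.normed volume) := by
    rw [ρ.support_normed_eq]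
    simpa using h
  simp [mollKernel, Function.notMem_support.1 this]

/-- The bump is even, so the convolution is an average of the translates `f (x + ξ)`, the form to
which the translation estimates apply. -/
theorem moll_apply (f : E d → E d) (x : E d) :
    moll ρ f x = ∫ ξ, ρ.normed volume ξ • f (x + ξ) := by
  unfold moll
  rw [convolution_lsmul, ← integral_neg_eq_self]
  simp [ρ.normed_neg]

theorem enorm_moll_le (f : E d → E d) (x : E d) :
    ‖moll ρ f x‖ₑ ≤ ∫⁻ ξ, mollKernel ρ ξ * ‖f (x + ξ)‖ₑ := by
  rw [moll_apply]
  refine (enorm_integral_le_lintegral_enorm _).trans (le_of_eq (lintegral_congr fun ξ => ?_))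
  rw [enorm_smul, Real.enorm_eq_ofReal (ρ.nonneg_normed ξ), mollKernel]

theorem contDiff_moll {f : E d → E d} (hf : LocallyIntegrable f volume) {n : ℕ∞} :
    ContDiff ℝ n (moll ρ f) :=
  ρ.hasCompactSupport_normed.contDiff_convolution_left _ ρ.contDiff_normed hf

/-- Averaging against the mollifier does not increase `L²` norms, locally. -/
theorem eLpNorm_moll_kernel_le {N : E d → ℝ≥0∞} (hN : Measurable N) {K K' : Set (E d)}
    (hK : MeasurableSet K) (hK' : MeasurableSet K')
    (h : ∀ x ∈ K, ∀ ξ, ‖ξ‖ < ρ.rOut → x + ξ ∈ K') :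
    eLpNorm (fun x => ∫⁻ ξ, mollKernel ρ ξ * N (x + ξ)) 2 (volume.restrict K) ≤
      eLpNorm N 2 (volume.restrict K') := by
  have h1 := eLpNorm_lintegral_translate_le (measurable_mollKernel ρ) (hN.indicator hK')
  rw [lintegral_mollKernel, one_mul, eLpNorm_indicator_eq_eLpNorm_restrict hK'] at h1
  refine le_trans ?_ h1
  rw [← eLpNorm_indicator_eq_eLpNorm_restrict hK]
  refine eLpNorm_mono_enorm fun x => ?_
  by_cases hx : x ∈ K
  · simp only [indicator_of_mem hx, enorm_eq_self]
    refine lintegral_mono fun ξ => ?_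
    by_cases hξ : ‖ξ‖ < ρ.rOut
    · rw [indicator_of_mem (h x hx ξ hξ)]
    · simp [mollKernel_eq_zero ρ (not_lt.1 hξ)]
  · simp [indicator_of_notMem hx]

theorem fderiv_moll_apply {f : E d → E d} (hf : LocallyIntegrable f volume) (x e : E d) :
    fderiv ℝ (moll ρ f) x e = ∫ y, fderiv ℝ (ρ.normed volume) (x - y) e • f y := by
  have hρ : ContDiff ℝ 1 (ρ.normed volume) := ρ.contDiff_normed (n := 1)
  have h1 := ρ.hasCompactSupport_normed.hasFDerivAt_convolution_left (μ := volume)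
    (ContinuousLinearMap.lsmul ℝ ℝ : ℝ →L[ℝ] E d →L[ℝ] E d) hρ hf x
  have h2 : moll ρ f = convolution (ρ.normed volume) f (ContinuousLinearMap.lsmul ℝ ℝ) volume := rfl
  rw [h2, h1.fderiv, convolution_eq_swap]
  have hcs : HasCompactSupport (fderiv ℝ (ρ.normed (volume : Measure (E d)))) :=
    ρ.hasCompactSupport_normed.fderiv ℝ
  have hint : Integrable (fun y => ((ContinuousLinearMap.lsmul ℝ ℝ : ℝ →L[ℝ] E d →L[ℝ] E d).precompL
      (E d)) (fderiv ℝ (ρ.normed volume) (x - y)) (f y)) volume := by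
    have := (hcs.convolutionExists_left ((ContinuousLinearMap.lsmul ℝ ℝ : ℝ →L[ℝ] E d →L[ℝ] E d).precompL
      (E d)) (hρ.continuous_fderiv (by norm_num)) hf) x
    exact this.integrable_swap
  rw [ContinuousLinearMap.integral_apply hint]
  rfl

/-- Mollification commutes with weak derivatives away from the boundary. -/
theorem fderiv_moll_extend (hD : IsOpen D) {i : Fin d} {f g : L2 D} (hfg : IsWeakPartial i f g)
    {x : E d} (hx : Metric.closedBall x ρ.rOut ⊆ D) :
    fderiv ℝ (moll ρ (extend f)) x (EuclideanSpace.single i 1) = moll ρ (extend g) x := by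
  set R := ρ.normed (volume : Measure (E d))
  have hR : ContDiff ℝ (⊤ : ℕ∞) R := ρ.contDiff_normed
  have hRx : ContDiff ℝ (⊤ : ℕ∞) fun y => R (x - y) := hR.comp (by fun_prop)
  rw [fderiv_moll_apply ρ (locallyIntegrable_extend hD f)]
  have e2 : moll ρ (extend g) x = ∫ y, R (x - y) • extend g y := convolution_lsmul_swap
  rw [e2]
  have hts : ∀ y, x - y ∉ Metric.ball (0 : E d) ρ.rOut → R (x - y) = 0 := fun y hy => by
    have : x - y ∉ Function.support R := by rwa [ρ.support_normed_eq]
    simpa using this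
  refine ext_inner_left ℝ fun a => ?_
  have hsupp : tsupport (fun y => R (x - y) • a) ⊆ Metric.closedBall x ρ.rOut := by
    refine closure_minimal (fun y hy => ?_) Metric.isClosed_closedBall
    by_contra hcon
    refine hy ?_
    have : R (x - y) = 0 := hts y fun hm => hcon (by
      rw [mem_ball_zero_iff, ← dist_eq_norm, dist_comm] at hm
      exact hm.le)
    simp [this]
  -- The mollifier centred at `x`, times a constant vector, is an admissible test field because its
  -- support stays in `D`. Differentiating in `y` instead of `x` gives the minus sign that cancels
  -- the one in the weak derivative.
  let φ : TestFun D := ⟨fun y => R (x - y) • a, hRx.smul contDiff_const,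
    HasCompactSupport.of_support_subset_isCompact (isCompact_closedBall x ρ.rOut)
      ((subset_tsupport _).trans hsupp), hsupp.trans hx⟩
  have hpd : ∀ y, partialDeriv i (φ : E d → E d) y =
      -(fderiv ℝ R (x - y) (EuclideanSpace.single i 1)) • a := by
    intro y
    have h1 : HasFDerivAt (fun y => R (x - y)) (-(fderiv ℝ R (x - y))) y := by
      have h0 := ((hR.differentiable (by simp)) (x - y)).hasFDerivAt
      have h0' : HasFDerivAt (fun y : E d => x - y) (-(ContinuousLinearMap.id ℝ (E d))) y :=
        (hasFDerivAt_id y).const_sub x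
      refine (h0.comp y h0').congr_fderiv ?_
      ext v
      simp
    have h2 : HasFDerivAt (φ : E d → E d) _ y := h1.smul_const a
    simp [partialDeriv, h2.fderiv]
  have key := hfg φ
  have hi1 : ∀ (k : E d → ℝ), Continuous k → (HasCompactSupport k) → ∀ u : L2 D,
      Integrable (fun y => k y • extend u y) := fun k hk hkc u =>
    (locallyIntegrable_extend hD u).integrable_smul_left_of_hasCompactSupport hk hkc
  have hc1 : HasCompactSupport fun y => R (x - y) := by
    refine HasCompactSupport.of_support_subset_isCompact (isCompact_closedBall x ρ.rOut) fun y hy => ?_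
    by_contra hcon
    refine hy (hts y fun hm => hcon ?_)
    rw [mem_ball_zero_iff, ← dist_eq_norm, dist_comm] at hm
    exact hm.le
  have hc2 : HasCompactSupport fun y => fderiv ℝ R (x - y) (EuclideanSpace.single i 1) := by
    have := (ρ.hasCompactSupport_normed (μ := (volume : Measure (E d)))).fderiv_apply ℝ
      (EuclideanSpace.single i (1 : ℝ))
    exact this.comp_homeomorph (Homeomorph.subLeft x)
  have l1 : inner ℝ (TestFun.partialL2 D i φ) f =
      - inner ℝ a (∫ y, fderiv ℝ R (x - y) (EuclideanSpace.single i 1) • extend f y) := by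
    have hk : Continuous fun y => fderiv ℝ R (x - y) (EuclideanSpace.single i 1) := by
      have := hR.continuous_fderiv (by simp)
      fun_prop
    rw [L2.inner_def, ← integral_inner (hi1 _ hk hc2 f), ← integral_neg,
      ← setIntegral_eq_integral_of_forall_compl_eq_zero (s := D)
        (f := fun y => -inner ℝ a (fderiv ℝ R (x - y) (EuclideanSpace.single i 1) • extend f y))]
    · refine integral_congr_ae ?_
      have h1 : (TestFun.partialL2 D i φ : E d → E d) =ᵐ[volume.restrict D] _ :=
        (TestFun.memLp_partialDeriv i φ).coeFn_toLp
      filter_upwards [h1, extend_ae_eq hD f] with y hy hy2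
      rw [hy, hpd, hy2, inner_smul_left, inner_smul_right]
      simp
    · intro y hy
      simp [extend_of_notMem f hy]
  have l2 : inner ℝ (TestFun.toL2 D φ) g = inner ℝ a (∫ y, R (x - y) • extend g y) := by
    rw [L2.inner_def, ← integral_inner (hi1 _ hRx.continuous hc1 g),
      ← setIntegral_eq_integral_of_forall_compl_eq_zero (s := D)
        (f := fun y => inner ℝ a (R (x - y) • extend g y))]
    · refine integral_congr_ae ?_
      have h1 : (TestFun.toL2 D φ : E d → E d) =ᵐ[volume.restrict D] _ :=
        (TestFun.memLp φ).coeFn_toLp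
      filter_upwards [h1, extend_ae_eq hD g] with y hy hy2
      rw [hy, hy2]
      simp [φ, inner_smul_left, inner_smul_right]
    · intro y hy
      simp [extend_of_notMem g hy]
  rw [l1, l2] at key
  linarith

/-- The strict inequality between `ρ.rOut` and `R` leaves room for the first order identity to hold
in a neighbourhood of `x`, so that it can be differentiated again. -/
theorem fderiv_fderiv_moll_extend (hD : IsOpen D) {i j : Fin d} {f g k : L2 D}
    (hfg : IsWeakPartial i f g) (hgk : IsWeakPartial j g k) {x : E d} {R : ℝ} (hR : ρ.rOut < R)
    (hx : Metric.ball x R ⊆ D) :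
    fderiv ℝ (fderiv ℝ (moll ρ (extend f))) x (EuclideanSpace.single j 1)
      (EuclideanSpace.single i 1) = moll ρ (extend k) x := by
  have hs : ContDiff ℝ 2 (moll ρ (extend f)) :=
    contDiff_moll ρ (locallyIntegrable_extend hD f) (n := 2)
  have hd1 : DifferentiableAt ℝ (fderiv ℝ (moll ρ (extend f))) x :=
    (hs.fderiv_right (m := 1) (by norm_num)).differentiable (by norm_num) x
  rw [← fderiv_moll_extend ρ hD hgk ((Metric.closedBall_subset_ball hR).trans hx)]
  have hev : (fun y => fderiv ℝ (moll ρ (extend f)) y (EuclideanSpace.single i 1)) =ᶠ[𝓝 x]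
      moll ρ (extend g) := by
    filter_upwards [Metric.ball_mem_nhds x (sub_pos.2 hR)] with y hy
    refine fderiv_moll_extend ρ hD hfg (fun z hz => hx ?_)
    rw [Metric.mem_ball] at hy ⊢
    rw [Metric.mem_closedBall] at hz
    linarith [dist_triangle z y x]
  rw [← hev.fderiv_eq]
  have := (hd1.hasFDerivAt.clm_apply (hasFDerivAt_const (EuclideanSpace.single i (1 : ℝ)) x)).fderiv
  rw [this]
  simp

end Mollifier

/-! ### Continuity of translations in `L²`. -/

section Translation

variable {d : ℕ}

theorem tendsto_eLpNorm_translate_sub {f : E d → E d} (hf : MemLp f 2 volume) :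
    Tendsto (fun z => eLpNorm (fun x => f (x + z) - f x) 2 volume) (𝓝 0) (𝓝 0) := by
  set g : Lp (E d) 2 (volume : Measure (E d)) := hf.toLp f
  let T : E d → C(E d, E d) := (ContinuousMap.mk (fun p : E d × E d => p.2 + p.1)).curry
  have hmp : ∀ z, MeasurePreserving (T z) volume volume := fun z =>
    measurePreserving_add_right volume z
  have hc : Continuous fun z => Lp.compMeasurePreserving (T z) (hmp z) g :=
    continuous_const.compMeasurePreservingLp (ContinuousMap.continuous _) hmp (by norm_num)
  have h0 : Tendsto (fun z => ‖Lp.compMeasurePreserving (T z) (hmp z) g - g‖) (𝓝 0)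
      (𝓝 ‖Lp.compMeasurePreserving (T 0) (hmp 0) g - g‖) :=
    (hc.sub (continuous_const (y := g))).norm.tendsto 0
  have e : ∀ z, eLpNorm (fun x => f (x + z) - f x) 2 volume =
      ENNReal.ofReal ‖Lp.compMeasurePreserving (T z) (hmp z) g - g‖ := by
    intro z
    rw [Lp.norm_def, ENNReal.ofReal_toReal (Lp.eLpNorm_ne_top _)]
    refine eLpNorm_congr_ae ?_
    have h1 : g =ᵐ[volume] f := hf.coeFn_toLp
    filter_upwards [Lp.coeFn_sub (Lp.compMeasurePreserving (T z) (hmp z) g) g,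
      Lp.coeFn_compMeasurePreserving g (hmp z), h1,
      (hmp z).quasiMeasurePreserving.ae_eq_comp h1] with x h2 h3 h4 h5
    rw [h2, Pi.sub_apply, h3, h4, h5]
    rfl
  simp only [e]
  have e0 : Lp.compMeasurePreserving (T 0) (hmp 0) g - g = 0 := by
    rw [sub_eq_zero]
    apply Lp.ext
    filter_upwards [Lp.coeFn_compMeasurePreserving g (hmp 0)] with x hx
    rw [hx]
    simp [T]
  have := ENNReal.tendsto_ofReal h0
  simpa only [e0, norm_zero, ENNReal.ofReal_zero] using this

end Translation

end Peridynamics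

namespace Peridynamics

/-! ### Interior cones and exit directions of Lipschitz domains. -/

section LipschitzGeometry

variable {d : ℕ} {D : Set (E d)}

theorem norm_projOrthogonal_sub_le (n x y : E d) :
    ‖(ℝ ∙ n)ᗮ.orthogonalProjectionOnto x - (ℝ ∙ n)ᗮ.orthogonalProjectionOnto y‖ ≤ ‖x - y‖ := by
  rw [← map_sub]
  exact (ℝ ∙ n)ᗮ.norm_orthogonalProjectionOnto_apply_le _

theorem projOrthogonal_smul_self (n : E d) (s : ℝ) :
    (ℝ ∙ n)ᗮ.orthogonalProjectionOnto (s • n) = 0 := by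
  rw [Submodule.orthogonalProjectionOnto_eq_zero_iff]
  exact Submodule.le_orthogonal_orthogonal _ (Submodule.smul_mem _ _ (Submodule.mem_span_singleton_self n))

/-- A Lipschitz domain satisfies the interior cone condition, locally uniformly. -/
theorem exists_convex_translate_subset (hD : IsOpen D) (hL : HasLipschitzBoundary D) {p : E d}
    (hp : p ∈ closure D) : ∃ (K : Set (E d)) (r : ℝ), 0 < r ∧ Convex ℝ K ∧ IsCompact K ∧
      (0 : E d) ∈ K ∧ (interior K).Nonempty ∧ ∀ x ∈ D ∩ Metric.ball p r, ∀ ξ ∈ K, x + ξ ∈ D := by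
  by_cases hpD : p ∈ D
  · obtain ⟨R, hR, hRD⟩ := Metric.isOpen_iff.1 hD p hpD
    refine ⟨Metric.closedBall 0 (R / 2), R / 2, by positivity, convex_closedBall _ _,
      isCompact_closedBall _ _, Metric.mem_closedBall_self (by positivity), ?_, ?_⟩
    · rw [interior_closedBall _ (by positivity)]
      exact ⟨0, Metric.mem_ball_self (by positivity)⟩
    · rintro x ⟨-, hx⟩ ξ hξ
      refine hRD ?_
      rw [Metric.mem_ball, dist_eq_norm] at *
      rw [mem_closedBall_zero_iff] at hξ
      calc ‖x + ξ - p‖ = ‖(x - p) + ξ‖ := by congr 1; abel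
        _ ≤ ‖x - p‖ + ‖ξ‖ := norm_add_le _ _
        _ < R := by linarith
  · obtain ⟨n, hn, L, γ, hγ, r, hr, hchart⟩ := hL p ⟨hp, by rwa [hD.interior_eq]⟩
    set P := (ℝ ∙ n)ᗮ.orthogonalProjectionOnto
    have hPn : ∀ s : ℝ, P (s • n) = 0 := projOrthogonal_smul_self n
    -- The cone `L ‖P ξ‖ ≤ ⟨n, ξ⟩`: along such `ξ` the height grows at least as much as an
    -- `L`-Lipschitz graph can, so a point above the graph stays above it.
    have hconv : Convex ℝ {ξ : E d | (L : ℝ) * ‖P ξ‖ - inner ℝ n ξ ≤ 0} := by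
      have h1 : ConvexOn ℝ univ fun ξ : E d => (L : ℝ) * ‖P ξ‖ - inner ℝ n ξ := by
        have h2 : ConvexOn ℝ univ fun ξ : E d => ‖P ξ‖ :=
          (convexOn_norm (E := (ℝ ∙ n)ᗮ) convex_univ).comp_linearMap P.toLinearMap
        have h3 : ConcaveOn ℝ univ fun ξ : E d => inner ℝ n ξ :=
          ((innerSL ℝ n).toLinearMap).concaveOn convex_univ
        exact (h2.smul L.2).sub h3
      simpa using h1.convex_le 0
    refine ⟨Metric.closedBall 0 (r / 2) ∩ {ξ | (L : ℝ) * ‖P ξ‖ - inner ℝ n ξ ≤ 0}, r / 2,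
      by positivity, (convex_closedBall _ _).inter hconv, (isCompact_closedBall _ _).inter_right
        (isClosed_le (by fun_prop) continuous_const), ⟨Metric.mem_closedBall_self (by positivity),
        by simp⟩, ?_, ?_⟩
    · have hopen : IsOpen (Metric.ball 0 (r / 2) ∩
          {ξ : E d | (L : ℝ) * ‖P ξ‖ - inner ℝ n ξ < 0}) :=
        Metric.isOpen_ball.inter (isOpen_lt (by fun_prop) continuous_const)
      refine ⟨(r / 4) • n, interior_maximal ?_ hopen ⟨?_, ?_⟩⟩
      · exact inter_subset_inter Metric.ball_subset_closedBall fun ξ hξ => le_of_lt hξ.out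
      · rw [mem_ball_zero_iff, norm_smul, hn, Real.norm_of_nonneg (by positivity)]
        linarith
      · rw [mem_ofPred_eq, hPn, norm_zero, mul_zero, inner_smul_right, real_inner_self_eq_norm_sq, hn]
        linarith
    · rintro x ⟨hxD, hx⟩ ξ ⟨hξ1, hξ2⟩
      rw [mem_closedBall_zero_iff] at hξ1
      rw [Metric.mem_ball, dist_eq_norm] at hx
      have hb1 : x ∈ Metric.ball p r := by
        rw [Metric.mem_ball, dist_eq_norm]; linarith
      have hb2 : x + ξ ∈ Metric.ball p r := by
        rw [Metric.mem_ball, dist_eq_norm]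
        calc ‖x + ξ - p‖ = ‖(x - p) + ξ‖ := by congr 1; abel
          _ ≤ ‖x - p‖ + ‖ξ‖ := norm_add_le _ _
          _ < r := by linarith
      rw [hchart _ hb2, map_add, inner_add_right]
      have h1 := (hchart _ hb1).1 hxD
      have h2 := hγ.dist_le_mul (P x + P ξ) (P x)
      rw [Real.dist_eq, dist_eq_norm, add_sub_cancel_left] at h2
      have h3 := le_abs_self (γ (P x + P ξ) - γ (P x))
      simp only [mem_ofPred_eq] at hξ2
      linarith

/-- Near a boundary point of a Lipschitz domain there is a direction leading out of the domain
within a distance comparable to the distance from the complement. -/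
theorem exists_direction_out (hL : HasLipschitzBoundary D) {p : E d}
    (hp : p ∈ frontier D) : ∃ (n : E d) (C r : ℝ), ‖n‖ = 1 ∧ 1 ≤ C ∧ 0 < r ∧
      ∀ x ∈ Metric.ball p r, ∀ q ∈ Metric.ball p r, q ∉ D → ∀ s, C * ‖x - q‖ ≤ s → s ≤ r →
        x - s • n ∉ D := by
  obtain ⟨n, hn, L, γ, hγ, r, hr, hchart⟩ := hL p hp
  set P := (ℝ ∙ n)ᗮ.orthogonalProjectionOnto
  have hPn : ∀ s : ℝ, P (s • n) = 0 := projOrthogonal_smul_self n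
  -- The height above the graph is an `(L + 1)`-Lipschitz function and is not positive at `q`, so
  -- lowering `x` by `(L + 1) ‖x - q‖` or more leaves `D`. The radius is halved to keep the lowered
  -- point inside the chart.
  refine ⟨n, L + 1, r / 2, hn, by simp, by positivity, fun x hx q hq hqD s hs hsr hmem => ?_⟩
  have hs0 : 0 ≤ s := le_trans (by positivity) hs
  rw [Metric.mem_ball, dist_eq_norm] at hx hq
  have hb2 : x - s • n ∈ Metric.ball p r := by
    rw [Metric.mem_ball, dist_eq_norm]
    calc ‖x - s • n - p‖ = ‖(x - p) - s • n‖ := by congr 1; abel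
      _ ≤ ‖x - p‖ + ‖s • n‖ := norm_sub_le _ _
      _ < r := by rw [norm_smul, hn, Real.norm_of_nonneg hs0]; linarith
  have hq' : q ∈ Metric.ball p r := by rw [Metric.mem_ball, dist_eq_norm]; linarith
  have h1 := (hchart _ hb2).1 hmem
  have h2 := mt (hchart _ hq').2 hqD
  rw [map_sub, hPn, sub_zero, inner_sub_right, inner_smul_right, real_inner_self_eq_norm_sq, hn] at h1
  have h3 := hγ.dist_le_mul (P x) (P q)
  rw [Real.dist_eq, dist_eq_norm] at h3
  have h4 : (L : ℝ) * ‖P x - P q‖ ≤ L * ‖x - q‖ :=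
    mul_le_mul_of_nonneg_left (norm_projOrthogonal_sub_le n x q) L.2
  have h5 : inner ℝ n x - inner ℝ n q ≤ ‖x - q‖ := by
    rw [← inner_sub_right]
    simpa [hn] using real_inner_le_norm n (x - q)
  have h6 := neg_abs_le (γ (P x) - γ (P q))
  push Not at h2
  nlinarith

/-- Lipschitz domains have no slits. At a boundary point, lowering all points close to it by a fixed
small amount gives an open set outside `D`; if the boundary point were interior to the closure, this
set would have to meet `D`. -/
theorem interior_closure_subset (hD : IsOpen D) (hL : HasLipschitzBoundary D) :
    interior (closure D) ⊆ D := by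
  intro p hp
  by_contra hpD
  have hpc : p ∈ closure D := interior_subset hp
  obtain ⟨n, C, r, hn, hC, hr, hout⟩ := exists_direction_out hL (p := p)
    ⟨hpc, by rwa [hD.interior_eq]⟩
  obtain ⟨R, hR, hRc⟩ := Metric.isOpen_iff.1 isOpen_interior p hp
  set s := min (R / 2) r with hs
  have hs0 : 0 < s := lt_min (by positivity) hr
  set t := min (s / C) (min r (R / 2))
  have hC0 : 0 < C := by linarith
  have ht0 : 0 < t := lt_min (by positivity) (lt_min hr (by positivity))
  obtain ⟨x, hxD, hx⟩ := Metric.mem_closure_iff.1 hpc t ht0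
  have hopen : IsOpen ((fun y => y + s • n) ⁻¹' (D ∩ Metric.ball p t)) :=
    (hD.inter Metric.isOpen_ball).preimage (by fun_prop)
  have hy : x - s • n ∈ (fun y => y + s • n) ⁻¹' (D ∩ Metric.ball p t) := by
    simp only [mem_preimage, sub_add_cancel]
    exact ⟨hxD, by rwa [Metric.mem_ball, dist_comm]⟩
  have hxp : ‖x - p‖ < t := by rwa [dist_comm, dist_eq_norm] at hx
  have hyc : x - s • n ∈ closure D := by
    refine interior_subset (hRc ?_)
    rw [Metric.mem_ball, dist_eq_norm]
    calc ‖x - s • n - p‖ = ‖(x - p) - s • n‖ := by congr 1; abel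
      _ ≤ ‖x - p‖ + ‖s • n‖ := norm_sub_le _ _
      _ < R := by
        rw [norm_smul, hn, Real.norm_of_nonneg hs0.le]
        have : t ≤ R / 2 := (min_le_right _ _).trans (min_le_right _ _)
        have : s ≤ R / 2 := min_le_left _ _
        linarith
  obtain ⟨y, hy1, hy2⟩ := mem_closure_iff.1 hyc _ hopen hy
  simp only [mem_preimage, mem_inter_iff, Metric.mem_ball, dist_eq_norm] at hy1
  have htr : t ≤ r := (min_le_right _ _).trans (min_le_left _ _)
  have htC : C * t ≤ s := by
    have : t ≤ s / C := min_le_left _ _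
    rw [le_div_iff₀ hC0] at this
    linarith
  refine hout (y + s • n) ?_ p (Metric.mem_ball_self hr) hpD s ?_ (min_le_right _ _) (by simpa)
  · rw [Metric.mem_ball, dist_eq_norm]
    linarith [hy1.2]
  · nlinarith [hy1.2]

end LipschitzGeometry

/-! ### Translation estimates for fields in `H¹₀`. -/

section H10

variable {d : ℕ} {D : Set (E d)}

theorem extend_sub_ae (hD : IsOpen D) (f g : L2 D) :
    extend (f - g) =ᵐ[volume] fun x => extend f x - extend g x := by
  have h := Lp.coeFn_sub f g
  rw [EventuallyEq, ae_restrict_iff' hD.measurableSet] at h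
  filter_upwards [h] with x hx
  by_cases hxD : x ∈ D
  · simpa [extend, hxD] using hx hxD
  · simp [extend, hxD]

theorem extend_add_ae (hD : IsOpen D) (f g : L2 D) :
    extend (f + g) =ᵐ[volume] fun x => extend f x + extend g x := by
  have h := Lp.coeFn_add f g
  rw [EventuallyEq, ae_restrict_iff' hD.measurableSet] at h
  filter_upwards [h] with x hx
  by_cases hxD : x ∈ D
  · simpa [extend, hxD] using hx hxD
  · simp [extend, hxD]

theorem extend_congr_ae (hD : IsOpen D) (f : L2 D) {g : E d → E d}
    (hg : f =ᵐ[volume.restrict D] g) (hg0 : ∀ x ∉ D, g x = 0) : extend f =ᵐ[volume] g := by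
  rw [EventuallyEq, ae_restrict_iff' hD.measurableSet] at hg
  filter_upwards [hg] with x hx
  by_cases hxD : x ∈ D
  · simp [extend, hxD, hx hxD]
  · simp [extend, hxD, hg0 x hxD]

theorem eLpNorm_translate_sub_le (hD : IsOpen D) (f : L2 D) (y : E d) :
    eLpNorm (fun x => extend f (x + y) - extend f x) 2 volume ≤ 2 * ENNReal.ofReal ‖f‖ := by
  have hm := measurable_extend hD f
  have h1 : eLpNorm (fun x => extend f (x + y)) 2 volume = ENNReal.ofReal ‖f‖ := by
    rw [← eLpNorm_extend hD f]
    exact eLpNorm_comp_measurePreserving hm.aestronglyMeasurable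
      (measurePreserving_add_right volume y)
  refine (eLpNorm_sub_le (f := fun x => extend f (x + y)) (hm.comp (measurable_add_const y)).aestronglyMeasurable hm.aestronglyMeasurable (by norm_num)).trans ?_
  rw [h1, eLpNorm_extend hD f, two_mul]

theorem extend_testFun (hD : IsOpen D) (φ : TestFun D) :
    extend (TestFun.toL2 D φ) =ᵐ[volume] (φ : E d → E d) :=
  extend_congr_ae hD _ (TestFun.memLp φ).coeFn_toLp
    fun _ hx => image_eq_zero_of_notMem_tsupport fun h => hx (φ.2.2.2 h)

theorem extend_partial_testFun (hD : IsOpen D) (i : Fin d) (φ : TestFun D) :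
    extend (TestFun.partialL2 D i φ) =ᵐ[volume] partialDeriv i (φ : E d → E d) :=
  extend_congr_ae hD _ (TestFun.memLp_partialDeriv i φ).coeFn_toLp fun x hx => by
    rw [partialDeriv, fderiv_of_notMem_tsupport ℝ fun h => hx (φ.2.2.2 h)]
    simp

/-- The difference is the integral of the gradient along the segment from `x` to `x + y`.
Cauchy–Schwarz in the parameter and translation invariance in `x` give the bound, with no boundary
terms because test fields vanish off `D`. -/
theorem eLpNorm_translate_sub_testFun_le (hD : IsOpen D) (φ : TestFun D) (y : E d) :
    eLpNorm (fun x => (φ : E d → E d) (x + y) - (φ : E d → E d) x) 2 volume ≤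
      ENNReal.ofReal (‖y‖ * ∑ i, ‖TestFun.partialL2 D i φ‖) := by
  set f : E d → E d := (φ : E d → E d)
  have hf : ContDiff ℝ (⊤ : ℕ∞) f := φ.2.1
  have hcf : Continuous (fderiv ℝ f) := hf.continuous_fderiv (by simp)
  have hpc : ∀ i, Continuous (partialDeriv i f) := fun i => by
    unfold partialDeriv; fun_prop
  set G : E d → ℝ≥0∞ := fun x => ∑ i, ‖y‖ₑ * ‖partialDeriv i f x‖ₑ
  have hG : Measurable G := Finset.measurable_sum _ fun i _ =>
    (hpc i).enorm.measurable.const_mul _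
  have hpt : ∀ x, ‖f (x + y) - f x‖ₑ ≤ ∫⁻ t in Ioc (0 : ℝ) 1, G (x + t • y) := by
    intro x
    have hg0 : ∀ t : ℝ, HasDerivAt (fun t : ℝ => f (x + t • y)) (fderiv ℝ f (x + t • y) y) t :=
      fun t => ((hf.differentiable (by simp) _).hasFDerivAt).comp_hasDerivAt t
        (by simpa using ((hasDerivAt_id t).smul_const y).const_add x)
    have hint := intervalIntegral.integral_eq_sub_of_hasDerivAt (a := 0) (b := 1)
      (fun t _ => hg0 t) ((by fun_prop : Continuous fun t : ℝ =>
        fderiv ℝ f (x + t • y) y).intervalIntegrable 0 1)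
    simp only [one_smul, zero_smul, add_zero] at hint
    rw [← hint, intervalIntegral.integral_of_le zero_le_one]
    refine (enorm_integral_le_lintegral_enorm _).trans (lintegral_mono fun t => ?_)
    calc ‖fderiv ℝ f (x + t • y) y‖ₑ ≤ ‖fderiv ℝ f (x + t • y)‖ₑ * ‖y‖ₑ :=
          (fderiv ℝ f (x + t • y)).le_opENorm y
      _ ≤ (∑ i, ‖partialDeriv i f (x + t • y)‖ₑ) * ‖y‖ₑ := by
          gcongr
          exact enorm_le_sum_enorm_single _
      _ = _ := by rw [Finset.sum_mul]; simp only [G, mul_comm]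
  have hGn : eLpNorm G 2 volume ≤ ENNReal.ofReal (‖y‖ * ∑ i, ‖TestFun.partialL2 D i φ‖) := by
    have e : G = ∑ i, fun x => ‖y‖ₑ * ‖partialDeriv i f x‖ₑ := by
      ext x; simp [G, Finset.sum_apply]
    rw [e]
    refine (eLpNorm_sum_le (fun i _ =>
      ((hpc i).enorm.measurable.const_mul _).aestronglyMeasurable) (by norm_num)).trans ?_
    rw [Finset.mul_sum, ENNReal.ofReal_sum_of_nonneg fun i _ => by positivity]
    refine Finset.sum_le_sum fun i _ => le_of_eq ?_
    have h1 : eLpNorm (fun x => ‖y‖ₑ * ‖partialDeriv i f x‖ₑ) 2 volume =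
        eLpNorm (fun x => ‖y‖ • partialDeriv i f x) 2 volume := by
      refine eLpNorm_congr_enorm_ae (.of_forall fun x => ?_)
      simp [enorm_smul]
    rw [h1]
    rw [show (fun x => ‖y‖ • partialDeriv i f x) = ‖y‖ • partialDeriv i f from rfl,
      eLpNorm_const_smul, ← eLpNorm_congr_ae (extend_partial_testFun hD i φ), eLpNorm_extend hD,
      ENNReal.ofReal_mul (norm_nonneg _)]
    simp
  refine le_trans ?_ hGn
  have key : eLpNorm (fun x => f (x + y) - f x) 2 volume ^ 2 ≤ eLpNorm G 2 volume ^ 2 := by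
    rw [eLpNorm_two_sq, eLpNorm_two_sq]
    simp only [enorm_eq_self]
    have hjm : Measurable fun q : E d × ℝ => G (q.1 + q.2 • y) ^ 2 := by fun_prop
    calc ∫⁻ x, ‖f (x + y) - f x‖ₑ ^ 2
        ≤ ∫⁻ x, ∫⁻ t in Ioc (0 : ℝ) 1, G (x + t • y) ^ 2 := by
          refine lintegral_mono fun x => ?_
          refine (pow_le_pow_left' (hpt x) 2).trans ?_
          have := sq_lintegral_mul_le (μ := volume.restrict (Ioc (0 : ℝ) 1)) (k := fun _ => 1)
            (f := fun t => G (x + t • y)) aemeasurable_const (by fun_prop)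
          simpa using this
      _ = ∫⁻ t in Ioc (0 : ℝ) 1, ∫⁻ x, G (x + t • y) ^ 2 :=
          lintegral_lintegral_swap hjm.aemeasurable
      _ = ∫⁻ t in Ioc (0 : ℝ) 1, ∫⁻ x, G x ^ 2 := by
          refine lintegral_congr fun t => ?_
          rw [lintegral_add_right_eq_self (fun x => G x ^ 2)]
      _ = _ := by simp
  exact (ENNReal.pow_le_pow_left_iff (by norm_num)).1 key

/-- Fields in `H¹₀` vary in `L²` at most linearly under translations, also across the boundary. -/
theorem eLpNorm_translate_sub_le_of_mem_H10 (hD : IsOpen D)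
    {z : PiLp 2 (fun _ : Unit ⊕ Fin d => L2 D)} (hz : z ∈ H10 D) (y : E d) :
    eLpNorm (fun x => extend (z (Sum.inl ())) (x + y) - extend (z (Sum.inl ())) x) 2 volume ≤
      ENNReal.ofReal (‖y‖ * ∑ i, ‖z (Sum.inr i)‖) := by
  obtain ⟨Z, hZ, hlim⟩ := mem_closure_iff_seq_limit.1 hz
  -- Approximation by test fields in the graph norm: translating the remaining error costs at most
  -- twice its norm, and the gradients converge as well.
  have hb : ∀ k, eLpNorm (fun x => extend (z (Sum.inl ())) (x + y) - extend (z (Sum.inl ())) x) 2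
      volume ≤ 2 * ENNReal.ofReal ‖z (Sum.inl ()) - Z k (Sum.inl ())‖ +
        ENNReal.ofReal (‖y‖ * ∑ i, ‖Z k (Sum.inr i)‖) := by
    intro k
    obtain ⟨φ, hφ⟩ := hZ k
    have h0 : Z k (Sum.inl ()) = TestFun.toL2 D φ := by rw [← hφ]; rfl
    have hi : ∀ i, Z k (Sum.inr i) = TestFun.partialL2 D i φ := fun i => by rw [← hφ]; rfl
    simp only [h0, hi]
    set w := z (Sum.inl ())
    have hae : (fun x => extend w (x + y) - extend w x) =ᵐ[volume]
        (fun x => extend (w - TestFun.toL2 D φ) (x + y) - extend (w - TestFun.toL2 D φ) x) +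
        (fun x => (φ : E d → E d) (x + y) - (φ : E d → E d) x) := by
      have a1 := extend_sub_ae hD w (TestFun.toL2 D φ)
      have a2 := extend_testFun hD φ
      have hq := (measurePreserving_add_right (volume : Measure (E d)) y).quasiMeasurePreserving
      filter_upwards [a1, a2, hq.ae_eq_comp a1, hq.ae_eq_comp a2] with x h1 h2 h3 h4
      simp only [Function.comp] at h3 h4
      simp only [Pi.add_apply, h1, h2, h3, h4]
      abel
    rw [eLpNorm_congr_ae hae]
    have hm := measurable_extend hD (w - TestFun.toL2 D φ)
    have hφc : Continuous (φ : E d → E d) := φ.2.1.continuous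
    refine (eLpNorm_add_le ((hm.comp (measurable_add_const y)).sub hm).aestronglyMeasurable
      (by fun_prop) (by norm_num)).trans ?_
    exact add_le_add (eLpNorm_translate_sub_le hD _ y) (eLpNorm_translate_sub_testFun_le hD φ y)
  have hc : ∀ j, Tendsto (fun k => Z k j) atTop (𝓝 (z j)) := fun j =>
    ((PiLp.continuous_apply 2 _ j).tendsto z).comp hlim
  have l1 : Tendsto (fun k => 2 * ENNReal.ofReal ‖z (Sum.inl ()) - Z k (Sum.inl ())‖ +
        ENNReal.ofReal (‖y‖ * ∑ i, ‖Z k (Sum.inr i)‖)) atTop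
      (𝓝 (2 * ENNReal.ofReal ‖z (Sum.inl ()) - z (Sum.inl ())‖ +
        ENNReal.ofReal (‖y‖ * ∑ i, ‖z (Sum.inr i)‖))) := by
    refine Tendsto.add (ENNReal.Tendsto.const_mul (ENNReal.tendsto_ofReal
      (Tendsto.norm (Tendsto.sub (G := L2 D) tendsto_const_nhds (hc (Sum.inl ())))))
        (.inr (by norm_num))) (ENNReal.tendsto_ofReal ?_)
    exact (tendsto_finsetSum _ fun i _ => (hc (Sum.inr i)).norm).const_mul _
  simpa using ge_of_tendsto' l1 hb

end H10

end Peridynamics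

namespace Peridynamics

/-! ### The continuous representative of a field in `W`, and its interpolation error. -/

section Representative

variable {d : ℕ} {D : Set (E d)}

/-- The sum of the norms of the second partial derivatives. -/
noncomputable def hessN (z : Jet D) (x : E d) : ℝ≥0∞ := ∑ i, ∑ j, ‖extend (z.hess i j) x‖ₑ

theorem measurable_hessN (hD : IsOpen D) (z : Jet D) : Measurable (hessN z) :=
  Finset.measurable_sum _ fun i _ => Finset.measurable_sum _ fun j _ =>
    (measurable_extend hD (z.hess i j)).enorm

/-- The `L²` modulus of continuity under translations of a field and its derivatives. -/
noncomputable def jetModulus (z : Jet D) (y : E d) : ℝ≥0∞ :=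
  eLpNorm (fun x => extend z.val (x + y) - extend z.val x) 2 volume +
    ∑ i, eLpNorm (fun x => extend (z.grad i) (x + y) - extend (z.grad i) x) 2 volume +
    ∑ i, ∑ j, eLpNorm (fun x => extend (z.hess i j) (x + y) - extend (z.hess i j) x) 2 volume

theorem tendsto_jetModulus (hD : IsOpen D) (z : Jet D) :
    Tendsto (jetModulus z) (𝓝 0) (𝓝 0) := by
  have h : ∀ f : L2 D, Tendsto (fun y => eLpNorm (fun x => extend f (x + y) - extend f x) 2 volume)
      (𝓝 0) (𝓝 0) := fun f => tendsto_eLpNorm_translate_sub (memLp_extend hD f)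
  have := ((h z.val).add (tendsto_finsetSum Finset.univ fun i _ => h (z.grad i))).add
    (tendsto_finsetSum Finset.univ fun i _ =>
      tendsto_finsetSum Finset.univ fun j _ => h (z.hess i j))
  unfold jetModulus
  simpa using this

theorem enorm_moll_sub_le (ρ : ContDiffBump (0 : E d)) {f : E d → E d}
    (hf : LocallyIntegrable f volume) (a b : E d) :
    ‖moll ρ f a - moll ρ f b‖ₑ ≤ ∫⁻ η, mollKernel ρ η * ‖f (a + η) - f (b + η)‖ₑ := by
  have hi : ∀ a, Integrable (fun η => ρ.normed volume η • f (a + η)) volume := fun a => by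
    have := (locallyIntegrable_map_homeomorph (Homeomorph.addLeft a) (f := f) (μ := volume)).1
      (by
        rw [show ⇑(Homeomorph.addLeft a) = fun x => a + x from rfl, map_add_left_eq_self]
        exact hf)
    exact this.integrable_smul_left_of_hasCompactSupport ρ.continuous_normed ρ.hasCompactSupport_normed
  rw [moll_apply, moll_apply, ← integral_sub (hi a) (hi b)]
  refine (enorm_integral_le_lintegral_enorm _).trans (le_of_eq (lintegral_congr fun ξ => ?_))
  rw [← smul_sub, enorm_smul, Real.enorm_eq_ofReal (ρ.nonneg_normed ξ), mollKernel]

/-- Mollification commutes with translations and does not increase the `L²` norm, so the bound is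
uniform in the mollifier. -/
theorem eLpNorm_moll_sub_le (ρ : ContDiffBump (0 : E d)) {f : E d → E d} (hfm : Measurable f)
    (hf : LocallyIntegrable f volume) (a b : E d) :
    eLpNorm (fun ξ => ‖moll ρ f (a + ξ) - moll ρ f (b + ξ)‖ₑ) 2 volume ≤
      eLpNorm (fun y => f (y + (a - b)) - f y) 2 volume := by
  set g : E d → ℝ≥0∞ := fun y => ‖f (y + (a - b)) - f y‖ₑ
  have hg : Measurable g := ((hfm.comp (measurable_add_const _)).sub hfm).enorm
  have h1 := eLpNorm_lintegral_translate_le (measurable_mollKernel ρ) hg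
  rw [lintegral_mollKernel, one_mul] at h1
  have h2 : eLpNorm g 2 volume = eLpNorm (fun y => f (y + (a - b)) - f y) 2 volume :=
    eLpNorm_enorm _
  rw [← h2]
  refine le_trans ?_ h1
  set H : E d → ℝ≥0∞ := fun x => ∫⁻ ξ, mollKernel ρ ξ * g (x + ξ)
  have hH : Measurable H := by
    have : Measurable fun p : E d × E d => mollKernel ρ p.2 * g (p.1 + p.2) :=
      ((measurable_mollKernel ρ).comp measurable_snd).mul
        (hg.comp (measurable_fst.add measurable_snd))
    exact this.lintegral_prod_right'
  have h3 : eLpNorm (fun ξ => H (b + ξ)) 2 volume = eLpNorm H 2 volume :=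
    eLpNorm_comp_measurePreserving hH.aestronglyMeasurable (measurePreserving_add_left volume b)
  rw [← h3]
  refine eLpNorm_mono_enorm fun ξ => ?_
  simp only [enorm_eq_self]
  refine (enorm_moll_sub_le ρ hf _ _).trans (lintegral_mono fun η => le_of_eq ?_)
  simp only [g]
  congr 4
  abel

/-- The second derivatives of a mollified field, averaged over a set inside the domain. -/
theorem eLpNorm_fderiv_fderiv_moll_le (hD : IsOpen D) (w : W D) (ρ : ContDiffBump (0 : E d))
    {K K' : Set (E d)} (hK : MeasurableSet K) (hK' : MeasurableSet K') {R : ℝ} (hR : ρ.rOut < R)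
    (h : ∀ x ∈ K, Metric.ball x R ⊆ K') (hK'D : K' ⊆ D) :
    eLpNorm (fun x => ‖fderiv ℝ (fderiv ℝ (moll ρ (extend (w : Jet D).val))) x‖ₑ) 2
      (volume.restrict K) ≤ eLpNorm (hessN (w : Jet D)) 2 (volume.restrict K') := by
  refine le_trans ?_ (eLpNorm_moll_kernel_le ρ (measurable_hessN hD w) hK hK' fun x hx ξ hξ =>
    h x hx (by simpa [Metric.mem_ball, dist_eq_norm] using hξ.trans hR))
  refine eLpNorm_mono_enorm_ae ((ae_restrict_iff' hK).2 (.of_forall fun x hx => ?_))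
  simp only [enorm_eq_self]
  refine (enorm_le_sum_enorm_single₂ _).trans ?_
  have e : ∫⁻ ξ, mollKernel ρ ξ * hessN (w : Jet D) (x + ξ) =
      ∑ i, ∑ j, ∫⁻ ξ, mollKernel ρ ξ * ‖extend ((w : Jet D).hess i j) (x + ξ)‖ₑ := by
    simp only [hessN, Finset.mul_sum]
    have hm : ∀ i j, Measurable fun ξ => mollKernel ρ ξ * ‖extend ((w : Jet D).hess i j) (x + ξ)‖ₑ :=
      fun i j => (measurable_mollKernel ρ).mul
        ((measurable_extend hD _).comp (measurable_const_add x)).enorm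
    rw [lintegral_finsetSum _ fun i _ => Finset.measurable_sum _ fun j _ => hm i j]
    exact Finset.sum_congr rfl fun i _ => lintegral_finsetSum _ fun j _ => hm i j
  rw [e]
  gcongr with i _ j _
  rw [fderiv_fderiv_moll_extend ρ hD (w.2.1 i) (w.2.2.1 i j) hR ((h x hx).trans hK'D)]
  exact enorm_moll_le _ _ _

/-- The modulus of continuity of mollified fields. -/
theorem enorm_moll_sub_le_jetModulus (hd : d ≤ 3) (hD : IsOpen D) (w : W D)
    (ρ : ContDiffBump (0 : E d)) {K : Set (E d)} (hK : Convex ℝ K) (hKm : MeasurableSet K)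
    (hK0 : volume K ≠ 0) (hKt : volume K ≠ ⊤) {h : ℝ} (hh : ∀ x ∈ K, ∀ y ∈ K, ‖x - y‖ ≤ h)
    (h0 : (0 : E d) ∈ K) {R : ℝ} (hR : ρ.rOut < R) {a b : E d}
    (ha : ∀ ξ ∈ K, Metric.ball (a + ξ) R ⊆ D) (hb : ∀ ξ ∈ K, Metric.ball (b + ξ) R ⊆ D) :
    volume K ^ (1 / 2 : ℝ) *
      ‖moll ρ (extend (w : Jet D).val) a - moll ρ (extend (w : Jet D).val) b‖ₑ ≤
      (1 + ENNReal.ofReal h + ENNReal.ofReal (2 * h ^ 2)) * jetModulus (w : Jet D) (a - b) := by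
  set g := moll ρ (extend (w : Jet D).val) with hg
  have hgs : ContDiff ℝ 2 g := contDiff_moll ρ (locallyIntegrable_extend hD _) (n := 2)
  have hgs1 : ContDiff ℝ 1 (fderiv ℝ g) := hgs.fderiv_right (by norm_num)
  -- Sobolev's inequality on `K` is applied to the difference of the two translates and read off at
  -- `ξ = 0`; all norms on its right are translation moduli.
  set φ : E d → E d := fun ξ => g (a + ξ) - g (b + ξ)
  have hφ : ContDiff ℝ 2 φ :=
    (hgs.comp (contDiff_const.add contDiff_id)).sub (hgs.comp (contDiff_const.add contDiff_id))
  have hdiff : Differentiable ℝ g := hgs.differentiable (by norm_num)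
  have hdiff1 : Differentiable ℝ (fderiv ℝ g) := hgs1.differentiable (by norm_num)
  have hφ1 : fderiv ℝ φ = fun ξ => fderiv ℝ g (a + ξ) - fderiv ℝ g (b + ξ) := by
    ext1 ξ
    have h1 : HasFDerivAt (fun ξ => g (a + ξ)) (fderiv ℝ g (a + ξ)) ξ :=
      (hasFDerivAt_comp_add_left _).2 (hdiff _).hasFDerivAt
    have h2 : HasFDerivAt (fun ξ => g (b + ξ)) (fderiv ℝ g (b + ξ)) ξ :=
      (hasFDerivAt_comp_add_left _).2 (hdiff _).hasFDerivAt
    exact (h1.sub h2).fderiv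
  have hφ2 : ∀ ξ, fderiv ℝ (fderiv ℝ φ) ξ =
      fderiv ℝ (fderiv ℝ g) (a + ξ) - fderiv ℝ (fderiv ℝ g) (b + ξ) := by
    intro ξ
    have h1 : HasFDerivAt (fun ξ => fderiv ℝ g (a + ξ)) (fderiv ℝ (fderiv ℝ g) (a + ξ)) ξ :=
      (hasFDerivAt_comp_add_left _).2 (hdiff1 _).hasFDerivAt
    have h2 : HasFDerivAt (fun ξ => fderiv ℝ g (b + ξ)) (fderiv ℝ (fderiv ℝ g) (b + ξ)) ξ :=
      (hasFDerivAt_comp_add_left _).2 (hdiff1 _).hasFDerivAt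
    rw [hφ1]
    exact (h1.sub h2).fderiv
  have key := enorm_le_of_convex hd hφ hK hKm hK0 hKt hh h0
  have hT : ∀ f : L2 D, Measurable fun ξ =>
      ‖moll ρ (extend f) (a + ξ) - moll ρ (extend f) (b + ξ)‖ₑ := fun f => by
    have : Continuous (moll ρ (extend f)) :=
      (contDiff_moll ρ (locallyIntegrable_extend hD f) (n := 1)).continuous
    exact Continuous.measurable (by fun_prop)
  have hT' : ∀ f : L2 D, eLpNorm (fun ξ =>
      ‖moll ρ (extend f) (a + ξ) - moll ρ (extend f) (b + ξ)‖ₑ) 2 (volume.restrict K) ≤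
      eLpNorm (fun x => extend f (x + (a - b)) - extend f x) 2 volume := fun f =>
    (eLpNorm_mono_measure _ Measure.restrict_le_self).trans
      (eLpNorm_moll_sub_le ρ (measurable_extend hD f) (locallyIntegrable_extend hD f) a b)
  have hcl : ∀ y, Metric.ball y R ⊆ D → Metric.closedBall y ρ.rOut ⊆ D := fun y hy =>
    (Metric.closedBall_subset_ball hR).trans hy
  have b0 : eLpNorm (fun x => ‖φ x‖ₑ) 2 (volume.restrict K) ≤ jetModulus (w : Jet D) (a - b) :=
    (hT' _).trans (by unfold jetModulus; rw [add_assoc]; exact le_self_add)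
  have b1 : eLpNorm (fun x => ‖fderiv ℝ φ x‖ₑ) 2 (volume.restrict K) ≤
      jetModulus (w : Jet D) (a - b) := by
    refine le_trans (b := ∑ i, eLpNorm (fun x => extend ((w : Jet D).grad i) (x + (a - b)) -
      extend ((w : Jet D).grad i) x) 2 volume) ?_
      (by unfold jetModulus; exact le_add_right le_add_self)
    refine le_trans ?_ (Finset.sum_le_sum fun i _ => hT' _)
    refine le_trans ?_ (eLpNorm_sum_le (fun i _ => (hT _).aestronglyMeasurable) (by norm_num))
    refine eLpNorm_mono_enorm_ae ((ae_restrict_iff' hKm).2 (.of_forall fun ξ hξ => ?_))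
    rw [enorm_eq_self, enorm_eq_self, Finset.sum_apply]
    refine (enorm_le_sum_enorm_single _).trans (Finset.sum_le_sum fun i _ => le_of_eq ?_)
    rw [hφ1]
    simp only [sub_apply, hg]
    rw [fderiv_moll_extend ρ hD (w.2.1 i) (hcl _ (ha ξ hξ)),
      fderiv_moll_extend ρ hD (w.2.1 i) (hcl _ (hb ξ hξ))]
  have b2 : eLpNorm (fun x => ‖fderiv ℝ (fderiv ℝ φ) x‖ₑ) 2 (volume.restrict K) ≤
      jetModulus (w : Jet D) (a - b) := by
    refine le_trans (b := ∑ i, ∑ j, eLpNorm (fun x => extend ((w : Jet D).hess i j) (x + (a - b)) -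
      extend ((w : Jet D).hess i j) x) 2 volume) ?_ (by unfold jetModulus; exact le_add_self)
    refine le_trans ?_ (Finset.sum_le_sum fun i _ => Finset.sum_le_sum fun j _ => hT' _)
    refine le_trans ?_ (Finset.sum_le_sum fun i _ =>
      eLpNorm_sum_le (fun j _ => (hT _).aestronglyMeasurable) (by norm_num))
    refine le_trans ?_ (eLpNorm_sum_le (fun i _ => (Finset.aestronglyMeasurable_sum _ fun j _ =>
      (hT _).aestronglyMeasurable)) (by norm_num))
    refine eLpNorm_mono_enorm_ae ((ae_restrict_iff' hKm).2 (.of_forall fun ξ hξ => ?_))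
    rw [enorm_eq_self, enorm_eq_self, Finset.sum_apply]
    simp only [Finset.sum_apply]
    refine (enorm_le_sum_enorm_single₂ _).trans (Finset.sum_le_sum fun i _ =>
      Finset.sum_le_sum fun j _ => le_of_eq ?_)
    rw [hφ2]
    simp only [sub_apply, hg]
    rw [fderiv_fderiv_moll_extend ρ hD (w.2.1 i) (w.2.2.1 i j) hR (ha ξ hξ),
      fderiv_fderiv_moll_extend ρ hD (w.2.1 i) (w.2.2.1 i j) hR (hb ξ hξ)]
  have e0 : φ 0 = g a - g b := by simp [φ]
  rw [e0] at key
  refine key.trans ?_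
  rw [add_mul, add_mul, one_mul]
  gcongr

/-- A sequence of mollifiers. -/
noncomputable def bumpSeq (d : ℕ) (n : ℕ) : ContDiffBump (0 : E d) where
  rIn := 1 / (2 * (n + 1))
  rOut := 1 / (n + 1)
  rIn_pos := by positivity
  rIn_lt_rOut := by
    apply one_div_lt_one_div_of_lt (by positivity)
    have : (0 : ℝ) ≤ n := n.cast_nonneg
    linarith

theorem tendsto_rOut_bumpSeq : Tendsto (fun n => (bumpSeq d n).rOut) atTop (𝓝 0) :=
  tendsto_one_div_add_atTop_nhds_zero_nat

theorem rOut_bumpSeq_le (n : ℕ) : (bumpSeq d n).rOut ≤ 2 * (bumpSeq d n).rIn := by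
  simp only [bumpSeq]
  field_simp
  norm_num

/-- The regularizations of a field. -/
noncomputable def regularize (w : W D) (n : ℕ) : E d → E d :=
  moll (bumpSeq d n) (extend (w : Jet D).val)

theorem ae_tendsto_regularize (hD : IsOpen D) (w : W D) :
    ∀ᵐ x, Tendsto (fun n => regularize w n x) atTop (𝓝 (extend (w : Jet D).val x)) :=
  ContDiffBump.ae_convolution_tendsto_right_of_locallyIntegrable (tendsto_rOut_bumpSeq)
    (.of_forall rOut_bumpSeq_le) (locallyIntegrable_extend hD _)

/-- The convex set is the cone of translations that keep `D` near `p` inside `D`, so the constant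
depends on `p` but neither on the field nor on the points. Compactness gives `a + K` and `b + K` a
margin inside `D`, which sufficiently fine mollifiers respect. -/
theorem exists_modulus_regularize (hd : d ≤ 3) (hD : IsOpen D) (hL : HasLipschitzBoundary D)
    {p : E d} (hp : p ∈ closure D) : ∃ r > 0, ∃ C : ℝ≥0∞, C ≠ ⊤ ∧ ∀ (w : W D),
      ∀ a ∈ D ∩ Metric.ball p r, ∀ b ∈ D ∩ Metric.ball p r,
      ∀ᶠ n in atTop, ‖regularize w n a - regularize w n b‖ₑ ≤ C * jetModulus (w : Jet D) (a - b) := by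
  obtain ⟨K, r, hr, hKc, hKk, hK0, hKi, hKD⟩ := exists_convex_translate_subset hD hL hp
  have hv0 : volume K ≠ 0 := (hKi.mono interior_subset |> fun _ =>
    (Measure.measure_pos_of_nonempty_interior volume hKi).ne')
  have hvt : volume K ≠ ⊤ := hKk.measure_lt_top.ne
  have hm0 : volume K ^ (1 / 2 : ℝ) ≠ 0 := by simp [hv0, hvt]
  have hmt : volume K ^ (1 / 2 : ℝ) ≠ ⊤ := by simp [hv0, hvt]
  have hh : ∀ x ∈ K, ∀ y ∈ K, ‖x - y‖ ≤ Metric.diam K := fun x hx y hy => by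
    rw [← dist_eq_norm]; exact Metric.dist_le_diam_of_mem hKk.isBounded hx hy
  refine ⟨r, hr, (volume K ^ (1 / 2 : ℝ))⁻¹ * (1 + ENNReal.ofReal (Metric.diam K) +
    ENNReal.ofReal (2 * Metric.diam K ^ 2)), ?_, fun w a ha b hb => ?_⟩
  · refine ENNReal.mul_ne_top (by simpa using hm0) (by finiteness)
  have hthick : ∀ a ∈ D ∩ Metric.ball p r, ∃ R > 0, ∀ ξ ∈ K, Metric.ball (a + ξ) R ⊆ D := by
    intro a ha
    obtain ⟨R, hR, hRD⟩ := (hKk.image (continuous_const_add a)).exists_thickening_subset_open hD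
      (by rintro _ ⟨ξ, hξ, rfl⟩; exact hKD a ha ξ hξ)
    exact ⟨R, hR, fun ξ hξ => (Metric.ball_subset_thickening (mem_image_of_mem _ hξ) R).trans hRD⟩
  obtain ⟨R1, hR1, h1⟩ := hthick a ha
  obtain ⟨R2, hR2, h2⟩ := hthick b hb
  have hev : ∀ᶠ n in atTop, (bumpSeq d n).rOut < min R1 R2 :=
    tendsto_rOut_bumpSeq.eventually_lt_const (lt_min hR1 hR2)
  filter_upwards [hev] with n hn
  have := enorm_moll_sub_le_jetModulus hd hD w (bumpSeq d n) hKc hKk.measurableSet hv0 hvt hh hK0 hn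
    (fun ξ hξ => (Metric.ball_subset_ball (min_le_left _ _)).trans (h1 ξ hξ))
    (fun ξ hξ => (Metric.ball_subset_ball (min_le_right _ _)).trans (h2 ξ hξ))
  rw [mul_assoc, ← ENNReal.div_eq_inv_mul, ENNReal.le_div_iff_mul_le (.inl hm0) (.inl hmt), mul_comm]
  exact this

theorem exists_small_modulus (hD : IsOpen D) (z : Jet D) {C : ℝ≥0∞} (hC : C ≠ ⊤) {η : ℝ≥0∞}
    (hη : 0 < η) : ∃ t > 0, ∀ y : E d, ‖y‖ < t → C * jetModulus z y < η := by
  have h1 : Tendsto (fun y => C * jetModulus z y) (𝓝 0) (𝓝 0) := by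
    simpa using ENNReal.Tendsto.const_mul (tendsto_jetModulus hD z) (.inr hC)
  obtain ⟨t, ht, h2⟩ := Metric.eventually_nhds_iff.1 (h1.eventually_lt_const hη)
  exact ⟨t, ht, fun y hy => h2 (by simpa using hy)⟩

/-- Convergence holds almost everywhere, hence on a dense set, and the common modulus of continuity
transfers the Cauchy property from a nearby good point to `x`. -/
theorem exists_tendsto_regularize (hd : d ≤ 3) (hD : IsOpen D) (hL : HasLipschitzBoundary D)
    (w : W D) {x : E d} (hx : x ∈ D) : ∃ l, Tendsto (fun n => regularize w n x) atTop (𝓝 l) := by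
  refine cauchySeq_tendsto_of_complete ?_
  obtain ⟨r, hr, C, hC, hmod⟩ := exists_modulus_regularize hd hD hL (subset_closure hx)
  rw [Metric.cauchySeq_iff']
  intro η hη
  obtain ⟨t, ht, hsmall⟩ := exists_small_modulus hD (w : Jet D) hC
    (η := ENNReal.ofReal (η / 3)) (by simpa using hη)
  have hdense := Measure.dense_of_ae (ae_tendsto_regularize hD w)
  obtain ⟨y, hy1, hy2⟩ := hdense.inter_open_nonempty (D ∩ Metric.ball x (min r t))
    (hD.inter Metric.isOpen_ball) ⟨x, hx, Metric.mem_ball_self (lt_min hr ht)⟩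
  have hyr : y ∈ D ∩ Metric.ball x r := ⟨hy1.1, Metric.ball_subset_ball (min_le_left _ _) hy1.2⟩
  have hyt : ‖x - y‖ < t := by
    have := hy1.2
    rw [Metric.mem_ball, dist_comm, dist_eq_norm] at this
    exact this.trans_le (min_le_right _ _)
  have hev : ∀ᶠ n in atTop, ‖regularize w n x - regularize w n y‖ < η / 3 := by
    filter_upwards [hmod w x ⟨hx, Metric.mem_ball_self hr⟩ y hyr] with n hn
    have h1 := hn.trans_lt (hsmall _ hyt)
    rw [← ofReal_norm] at h1
    exact (ENNReal.ofReal_lt_ofReal_iff (by positivity)).1 h1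
  obtain ⟨N1, hN1⟩ := eventually_atTop.1 hev
  obtain ⟨N2, hN2⟩ := Metric.cauchySeq_iff.1 (Tendsto.cauchySeq hy2.out) (η / 3) (by positivity)
  refine ⟨max N1 N2, fun n hn => ?_⟩
  have a1 := hN1 n (le_of_max_le_left hn)
  have a2 := hN1 (max N1 N2) (le_max_left _ _)
  have a3 := hN2 n (le_of_max_le_right hn) (max N1 N2) (le_max_right _ _)
  rw [← dist_eq_norm] at a1 a2
  rw [dist_comm] at a2
  calc _ ≤ dist (regularize w n x) (regularize w n y) +
        dist (regularize w n y) (regularize w (max N1 N2) y) +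
        dist (regularize w (max N1 N2) y) (regularize w (max N1 N2) x) := dist_triangle4 _ _ _ _
    _ < η := by linarith

/-- The continuous representative of a field in `W`, zero outside `D`. -/
noncomputable def rep (w : W D) : E d → E d :=
  D.indicator fun x => limUnder atTop fun n => regularize w n x

theorem rep_of_notMem (w : W D) {x : E d} (hx : x ∉ D) : rep w x = 0 :=
  indicator_of_notMem hx _

theorem tendsto_rep (hd : d ≤ 3) (hD : IsOpen D) (hL : HasLipschitzBoundary D) (w : W D)
    {x : E d} (hx : x ∈ D) : Tendsto (fun n => regularize w n x) atTop (𝓝 (rep w x)) := by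
  rw [rep, indicator_of_mem hx]
  exact tendsto_nhds_limUnder (exists_tendsto_regularize hd hD hL w hx)

theorem extend_ae_eq_rep (hd : d ≤ 3) (hD : IsOpen D) (hL : HasLipschitzBoundary D) (w : W D) :
    extend (W.toL2 w) =ᵐ[volume] rep w := by
  filter_upwards [ae_tendsto_regularize hD w] with x hx
  by_cases hxD : x ∈ D
  · exact tendsto_nhds_unique hx (tendsto_rep hd hD hL w hxD)
  · rw [rep_of_notMem w hxD, extend_of_notMem _ hxD]

theorem exists_modulus_rep (hd : d ≤ 3) (hD : IsOpen D) (hL : HasLipschitzBoundary D)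
    {p : E d} (hp : p ∈ closure D) : ∃ r > 0, ∃ C : ℝ≥0∞, C ≠ ⊤ ∧ ∀ (w : W D),
      ∀ a ∈ D ∩ Metric.ball p r, ∀ b ∈ D ∩ Metric.ball p r,
      ‖rep w a - rep w b‖ₑ ≤ C * jetModulus (w : Jet D) (a - b) := by
  obtain ⟨r, hr, C, hC, h⟩ := exists_modulus_regularize hd hD hL hp
  refine ⟨r, hr, C, hC, fun w a ha b hb => ?_⟩
  exact le_of_tendsto ((tendsto_rep hd hD hL w ha.1).sub (tendsto_rep hd hD hL w hb.1)).enorm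
    (h w a ha b hb)

theorem eLpNorm_rep_translate_sub_le (hd : d ≤ 3) (hD : IsOpen D) (hL : HasLipschitzBoundary D)
    (w : W D) (y : E d) : eLpNorm (fun x => rep w (x + y) - rep w x) 2 volume ≤
      ENNReal.ofReal (‖y‖ * ∑ i, ‖(w : Jet D).grad i‖) := by
  have h := eLpNorm_translate_sub_le_of_mem_H10 hD w.2.2.2 y
  refine le_trans (le_of_eq (eLpNorm_congr_ae ?_)) h
  have a1 := extend_ae_eq_rep hd hD hL w
  filter_upwards [a1, (measurePreserving_add_right (volume : Measure (E d))
    y).quasiMeasurePreserving.ae_eq_comp a1] with x h1 h2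
  simp only [Function.comp] at h2
  rw [← h1, ← h2]
  rfl

/-- The representative tends to zero at the boundary. -/
theorem tendsto_rep_boundary (hd : d ≤ 3) (hD : IsOpen D) (hL : HasLipschitzBoundary D)
    (w : W D) {p : E d} (hp : p ∈ frontier D) : Tendsto (rep w) (𝓝 p) (𝓝 0) := by
  have hpD : p ∉ D := fun h => by
    have := hp.2
    rw [hD.interior_eq] at this
    exact this h
  obtain ⟨r, hr, C, hC, hmod⟩ := exists_modulus_rep hd hD hL hp.1
  obtain ⟨n, C', r', hn, hC', hr', hout⟩ := exists_direction_out hL hp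
  rw [Metric.tendsto_nhds_nhds]
  by_contra! hcon
  obtain ⟨a, ha, hcon⟩ := hcon
  obtain ⟨t, ht, hsmall⟩ := exists_small_modulus hD (w : Jet D) hC (η := ENNReal.ofReal (a / 2))
    (by simpa using ha)
  set η := min r (t / 2)
  have hη : 0 < η := lt_min hr (by positivity)
  obtain ⟨x0, hx0, hx0a⟩ := hcon η hη
  rw [dist_zero_right] at hx0a
  have hx0D : x0 ∈ D := by
    by_contra hx
    rw [rep_of_notMem w hx, norm_zero] at hx0a
    linarith
  -- Suppose the values stay at least `a` in norm at some points arbitrarily close to `p`. The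
  -- modulus of continuity spreads the bound, as `a / 2`, to all of `D` near `p`.
  have hlow : ∀ x ∈ D ∩ Metric.ball p η, a / 2 ≤ ‖rep w x‖ := by
    rintro x ⟨hxD, hx⟩
    have hη1 : η ≤ r := min_le_left _ _
    have hη2 : η ≤ t / 2 := min_le_right _ _
    have h1 := hmod w x0 ⟨hx0D, Metric.mem_ball.2 (by linarith)⟩ x
      ⟨hxD, Metric.ball_subset_ball hη1 hx⟩
    have h2 : ‖x0 - x‖ < t := by
      rw [← dist_eq_norm]
      rw [Metric.mem_ball, dist_comm] at hx
      linarith [dist_triangle x0 p x]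
    have h3 := h1.trans_lt (hsmall _ h2)
    rw [← ofReal_norm] at h3
    have h4 := (ENNReal.ofReal_lt_ofReal_iff (by positivity)).1 h3
    have h5 := norm_le_norm_add_norm_sub' (rep w x0) (rep w x)
    linarith
  set τ := min r' (η / 2)
  have hτ : 0 < τ := lt_min hr' (by positivity)
  set δ := min (min (τ / C') (η / 2)) r'
  have hδ : 0 < δ := lt_min (lt_min (by positivity) (by positivity)) hr'
  set S := D ∩ Metric.ball p δ
  have hSo : IsOpen S := hD.inter Metric.isOpen_ball
  have hSn : S.Nonempty := by
    obtain ⟨y, hy, hy2⟩ := Metric.mem_closure_iff.1 hp.1 δ hδ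
    exact ⟨y, hy, by rwa [Metric.mem_ball, dist_comm]⟩
  have hS0 : volume S ≠ 0 := (hSo.measure_pos volume hSn).ne'
  set G := ∑ i, ‖(w : Jet D).grad i‖
  have hrm : AEMeasurable (rep w) volume :=
    (measurable_extend hD _).aemeasurable.congr (extend_ae_eq_rep hd hD hL w)
  -- Each point of `S` leaves `D` when moved by `τ` against `n`. Dividing this way into `m + 1`
  -- steps of length `s`, one step must take the field from size at least `a / 2` to `0`. By the
  -- `H¹₀` estimate a step has squared `L²` norm at most `(s G)²`, so all steps together contribute
  -- at most `(τ G)² / (m + 1)`, which tends to zero although `S` has positive volume.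
  have hbound : ∀ m : ℕ, ENNReal.ofReal (a / 2) ^ 2 * volume S ≤
      ENNReal.ofReal ((τ * G) ^ 2 / (m + 1)) := by
    intro m
    set s := τ / (m + 1)
    have hs : 0 < s := by positivity
    have hcross : ∀ x ∈ S, ENNReal.ofReal (a / 2) ^ 2 ≤ ∑ j ∈ Finset.range (m + 1),
        ‖rep w ((x + -((j : ℝ) * s) • n) + -s • n) - rep w (x + -((j : ℝ) * s) • n)‖ₑ ^ 2 := by
      rintro x ⟨hxD, hxb⟩
      have hex : ∃ j : ℕ, x - ((j : ℝ) * s) • n ∉ D := by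
        refine ⟨m + 1, hout x ?_ p (Metric.mem_ball_self hr') hpD _ ?_ ?_⟩
        · exact Metric.ball_subset_ball (min_le_right _ _) hxb
        · rw [Metric.mem_ball, dist_eq_norm] at hxb
          have h1 : δ ≤ τ / C' := (min_le_left _ _).trans (min_le_left _ _)
          have h2 : ‖x - p‖ ≤ τ / C' := by linarith
          rw [le_div_iff₀ (by linarith)] at h2
          have h3 : ((m + 1 : ℕ) : ℝ) * s = τ := by
            simp only [s]; push_cast; field_simp
          rw [h3]
          linarith
        · have h3 : ((m + 1 : ℕ) : ℝ) * s = τ := by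
            simp only [s]; push_cast; field_simp
          rw [h3]
          exact min_le_left _ _
      classical
      -- The first grid point outside `D` is selected. Its index is positive because `x` lies in
      -- `D`, so its predecessor exists and is still inside.
      have hj1 : Nat.find hex ≠ 0 := fun h0 => by
        have := Nat.find_spec hex
        rw [h0] at this
        simp [hxD] at this
      have hjm : Nat.find hex ≤ m + 1 := by
        refine Nat.find_min' hex (hout x ?_ p (Metric.mem_ball_self hr') hpD _ ?_ ?_)
        · exact Metric.ball_subset_ball (min_le_right _ _) hxb
        · rw [Metric.mem_ball, dist_eq_norm] at hxb
          have h1 : δ ≤ τ / C' := (min_le_left _ _).trans (min_le_left _ _)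
          have h2 : ‖x - p‖ ≤ τ / C' := by linarith
          rw [le_div_iff₀ (by linarith)] at h2
          have h3 : ((m + 1 : ℕ) : ℝ) * s = τ := by
            simp only [s]; push_cast; field_simp
          rw [h3]
          linarith
        · have h3 : ((m + 1 : ℕ) : ℝ) * s = τ := by
            simp only [s]; push_cast; field_simp
          rw [h3]
          exact min_le_left _ _
      obtain ⟨j, hj⟩ := Nat.exists_eq_succ_of_ne_zero hj1
      have hjD : x - ((j : ℝ) * s) • n ∈ D := by
        have := Nat.find_min hex (m := j) (by omega)
        simpa using this
      have hjD' : x - (((j + 1 : ℕ) : ℝ) * s) • n ∉ D := by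
        have := Nat.find_spec hex
        rwa [hj] at this
      refine le_trans ?_ (Finset.single_le_sum (f := fun j : ℕ =>
        ‖rep w ((x + -((j : ℝ) * s) • n) + -s • n) - rep w (x + -((j : ℝ) * s) • n)‖ₑ ^ 2)
        (fun _ _ => zero_le) (Finset.mem_range.2 (by omega : j < m + 1)))
      have e1 : x + -((j : ℝ) * s) • n = x - ((j : ℝ) * s) • n := by module
      have e2 : (x + -((j : ℝ) * s) • n) + -s • n = x - (((j + 1 : ℕ) : ℝ) * s) • n := by
        push_cast; module
      simp only [e2]
      rw [e1, rep_of_notMem w hjD', zero_sub, enorm_neg]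
      have hjb : x - ((j : ℝ) * s) • n ∈ Metric.ball p η := by
        rw [Metric.mem_ball, dist_eq_norm] at *
        calc ‖x - ((j : ℝ) * s) • n - p‖ = ‖(x - p) - ((j : ℝ) * s) • n‖ := by congr 1; abel
          _ ≤ ‖x - p‖ + ‖((j : ℝ) * s) • n‖ := norm_sub_le _ _
          _ < η / 2 + η / 2 := by
            refine add_lt_add_of_lt_of_le (hxb.trans_le ((min_le_left _ _).trans (min_le_right _ _))) ?_
            rw [norm_smul, hn, mul_one, Real.norm_of_nonneg (by positivity)]
            have h1 : (j : ℝ) ≤ m + 1 := by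
              have : j ≤ m + 1 := by omega
              exact_mod_cast this
            calc (j : ℝ) * s ≤ (m + 1) * s := by gcongr
              _ = τ := by simp only [s]; field_simp
              _ ≤ η / 2 := min_le_right _ _
          _ = η := by ring
      rw [← ofReal_norm]
      gcongr
      exact hlow _ ⟨hjD, hjb⟩
    have hterm : ∀ j : ℕ, ∫⁻ x, ‖rep w ((x + -((j : ℝ) * s) • n) + -s • n) -
        rep w (x + -((j : ℝ) * s) • n)‖ₑ ^ 2 ≤ ENNReal.ofReal ((s * G) ^ 2) := by
      intro j
      rw [lintegral_add_right_eq_self (fun x => ‖rep w (x + -s • n) - rep w x‖ₑ ^ 2)]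
      have h1 := eLpNorm_rep_translate_sub_le hd hD hL w (-s • n)
      rw [norm_smul, hn, mul_one, norm_neg, Real.norm_of_nonneg hs.le] at h1
      have h2 := pow_le_pow_left' h1 2
      rwa [eLpNorm_two_sq, ← ENNReal.ofReal_pow (by positivity)] at h2
    calc ENNReal.ofReal (a / 2) ^ 2 * volume S = ∫⁻ _ in S, ENNReal.ofReal (a / 2) ^ 2 := by simp
      _ ≤ ∫⁻ x in S, ∑ j ∈ Finset.range (m + 1),
          ‖rep w ((x + -((j : ℝ) * s) • n) + -s • n) - rep w (x + -((j : ℝ) * s) • n)‖ₑ ^ 2 :=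
          setLIntegral_mono' hSo.measurableSet hcross
      _ ≤ ∫⁻ x, ∑ j ∈ Finset.range (m + 1),
          ‖rep w ((x + -((j : ℝ) * s) • n) + -s • n) - rep w (x + -((j : ℝ) * s) • n)‖ₑ ^ 2 :=
          setLIntegral_le_lintegral _ _
      _ = ∑ j ∈ Finset.range (m + 1), ∫⁻ x,
          ‖rep w ((x + -((j : ℝ) * s) • n) + -s • n) - rep w (x + -((j : ℝ) * s) • n)‖ₑ ^ 2 := by
          refine lintegral_finsetSum' _ fun j _ => ?_
          have hq : ∀ y : E d, AEMeasurable (fun x => rep w (x + y)) volume := fun y =>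
            hrm.comp_quasiMeasurePreserving
              (measurePreserving_add_right volume y).quasiMeasurePreserving
          have h1 := hq (-((j : ℝ) * s) • n + -s • n)
          simp only [← add_assoc] at h1
          exact ((h1.sub (hq _)).enorm).pow_const 2
      _ ≤ ∑ j ∈ Finset.range (m + 1), ENNReal.ofReal ((s * G) ^ 2) :=
          Finset.sum_le_sum fun j _ => hterm j
      _ = ENNReal.ofReal ((τ * G) ^ 2 / (m + 1)) := by
          rw [Finset.sum_const, Finset.card_range, nsmul_eq_mul, ← ENNReal.ofReal_natCast,
            ← ENNReal.ofReal_mul (by positivity)]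
          congr 1
          simp only [s]
          push_cast
          field_simp
  have hlim : Tendsto (fun m : ℕ => ENNReal.ofReal ((τ * G) ^ 2 / ((m : ℝ) + 1))) atTop (𝓝 0) := by
    have := (tendsto_one_div_add_atTop_nhds_zero_nat (𝕜 := ℝ)).const_mul ((τ * G) ^ 2)
    have := ENNReal.tendsto_ofReal this
    simpa [div_eq_mul_inv] using this
  have h0 := ge_of_tendsto' hlim hbound
  have : ENNReal.ofReal (a / 2) ^ 2 * volume S ≠ 0 :=
    mul_ne_zero (pow_ne_zero 2 (by simpa using ha)) hS0
  exact this (le_antisymm h0 zero_le)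

theorem continuous_rep (hd : d ≤ 3) (hD : IsOpen D) (hL : HasLipschitzBoundary D) (w : W D) :
    Continuous (rep w) := by
  rw [continuous_iff_continuousAt]
  intro x
  by_cases hx : x ∈ D
  · obtain ⟨r, hr, C, hC, hmod⟩ := exists_modulus_rep hd hD hL (subset_closure hx)
    rw [ContinuousAt, Metric.tendsto_nhds_nhds]
    intro a ha
    obtain ⟨t, ht, hsmall⟩ := exists_small_modulus hD (w : Jet D) hC (η := ENNReal.ofReal a)
      (by simpa using ha)
    obtain ⟨R, hR, hRD⟩ := Metric.isOpen_iff.1 hD x hx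
    refine ⟨min (min r t) R, lt_min (lt_min hr ht) hR, fun y hy => ?_⟩
    have hyR : y ∈ D := hRD (hy.trans_le (min_le_right _ _))
    have h1 := hmod w y ⟨hyR, hy.trans_le ((min_le_left _ _).trans (min_le_left _ _))⟩ x
      ⟨hx, Metric.mem_ball_self hr⟩
    have h2 : ‖y - x‖ < t := by
      rw [← dist_eq_norm]; exact hy.trans_le ((min_le_left _ _).trans (min_le_right _ _))
    have h3 := h1.trans_lt (hsmall _ h2)
    rw [← ofReal_norm, ← dist_eq_norm] at h3
    exact (ENNReal.ofReal_lt_ofReal_iff ha).1 h3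
  · rw [ContinuousAt, rep_of_notMem w hx]
    by_cases hxc : x ∈ closure D
    · exact tendsto_rep_boundary hd hD hL w ⟨hxc, by rwa [hD.interior_eq]⟩
    · refine tendsto_const_nhds.congr' ?_
      filter_upwards [isClosed_closure.isOpen_compl.mem_nhds hxc] with y hy
      rw [rep_of_notMem w fun h => hy (subset_closure h)]

/-- Linear interpolation error on a convex set in the closure of the domain. -/
theorem enorm_rep_sub_interp_le (hd : d ≤ 3) (hD : IsOpen D) (hL : HasLipschitzBoundary D)
    (w : W D) {K : Set (E d)} (hK : Convex ℝ K) (hKk : IsCompact K) (hKi : (interior K).Nonempty)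
    (hKD : K ⊆ closure D) {h : ℝ} (hh : ∀ x ∈ K, ∀ y ∈ K, ‖x - y‖ ≤ h)
    {ι : Type*} (s : Finset ι) (c : ι → ℝ) (v : ι → E d)
    (hc : ∀ i ∈ s, 0 ≤ c i) (hc1 : ∑ i ∈ s, c i = 1) (hv : ∀ i ∈ s, v i ∈ K) :
    volume K ^ (1 / 2 : ℝ) * ‖rep w (∑ i ∈ s, c i • v i) - ∑ i ∈ s, c i • rep w (v i)‖ₑ ≤
      ENNReal.ofReal (4 * h ^ 2) * eLpNorm (hessN (w : Jet D)) 2 (volume.restrict K) := by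
  obtain ⟨z, hz⟩ := hKi
  have hiD : interior K ⊆ D := (interior_mono hKD).trans (interior_closure_subset hD hL)
  have hv0 : volume K ≠ 0 := (Measure.measure_pos_of_nonempty_interior volume ⟨z, hz⟩).ne'
  have hvt : volume K ≠ ⊤ := hKk.measure_lt_top.ne
  have hcw := continuous_rep hd hD hL w
  -- `K` may touch the boundary of `D`, where mollification fails. Shrinking it towards the interior
  -- point `z` leaves a margin in `D`; there the smooth estimate passes to the limit of the
  -- mollifications, and afterwards `θ` tends to `1`.
  have hshrink : ∀ θ : ℝ, 0 < θ → θ < 1 →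
      (ENNReal.ofReal (θ ^ d) * volume K) ^ (1 / 2 : ℝ) *
        ‖rep w (∑ i ∈ s, c i • AffineMap.homothety z θ (v i)) -
          ∑ i ∈ s, c i • rep w (AffineMap.homothety z θ (v i))‖ₑ ≤
      ENNReal.ofReal (4 * h ^ 2) * eLpNorm (hessN (w : Jet D)) 2 (volume.restrict K) := by
    intro θ hθ hθ1
    set T := AffineMap.homothety z θ '' K
    have hTk : IsCompact T := hKk.image (AffineMap.continuous_of_finiteDimensional _)
    have hTc : Convex ℝ T := hK.affine_image _
    have hTi : T ⊆ interior K := by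
      rintro _ ⟨x, hx, rfl⟩
      rw [AffineMap.homothety_apply]
      have := hK.combo_interior_self_mem_interior hz hx (a := 1 - θ) (b := θ) (by linarith) hθ.le
        (by ring)
      convert this using 1
      simp only [vsub_eq_sub, vadd_eq_add]
      module
    have hvT : volume T = ENNReal.ofReal (θ ^ d) * volume K := by
      rw [Measure.addHaar_image_homothety, finrank_euclideanSpace_fin, abs_of_pos (by positivity)]
    have hvT0 : volume T ≠ 0 := by
      rw [hvT]; exact mul_ne_zero (by simpa using pow_pos hθ d) hv0
    have hhT : ∀ x ∈ T, ∀ y ∈ T, ‖x - y‖ ≤ h := fun x hx y hy =>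
      hh x (interior_subset (hTi hx)) y (interior_subset (hTi hy))
    obtain ⟨R, hR, hRK⟩ := hTk.exists_thickening_subset_open isOpen_interior hTi
    have hball : ∀ x ∈ T, Metric.ball x R ⊆ interior K := fun x hx =>
      (Metric.ball_subset_thickening hx R).trans hRK
    have hvTm : ∀ i ∈ s, AffineMap.homothety z θ (v i) ∈ T := fun i hi =>
      mem_image_of_mem _ (hv i hi)
    have hsumT : ∑ i ∈ s, c i • AffineMap.homothety z θ (v i) ∈ T := hTc.sum_mem hc hc1 hvTm
    have hmem : ∀ x ∈ T, x ∈ D := fun x hx => hiD (hTi hx)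
    have hlim : Tendsto (fun n => volume T ^ (1 / 2 : ℝ) *
        ‖regularize w n (∑ i ∈ s, c i • AffineMap.homothety z θ (v i)) -
          ∑ i ∈ s, c i • regularize w n (AffineMap.homothety z θ (v i))‖ₑ) atTop
        (𝓝 (volume T ^ (1 / 2 : ℝ) *
        ‖rep w (∑ i ∈ s, c i • AffineMap.homothety z θ (v i)) -
          ∑ i ∈ s, c i • rep w (AffineMap.homothety z θ (v i))‖ₑ)) := by
      refine ENNReal.Tendsto.const_mul (Tendsto.enorm ?_)
        (.inr (by simp [hvT0, hTk.measure_lt_top.ne]))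
      exact (tendsto_rep hd hD hL w (hmem _ hsumT)).sub (tendsto_finsetSum _ fun i hi =>
        (tendsto_rep hd hD hL w (hmem _ (hvTm i hi))).const_smul _)
    rw [← hvT]
    refine le_of_tendsto hlim ?_
    filter_upwards [(tendsto_rOut_bumpSeq (d := d)).eventually_lt_const hR] with n hn
    have hs : ContDiff ℝ 2 (regularize w n) :=
      contDiff_moll _ (locallyIntegrable_extend hD _) (n := 2)
    refine (enorm_sub_interp_le hd hs hTc hTk.measurableSet hvT0 hTk.measure_lt_top.ne hhT s c
      (fun i => AffineMap.homothety z θ (v i)) hc hc1 hvTm).trans ?_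
    gcongr
    refine (eLpNorm_fderiv_fderiv_moll_le hD w (bumpSeq d n) hTk.measurableSet
      isOpen_interior.measurableSet hn hball hiD).trans ?_
    exact eLpNorm_mono_measure _ (Measure.restrict_mono interior_subset le_rfl)
  have hcθ : ∀ x, Continuous fun θ : ℝ => AffineMap.homothety z θ x := fun x => by
    simp only [AffineMap.homothety_apply, vsub_eq_sub, vadd_eq_add]
    fun_prop
  have hlim : Tendsto (fun θ : ℝ => (ENNReal.ofReal (θ ^ d) * volume K) ^ (1 / 2 : ℝ) *
        ‖rep w (∑ i ∈ s, c i • AffineMap.homothety z θ (v i)) -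
          ∑ i ∈ s, c i • rep w (AffineMap.homothety z θ (v i))‖ₑ) (𝓝[<] 1)
      (𝓝 ((ENNReal.ofReal ((1 : ℝ) ^ d) * volume K) ^ (1 / 2 : ℝ) *
        ‖rep w (∑ i ∈ s, c i • AffineMap.homothety z (1 : ℝ) (v i)) -
          ∑ i ∈ s, c i • rep w (AffineMap.homothety z (1 : ℝ) (v i))‖ₑ)) := by
    refine tendsto_nhdsWithin_of_tendsto_nhds (ENNReal.Tendsto.mul ?_ (.inr (by simp)) ?_
      (.inr (by simp [hvt])))
    · refine ((ENNReal.continuous_rpow_const).tendsto _).comp ?_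
      exact ENNReal.Tendsto.mul_const (ENNReal.tendsto_ofReal
        ((continuous_pow d).tendsto 1)) (.inr hvt)
    · have : Continuous fun θ : ℝ => ‖rep w (∑ i ∈ s, c i • AffineMap.homothety z θ (v i)) -
          ∑ i ∈ s, c i • rep w (AffineMap.homothety z θ (v i))‖ₑ := by
        refine Continuous.enorm (Continuous.sub ?_ ?_)
        · refine hcw.comp (continuous_finsetSum _ fun i _ => ?_)
          have := hcθ (v i)
          fun_prop
        · refine continuous_finsetSum _ fun i _ => ?_
          have := hcw.comp (hcθ (v i))
          simp only [Function.comp_def] at this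
          fun_prop
      exact this.tendsto 1
  have := le_of_tendsto hlim (by
    filter_upwards [Ioo_mem_nhdsLT (zero_lt_one (α := ℝ))] with θ hθ
    exact hshrink θ hθ.1 hθ.2)
  simpa using this

end Representative

end Peridynamics

namespace Peridynamics

/-! ### Fields of `W` in thin boundary layers. -/

section Layer

variable {d : ℕ} {D : Set (E d)}

theorem norm_toL2_le (w : W D) : ‖W.toL2 w‖ ≤ ‖w‖ :=
  PiLp.norm_apply_le (w : Jet D) _

theorem norm_grad_le (w : W D) (i : Fin d) : ‖(w : Jet D).grad i‖ ≤ ‖w‖ :=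
  PiLp.norm_apply_le (w : Jet D) _

theorem norm_hess_le (w : W D) (i j : Fin d) : ‖(w : Jet D).hess i j‖ ≤ ‖w‖ :=
  PiLp.norm_apply_le (w : Jet D) _

theorem sum_norm_grad_le (w : W D) : ∑ i, ‖(w : Jet D).grad i‖ ≤ d * ‖w‖ := by
  refine (Finset.sum_le_sum fun i _ => norm_grad_le w i).trans ?_
  simp

theorem eLpNorm_hessN_le (hD : IsOpen D) (w : W D) :
    eLpNorm (hessN (w : Jet D)) 2 volume ≤ ENNReal.ofReal (d ^ 2 * ‖w‖) := by
  have hm : ∀ i j, AEStronglyMeasurable (fun x => ‖extend ((w : Jet D).hess i j) x‖ₑ) volume :=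
    fun i j => (measurable_extend hD _).enorm.aestronglyMeasurable
  have e : hessN (w : Jet D) = ∑ i, ∑ j, fun x => ‖extend ((w : Jet D).hess i j) x‖ₑ := by
    ext x
    simp [hessN, Finset.sum_apply]
  rw [e]
  refine (eLpNorm_sum_le (fun i _ => Finset.aestronglyMeasurable_sum _ fun j _ => hm i j)
    (by norm_num)).trans ?_
  refine (Finset.sum_le_sum fun i _ => eLpNorm_sum_le (fun j _ => hm i j) (by norm_num)).trans ?_
  have h1 : ∀ i j, eLpNorm (fun x => ‖extend ((w : Jet D).hess i j) x‖ₑ) 2 volume ≤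
      ENNReal.ofReal ‖w‖ := fun i j => by
    rw [eLpNorm_enorm, eLpNorm_extend hD]
    exact ENNReal.ofReal_le_ofReal (norm_hess_le w i j)
  refine (Finset.sum_le_sum fun i _ => Finset.sum_le_sum fun j _ => h1 i j).trans (le_of_eq ?_)
  simp only [Finset.sum_const, Finset.card_univ, Fintype.card_fin, nsmul_eq_mul]
  rw [ENNReal.ofReal_mul (by positivity), ENNReal.ofReal_pow (by positivity),
    ENNReal.ofReal_natCast]
  ring

/-- A field in `W` is small in a thin layer at the boundary. -/
theorem exists_layer_bound (hd : d ≤ 3) (hD : IsOpen D) (hDb : Bornology.IsBounded D)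
    (hL : HasLipschitzBoundary D) (hfr : (frontier D).Nonempty) : ∃ C > 0, ∀ (w : W D) (δ : ℝ),
      0 ≤ δ → eLpNorm (rep w) 2 (volume.restrict {x ∈ D | Metric.infDist x (frontier D) ≤ δ}) ≤
        ENNReal.ofReal (C * δ * ‖w‖) := by
  have hfc : IsCompact (frontier D) :=
    Metric.isCompact_of_isClosed_isBounded isClosed_frontier
      (hDb.closure.subset frontier_subset_closure)
  choose! n C r hn hC hr hout using fun p (hp : p ∈ frontier D) => exists_direction_out hL hp
  obtain ⟨t, htc⟩ := hfc.elim_nhds_subcover' (fun p _ => Metric.ball p (r p / 2))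
    fun p hp => Metric.ball_mem_nhds p (half_pos (hr p hp))
  -- Finitely many half balls cover the boundary. Below `δ0`, points of the layer stay in the full
  -- ball of the chart that contains their nearest boundary point, and the exit shift is admissible
  -- there.
  obtain ⟨δ0, hδ0, hδ0t⟩ : ∃ δ0 > 0, ∀ p ∈ t, C p * δ0 ≤ r p ∧ δ0 ≤ r p / 2 := by
    have : ∀ p ∈ t, ∃ δ0 > 0, ∀ δ ≤ δ0, C p * δ ≤ r p ∧ δ ≤ r p / 2 := by
      intro p hp
      have h0 : 0 < C p := by linarith [hC p p.2]
      have h1 := hr p p.2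
      refine ⟨min (r p / C p) (r p / 2), by positivity, fun δ hδ => ⟨?_, hδ.trans (min_le_right _ _)⟩⟩
      have := hδ.trans (min_le_left _ _)
      rw [le_div_iff₀ h0] at this
      linarith
    choose! e he1 he2 using this
    by_cases hne : t.Nonempty
    · refine ⟨t.inf' hne e, (Finset.lt_inf'_iff hne).2 he1, fun p hp => he2 p hp _
        (Finset.inf'_le _ hp)⟩
    · rw [Finset.not_nonempty_iff_eq_empty] at hne
      exact ⟨1, one_pos, by simp [hne]⟩
  have hCpos : 0 ≤ ∑ p ∈ t, C p := Finset.sum_nonneg fun p _ => by linarith [hC p p.2]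
  refine ⟨(∑ p ∈ t, C p) * d + 1 / δ0, by positivity, fun w δ hδ => ?_⟩
  rcases lt_or_ge δ δ0 with hlt | hge
  · set S := {x ∈ D | Metric.infDist x (frontier D) ≤ δ}
    have hSm : MeasurableSet S :=
      hD.measurableSet.inter (measurableSet_le (Metric.continuous_infDist_pt _).measurable
        measurable_const)
    have hrc : Continuous (rep w) := continuous_rep hd hD hL w
    -- A layer point is carried out of `D` by the shift of one of the finitely many charts. The
    -- field vanishes there, so its value at `x` is a translation difference over a distance `O(δ)`.
    have hpt : ∀ x ∈ S, ‖rep w x‖ₑ ≤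
        ∑ p ∈ t, ‖rep w (x + -(C p * δ) • n p) - rep w x‖ₑ := by
      rintro x ⟨hxD, hx⟩
      obtain ⟨q, hq, hxq⟩ := hfc.exists_infDist_eq_dist hfr x
      rw [hxq, dist_eq_norm] at hx
      obtain ⟨p, hp, hqp⟩ := mem_iUnion₂.1 (htc hq)
      have hδp := hδ0t p hp
      have hCp := hC p p.2
      rw [Metric.mem_ball] at hqp
      have hqD : q ∉ D := fun h => by
        have := hq.2
        rw [hD.interior_eq] at this
        exact this h
      have hout' := hout p p.2 x (by
        rw [Metric.mem_ball]
        have := dist_triangle x q p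
        rw [dist_eq_norm x q] at this
        linarith) q (by rw [Metric.mem_ball]; linarith [hr p p.2]) hqD (C p * δ)
        (mul_le_mul_of_nonneg_left hx (by linarith))
        ((mul_le_mul_of_nonneg_left hlt.le (by linarith)).trans hδp.1)
      have e : x + -(C p * δ) • n p = x - (C p * δ) • n p := by module
      refine le_trans (le_of_eq ?_) (Finset.single_le_sum (f := fun p : frontier D =>
        ‖rep w (x + -(C p * δ) • n p) - rep w x‖ₑ) (fun _ _ => zero_le) hp)
      rw [e, rep_of_notMem w hout', zero_sub, enorm_neg]
    have hmeas : ∀ p : frontier D, AEStronglyMeasurable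
        (fun x => ‖rep w (x + -(C p * δ) • n p) - rep w x‖ₑ) volume := fun p =>
      Continuous.aestronglyMeasurable (by fun_prop)
    calc eLpNorm (rep w) 2 (volume.restrict S)
        ≤ eLpNorm (∑ p ∈ t, fun x => ‖rep w (x + -(C p * δ) • n p) - rep w x‖ₑ) 2
            (volume.restrict S) := by
          refine eLpNorm_mono_enorm_ae ((ae_restrict_iff' hSm).2 (.of_forall fun x hx => ?_))
          rw [enorm_eq_self, Finset.sum_apply]
          exact hpt x hx
      _ ≤ eLpNorm (∑ p ∈ t, fun x => ‖rep w (x + -(C p * δ) • n p) - rep w x‖ₑ) 2 volume :=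
          eLpNorm_mono_measure _ Measure.restrict_le_self
      _ ≤ ∑ p ∈ t, eLpNorm (fun x => ‖rep w (x + -(C p * δ) • n p) - rep w x‖ₑ) 2 volume :=
          eLpNorm_sum_le (fun p _ => hmeas p) (by norm_num)
      _ ≤ ∑ p ∈ t, ENNReal.ofReal (C p * δ * (d * ‖w‖)) := by
          refine Finset.sum_le_sum fun p _ => ?_
          rw [eLpNorm_enorm]
          refine (eLpNorm_rep_translate_sub_le hd hD hL w _).trans (ENNReal.ofReal_le_ofReal ?_)
          have hCp := hC p p.2
          rw [norm_smul, hn p p.2, mul_one, norm_neg, Real.norm_of_nonneg (by positivity)]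
          gcongr
          exact sum_norm_grad_le w
      _ = ENNReal.ofReal ((∑ p ∈ t, C p) * d * δ * ‖w‖) := by
          rw [← ENNReal.ofReal_sum_of_nonneg]
          · congr 1
            simp only [Finset.sum_mul]
            exact Finset.sum_congr rfl fun p _ => by ring
          · intro p _
            have hCp := hC p p.2
            positivity
      _ ≤ _ := by
          refine ENNReal.ofReal_le_ofReal ?_
          have : 0 ≤ 1 / δ0 * δ * ‖w‖ := by positivity
          nlinarith
  -- For layers of width at least `δ0` the trivial bound by the `L²` norm is enough; this is what
  -- the term `1 / δ0` of the constant is for.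
  · refine (eLpNorm_mono_measure _ Measure.restrict_le_self).trans ?_
    rw [← eLpNorm_congr_ae (extend_ae_eq_rep hd hD hL w), eLpNorm_extend hD]
    refine ENNReal.ofReal_le_ofReal ((norm_toL2_le w).trans ?_)
    have h1 : 1 ≤ 1 / δ0 * δ := by rw [one_div, ← div_eq_inv_mul]; exact (one_le_div hδ0).2 hge
    have h2 : 0 ≤ (∑ p ∈ t, C p) * d * δ := by positivity
    have h3 := norm_nonneg w
    nlinarith

end Layer

/-! ### Barycentric coordinates on simplices. -/

section Simplex

variable {d : ℕ}

/-- The vertex sets of nondegenerate simplices. -/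
def IsSimplex (s : Finset (E d)) : Prop :=
  s.card = d + 1 ∧ AffineIndependent ℝ ((↑) : s → E d)

/-- The vertices of a simplex as an affine basis. -/
noncomputable def IsSimplex.basis {s : Finset (E d)} (hs : IsSimplex s) : AffineBasis s ℝ (E d) where
  toFun := (↑)
  ind' := hs.2
  tot' := by
    rw [hs.2.affineSpan_eq_top_iff_card_eq_finrank_add_one]
    simp [hs.1]

open Classical in
/-- The barycentric coordinate of a simplex belonging to a vertex. -/
noncomputable def bary (s : Finset (E d)) (p : E d) : E d →ᵃ[ℝ] ℝ :=
  if h : IsSimplex s ∧ p ∈ s then h.1.basis.coord ⟨p, h.2⟩ else 0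

variable {s : Finset (E d)}

theorem bary_eq (hs : IsSimplex s) (p : s) : bary s p = hs.basis.coord p := by
  rw [bary, dif_pos ⟨hs, p.2⟩]

theorem bary_self (hs : IsSimplex s) {p : E d} (hp : p ∈ s) : bary s p p = 1 := by
  rw [show p = ((⟨p, hp⟩ : s) : E d) from rfl, bary_eq hs]
  exact hs.basis.coord_apply_eq ⟨p, hp⟩

theorem bary_ne (hs : IsSimplex s) {p q : E d} (hp : p ∈ s) (hq : q ∈ s) (h : p ≠ q) :
    bary s p q = 0 := by
  rw [show p = ((⟨p, hp⟩ : s) : E d) from rfl, bary_eq hs]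
  exact hs.basis.coord_apply_ne (i := ⟨p, hp⟩) (j := ⟨q, hq⟩) fun e => h (congrArg Subtype.val e)

theorem sum_bary (hs : IsSimplex s) (x : E d) : ∑ p ∈ s, bary s p x = 1 := by
  rw [← Finset.sum_coe_sort]
  simp only [bary_eq hs]
  exact hs.basis.sum_coord_apply_eq_one x

theorem sum_bary_smul (hs : IsSimplex s) (x : E d) : ∑ p ∈ s, bary s p x • p = x := by
  rw [← Finset.sum_coe_sort s fun p => bary s p x • p]
  simp only [bary_eq hs]
  exact hs.basis.linear_combination_coord_eq_self x

theorem range_basis (hs : IsSimplex s) : range hs.basis = (s : Set (E d)) := Subtype.range_val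

theorem mem_convexHull_iff_bary (hs : IsSimplex s) {x : E d} :
    x ∈ convexHull ℝ (s : Set (E d)) ↔ ∀ p ∈ s, 0 ≤ bary s p x := by
  rw [← range_basis hs, hs.basis.convexHull_eq_nonneg_coord]
  constructor
  · intro h p hp
    have := h ⟨p, hp⟩
    rwa [← bary_eq hs] at this
  · intro h p
    rw [← bary_eq hs]
    exact h p p.2

theorem interior_simplex_nonempty (hs : IsSimplex s) :
    (interior (convexHull ℝ (s : Set (E d)))).Nonempty := by
  rw [← range_basis hs]
  exact ⟨_, hs.basis.centroid_mem_interior_convexHull⟩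

theorem bary_le_one (hs : IsSimplex s) {x : E d} (hx : x ∈ convexHull ℝ (s : Set (E d))) {p : E d}
    (hp : p ∈ s) : bary s p x ≤ 1 := by
  rw [← sum_bary hs x]
  exact Finset.single_le_sum (f := fun p => bary s p x)
    (fun q hq => (mem_convexHull_iff_bary hs).1 hx q hq) hp

theorem affineMap_eqOn_convexHull {V : Type*} [AddCommGroup V] [Module ℝ V] {A B : E d →ᵃ[ℝ] V}
    {F : Set (E d)} (h : ∀ p ∈ F, A p = B p) : ∀ x ∈ convexHull ℝ F, A x = B x := by
  intro x hx
  have hsub : convexHull ℝ F ⊆ (A - B) ⁻¹' {0} := by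
    refine convexHull_min (fun p hp => ?_) ((convex_singleton (𝕜 := ℝ) (0 : V)).affine_preimage _)
    simp [h p hp]
  have := hsub hx
  simpa [sub_eq_zero] using this

/-- The affine field with given values at the vertices of a simplex. -/
noncomputable def affineInterp (s : Finset (E d)) (g : E d → E d) : E d →ᵃ[ℝ] E d :=
  ∑ p ∈ s, (LinearMap.toSpanSingleton ℝ (E d) (g p)).toAffineMap.comp (bary s p)

theorem affineInterp_apply (s : Finset (E d)) (g : E d → E d) (x : E d) :
    affineInterp s g x = ∑ p ∈ s, bary s p x • g p := by
  have h : ∀ (F : E d → E d →ᵃ[ℝ] E d) (t : Finset (E d)), (∑ p ∈ t, F p) x = ∑ p ∈ t, F p x := by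
    intro F t
    classical
    induction t using Finset.induction_on with
    | empty => simp
    | insert a t ha ih => rw [Finset.sum_insert ha, Finset.sum_insert ha, AffineMap.coe_add,
        Pi.add_apply, ih]
  rw [affineInterp, h]
  rfl

theorem affineInterp_vertex (hs : IsSimplex s) (g : E d → E d) {p : E d} (hp : p ∈ s) :
    affineInterp s g p = g p := by
  rw [affineInterp_apply, Finset.sum_eq_single_of_mem p hp, bary_self hs hp, one_smul]
  intro q hq hqp
  rw [bary_ne hs hq hp hqp, zero_smul]

/-- The gradient of a barycentric coordinate is controlled by the radius of an inscribed ball. -/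
theorem abs_bary_linear_le (hs : IsSimplex s) {z : E d} {ρ : ℝ} (hρ : 0 < ρ)
    (hz : Metric.closedBall z ρ ⊆ convexHull ℝ (s : Set (E d))) {p : E d} (hp : p ∈ s) (v : E d) :
    2 * ρ * |(bary s p).linear v| ≤ ‖v‖ := by
  rcases eq_or_ne v 0 with rfl | hv
  · simp
  have hv0 : 0 < ‖v‖ := norm_pos_iff.2 hv
  -- In the direction of `v` the simplex contains a segment of length `2 ρ`, along which the
  -- coordinate stays in `[0, 1]`.
  have hmem : ∀ ε : ℝ, |ε| = 1 → (ε * (ρ / ‖v‖)) • v +ᵥ z ∈ convexHull ℝ (s : Set (E d)) := by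
    intro ε hε
    refine hz ?_
    rw [mem_closedBall_iff_norm, vadd_eq_add, add_sub_cancel_right, norm_smul, Real.norm_eq_abs,
      abs_mul, hε, one_mul, abs_of_pos (by positivity), div_mul_cancel₀ _ hv0.ne']
  have e : ∀ ε : ℝ, bary s p ((ε * (ρ / ‖v‖)) • v +ᵥ z) =
      ε * (ρ / ‖v‖) * (bary s p).linear v + bary s p z := fun ε => by
    rw [AffineMap.map_vadd, map_smul]
    rfl
  have h1 := hmem 1 (by simp)
  have h2 := hmem (-1) (by simp)
  have a1 := (mem_convexHull_iff_bary hs).1 h1 p hp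
  have a2 := bary_le_one hs h1 hp
  have b1 := (mem_convexHull_iff_bary hs).1 h2 p hp
  have b2 := bary_le_one hs h2 hp
  rw [e] at a1 a2 b1 b2
  set l := (bary s p).linear v
  have h3 : 2 * (ρ / ‖v‖) * |l| ≤ 1 := by
    rcases abs_cases l with ⟨h, -⟩ | ⟨h, -⟩ <;> rw [h] <;> linarith
  calc 2 * ρ * |l| = (2 * (ρ / ‖v‖) * |l|) * ‖v‖ := by field_simp
    _ ≤ 1 * ‖v‖ := by gcongr
    _ = ‖v‖ := one_mul _

end Simplex

end Peridynamics

namespace Peridynamics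

/-! ### Conforming meshes: stars of vertices and the nodal interpolant. -/

namespace Mesh

variable {d : ℕ} (m : Mesh d)

/-- The closed simplex spanned by a set of vertices. -/
abbrev hull (s : Finset (E d)) : Set (E d) := convexHull ℝ (s : Set (E d))

variable {m}

theorem isSimplex {s : Finset (E d)} (hs : s ∈ m.elems) : IsSimplex s :=
  ⟨m.card_eq s hs, m.indep s hs⟩

theorem isClosed_hull (s : Finset (E d)) : IsClosed (hull s) :=
  (s.finite_toSet.isCompact_convexHull ℝ).isClosed

theorem hull_subset_region {s : Finset (E d)} (hs : s ∈ m.elems) : hull s ⊆ m.region :=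
  fun _ hx => mem_iUnion₂.2 ⟨s, hs, hx⟩

theorem mem_vertices {s : Finset (E d)} (hs : s ∈ m.elems) {p : E d} (hp : p ∈ s) :
    p ∈ m.vertices := mem_iUnion₂.2 ⟨s, hs, hp⟩

theorem vertex_mem_hull {s : Finset (E d)} {p : E d} (hp : p ∈ s) : p ∈ hull s :=
  subset_convexHull ℝ _ hp

section Conformity

variable {s t : Finset (E d)} (hs : s ∈ m.elems) (ht : t ∈ m.elems)
include hs ht

/-- By conformity `x` lies in the hull of the common vertices. On these the two affine coordinates
coincide, hence on their hull. -/
theorem bary_agree {x p : E d} (hxs : x ∈ hull s) (hxt : x ∈ hull t) (hps : p ∈ s) (hpt : p ∈ t) :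
    bary s p x = bary t p x := by
  have hx : x ∈ convexHull ℝ ((s : Set (E d)) ∩ t) := by
    rw [← m.conforming s hs t ht]; exact ⟨hxs, hxt⟩
  refine affineMap_eqOn_convexHull (fun q hq => ?_) x hx
  rcases eq_or_ne p q with rfl | hpq
  · rw [bary_self (isSimplex hs) hps, bary_self (isSimplex ht) hpt]
  · rw [bary_ne (isSimplex hs) hps hq.1 hpq, bary_ne (isSimplex ht) hpt hq.2 hpq]

theorem bary_eq_zero {x p : E d} (hxs : x ∈ hull s) (hxt : x ∈ hull t) (hps : p ∈ s) (hpt : p ∉ t) :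
    bary s p x = 0 := by
  have hx : x ∈ convexHull ℝ ((s : Set (E d)) ∩ t) := by
    rw [← m.conforming s hs t ht]; exact ⟨hxs, hxt⟩
  refine affineMap_eqOn_convexHull (A := bary s p) (B := 0) (fun q hq => ?_) x hx
  rw [bary_ne (isSimplex hs) hps hq.1 fun e => hpt (e ▸ hq.2)]
  rfl

theorem mem_of_vertex_mem_hull {p : E d} (hps : p ∈ s) (hpt : p ∈ hull t) : p ∈ t := by
  by_contra h
  have := bary_eq_zero hs ht (vertex_mem_hull hps) hpt hps h
  rw [bary_self (isSimplex hs) hps] at this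
  exact one_ne_zero this

end Conformity

/-- The cone with apex `p` spanned by a simplex with vertex `p`. -/
def starCone (s : Finset (E d)) (p : E d) : Set (E d) := {y | ∀ q ∈ s, q ≠ p → 0 ≤ bary s q y}

theorem continuous_bary (s : Finset (E d)) (p : E d) : Continuous (bary s p) :=
  AffineMap.continuous_of_finiteDimensional _

theorem isClosed_starCone (s : Finset (E d)) (p : E d) : IsClosed (starCone s p) := by
  have : starCone s p = ⋂ q ∈ s, ⋂ (_ : q ≠ p), {y | 0 ≤ bary s q y} := by
    ext y; simp [starCone]
  rw [this]
  exact isClosed_biInter fun q _ => isClosed_iInter fun _ =>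
    isClosed_le continuous_const (continuous_bary s q)

theorem hull_subset_starCone {s : Finset (E d)} (hs : IsSimplex s) (p : E d) :
    hull s ⊆ starCone s p := fun _ hx q hq _ => (mem_convexHull_iff_bary hs).1 hx q hq

theorem mem_hull_of_mem_starCone {s : Finset (E d)} (hs : IsSimplex s) {p y : E d}
    (hy : y ∈ starCone s p) (hp : 0 ≤ bary s p y) : y ∈ hull s :=
  (mem_convexHull_iff_bary hs).2 fun q hq => by
    rcases eq_or_ne q p with rfl | h
    · exact hp
    · exact hy q hq h

theorem bary_homothety {s : Finset (E d)} (q p y : E d) (θ : ℝ) :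
    bary s q (AffineMap.homothety p θ y) = bary s q p + θ * (bary s q y - bary s q p) := by
  rw [AffineMap.homothety_eq_lineMap, AffineMap.apply_lineMap, AffineMap.lineMap_apply]
  simp [add_comm]

theorem homothety_mem_starCone_iff {s : Finset (E d)} (hs : IsSimplex s) {p y : E d} (hp : p ∈ s)
    {θ : ℝ} (hθ : 0 < θ) : AffineMap.homothety p θ y ∈ starCone s p ↔ y ∈ starCone s p := by
  refine forall₃_congr fun q hq hqp => ?_
  rw [bary_homothety, bary_ne hs hq hp hqp]
  simp [hθ]

theorem tendsto_homothety (p y : E d) :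
    Tendsto (fun θ : ℝ => AffineMap.homothety p θ y) (𝓝[>] 0) (𝓝 p) := by
  have h : Continuous fun θ : ℝ => AffineMap.homothety p θ y := by
    simp only [AffineMap.homothety_apply, vsub_eq_sub, vadd_eq_add]
    fun_prop
  have := h.tendsto 0
  rw [AffineMap.homothety_zero] at this
  exact tendsto_nhdsWithin_of_tendsto_nhds this

/-- The cones of the simplices at an interior vertex fill the space. -/
theorem exists_mem_starCone {p : E d} (hpv : p ∈ m.vertices) (hp : p ∈ interior m.region) (y : E d) :
    ∃ t ∈ m.elems, p ∈ t ∧ y ∈ starCone t p := by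
  obtain ⟨s, hs, hps⟩ := mem_iUnion₂.1 hpv
  -- Near an interior vertex every point lies in an element that touches `p`, and conformity makes
  -- `p` a vertex of that element. The cones are invariant under homotheties about `p`, so a point
  -- `y` far away is scaled into this neighbourhood.
  have hev : ∀ᶠ x in 𝓝 p, ∃ t ∈ m.elems, p ∈ t ∧ x ∈ hull t := by
    have h1 : ∀ᶠ x in 𝓝 p, x ∈ m.region := mem_interior_iff_mem_nhds.1 hp
    have h2 : ∀ᶠ x in 𝓝 p, ∀ t ∈ m.elems, x ∈ hull t → p ∈ hull t := by
      rw [eventually_all_finset]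
      intro t _
      by_cases hpt : p ∈ hull t
      · exact .of_forall fun _ _ => hpt
      · filter_upwards [(isClosed_hull t).isOpen_compl.mem_nhds hpt] with x hx hx'
        exact absurd hx' hx
    filter_upwards [h1, h2] with x hx1 hx2
    obtain ⟨t, ht, hxt⟩ := mem_iUnion₂.1 hx1
    exact ⟨t, ht, mem_of_vertex_mem_hull hs ht hps (hx2 t ht hxt), hxt⟩
  obtain ⟨θ, ⟨t, ht, hpt, hy⟩, hθ⟩ :=
    (((tendsto_homothety p y).eventually hev).and self_mem_nhdsWithin).exists
  exact ⟨t, ht, hpt, (homothety_mem_starCone_iff (isSimplex ht) hpt hθ).1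
    (hull_subset_starCone (isSimplex ht) p hy)⟩

/-- Scaled towards `p`, the point lies in both elements, where the coordinates of `p` agree. A
homothety about `p` multiplies the defect of this coordinate from `1` by the same factor in both, so
they agree at `x` itself. -/
theorem mem_hull_of_mem_starCone_of_pos {s t : Finset (E d)} (hs : s ∈ m.elems) (ht : t ∈ m.elems)
    {p x : E d} (hps : p ∈ s) (hpt : p ∈ t) (hx : x ∈ hull s) (hx0 : 0 < bary s p x)
    (hxt : x ∈ starCone t p) : x ∈ hull t ∧ 0 < bary t p x := by
  have h1 : ∀ᶠ θ in 𝓝[>] (0 : ℝ), 0 < bary t p (AffineMap.homothety p θ x) := by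
    have := ((continuous_bary t p).tendsto p).comp (tendsto_homothety p x)
    rw [bary_self (isSimplex ht) hpt] at this
    exact this.eventually_const_lt one_pos
  obtain ⟨θ, hθ1, hθ0, hθ2⟩ := (h1.and (Ioo_mem_nhdsGT (zero_lt_one (α := ℝ)))).exists
  set y := AffineMap.homothety p θ x
  have hyt : y ∈ hull t := mem_hull_of_mem_starCone (isSimplex ht)
    ((homothety_mem_starCone_iff (isSimplex ht) hpt hθ0).2 hxt) hθ1.le
  have hys : y ∈ hull s := by
    have := (convex_convexHull ℝ (s : Set (E d))) (vertex_mem_hull hps) hx (a := 1 - θ) (b := θ)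
      (by linarith) hθ0.le (by ring)
    convert this using 1
    simp only [y, AffineMap.homothety_apply, vsub_eq_sub, vadd_eq_add]
    module
  have h2 := bary_agree hs ht hys hyt hps hpt
  rw [bary_homothety, bary_homothety, bary_self (isSimplex hs) hps,
    bary_self (isSimplex ht) hpt] at h2
  have h3 : bary s p x = bary t p x := by
    have := mul_left_cancel₀ hθ0.ne' (add_left_cancel h2)
    linarith
  rw [h3] at hx0
  exact ⟨mem_hull_of_mem_starCone (isSimplex ht) hxt hx0.le, hx0⟩

/-- The cones at `p` cover space. Of these finitely many closed cones, only those through `x` matter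
near `x`; in the corresponding elements the coordinate of `p` is positive at `x`, so points of the
cone close to `x` are in the element. -/
theorem mem_interior_region {s : Finset (E d)} (hs : s ∈ m.elems) {p x : E d} (hps : p ∈ s)
    (hp : p ∈ interior m.region) (hx : x ∈ hull s) (hx0 : 0 < bary s p x) :
    x ∈ interior m.region := by
  rw [mem_interior_iff_mem_nhds]
  have h1 : ∀ᶠ y in 𝓝 x, ∀ t ∈ m.elems, p ∈ t → y ∈ starCone t p → y ∈ hull t := by
    rw [eventually_all_finset]
    intro t ht
    by_cases hpt : p ∈ t
    · by_cases hxt : x ∈ starCone t p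
      · have h2 := (mem_hull_of_mem_starCone_of_pos hs ht hps hpt hx hx0 hxt).2
        filter_upwards [((continuous_bary t p).tendsto x).eventually_const_lt h2] with y hy _ hyt
        exact mem_hull_of_mem_starCone (isSimplex ht) hyt hy.le
      · filter_upwards [(isClosed_starCone t p).isOpen_compl.mem_nhds hxt] with y hy _ hyt
        exact absurd hyt hy
    · exact .of_forall fun _ h => absurd h hpt
  filter_upwards [h1] with y hy
  obtain ⟨t, ht, hpt, hyt⟩ := exists_mem_starCone (mem_vertices hs hps) hp y
  exact hull_subset_region ht (hy t ht hpt hyt)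

open Classical in
/-- The continuous piecewise linear interpolant of a field. -/
noncomputable def nodal (m : Mesh d) (g : E d → E d) (x : E d) : E d :=
  if h : ∃ s ∈ m.elems, x ∈ hull s then affineInterp h.choose g x else 0

theorem nodal_of_notMem (g : E d → E d) {x : E d} (hx : x ∉ m.region) : m.nodal g x = 0 := by
  rw [nodal, dif_neg]
  rintro ⟨s, hs, h⟩
  exact hx (hull_subset_region hs h)

/-- The choice of element in the definition does not matter: two elements through `x` meet in the
hull of common vertices, where both affine interpolants take the values of `g`. -/
theorem nodal_eq_affineInterp (g : E d → E d) {s : Finset (E d)} (hs : s ∈ m.elems) {x : E d}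
    (hx : x ∈ hull s) : m.nodal g x = affineInterp s g x := by
  have h : ∃ s ∈ m.elems, x ∈ hull s := ⟨s, hs, hx⟩
  rw [nodal, dif_pos h]
  obtain ⟨ht, hxt⟩ := h.choose_spec
  refine affineMap_eqOn_convexHull (F := (h.choose : Set (E d)) ∩ s) (fun p hp => ?_) x ?_
  · rw [affineInterp_vertex (isSimplex ht) g hp.1, affineInterp_vertex (isSimplex hs) g hp.2]
  · rw [← m.conforming _ ht s hs]
    exact ⟨hxt, hx⟩

theorem nodal_eq_sum (g : E d → E d) {s : Finset (E d)} (hs : s ∈ m.elems) {x : E d}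
    (hx : x ∈ hull s) : m.nodal g x = ∑ p ∈ s, bary s p x • g p := by
  rw [nodal_eq_affineInterp g hs hx, affineInterp_apply]

theorem nodal_vertex (g : E d → E d) {p : E d} (hp : p ∈ m.vertices) : m.nodal g p = g p := by
  obtain ⟨s, hs, hps⟩ := mem_iUnion₂.1 hp
  rw [nodal_eq_affineInterp g hs (vertex_mem_hull hps), affineInterp_vertex (isSimplex hs) g hps]

/-- If a vertex had positive weight at a boundary point of the region and were interior, the point
would be interior as well. So only boundary vertices contribute, and there `g` vanishes. -/
theorem nodal_frontier {g : E d → E d} (hg : ∀ p ∈ m.vertices ∩ frontier m.region, g p = 0) {x : E d}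
    (hx : x ∈ frontier m.region) : m.nodal g x = 0 := by
  have hxr : x ∈ m.region := m.isCompact_region.isClosed.frontier_subset hx
  obtain ⟨s, hs, hxs⟩ := mem_iUnion₂.1 hxr
  rw [nodal_eq_sum g hs hxs]
  refine Finset.sum_eq_zero fun p hp => ?_
  rcases ((mem_convexHull_iff_bary (isSimplex hs)).1 hxs p hp).eq_or_lt with h0 | hpos
  · rw [← h0, zero_smul]
  · rw [hg p ⟨mem_vertices hs hp, subset_closure (hull_subset_region hs (vertex_mem_hull hp)),
      fun hpi => hx.2 (mem_interior_region hs hp hpi hxs hpos)⟩, smul_zero]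

/-- Continuity is obtained by gluing along closed sets: the finitely many elements, and the closure
of the complement of the region, on which the interpolant is zero. -/
theorem nodal_mem_FE {g : E d → E d} (hg : ∀ p ∈ m.vertices ∩ frontier m.region, g p = 0) :
    m.nodal g ∈ m.FE := by
  refine ⟨?_, fun s hs => ⟨affineInterp s g, fun x hx => nodal_eq_affineInterp g hs hx⟩,
    fun x hx => nodal_of_notMem g hx⟩
  have h1 : ContinuousOn (m.nodal g) m.region := by
    have hlf : LocallyFinite fun s : m.elems => hull (s : Finset (E d)) := locallyFinite_of_finite _
    have e : m.region = ⋃ s : m.elems, hull (s : Finset (E d)) := by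
      ext x; simp [region]
    rw [e]
    refine hlf.continuousOn_iUnion (fun s => isClosed_hull _) fun s => ?_
    have hc : Continuous (affineInterp (s : Finset (E d)) g) :=
      AffineMap.continuous_of_finiteDimensional _
    exact hc.continuousOn.congr fun x hx => nodal_eq_affineInterp g s.2 hx
  have h2 : ContinuousOn (m.nodal g) (closure m.regionᶜ) := by
    refine (continuousOn_const (c := (0 : E d))).congr fun x hx => ?_
    by_cases hxr : x ∈ m.region
    · refine nodal_frontier hg ⟨subset_closure hxr, fun h => ?_⟩
      rw [closure_compl] at hx
      exact hx h
    · exact nodal_of_notMem g hxr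
  have h3 := h1.union_of_isClosed h2 m.isCompact_region.isClosed isClosed_closure
  rw [← continuousOn_univ]
  refine h3.mono fun x _ => ?_
  by_cases hx : x ∈ m.region
  · exact .inl hx
  · exact .inr (subset_closure hx)

/-- The values of a finite element field at boundary points of the mesh vanish. -/
theorem FE_eq_zero_of_frontier (w : m.FE) {x : E d} (hx : x ∈ frontier m.region) :
    (w : E d → E d) x = 0 := by
  have hcl : x ∈ closure m.regionᶜ := by
    rw [closure_compl]; exact hx.2
  have hsub : closure m.regionᶜ ⊆ {y | (w : E d → E d) y = 0} :=
    closure_minimal (fun y hy => w.2.2.2 y hy) (isClosed_eq w.2.1 continuous_const)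
  exact hsub hcl

section Domain

variable {D : Set (E d)} {σ κ h : ℝ}

theorem Fits.frontier_disjoint (hD : IsOpen D) {p : E d} (hp : p ∈ frontier D) : p ∉ D := fun h => by
  have := hp.2
  rw [hD.interior_eq] at this
  exact this h

theorem Fits.interior_region_subset (hm : m.Fits D σ κ h) (hD : IsOpen D)
    (hL : HasLipschitzBoundary D) : interior m.region ⊆ D :=
  (interior_mono hm.subset).trans (interior_closure_subset hD hL)

theorem Fits.mem_interior_region_of_mem (hm : m.Fits D σ κ h) (hD : IsOpen D) {p : E d}
    (hp : p ∈ m.vertices ∩ D) : p ∈ interior m.region := by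
  by_contra hpi
  obtain ⟨s, hs, hps⟩ := mem_iUnion₂.1 hp.1
  exact Fits.frontier_disjoint hD (hm.vertex ⟨hp.1,
    subset_closure (hull_subset_region hs (vertex_mem_hull hps)), hpi⟩) hp.2

/-- Finite element fields vanish outside the domain. -/
theorem Fits.FE_eq_zero_of_notMem (hm : m.Fits D σ κ h) (hD : IsOpen D)
    (hL : HasLipschitzBoundary D) (w : m.FE) {x : E d} (hx : x ∉ D) : (w : E d → E d) x = 0 := by
  by_cases hxr : x ∈ m.region
  · exact FE_eq_zero_of_frontier w ⟨subset_closure hxr,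
      fun hi => hx (hm.interior_region_subset hD hL hi)⟩
  · exact w.2.2.2 x hxr

theorem Fits.nodal_mem_FE (hm : m.Fits D σ κ h) (hD : IsOpen D) {g : E d → E d}
    (hg : ∀ x ∉ D, g x = 0) : m.nodal g ∈ m.FE :=
  Mesh.nodal_mem_FE fun p hp => hg p (Fits.frontier_disjoint hD (hm.vertex hp))

end Domain

end Mesh

end Peridynamics

namespace Peridynamics

/-! ### Second order approximation in `L²` by interpolation and projection. -/

namespace Mesh

variable {d : ℕ} {m : Mesh d} {D : Set (E d)} {σ κ h : ℝ}

theorem not_mem_interior_of_bary_eq_zero {s : Finset (E d)} (hs : IsSimplex s) {p x : E d}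
    (hp : p ∈ s) (hx : bary s p x = 0) : x ∉ interior (hull s) := by
  unfold hull
  rw [← range_basis hs, AffineBasis.interior_convexHull]
  intro h
  have := h ⟨p, hp⟩
  rw [← bary_eq hs, hx] at this
  exact lt_irrefl _ this

/-- A vertex of `s` that is not in `t` has coordinate zero on the intersection, which therefore lies
in the boundary of a convex set, a null set. -/
theorem aedisjoint_hull {s t : Finset (E d)} (hs : s ∈ m.elems) (ht : t ∈ m.elems) (hst : s ≠ t) :
    AEDisjoint volume (hull s) (hull t) := by
  obtain ⟨p, hps, hpt⟩ : ∃ p ∈ s, p ∉ t := by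
    by_contra! hcon
    exact hst (Finset.eq_of_subset_of_card_le hcon (by rw [m.card_eq s hs, m.card_eq t ht]))
  refine measure_mono_null (t := frontier (hull s)) (fun x hx => ⟨subset_closure hx.1, ?_⟩)
    ((convex_convexHull ℝ _).addHaar_frontier volume)
  exact not_mem_interior_of_bary_eq_zero (isSimplex hs) hps (bary_eq_zero hs ht hx.1 hx.2 hps hpt)

theorem lintegral_region (f : E d → ℝ≥0∞) :
    ∫⁻ x in m.region, f x = ∑ s ∈ m.elems, ∫⁻ x in hull s, f x :=
  lintegral_biUnion_finset₀ (fun _ hs _ ht hst => aedisjoint_hull hs ht hst)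
    (fun s _ => (isClosed_hull s).measurableSet.nullMeasurableSet) f

theorem volume_hull_ne_zero {s : Finset (E d)} (hs : IsSimplex s) : volume (hull s) ≠ 0 :=
  (Measure.measure_pos_of_nonempty_interior volume (interior_simplex_nonempty hs)).ne'

theorem volume_hull_ne_top (s : Finset (E d)) : volume (hull s) ≠ ⊤ :=
  (s.finite_toSet.isCompact_convexHull ℝ).measure_lt_top.ne

theorem norm_sub_le_diam {s : Finset (E d)} {x y : E d} (hx : x ∈ hull s) (hy : y ∈ hull s) :
    ‖x - y‖ ≤ Metric.diam (hull s) := by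
  rw [← dist_eq_norm]
  exact Metric.dist_le_diam_of_mem (s.finite_toSet.isCompact_convexHull ℝ).isBounded hx hy

/-- The pointwise interpolation error on an element. -/
theorem enorm_rep_sub_nodal_le (hd : d ≤ 3) (hD : IsOpen D) (hL : HasLipschitzBoundary D)
    (w : W D) {s : Finset (E d)} (hs : s ∈ m.elems) (hsD : hull s ⊆ closure D) {x : E d}
    (hx : x ∈ hull s) :
    volume (hull s) ^ (1 / 2 : ℝ) * ‖rep w x - m.nodal (rep w) x‖ₑ ≤
      ENNReal.ofReal (4 * Metric.diam (hull s) ^ 2) *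
        eLpNorm (hessN (w : Jet D)) 2 (volume.restrict (hull s)) := by
  have := enorm_rep_sub_interp_le hd hD hL w (convex_convexHull ℝ _)
    (s.finite_toSet.isCompact_convexHull ℝ) (interior_simplex_nonempty (isSimplex hs)) hsD
    (fun x hx y hy => norm_sub_le_diam hx hy) s (fun p => bary s p x) id
    (fun p hp => (mem_convexHull_iff_bary (isSimplex hs)).1 hx p hp) (sum_bary (isSimplex hs) x)
    (fun p hp => vertex_mem_hull hp)
  simp only [id] at this
  rwa [sum_bary_smul (isSimplex hs), ← nodal_eq_sum (rep w) hs hx] at this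

theorem sq_rpow_half (v : ℝ≥0∞) : (v ^ (1 / 2 : ℝ)) ^ 2 = v := by
  rw [← ENNReal.rpow_natCast, ← ENNReal.rpow_mul]; norm_num

theorem sq_enorm_rep_sub_nodal_le (hd : d ≤ 3) (hD : IsOpen D) (hL : HasLipschitzBoundary D)
    (w : W D) {s : Finset (E d)} (hs : s ∈ m.elems) (hsD : hull s ⊆ closure D) {x : E d}
    (hx : x ∈ hull s) :
    volume (hull s) * ‖rep w x - m.nodal (rep w) x‖ₑ ^ 2 ≤
      ENNReal.ofReal (4 * Metric.diam (hull s) ^ 2) ^ 2 *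
        ∫⁻ x in hull s, hessN (w : Jet D) x ^ 2 := by
  have h2 := pow_le_pow_left' (enorm_rep_sub_nodal_le hd hD hL w hs hsD hx) 2
  rw [mul_pow, mul_pow, sq_rpow_half, eLpNorm_two_sq] at h2
  simpa only [enorm_eq_self] using h2

/-- The pointwise bound on an element is a constant whose square, times the volume, is local in the
second derivatives; summing over the elements loses nothing because they overlap in null sets. -/
theorem eLpNorm_rep_sub_nodal_region_le (hd : d ≤ 3) (hD : IsOpen D) (hL : HasLipschitzBoundary D)
    (w : W D) (hm : m.Fits D σ κ h) :
    eLpNorm (fun x => rep w x - m.nodal (rep w) x) 2 (volume.restrict m.region) ≤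
      ENNReal.ofReal (4 * h ^ 2) * eLpNorm (hessN (w : Jet D)) 2 volume := by
  refine (ENNReal.pow_le_pow_left_iff (two_ne_zero)).1 ?_
  rw [eLpNorm_two_sq, mul_pow, eLpNorm_two_sq, lintegral_region]
  simp only [enorm_eq_self]
  calc ∑ s ∈ m.elems, ∫⁻ x in hull s, ‖rep w x - m.nodal (rep w) x‖ₑ ^ 2
      ≤ ∑ s ∈ m.elems, ENNReal.ofReal (4 * h ^ 2) ^ 2 * ∫⁻ x in hull s, hessN (w : Jet D) x ^ 2 := by
        refine Finset.sum_le_sum fun s hs => ?_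
        set B := ENNReal.ofReal (4 * h ^ 2) ^ 2 * ∫⁻ x in hull s, hessN (w : Jet D) x ^ 2
        have hv0 := volume_hull_ne_zero (isSimplex hs)
        have hvt := volume_hull_ne_top s
        have hb : ∀ x ∈ hull s, ‖rep w x - m.nodal (rep w) x‖ₑ ^ 2 ≤ B / volume (hull s) := by
          intro x hx
          rw [ENNReal.le_div_iff_mul_le (.inl hv0) (.inl hvt), mul_comm]
          refine (sq_enorm_rep_sub_nodal_le hd hD hL w hs
            ((hull_subset_region hs).trans hm.subset) hx).trans ?_
          exact mul_le_mul_left (pow_le_pow_left' (ENNReal.ofReal_le_ofReal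
            (mul_le_mul_of_nonneg_left (pow_le_pow_left₀ Metric.diam_nonneg (hm.size s hs) 2)
              (by norm_num))) 2) _
        calc _ ≤ ∫⁻ _ in hull s, B / volume (hull s) :=
              setLIntegral_mono' (isClosed_hull s).measurableSet hb
          _ = B := by
              rw [setLIntegral_const, ENNReal.div_mul_cancel hv0 hvt]
    _ = ENNReal.ofReal (4 * h ^ 2) ^ 2 * ∫⁻ x in m.region, hessN (w : Jet D) x ^ 2 := by
        rw [lintegral_region, Finset.mul_sum]
    _ ≤ _ := by
        gcongr
        exact Measure.restrict_le_self

theorem frontier_nonempty (hd0 : 0 < d) (hDb : Bornology.IsBounded D) (hDn : D.Nonempty) :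
    (frontier D).Nonempty := by
  have : Nonempty (Fin d) := ⟨⟨0, hd0⟩⟩
  have : Nontrivial (E d) := inferInstance
  rw [nonempty_frontier_iff]
  refine ⟨hDn, fun h => ?_⟩
  rw [h] at hDb
  exact NormedSpace.unbounded_univ ℝ (E d) hDb

variable (D κ) in
/-- The error of piecewise linear interpolation is of second order in `L²`. -/
theorem exists_interp_bound (hd0 : 0 < d) (hd : d ≤ 3) (hD : IsOpen D) (hDb : Bornology.IsBounded D)
    (hL : HasLipschitzBoundary D) (hκ : 0 ≤ κ) : ∃ C > 0, ∀ (m : Mesh d) (σ h : ℝ),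
      m.Fits D σ κ h → ∀ w : W D,
        eLpNorm (fun x => rep w x - m.nodal (rep w) x) 2 volume ≤
          ENNReal.ofReal (C * h ^ 2 * ‖w‖) := by
  have hoff : ∀ (m : Mesh d) (σ h : ℝ), m.Fits D σ κ h → ∀ w : W D, ∀ x ∉ D,
      rep w x - m.nodal (rep w) x = 0 := fun m σ h hm w x hx => by
    have h2 := hm.FE_eq_zero_of_notMem hD hL
      ⟨_, hm.nodal_mem_FE hD fun x hx => rep_of_notMem w hx⟩ hx
    simp only at h2
    rw [rep_of_notMem w hx, h2, sub_zero]
  by_cases hDn : D.Nonempty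
  swap
  · refine ⟨1, one_pos, fun m σ h hm w => ?_⟩
    rw [not_nonempty_iff_eq_empty] at hDn
    have : (fun x => rep w x - m.nodal (rep w) x) = 0 := by
      ext1 x
      exact hoff m σ h hm w x (by simp [hDn])
    simp [this]
  obtain ⟨C, hC, hlayer⟩ := exists_layer_bound hd hD hDb hL (frontier_nonempty hd0 hDb hDn)
  refine ⟨4 * d ^ 2 + C * κ, by positivity, fun m σ h hm w => ?_⟩
  set f : E d → E d := fun x => rep w x - m.nodal (rep w) x with hf
  have hfc : Continuous f := (continuous_rep hd hD hL w).sub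
    (hm.nodal_mem_FE hD fun x hx => rep_of_notMem w hx).1
  have hrm : MeasurableSet m.region := m.isCompact_region.measurableSet
  have hDm : MeasurableSet (D \ m.region) := hD.measurableSet.diff hrm
  have e : f = m.region.indicator f + (D \ m.region).indicator f := by
    ext1 x
    by_cases hx : x ∈ m.region
    · simp [hx]
    · by_cases hxD : x ∈ D
      · simp [hx, hxD]
      · have := hoff m σ h hm w x hxD
        simp [hx, hxD, hf, this]
  have h1 : eLpNorm (m.region.indicator f) 2 volume ≤ ENNReal.ofReal (4 * d ^ 2 * h ^ 2 * ‖w‖) := by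
    rw [eLpNorm_indicator_eq_eLpNorm_restrict hrm]
    refine (eLpNorm_rep_sub_nodal_region_le hd hD hL w hm).trans ?_
    refine (mul_le_mul_right (eLpNorm_hessN_le hD w) _).trans (le_of_eq ?_)
    rw [← ENNReal.ofReal_mul (by positivity)]
    congr 1
    ring
  -- On the part of `D` without mesh the interpolant is zero and the error is the field itself. The
  -- width `κ h²` of this layer makes it of second order.
  have h2 : eLpNorm ((D \ m.region).indicator f) 2 volume ≤ ENNReal.ofReal (C * (κ * h ^ 2) * ‖w‖) := by
    rw [eLpNorm_indicator_eq_eLpNorm_restrict hDm]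
    refine le_trans ?_ (hlayer w (κ * h ^ 2) (by positivity))
    calc eLpNorm f 2 (volume.restrict (D \ m.region))
        = eLpNorm (rep w) 2 (volume.restrict (D \ m.region)) := by
          refine eLpNorm_congr_ae ((ae_restrict_iff' hDm).2 (.of_forall fun x hx => ?_))
          simp [hf, nodal_of_notMem _ hx.2]
      _ ≤ _ := by
          refine eLpNorm_mono_measure _ (Measure.restrict_mono (fun x hx => ?_) le_rfl)
          exact ⟨hx.1, hm.layer x hx⟩
  rw [e]
  refine (eLpNorm_add_le (hfc.aestronglyMeasurable.indicator hrm)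
    (hfc.aestronglyMeasurable.indicator hDm) (by norm_num)).trans ((add_le_add h1 h2).trans ?_)
  rw [← ENNReal.ofReal_add (by positivity) (by positivity)]
  exact le_of_eq (congrArg _ (by ring))

/-- The interpolant of a field in `W`. -/
noncomputable def Fits.interp (hm : m.Fits D σ κ h) (hD : IsOpen D) (w : W D) : m.FE :=
  ⟨m.nodal (rep w), hm.nodal_mem_FE hD fun _ hx => rep_of_notMem w hx⟩

theorem toL2_ae_eq (w : m.FE) : (m.toL2 D w : E d → E d) =ᵐ[volume.restrict D] (w : E d → E d) :=
  (m.FE_memLp D w).coeFn_toLp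

theorem extend_toL2_ae_eq (hm : m.Fits D σ κ h) (hD : IsOpen D) (hL : HasLipschitzBoundary D)
    (w : m.FE) : extend (m.toL2 D w) =ᵐ[volume] (w : E d → E d) :=
  extend_congr_ae hD _ (toL2_ae_eq w) fun _ hx => hm.FE_eq_zero_of_notMem hD hL w hx

theorem ofReal_norm_toL2_sub (hd : d ≤ 3) (hm : m.Fits D σ κ h) (hD : IsOpen D)
    (hL : HasLipschitzBoundary D) (g : m.FE) (w : W D) :
    ENNReal.ofReal ‖m.toL2 D g - W.toL2 w‖ =
      eLpNorm (fun x => (g : E d → E d) x - rep w x) 2 volume := by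
  rw [← eLpNorm_extend hD]
  refine eLpNorm_congr_ae ?_
  filter_upwards [extend_sub_ae hD (m.toL2 D g) (W.toL2 w), extend_toL2_ae_eq hm hD hL g,
    extend_ae_eq_rep hd hD hL w] with x h1 h2 h3
  rw [h1, h2, h3]

theorem ofReal_norm_toL2 (hm : m.Fits D σ κ h) (hD : IsOpen D)
    (hL : HasLipschitzBoundary D) (g : m.FE) :
    ENNReal.ofReal ‖m.toL2 D g‖ = eLpNorm (g : E d → E d) 2 volume := by
  rw [← eLpNorm_extend hD]
  exact eLpNorm_congr_ae (extend_toL2_ae_eq hm hD hL g)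

variable (D κ) in
theorem exists_norm_interp_sub_le (hd0 : 0 < d) (hd : d ≤ 3) (hD : IsOpen D)
    (hDb : Bornology.IsBounded D) (hL : HasLipschitzBoundary D) (hκ : 0 ≤ κ) :
    ∃ C > 0, ∀ (m : Mesh d) (σ h : ℝ) (hm : m.Fits D σ κ h) (w : W D),
      ‖m.toL2 D (hm.interp hD w) - W.toL2 w‖ ≤ C * h ^ 2 * ‖w‖ := by
  obtain ⟨C, hC, hb⟩ := exists_interp_bound D κ hd0 hd hD hDb hL hκ
  refine ⟨C, hC, fun m σ h hm w => ?_⟩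
  have h1 := hb m σ h hm w
  rw [← ENNReal.ofReal_le_ofReal_iff (by positivity), ofReal_norm_toL2_sub hd hm hD hL]
  refine le_trans (le_of_eq ?_) h1
  rw [← eLpNorm_neg]
  congr 1
  ext1 x
  simp [Fits.interp]

/-- Best approximation property of the orthogonal projection; it lets the interpolant bound the
projection error. -/
theorem norm_sub_proj_le (m : Mesh d) (D : Set (E d)) (f : L2 D) (g : m.FE) :
    ‖f - m.proj D f‖ ≤ ‖m.toL2 D g - f‖ := by
  rw [norm_sub_rev (m.toL2 D g)]
  unfold proj
  rw [Submodule.starProjection_minimal]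
  exact ciInf_le ⟨0, by rintro _ ⟨y, rfl⟩; exact norm_nonneg _⟩
    (⟨m.toL2 D g, LinearMap.mem_range_self _ g⟩ : LinearMap.range (m.toL2 D))

end Mesh

end Peridynamics

namespace Peridynamics

/-! ### The bond potential. -/

section Potential

variable {f : ℝ → ℝ}

theorem C2_nonneg (f : ℝ → ℝ) : 0 ≤ C2 f := Real.iSup_nonneg fun _ => abs_nonneg _

theorem IsPotential.contDiff_F1 (hf : IsPotential f) : ContDiff ℝ (⊤ : ℕ∞) (F1 f) :=
  contDiffOn_univ.1 (hf.smooth.comp (t := Ici 0) (g := f) (f := fun r : ℝ => r ^ 2)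
    (contDiff_id.pow 2).contDiffOn fun r _ => sq_nonneg r)

theorem IsPotential.deriv_F1 (hf : IsPotential f) (s : ℝ) :
    deriv (F1 f) s = derivWithin f (Ici 0) (s ^ 2) * (2 * s) := by
  have h1 : HasDerivWithinAt f (derivWithin f (Ici 0) (s ^ 2)) (Ici 0) (s ^ 2) :=
    ((hf.smooth.differentiableOn (by simp)) _ (sq_nonneg s)).hasDerivWithinAt
  have h2 : HasDerivAt (fun r : ℝ => r ^ 2) (2 * s) s := by simpa using hasDerivAt_pow 2 s
  have h3 := HasDerivWithinAt.comp (h₂ := f) (h := fun r : ℝ => r ^ 2) s h1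
    (h2.hasDerivWithinAt (s := univ)) fun r _ => sq_nonneg r
  exact (h3.hasDerivAt univ_mem).deriv

theorem IsPotential.abs_deriv_F1_sub_le (hf : IsPotential f) (s t : ℝ) :
    |deriv (F1 f) s - deriv (F1 f) t| ≤ C2 f * |s - t| := by
  have hd : Differentiable ℝ (deriv (F1 f)) :=
    (contDiff_infty.1 hf.contDiff_F1 2).differentiable_deriv_two
  have hb : ∀ r, ‖deriv (deriv (F1 f)) r‖ ≤ C2 f := fun r => by
    have := le_ciSup (hf.bounded 2 (by norm_num) (by norm_num)) r
    rw [show iteratedDeriv 2 (F1 f) = deriv (deriv (F1 f)) from by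
      rw [iteratedDeriv_succ, iteratedDeriv_one]] at this
    refine this.trans (le_of_eq ?_)
    rw [C2, show iteratedDeriv 2 (F1 f) = deriv (deriv (F1 f)) from by
      rw [iteratedDeriv_succ, iteratedDeriv_one]]
  exact Convex.norm_image_sub_le_of_norm_deriv_le (s := univ) (fun x _ => hd x) (fun x _ => hb x)
    convex_univ (mem_univ t) (mem_univ s)

/-- The bond law is `F₁'(√r S) / (2 √r)`, and `F₁'` is Lipschitz with constant `C₂`; the factor `√r`
gained from the argument cancels the denominator, so the bound does not depend on `r`. -/
theorem IsPotential.abs_bond_sub_le (hf : IsPotential f) {r : ℝ} (hr : 0 < r) (S S' : ℝ) :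
    |derivWithin f (Ici 0) (r * S ^ 2) * S - derivWithin f (Ici 0) (r * S' ^ 2) * S'| ≤
      C2 f / 2 * |S - S'| := by
  have ha : 0 < √r := Real.sqrt_pos.2 hr
  have e : ∀ S, derivWithin f (Ici 0) (r * S ^ 2) * S = deriv (F1 f) (√r * S) / (2 * √r) := by
    intro S
    rw [hf.deriv_F1, mul_pow, Real.sq_sqrt hr.le]
    field_simp
  rw [e, e, ← sub_div, abs_div, abs_of_pos (by positivity : 0 < 2 * √r), div_le_iff₀ (by positivity)]
  refine (hf.abs_deriv_F1_sub_le _ _).trans (le_of_eq ?_)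
  rw [← mul_sub, abs_mul, abs_of_pos ha]
  ring

theorem IsPotential.continuousOn_derivWithin (hf : IsPotential f) :
    ContinuousOn (derivWithin f (Ici 0)) (Ici 0) :=
  hf.smooth.continuousOn_derivWithin (uniqueDiffOn_Ici 0) (by simp)

/-- Clamping the argument at `0` gives a function that is continuous on all of `ℝ` and agrees with
`f'` on the arguments that occur. -/
theorem IsPotential.continuous_derivWithin_max (hf : IsPotential f) :
    Continuous fun r => derivWithin f (Ici 0) (max r 0) :=
  hf.continuousOn_derivWithin.comp_continuous (by fun_prop) fun r => (le_max_right r 0 : (0 : ℝ) ≤ max r 0)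

end Potential

theorem eLpNorm_two_const_mul {α : Type*} [MeasurableSpace α] {μ : Measure α} {c : ℝ≥0∞}
    (hc : c ≠ ⊤) (g : α → ℝ≥0∞) :
    eLpNorm (fun x => c * g x) 2 μ = c * eLpNorm g 2 μ := by
  refine (ENNReal.pow_right_strictMono two_ne_zero).injective ?_
  simp only [mul_pow, eLpNorm_two_sq, enorm_eq_self]
  exact lintegral_const_mul' _ _ (ENNReal.pow_ne_top hc)

/-! ### The peridynamic force as an operator on `L²`. -/

section Bond

variable {d : ℕ} {ε M : ℝ} {f J : ℝ → ℝ} {ω : E d → ℝ} {D : Set (E d)}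

theorem IsInfluence.nonneg' (hJ : IsInfluence J M) {r : ℝ} (hr : 0 ≤ r) : 0 ≤ J r := by
  rcases lt_or_ge r 1 with h | h
  · exact hJ.nonneg r hr h
  · rw [hJ.support r h]

theorem IsInfluence.bound_nonneg (hJ : IsInfluence J M) : 0 ≤ M :=
  (hJ.nonneg 0 le_rfl one_pos).trans (hJ.le 0 le_rfl one_pos)

theorem IsInfluence.le' (hJ : IsInfluence J M) {r : ℝ} (hr : 0 ≤ r) : J r ≤ M := by
  rcases lt_or_ge r 1 with h | h
  · exact hJ.le r hr h
  · rw [hJ.support r h]; exact hJ.bound_nonneg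

/-- The force exerted on `x` through the bond to `x + ξ`. -/
noncomputable def bond (ε : ℝ) (f J : ℝ → ℝ) (ω : E d → ℝ) (u : E d → E d) (x ξ : E d) : E d :=
  (ω x * ω (x + ξ) * J (‖ξ‖ / ε) * derivWithin f (Ici 0) (‖ξ‖ * strain u (x + ξ) x ^ 2)
      * strain u (x + ξ) x) • (‖ξ‖⁻¹ • ξ)

/-- The kernel `J(|ξ| / ε) / |ξ|`. -/
noncomputable def bondKernel (d : ℕ) (ε : ℝ) (J : ℝ → ℝ) (ξ : E d) : ℝ≥0∞ :=
  ENNReal.ofReal (J (‖ξ‖ / ε) / ‖ξ‖)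

theorem force_eq (hε : 0 < ε) (hJ : IsInfluence J M) (u : E d → E d) (x : E d) :
    force ε f J ω u x =
      (4 / (ε ^ (d + 1) * unitBallVolume d)) • ∫ ξ, bond ε f J ω u x ξ := by
  rw [force]
  congr 1
  rw [setIntegral_eq_integral_of_forall_compl_eq_zero]
  · rw [← integral_add_left_eq_self _ x]
    simp [bond]
  · intro y hy
    have : 1 ≤ ‖y - x‖ / ε := by
      rw [one_le_div hε]
      simpa [dist_eq_norm] using hy
    simp [hJ.support _ this]

theorem norm_normalize_le (ξ : E d) : ‖‖ξ‖⁻¹ • ξ‖ ≤ 1 := by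
  rw [norm_smul, norm_inv, norm_norm]
  exact inv_mul_le_one

theorem abs_strain_sub_le (u v : E d → E d) (y x : E d) :
    |strain u y x - strain v y x| ≤ ‖(u y - v y) - (u x - v x)‖ / ‖y - x‖ := by
  rw [strain, strain, ← inner_sub_left, ← smul_sub]
  refine (abs_real_inner_le_norm _ _).trans ?_
  refine (mul_le_of_le_one_right (norm_nonneg _) (norm_normalize_le _)).trans (le_of_eq ?_)
  rw [norm_smul, norm_inv, norm_norm, div_eq_inv_mul]
  congr 2
  abel

/-- The bond law contributes `C₂/2`, the boundary functions at most `1`, and the strain a factor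
`1/|ξ|`. This is the origin of the kernel `J(|ξ|/ε)/|ξ|`. -/
theorem norm_bond_sub_le (hf : IsPotential f) (hε : 0 < ε) (hJ : IsInfluence J M)
    (hω : IsBoundaryFunction D ε ω) (u v : E d → E d) (x ξ : E d) :
    ‖bond ε f J ω u x ξ - bond ε f J ω v x ξ‖ ≤
      C2 f / 2 * (J (‖ξ‖ / ε) / ‖ξ‖ * ‖(u (x + ξ) - v (x + ξ)) - (u x - v x)‖) := by
  rcases eq_or_ne ξ 0 with rfl | hξ
  · simp [bond]
  have hr : 0 < ‖ξ‖ := norm_pos_iff.2 hξ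
  rw [bond, bond, ← sub_smul, norm_smul]
  refine (mul_le_of_le_one_right (norm_nonneg _) (norm_normalize_le _)).trans ?_
  have hs := abs_strain_sub_le u v (x + ξ) x
  rw [add_sub_cancel_left] at hs
  have hb := (hf.abs_bond_sub_le hr (strain u (x + ξ) x) (strain v (x + ξ) x)).trans
    (mul_le_mul_of_nonneg_left hs (by have := C2_nonneg f; positivity))
  have hw : |ω x * ω (x + ξ)| ≤ 1 := by
    rw [abs_of_nonneg (mul_nonneg (hω.nonneg _) (hω.nonneg _))]
    exact mul_le_one₀ (hω.le_one _) (hω.nonneg _) (hω.le_one _)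
  have hJ0 : 0 ≤ J (‖ξ‖ / ε) := hJ.nonneg' (by positivity)
  rw [mul_assoc _ (derivWithin f (Ici 0) _), mul_assoc _ (derivWithin f (Ici 0) _), ← mul_sub,
    Real.norm_eq_abs, abs_mul, abs_mul, abs_of_nonneg hJ0]
  calc _ ≤ 1 * J (‖ξ‖ / ε) * (C2 f / 2 * (‖u (x + ξ) - v (x + ξ) - (u x - v x)‖ / ‖ξ‖)) := by
        gcongr
    _ = _ := by ring

theorem bond_zero (x ξ : E d) : bond ε f J ω 0 x ξ = 0 := by
  simp [bond, strain]

theorem norm_bond_le (hf : IsPotential f) (hε : 0 < ε) (hJ : IsInfluence J M)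
    (hω : IsBoundaryFunction D ε ω) (u : E d → E d) (x ξ : E d) :
    ‖bond ε f J ω u x ξ‖ ≤ C2 f / 2 * (J (‖ξ‖ / ε) / ‖ξ‖ * ‖u (x + ξ) - u x‖) := by
  have := norm_bond_sub_le hf hε hJ hω u 0 x ξ
  simpa [bond_zero] using this

theorem measurable_bond (hf : IsPotential f) (hJ : IsInfluence J M)
    (hω : IsBoundaryFunction D ε ω) {u : E d → E d} (hu : Measurable u) :
    Measurable fun p : E d × E d => bond ε f J ω u p.1 p.2 := by
  have hs : Measurable fun p : E d × E d => strain u (p.1 + p.2) p.1 := by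
    unfold strain
    fun_prop
  have hω' := hω.continuous.measurable
  have hJ' := hJ.measurable
  have hf' := hf.continuous_derivWithin_max.measurable
  have e : (fun p : E d × E d => bond ε f J ω u p.1 p.2) = fun p => (ω p.1 * ω (p.1 + p.2) *
      J (‖p.2‖ / ε) * (fun r => derivWithin f (Ici 0) (max r 0)) (‖p.2‖ * strain u (p.1 + p.2) p.1 ^ 2)
      * strain u (p.1 + p.2) p.1) • (‖p.2‖⁻¹ • p.2) := by
    ext1 p
    simp only [bond]
    rw [max_eq_left (by positivity)]
  rw [e]
  have h1 : Measurable fun p : E d × E d => J (‖p.2‖ / ε) := hJ'.comp (by fun_prop)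
  have h2 : Measurable fun p : E d × E d => (fun r => derivWithin f (Ici 0) (max r 0))
    (‖p.2‖ * strain u (p.1 + p.2) p.1 ^ 2) := hf'.comp (by fun_prop)
  have h3 : Measurable fun p : E d × E d => ω (p.1 + p.2) := hω'.comp (by fun_prop)
  have h4 : Measurable fun p : E d × E d => ω p.1 := hω'.comp (by fun_prop)
  exact ((((h4.mul h3).mul h1).mul h2).mul hs).smul (by fun_prop)

theorem stronglyMeasurable_force (hf : IsPotential f) (hε : 0 < ε) (hJ : IsInfluence J M)
    (hω : IsBoundaryFunction D ε ω) {u : E d → E d} (hu : Measurable u) :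
    StronglyMeasurable (force ε f J ω u) := by
  rw [funext (force_eq (f := f) (ω := ω) hε hJ u)]
  exact ((measurable_bond hf hJ hω hu).stronglyMeasurable.integral_prod_right'
    (ν := volume)).const_smul (4 / (ε ^ (d + 1) * unitBallVolume d))

theorem measurable_bondKernel (hJ : IsInfluence J M) : Measurable (bondKernel d ε J) := by
  have := hJ.measurable
  have h1 : Measurable fun ξ : E d => J (‖ξ‖ / ε) := this.comp (by fun_prop)
  exact (h1.div measurable_norm).ennreal_ofReal

theorem unitBallVolume_pos (d : ℕ) : 0 < unitBallVolume d :=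
  ENNReal.toReal_pos (Metric.measure_ball_pos _ _ one_pos).ne' measure_ball_lt_top.ne

/-- In polar coordinates the integrand becomes `r^(d-2)`, which is continuous for `d ≥ 2`. -/
theorem integrableOn_inv_norm (hd : 2 ≤ d) (r : ℝ) :
    IntegrableOn (fun ξ : E d => ‖ξ‖⁻¹) (Metric.ball 0 r) := by
  have : Nonempty (Fin d) := ⟨⟨0, by omega⟩⟩
  have h := (integrableOn_fun_norm_addHaar (volume : Measure (E d)) (f := fun y : ℝ => y⁻¹)
    (r := r)).2 ?_
  · exact h
  · rw [finrank_euclideanSpace, Fintype.card_fin]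
    have h2 : IntegrableOn (fun y : ℝ => y ^ (d - 2)) (Ioo 0 r) :=
      ((continuous_pow _).integrableOn_Icc (a := 0) (b := r)).mono_set Ioo_subset_Icc_self
    refine h2.congr_fun (fun y hy => ?_) measurableSet_Ioo
    obtain ⟨n, rfl⟩ := Nat.exists_eq_add_of_le hd
    have : y ≠ 0 := hy.1.ne'
    simp only [smul_eq_mul]
    rw [show 2 + n - 1 = (2 + n - 2) + 1 by omega, pow_succ]
    field_simp

theorem integrable_influence (hd : 2 ≤ d) (hJ : IsInfluence J M) :
    Integrable fun ξ : E d => J ‖ξ‖ / ‖ξ‖ := by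
  have hs : Function.support (fun ξ : E d => J ‖ξ‖ / ‖ξ‖) ⊆ Metric.ball 0 1 := by
    intro ξ hξ
    by_contra h
    have : 1 ≤ ‖ξ‖ := by simpa using h
    exact hξ (by simp [hJ.support _ this])
  rw [← integrableOn_iff_integrable_of_support_subset hs]
  refine ((integrableOn_inv_norm hd 1).const_mul M).mono' ?_ (.of_forall fun ξ => ?_)
  · exact ((hJ.measurable.comp measurable_norm).div measurable_norm).aestronglyMeasurable
  · rw [norm_div, norm_norm, div_eq_mul_inv, Real.norm_eq_abs,
      abs_of_nonneg (hJ.nonneg' (norm_nonneg _))]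
    exact mul_le_mul_of_nonneg_right (hJ.le' (norm_nonneg _)) (by positivity)

/-- The substitution `ξ = ε η` gives `ε^d` from the volume and `ε⁻¹` from the kernel. -/
theorem lintegral_bondKernel (hd : 2 ≤ d) (hε : 0 < ε) (hJ : IsInfluence J M) :
    ∫⁻ ξ, bondKernel d ε J ξ =
      ENNReal.ofReal (ε ^ (d - 1) * ∫ ξ in Metric.ball (0 : E d) 1, J ‖ξ‖ / ‖ξ‖) := by
  have hset : ∫ ξ in Metric.ball (0 : E d) 1, J ‖ξ‖ / ‖ξ‖ = ∫ ξ : E d, J ‖ξ‖ / ‖ξ‖ := by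
    refine setIntegral_eq_integral_of_forall_compl_eq_zero fun ξ hξ => ?_
    have : 1 ≤ ‖ξ‖ := by simpa using hξ
    simp [hJ.support _ this]
  have e : (fun ξ : E d => J (‖ξ‖ / ε) / ‖ξ‖) =
      fun ξ => ε⁻¹ * (fun η : E d => J ‖η‖ / ‖η‖) (ε⁻¹ • ξ) := by
    ext1 ξ
    simp only [norm_smul, norm_inv, Real.norm_eq_abs, abs_of_pos hε]
    rw [← div_eq_inv_mul]
    field_simp
  have hint : Integrable fun ξ : E d => J (‖ξ‖ / ε) / ‖ξ‖ := by
    rw [e]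
    exact ((integrable_influence hd hJ).comp_smul (inv_ne_zero hε.ne')).const_mul _
  unfold bondKernel
  rw [← ofReal_integral_eq_lintegral_ofReal hint (.of_forall fun ξ =>
    div_nonneg (hJ.nonneg' (by positivity)) (norm_nonneg _)), hset, e, integral_const_mul,
    Measure.integral_comp_inv_smul_of_nonneg volume (fun η : E d => J ‖η‖ / ‖η‖) hε.le, finrank_euclideanSpace, Fintype.card_fin,
    smul_eq_mul, ← mul_assoc]
  obtain ⟨n, rfl⟩ := Nat.exists_eq_add_of_le hd
  congr 2
  rw [show 2 + n - 1 = n + 1 by omega, show 2 + n = n + 1 + 1 by omega, pow_succ]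
  field_simp

theorem lintegral_bondKernel_ne_top (hd : 2 ≤ d) (hε : 0 < ε) (hJ : IsInfluence J M) :
    ∫⁻ ξ, bondKernel d ε J ξ ≠ ⊤ := by
  rw [lintegral_bondKernel hd hε hJ]; exact ENNReal.ofReal_ne_top

theorem enorm_bond_sub_le (hf : IsPotential f) (hε : 0 < ε) (hJ : IsInfluence J M)
    (hω : IsBoundaryFunction D ε ω) (u v : E d → E d) (x ξ : E d) :
    ‖bond ε f J ω u x ξ - bond ε f J ω v x ξ‖ₑ ≤ ENNReal.ofReal (C2 f / 2) *
      (bondKernel d ε J ξ * ‖(u (x + ξ) - v (x + ξ)) - (u x - v x)‖ₑ) := by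
  have h0 : 0 ≤ J (‖ξ‖ / ε) / ‖ξ‖ := div_nonneg (hJ.nonneg' (by positivity)) (norm_nonneg _)
  have := C2_nonneg f
  rw [← ofReal_norm, ← ofReal_norm, bondKernel, ← ENNReal.ofReal_mul h0,
    ← ENNReal.ofReal_mul (by positivity)]
  exact ENNReal.ofReal_le_ofReal (norm_bond_sub_le hf hε hJ hω u v x ξ)

theorem integrable_bond (hd : 2 ≤ d) (hf : IsPotential f) (hε : 0 < ε) (hJ : IsInfluence J M)
    (hω : IsBoundaryFunction D ε ω) {u : E d → E d} (hu : Measurable u) {x : E d}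
    (hx : ∫⁻ ξ, bondKernel d ε J ξ * ‖u (x + ξ)‖ₑ ≠ ⊤) : Integrable (bond ε f J ω u x) := by
  have hk := measurable_bondKernel (d := d) (ε := ε) hJ
  refine ⟨((measurable_bond hf hJ hω hu).comp
    (measurable_const.prodMk measurable_id)).aestronglyMeasurable, ?_⟩
  rw [hasFiniteIntegral_iff_enorm]
  have hle : ∀ ξ, ‖bond ε f J ω u x ξ‖ₑ ≤ ENNReal.ofReal (C2 f / 2) *
      (bondKernel d ε J ξ * ‖u (x + ξ)‖ₑ + bondKernel d ε J ξ * ‖u x‖ₑ) := fun ξ => by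
    have := enorm_bond_sub_le hf hε hJ hω u 0 x ξ
    simp only [bond_zero, sub_zero, Pi.zero_apply] at this
    refine this.trans ?_
    rw [← mul_add]
    gcongr
    exact enorm_sub_le
  refine (lintegral_mono hle).trans_lt ?_
  rw [lintegral_const_mul' _ _ ENNReal.ofReal_ne_top, lintegral_add_left (by fun_prop),
    lintegral_mul_const' _ _ enorm_ne_top]
  exact ENNReal.mul_lt_top ENNReal.ofReal_lt_top (ENNReal.add_lt_top.2 ⟨hx.lt_top,
    ENNReal.mul_lt_top (lintegral_bondKernel_ne_top hd hε hJ).lt_top enorm_lt_top⟩)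

theorem enorm_force_sub_le (hd : 2 ≤ d) (hf : IsPotential f) (hε : 0 < ε) (hJ : IsInfluence J M)
    (hω : IsBoundaryFunction D ε ω) {u v : E d → E d} (hu : Measurable u) (hv : Measurable v)
    {x : E d} (hxu : ∫⁻ ξ, bondKernel d ε J ξ * ‖u (x + ξ)‖ₑ ≠ ⊤)
    (hxv : ∫⁻ ξ, bondKernel d ε J ξ * ‖v (x + ξ)‖ₑ ≠ ⊤) :
    ‖force ε f J ω u x - force ε f J ω v x‖ₑ ≤
      ENNReal.ofReal (4 / (ε ^ (d + 1) * unitBallVolume d) * (C2 f / 2)) *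
        ((∫⁻ ξ, bondKernel d ε J ξ * ‖u (x + ξ) - v (x + ξ)‖ₑ) +
          (∫⁻ ξ, bondKernel d ε J ξ) * ‖u x - v x‖ₑ) := by
  have hk := measurable_bondKernel (d := d) (ε := ε) hJ
  have hc : 0 ≤ 4 / (ε ^ (d + 1) * unitBallVolume d) := by
    have := unitBallVolume_pos d
    positivity
  rw [force_eq hε hJ, force_eq hε hJ, ← smul_sub,
    ← integral_sub (integrable_bond hd hf hε hJ hω hu hxu) (integrable_bond hd hf hε hJ hω hv hxv),
    enorm_smul, ENNReal.ofReal_mul hc, mul_assoc, Real.enorm_eq_ofReal hc]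
  gcongr
  refine (enorm_integral_le_lintegral_enorm _).trans
    ((lintegral_mono fun ξ => enorm_bond_sub_le hf hε hJ hω u v x ξ).trans ?_)
  rw [lintegral_const_mul' _ _ ENNReal.ofReal_ne_top, ← lintegral_mul_const' _ _ enorm_ne_top,
    ← lintegral_add_left (by fun_prop)]
  gcongr with ξ
  rw [← mul_add]
  gcongr
  exact enorm_sub_le

/-- By Schur's test the integral is square integrable in `x`, hence finite almost everywhere. At
such points the bond integrals converge absolutely, so that differences of forces may be taken under
the integral. -/
theorem ae_lintegral_bondKernel_ne_top (hd : 2 ≤ d) (hε : 0 < ε) (hJ : IsInfluence J M)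
    {u : E d → E d} (hu : Measurable u) (hu2 : MemLp u 2 volume) :
    ∀ᵐ x, ∫⁻ ξ, bondKernel d ε J ξ * ‖u (x + ξ)‖ₑ ≠ ⊤ := by
  have hk := measurable_bondKernel (d := d) (ε := ε) hJ
  have h := eLpNorm_lintegral_translate_le hk (f := fun x => ‖u x‖ₑ) (by fun_prop)
  have hm : Measurable fun x => ∫⁻ ξ, bondKernel d ε J ξ * ‖u (x + ξ)‖ₑ :=
    Measurable.lintegral_prod_right' (f := fun p : E d × E d => bondKernel d ε J p.2 *
      ‖u (p.1 + p.2)‖ₑ) (by fun_prop)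
  have hfin : ∫⁻ x, (∫⁻ ξ, bondKernel d ε J ξ * ‖u (x + ξ)‖ₑ) ^ 2 ≠ ⊤ := by
    have h2 : eLpNorm (fun x => ∫⁻ ξ, bondKernel d ε J ξ * ‖u (x + ξ)‖ₑ) 2 volume ^ 2 ≠ ⊤ := by
      refine ENNReal.pow_ne_top (h.trans_lt ?_).ne
      rw [eLpNorm_enorm]
      exact ENNReal.mul_lt_top (lintegral_bondKernel_ne_top hd hε hJ).lt_top hu2.2
    rw [eLpNorm_two_sq] at h2
    simpa only [enorm_eq_self] using h2
  filter_upwards [ae_lt_top (hm.pow_const 2) hfin] with x hx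
  intro h
  simp [h] at hx

/-- Origin of `L₁/ε²`: the prefactor of the force, the constant `C₂/2` of the bond law, a factor `2`
for the two end points of a bond, and the mass `ε^(d-1)` of the kernel. -/
theorem L1_eq (hd : 2 ≤ d) (hε : 0 < ε) : 4 / (ε ^ (d + 1) * unitBallVolume d) * (C2 f / 2) *
    (2 * (ε ^ (d - 1) * ∫ ξ in Metric.ball (0 : E d) 1, J ‖ξ‖ / ‖ξ‖)) = L1 d f J / ε ^ 2 := by
  have := unitBallVolume_pos d
  rw [L1]
  obtain ⟨n, rfl⟩ := Nat.exists_eq_add_of_le hd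
  rw [show 2 + n + 1 = (2 + n - 1) + 2 by omega, pow_add]
  field_simp

theorem L1_nonneg (hJ : IsInfluence J M) : 0 ≤ L1 d f J := by
  have := C2_nonneg f
  have := unitBallVolume_pos d
  have : 0 ≤ ∫ ξ in Metric.ball (0 : E d) 1, J ‖ξ‖ / ‖ξ‖ :=
    integral_nonneg fun ξ => div_nonneg (hJ.nonneg' (norm_nonneg _)) (norm_nonneg _)
  unfold L1
  positivity

/-- The peridynamic force is Lipschitz in `L²`. -/
theorem eLpNorm_force_sub_le (hd : 2 ≤ d) (hf : IsPotential f) (hε : 0 < ε) (hJ : IsInfluence J M)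
    (hω : IsBoundaryFunction D ε ω) {u v : E d → E d} (hu : Measurable u) (hv : Measurable v)
    (hu2 : MemLp u 2 volume) (hv2 : MemLp v 2 volume) :
    eLpNorm (fun x => force ε f J ω u x - force ε f J ω v x) 2 volume ≤
      ENNReal.ofReal (L1 d f J / ε ^ 2) * eLpNorm (fun x => u x - v x) 2 volume := by
  have hk := measurable_bondKernel (d := d) (ε := ε) hJ
  have hωd := unitBallVolume_pos d
  have hC := C2_nonneg f
  set c := ENNReal.ofReal (4 / (ε ^ (d + 1) * unitBallVolume d) * (C2 f / 2)) with hc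
  set I := ∫⁻ ξ, bondKernel d ε J ξ with hI
  have hm : Measurable fun x => ∫⁻ ξ, bondKernel d ε J ξ * ‖u (x + ξ) - v (x + ξ)‖ₑ :=
    Measurable.lintegral_prod_right' (f := fun p : E d × E d => bondKernel d ε J p.2 *
      ‖u (p.1 + p.2) - v (p.1 + p.2)‖ₑ) (by fun_prop)
  calc _ ≤ eLpNorm (fun x => c * ((∫⁻ ξ, bondKernel d ε J ξ * ‖u (x + ξ) - v (x + ξ)‖ₑ) +
          I * ‖u x - v x‖ₑ)) 2 volume := by
        refine eLpNorm_mono_enorm_ae ?_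
        filter_upwards [ae_lintegral_bondKernel_ne_top hd hε hJ hu hu2,
          ae_lintegral_bondKernel_ne_top hd hε hJ hv hv2] with x h1 h2
        exact enorm_force_sub_le hd hf hε hJ hω hu hv h1 h2
    _ = c * eLpNorm (fun x => (∫⁻ ξ, bondKernel d ε J ξ * ‖u (x + ξ) - v (x + ξ)‖ₑ) +
          I * ‖u x - v x‖ₑ) 2 volume := eLpNorm_two_const_mul ENNReal.ofReal_ne_top _
    _ ≤ c * (I * eLpNorm (fun x => u x - v x) 2 volume +
          I * eLpNorm (fun x => u x - v x) 2 volume) := by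
        gcongr
        refine (eLpNorm_add_le hm.aestronglyMeasurable (Measurable.aestronglyMeasurable
          (by fun_prop)) (by norm_num)).trans (add_le_add ?_ (le_of_eq ?_))
        · refine (eLpNorm_lintegral_translate_le hk (f := fun x => ‖u x - v x‖ₑ)
            (by fun_prop)).trans (le_of_eq ?_)
          rw [eLpNorm_enorm]
        · rw [eLpNorm_two_const_mul (lintegral_bondKernel_ne_top hd hε hJ), eLpNorm_enorm]
    _ = _ := by
        rw [← add_mul, ← mul_assoc, ← two_mul, hI, lintegral_bondKernel hd hε hJ, hc,
          mul_assoc (ENNReal.ofReal _), ← mul_assoc, ← L1_eq (f := f) (J := J) hd hε,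
          ENNReal.ofReal_mul (by positivity) (q := 2 * _), ENNReal.ofReal_mul zero_le_two,
          ENNReal.ofReal_ofNat]

theorem force_zero : force ε f J ω 0 = 0 := by
  ext1 x
  simp [force, strain]

theorem memLp_force (hd : 2 ≤ d) (hf : IsPotential f) (hε : 0 < ε) (hJ : IsInfluence J M)
    (hω : IsBoundaryFunction D ε ω) {u : E d → E d} (hu : Measurable u) (hu2 : MemLp u 2 volume) :
    MemLp (force ε f J ω u) 2 volume := by
  refine ⟨(stronglyMeasurable_force hf hε hJ hω hu).aestronglyMeasurable, ?_⟩
  have := eLpNorm_force_sub_le hd hf hε hJ hω hu measurable_const hu2 (v := fun _ => 0)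
    MemLp.zero
  have h0 : force ε f J ω (fun _ => 0) = 0 := force_zero
  simp only [h0, Pi.zero_apply, sub_zero] at this
  exact this.trans_lt (ENNReal.mul_lt_top ENNReal.ofReal_lt_top hu2.2)

/-- Equality almost everywhere is not enough: the value at `x` enters every bond of `x` and must
agree separately. -/
theorem force_congr_ae {u v : E d → E d} (h : u =ᵐ[volume] v) {x : E d} (hx : u x = v x) :
    force ε f J ω u x = force ε f J ω v x := by
  unfold force
  congr 1
  refine integral_congr_ae (ae_restrict_of_ae ?_)
  filter_upwards [h] with y hy
  simp [strain, hx, hy]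

theorem continuous_force (hd : 2 ≤ d) (hf : IsPotential f) (hε : 0 < ε) (hJ : IsInfluence J M)
    (hω : IsBoundaryFunction D ε ω) {u : E d → E d} (hu : Continuous u) {B : ℝ}
    (hB : ∀ x, ‖u x‖ ≤ B) : Continuous (force ε f J ω u) := by
  rw [funext (force_eq (f := f) (ω := ω) hε hJ u)]
  suffices h : Continuous fun x => ∫ ξ, bond ε f J ω u x ξ from
    h.const_smul (4 / (ε ^ (d + 1) * unitBallVolume d))
  have hω' := hω.continuous
  have hC := C2_nonneg f
  refine continuous_of_dominated (bound := fun ξ => C2 f / 2 * (J (‖ξ‖ / ε) / ‖ξ‖ * (2 * B)))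
    (fun x => ((measurable_bond hf hJ hω hu.measurable).comp
      (measurable_const.prodMk measurable_id)).aestronglyMeasurable)
    (fun x => .of_forall fun ξ => ?_) ?_ (.of_forall fun ξ => ?_)
  · refine (norm_bond_le hf hε hJ hω u x ξ).trans ?_
    have := hJ.nonneg' (r := ‖ξ‖ / ε) (by positivity)
    gcongr
    refine (norm_sub_le _ _).trans ?_
    linarith [hB (x + ξ), hB x]
  · have : Integrable fun ξ : E d => J (‖ξ‖ / ε) / ‖ξ‖ := by
      refine ⟨((hJ.measurable.comp (by fun_prop)).div measurable_norm).aestronglyMeasurable, ?_⟩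
      rw [hasFiniteIntegral_iff_ofReal (.of_forall fun ξ =>
        div_nonneg (hJ.nonneg' (by positivity)) (norm_nonneg _))]
      exact (lintegral_bondKernel_ne_top hd hε hJ).lt_top
    exact (this.mul_const _).const_mul _
  · have hs : Continuous fun x => strain u (x + ξ) x := by
      simp only [strain, add_sub_cancel_left]
      fun_prop
    have e : (fun x => bond ε f J ω u x ξ) = fun x => (ω x * ω (x + ξ) *
      J (‖ξ‖ / ε) * (fun r => derivWithin f (Ici 0) (max r 0)) (‖ξ‖ * strain u (x + ξ) x ^ 2)
      * strain u (x + ξ) x) • (‖ξ‖⁻¹ • ξ) := by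
      ext1 x
      simp only [bond]
      rw [max_eq_left (by positivity)]
    rw [e]
    have hg : Continuous fun x => (fun r => derivWithin f (Ici 0) (max r 0))
        (‖ξ‖ * strain u (x + ξ) x ^ 2) := hf.continuous_derivWithin_max.comp (by fun_prop)
    fun_prop

end Bond

end Peridynamics

namespace Peridynamics

/-! ### Taylor's formula in time. -/

section Taylor

variable {F : Type*} [NormedAddCommGroup F] [NormedSpace ℝ F] {z z' z'' : ℝ → F} {T B : ℝ}

/-- The remainder, as a function of its end point, has derivative `z' τ - z' s`, of norm at most `B
(τ - s)`; comparison with the quadratic `B (τ - s)² / 2` follows. -/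
theorem norm_sub_sub_smul_left_le (hz : ∀ t ∈ Icc 0 T, HasDerivWithinAt z (z' t) (Icc 0 T) t)
    (hz' : ∀ t ∈ Icc 0 T, HasDerivWithinAt z' (z'' t) (Icc 0 T) t)
    (hB : ∀ t ∈ Icc 0 T, ‖z'' t‖ ≤ B) {s t : ℝ} (hs : 0 ≤ s) (hst : s ≤ t) (ht : t ≤ T) :
    ‖z t - z s - (t - s) • z' s‖ ≤ B * (t - s) ^ 2 / 2 := by
  have hsub : Icc s t ⊆ Icc 0 T := Icc_subset_Icc hs ht
  have hd : ∀ τ ∈ Icc s t, HasDerivWithinAt (fun τ => z τ - z s - (τ - s) • z' s)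
      (z' τ - z' s) (Icc 0 T) τ := fun τ hτ => by
    have h1 : HasDerivWithinAt (fun τ => (τ - s) • z' s) ((1 : ℝ) • z' s) (Icc 0 T) τ :=
      (((hasDerivAt_id τ).sub_const s).smul_const (z' s)).hasDerivWithinAt
    rw [one_smul] at h1
    exact ((hz τ (hsub hτ)).sub_const _).sub h1
  refine image_norm_le_of_norm_deriv_right_le_deriv_boundary
    (f := fun τ => z τ - z s - (τ - s) • z' s) (f' := fun τ => z' τ - z' s)
    (B := fun τ => B * (τ - s) ^ 2 / 2) (B' := fun τ => B * (τ - s))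
    (fun τ hτ => ((hd τ hτ).continuousWithinAt).mono hsub) (fun τ hτ => ?_) (by simp)
    (fun τ => ?_) (fun τ hτ => ?_) (right_mem_Icc.2 hst)
  · exact (hd τ (Ico_subset_Icc_self hτ)).mono_of_mem_nhdsWithin
      (Icc_mem_nhdsGE_of_mem ⟨hs.trans hτ.1, hτ.2.trans_le ht⟩)
  · have := ((((hasDerivAt_id τ).sub_const s).pow 2).const_mul B).div_const 2
    refine this.congr_deriv ?_
    simp
    ring
  · have := (convex_Icc (0 : ℝ) T).norm_image_sub_le_of_norm_hasDerivWithin_le hz' hB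
      (hsub (left_mem_Icc.2 hst)) (hsub (Ico_subset_Icc_self hτ))
    rwa [Real.norm_of_nonneg (sub_nonneg.2 hτ.1)] at this

/-- The previous estimate under the time reversal `τ ↦ T - τ`. -/
theorem norm_sub_sub_smul_right_le (hz : ∀ t ∈ Icc 0 T, HasDerivWithinAt z (z' t) (Icc 0 T) t)
    (hz' : ∀ t ∈ Icc 0 T, HasDerivWithinAt z' (z'' t) (Icc 0 T) t)
    (hB : ∀ t ∈ Icc 0 T, ‖z'' t‖ ≤ B) {s t : ℝ} (hs : 0 ≤ s) (hst : s ≤ t) (ht : t ≤ T) :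
    ‖z t - z s - (t - s) • z' t‖ ≤ B * (t - s) ^ 2 / 2 := by
  have hr : ∀ τ ∈ Icc 0 T, T - τ ∈ Icc 0 T := fun τ hτ => ⟨by linarith [hτ.2], by linarith [hτ.1]⟩
  have hc : ∀ τ, HasDerivWithinAt (fun τ => T - τ) (-1 : ℝ) (Icc 0 T) τ := fun τ => by
    simpa using ((hasDerivAt_id τ).const_sub T).hasDerivWithinAt (s := Icc 0 T)
  have h := norm_sub_sub_smul_left_le (z := fun τ => z (T - τ)) (z' := fun τ => (-1 : ℝ) • z' (T - τ))
    (z'' := fun τ => (-1 : ℝ) • (-1 : ℝ) • z'' (T - τ)) (B := B)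
    (fun τ hτ => (hz _ (hr τ hτ)).scomp τ (hc τ) hr)
    (fun τ hτ => ((hz' _ (hr τ hτ)).scomp τ (hc τ) hr).const_smul (-1 : ℝ))
    (fun τ hτ => by simpa using hB _ (hr τ hτ)) (s := T - t) (t := T - s)
    (by linarith) (by linarith) (by linarith)
  simp only [sub_sub_cancel] at h
  rw [← norm_neg]
  refine le_trans (le_of_eq (congrArg _ ?_)) (h.trans (le_of_eq ?_))
  · module
  · ring

end Taylor

/-! ### Discrete Gronwall inequality. -/

section Growth

/-- A discrete Gronwall inequality. -/
theorem add_le_exp_mul_of_step {T Δt L a b Γ : ℝ} {x y : ℕ → ℝ} (hΔt : 0 < Δt) (hΔ1 : Δt < 1)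
    (hL : 0 ≤ L) (ha : 0 ≤ a) (hb : 0 ≤ b) (hΓ : 0 ≤ Γ) (hx0 : ∀ k, 0 ≤ x k) (hy0 : ∀ k, 0 ≤ y k)
    (hx : ∀ k : ℕ, (k + 1) * Δt ≤ T → x (k + 1) ≤ x k + Δt * y (k + 1) + Δt * a)
    (hy : ∀ k : ℕ, (k + 1) * Δt ≤ T →
      y (k + 1) ≤ y k + Δt * (L * x k) + Δt * b + if k = 0 then Γ else 0)
    {k : ℕ} (hk : k * Δt ≤ T) :
    x k + y k ≤ Real.exp (T * (1 + L) * (1 / (1 - Δt))) *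
      (x 0 + y 0 + (T * (a + b) + Γ) / (1 - Δt)) := by
  have h1 : 0 < 1 - Δt := by linarith
  -- This is `(1 + Δt L) / (1 - Δt)`: the implicit term `Δt * y (k + 1)` is absorbed on the left,
  -- which requires `Δt < 1`.
  set q := 1 + Δt * (1 + L) / (1 - Δt) with hq
  have hq1 : 1 ≤ q := by
    have : 0 ≤ Δt * (1 + L) / (1 - Δt) := by positivity
    linarith
  have hqe : (1 - Δt) * q = 1 + Δt * L := by rw [hq]; field_simp; ring
  have step : ∀ j : ℕ, (j + 1) * Δt ≤ T → x (j + 1) + y (j + 1) ≤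
      q * (x j + y j) + (Δt * (a + b) + if j = 0 then Γ else 0) / (1 - Δt) := by
    intro j hj
    have hG : (0 : ℝ) ≤ if j = 0 then Γ else 0 := by split_ifs <;> simp [hΓ]
    have e1 := hx j hj
    have e2 := hy j hj
    generalize (if j = 0 then Γ else (0 : ℝ)) = G at *
    have e3 : (1 - Δt) * (x (j + 1) + y (j + 1)) ≤ (1 + Δt * L) * (x j + y j) +
        (Δt * (a + b) + G) := by
      have := mul_nonneg hΔt.le (hx0 (j + 1))
      have := mul_nonneg (mul_nonneg hΔt.le hL) (hy0 j)
      nlinarith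
    rw [← hqe, mul_assoc] at e3
    have e4 : (1 - Δt) * (x (j + 1) + y (j + 1) - q * (x j + y j)) ≤ Δt * (a + b) + G := by
      linarith
    rw [← sub_le_iff_le_add', le_div_iff₀ h1]
    linarith
  -- The extra defect `Γ` occurs in the first step only, so it is counted once, from `j = 1` on.
  -- Defects are multiplied by the full power of `q`, which is harmless since `q ≥ 1`.
  have main : ∀ j : ℕ, j * Δt ≤ T →
      x j + y j ≤ q ^ j * (x 0 + y 0 + (j * (Δt * (a + b)) + if j = 0 then 0 else Γ) / (1 - Δt)) := by
    intro j
    induction j with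
    | zero => intro _; simp
    | succ j ih =>
      intro hj
      push_cast at hj
      have hj' : (j : ℝ) * Δt ≤ T := by linarith
      refine (step j hj).trans ?_
      have e1 := mul_le_mul_of_nonneg_left (ih hj') (by linarith : 0 ≤ q)
      have hp : 1 ≤ q ^ (j + 1) := one_le_pow₀ hq1
      have hG : (0 : ℝ) ≤ if j = 0 then Γ else 0 := by split_ifs <;> simp [hΓ]
      have e2 : (Δt * (a + b) + if j = 0 then Γ else 0) / (1 - Δt) ≤
          q ^ (j + 1) * ((Δt * (a + b) + if j = 0 then Γ else 0) / (1 - Δt)) :=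
        le_mul_of_one_le_left (by positivity) hp
      refine (add_le_add e1 e2).trans (le_of_eq ?_)
      rw [← mul_assoc, ← pow_succ', ← mul_add, add_assoc, ← add_div]
      congr 3
      rcases eq_or_ne j 0 with rfl | hj0
      · simp
      · simp [hj0]; ring
  refine (main k hk).trans ?_
  have hk0 : (0 : ℝ) ≤ k * (Δt * (a + b)) := by positivity
  have hG : (0 : ℝ) ≤ if k = 0 then 0 else Γ := by split_ifs <;> simp [hΓ]
  have hG' : (if k = 0 then 0 else Γ) ≤ Γ := by split_ifs <;> simp [hΓ]
  have hx00 := hx0 0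
  have hy00 := hy0 0
  refine mul_le_mul ?_ ?_ (by positivity) (Real.exp_pos _).le
  · calc q ^ k ≤ Real.exp (Δt * (1 + L) / (1 - Δt)) ^ k := by
          refine pow_le_pow_left₀ (by linarith) ?_ k
          rw [hq, add_comm]
          exact Real.add_one_le_exp _
      _ = Real.exp ((k * Δt) * ((1 + L) / (1 - Δt))) := by
          rw [← Real.exp_nat_mul]; congr 1; ring
      _ ≤ _ := by
          rw [Real.exp_le_exp, show T * (1 + L) * (1 / (1 - Δt)) = T * ((1 + L) / (1 - Δt)) by ring]
          gcongr
  · have : k * (Δt * (a + b)) ≤ T * (a + b) := by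
      rw [← mul_assoc]
      exact mul_le_mul_of_nonneg_right hk (by positivity)
    linarith [div_le_div_of_nonneg_right (add_le_add this hG') h1.le]

end Growth

/-! ### Exact solutions and their truncation errors in time. -/

section Solutions

variable {d : ℕ} {D : Set (E d)} {T : ℝ}

/-- The inclusion of `W` into `L²`. -/
noncomputable def W.toL2L (D : Set (E d)) : W D →L[ℝ] L2 D :=
  LinearMap.mkContinuous { toFun := W.toL2, map_add' := fun _ _ => rfl, map_smul' := fun _ _ => rfl } 1
    fun w => (norm_toL2_le w).trans (one_mul _).ge

theorem W.toL2L_apply (w : W D) : W.toL2L D w = W.toL2 w := rfl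

theorem W.toL2_smul (c : ℝ) (w : W D) : W.toL2 (c • w) = c • W.toL2 w := (W.toL2L D).map_smul c w

theorem norm_le_supH2 {w : ℝ → W D} (hw : ContinuousOn w (Icc 0 T)) {t : ℝ} (ht : t ∈ Icc 0 T) :
    ‖w t‖ ≤ supH2 T w := by
  have := isCompact_Icc.bddAbove_image hw.norm
  rw [image_eq_range] at this
  exact le_ciSup this (⟨t, ht⟩ : Icc (0 : ℝ) T)

theorem norm_le_supL2 {w : ℝ → W D} (hw : ContinuousOn w (Icc 0 T)) {t : ℝ} (ht : t ∈ Icc 0 T) :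
    ‖W.toL2 (w t)‖ ≤ supL2 T w := by
  have := isCompact_Icc.bddAbove_image ((W.toL2L D).continuous.comp_continuousOn hw).norm
  rw [image_eq_range] at this
  exact le_ciSup this (⟨t, ht⟩ : Icc (0 : ℝ) T)

theorem supL2_nonneg (T : ℝ) (w : ℝ → W D) : 0 ≤ supL2 T w :=
  Real.iSup_nonneg fun _ => norm_nonneg _

theorem supH2_nonneg (T : ℝ) (w : ℝ → W D) : 0 ≤ supH2 T w :=
  Real.iSup_nonneg fun _ => norm_nonneg _

theorem secondDeriv_eq (T : ℝ) (w : ℝ → W D) :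
    secondDeriv T w = derivWithin (derivWithin w (Icc 0 T)) (Icc 0 T) := by
  rw [secondDeriv, iteratedDerivWithin_succ, iteratedDerivWithin_one]

theorem continuousOn_secondDeriv (hT : 0 < T) {w : ℝ → W D} (hw : ContDiffOn ℝ 2 w (Icc 0 T)) :
    ContinuousOn (secondDeriv T w) (Icc 0 T) :=
  hw.continuousOn_iteratedDerivWithin (by norm_num) (uniqueDiffOn_Icc hT)

theorem hasDerivWithinAt_derivWithin (hT : 0 < T) {w : ℝ → W D}
    (hw : ContDiffOn ℝ 2 w (Icc 0 T)) {t : ℝ} (ht : t ∈ Icc 0 T) :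
    HasDerivWithinAt w (derivWithin w (Icc 0 T) t) (Icc 0 T) t ∧
      HasDerivWithinAt (derivWithin w (Icc 0 T)) (secondDeriv T w t) (Icc 0 T) t := by
  refine ⟨(hw.differentiableOn (by norm_num) t ht).hasDerivWithinAt, ?_⟩
  rw [secondDeriv_eq]
  have := hw.differentiableOn_iteratedDerivWithin (m := 1) (by norm_num) (uniqueDiffOn_Icc hT)
  rw [iteratedDerivWithin_one] at this
  exact (this t ht).hasDerivWithinAt

section Truncation

variable {G : Type*} [NormedAddCommGroup G] [NormedSpace ℝ G]

/-- The operator `A` serves twice: as the inclusion into `L²` for all schemes, and as the identity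
of `W` for the strong scheme, which also needs the defect in the `H²` norm. -/
theorem norm_truncation_left_le (hT : 0 < T) {w : ℝ → W D} (hw : ContDiffOn ℝ 2 w (Icc 0 T))
    (A : W D →L[ℝ] G) {B : ℝ} (hB : ∀ t ∈ Icc 0 T, ‖A (secondDeriv T w t)‖ ≤ B)
    {s t : ℝ} (hs : 0 ≤ s) (hst : s < t) (ht : t ≤ T) :
    ‖A (derivWithin w (Icc 0 T) s - (t - s)⁻¹ • (w t - w s))‖ ≤ B / 2 * (t - s) := by
  have h := norm_sub_sub_smul_left_le (z := fun τ => A (w τ))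
    (fun τ hτ => A.hasFDerivAt.comp_hasDerivWithinAt τ (hasDerivWithinAt_derivWithin hT hw hτ).1)
    (fun τ hτ => A.hasFDerivAt.comp_hasDerivWithinAt τ (hasDerivWithinAt_derivWithin hT hw hτ).2)
    hB hs hst.le ht
  have hp : 0 < t - s := sub_pos.2 hst
  have e : A (derivWithin w (Icc 0 T) s - (t - s)⁻¹ • (w t - w s)) =
      -((t - s)⁻¹ • (A (w t) - A (w s) - (t - s) • A (derivWithin w (Icc 0 T) s))) := by
    rw [map_sub, map_smul, map_sub, smul_sub _ _ ((t - s) • _), inv_smul_smul₀ hp.ne']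
    abel
  rw [e, norm_neg, norm_smul, norm_inv, Real.norm_of_nonneg hp.le, inv_mul_le_iff₀ hp]
  refine h.trans (le_of_eq ?_)
  ring

theorem norm_truncation_right_le (hT : 0 < T) {w : ℝ → W D} (hw : ContDiffOn ℝ 2 w (Icc 0 T))
    (A : W D →L[ℝ] G) {B : ℝ} (hB : ∀ t ∈ Icc 0 T, ‖A (secondDeriv T w t)‖ ≤ B)
    {s t : ℝ} (hs : 0 ≤ s) (hst : s < t) (ht : t ≤ T) :
    ‖A (derivWithin w (Icc 0 T) t - (t - s)⁻¹ • (w t - w s))‖ ≤ B / 2 * (t - s) := by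
  have h := norm_sub_sub_smul_right_le (z := fun τ => A (w τ))
    (fun τ hτ => A.hasFDerivAt.comp_hasDerivWithinAt τ (hasDerivWithinAt_derivWithin hT hw hτ).1)
    (fun τ hτ => A.hasFDerivAt.comp_hasDerivWithinAt τ (hasDerivWithinAt_derivWithin hT hw hτ).2)
    hB hs hst.le ht
  have hp : 0 < t - s := sub_pos.2 hst
  have e : A (derivWithin w (Icc 0 T) t - (t - s)⁻¹ • (w t - w s)) =
      -((t - s)⁻¹ • (A (w t) - A (w s) - (t - s) • A (derivWithin w (Icc 0 T) t))) := by
    rw [map_sub, map_smul, map_sub, smul_sub _ _ ((t - s) • _), inv_smul_smul₀ hp.ne']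
    abel
  rw [e, norm_neg, norm_smul, norm_inv, Real.norm_of_nonneg hp.le, inv_mul_le_iff₀ hp]
  refine h.trans (le_of_eq ?_)
  ring

end Truncation

section Exact

variable {ε M : ℝ} {f J : ℝ → ℝ} {ω : E d → ℝ} {b : ℝ → L2 D} {u v : ℝ → W D}

theorem IsExactSolution.derivWithin_u (hT : 0 < T) (h : IsExactSolution D ε f J ω T b u v) {t : ℝ}
    (ht : t ∈ Icc 0 T) : derivWithin u (Icc 0 T) t = v t :=
  (h.velocity t ht).derivWithin (uniqueDiffOn_Icc hT t ht)

theorem IsExactSolution.secondDeriv_u (hT : 0 < T) (h : IsExactSolution D ε f J ω T b u v) {t : ℝ}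
    (ht : t ∈ Icc 0 T) : secondDeriv T u t = derivWithin v (Icc 0 T) t := by
  rw [secondDeriv_eq]
  exact derivWithin_congr (fun s hs => h.derivWithin_u hT hs) (h.derivWithin_u hT ht)

end Exact

end Solutions

end Peridynamics

namespace Peridynamics

/-! ### Force and projection on `L²`. -/

section ForceL2

variable {d : ℕ} {ε M : ℝ} {f J : ℝ → ℝ} {ω : E d → ℝ} {D : Set (E d)}

open scoped Classical in
/-- The peridynamic force as a map of `L²(D; ℝᵈ)` to itself. -/
noncomputable def forceL2 (ε : ℝ) (f J : ℝ → ℝ) (ω : E d → ℝ) (g : L2 D) : L2 D :=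
  if h : MemLp (force ε f J ω (extend g)) 2 (volume.restrict D) then h.toLp _ else 0

theorem forceL2_ae_eq (hd : 2 ≤ d) (hf : IsPotential f) (hε : 0 < ε) (hJ : IsInfluence J M)
    (hω : IsBoundaryFunction D ε ω) (hD : IsOpen D) (g : L2 D) :
    forceL2 ε f J ω g =ᵐ[volume.restrict D] force ε f J ω (extend g) := by
  have h : MemLp (force ε f J ω (extend g)) 2 (volume.restrict D) :=
    (memLp_force hd hf hε hJ hω (measurable_extend hD g) (memLp_extend hD g)).restrict D
  rw [forceL2, dif_pos h]
  exact h.coeFn_toLp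

theorem norm_le_of_eLpNorm_le {g : L2 D} {r : ℝ} (hr : 0 ≤ r)
    (h : eLpNorm g 2 (volume.restrict D) ≤ ENNReal.ofReal r) : ‖g‖ ≤ r := by
  rw [Lp.norm_def]
  exact ENNReal.toReal_le_of_le_ofReal hr h

theorem eLpNorm_force_extend_sub_le (hd : 2 ≤ d) (hf : IsPotential f) (hε : 0 < ε)
    (hJ : IsInfluence J M) (hω : IsBoundaryFunction D ε ω) (hD : IsOpen D) (g g' : L2 D) :
    eLpNorm (fun x => force ε f J ω (extend g) x - force ε f J ω (extend g') x) 2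
      (volume.restrict D) ≤ ENNReal.ofReal (L1 d f J / ε ^ 2 * ‖g - g'‖) := by
  have hL := L1_nonneg (d := d) (f := f) hJ
  rw [ENNReal.ofReal_mul (by positivity), ← eLpNorm_extend hD]
  refine (eLpNorm_mono_measure _ Measure.restrict_le_self).trans
    ((eLpNorm_force_sub_le hd hf hε hJ hω (measurable_extend hD g) (measurable_extend hD g')
      (memLp_extend hD g) (memLp_extend hD g')).trans (le_of_eq ?_))
  rw [eLpNorm_congr_ae (extend_sub_ae hD g g')]

theorem norm_forceL2_sub_le (hd : 2 ≤ d) (hf : IsPotential f) (hε : 0 < ε)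
    (hJ : IsInfluence J M) (hω : IsBoundaryFunction D ε ω) (hD : IsOpen D) (g g' : L2 D) :
    ‖forceL2 ε f J ω g - forceL2 ε f J ω g'‖ ≤ L1 d f J / ε ^ 2 * ‖g - g'‖ := by
  have hL := L1_nonneg (d := d) (f := f) hJ
  refine norm_le_of_eLpNorm_le (by positivity) (le_trans (le_of_eq (eLpNorm_congr_ae ?_))
    (eLpNorm_force_extend_sub_le hd hf hε hJ hω hD g g'))
  filter_upwards [Lp.coeFn_sub (forceL2 ε f J ω g) (forceL2 ε f J ω g'),
    forceL2_ae_eq hd hf hε hJ hω hD g, forceL2_ae_eq hd hf hε hJ hω hD g'] with x h1 h2 h3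
  rw [h1, Pi.sub_apply, h2, h3]

theorem IsExactSolution.motion_L2 {T : ℝ} {b : ℝ → L2 D} {u v : ℝ → W D} (hd : 2 ≤ d)
    (hf : IsPotential f) (hε : 0 < ε) (hJ : IsInfluence J M) (hω : IsBoundaryFunction D ε ω)
    (hD : IsOpen D) (h : IsExactSolution D ε f J ω T b u v) {t : ℝ} (ht : t ∈ Icc 0 T) :
    W.toL2 (derivWithin v (Icc 0 T) t) = forceL2 ε f J ω (W.toL2 (u t)) + b t := by
  refine Lp.ext ?_
  filter_upwards [h.motion t ht, Lp.coeFn_add (forceL2 ε f J ω (W.toL2 (u t))) (b t),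
    forceL2_ae_eq hd hf hε hJ hω hD (W.toL2 (u t))] with x h1 h2 h3
  rw [h1, h2, Pi.add_apply, h3]

variable {m : Mesh d} {σ κ h : ℝ}

theorem Mesh.Fits.force_toL2_ae_eq (hm : m.Fits D σ κ h) (hD : IsOpen D)
    (hL : HasLipschitzBoundary D) (w : m.FE) :
    force ε f J ω (extend (m.toL2 D w)) =ᵐ[volume] force ε f J ω (w : E d → E d) := by
  have := Mesh.extend_toL2_ae_eq hm hD hL w
  filter_upwards [this] with x hx
  exact force_congr_ae this hx

theorem Mesh.Fits.integral_inner_force (hm : m.Fits D σ κ h) (hd : 2 ≤ d) (hf : IsPotential f)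
    (hε : 0 < ε) (hJ : IsInfluence J M) (hω : IsBoundaryFunction D ε ω) (hD : IsOpen D)
    (hL : HasLipschitzBoundary D) (g w : m.FE) :
    ∫ x in D, inner ℝ (force ε f J ω (g : E d → E d) x) ((w : E d → E d) x) =
      inner ℝ (forceL2 ε f J ω (m.toL2 D g)) (m.toL2 D w) := by
  rw [L2.inner_def]
  refine integral_congr_ae ?_
  filter_upwards [forceL2_ae_eq hd hf hε hJ hω hD (m.toL2 D g), Mesh.toL2_ae_eq w,
    ae_restrict_of_ae (hm.force_toL2_ae_eq hD hL g (ε := ε) (f := f) (J := J) (ω := ω))]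
    with x h1 h2 h3
  rw [h1, h2, h3]

theorem Mesh.proj_toL2 (m : Mesh d) (D : Set (E d)) (w : m.FE) :
    m.proj D (m.toL2 D w) = m.toL2 D w :=
  Submodule.starProjection_eq_self_iff.2 ⟨w, rfl⟩

theorem Mesh.norm_proj_le (m : Mesh d) (D : Set (E d)) (g : L2 D) : ‖m.proj D g‖ ≤ ‖g‖ :=
  Submodule.norm_starProjection_apply_le _ g

theorem Mesh.toL2_eq_proj {w : m.FE} {g : L2 D}
    (h : ∀ z : m.FE, inner ℝ (m.toL2 D w) (m.toL2 D z) = inner ℝ g (m.toL2 D z)) :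
    m.toL2 D w = m.proj D g := by
  refine (Submodule.eq_starProjection_of_mem_of_inner_eq_zero
    (LinearMap.mem_range_self (m.toL2 D) w) ?_).symm
  rintro _ ⟨z, rfl⟩
  rw [inner_sub_left, h z, sub_self]

end ForceL2

/-! ### One time step, in abstract form. -/

section Steps

variable {X : Type*} [NormedAddCommGroup X] [NormedSpace ℝ X] {Q : X →L[ℝ] X} {Δt : ℝ}

/-- The new error is the old error, plus `Δt` times the new velocity error, plus `Δt` times the
image under `Q` of the truncation error; the last does not grow because `Q` is a contraction. -/
theorem norm_displacement_step_le (hQ : ∀ x, ‖Q x‖ ≤ ‖x‖) (hΔt : 0 < Δt) {U U' V' u u' v' : X}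
    (h : U' = U + Δt • V') :
    ‖U' - Q u'‖ ≤ ‖U - Q u‖ + Δt * ‖V' - Q v'‖ + Δt * ‖v' - Δt⁻¹ • (u' - u)‖ := by
  have e : U' - Q u' = (U - Q u) + Δt • (V' - Q v') + Δt • Q (v' - Δt⁻¹ • (u' - u)) := by
    rw [h, map_sub, map_smul, map_sub, smul_sub Δt (Q v'), smul_inv_smul₀ hΔt.ne']
    module
  rw [e]
  refine (norm_add₃_le).trans ?_
  rw [norm_smul, norm_smul, Real.norm_of_nonneg hΔt.le]
  gcongr
  exact hQ _

/-- The parameter `θ` is the fraction of the force used in the step. The missing fraction `1 - θ` of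
the exact acceleration appears as an additional defect. -/
theorem norm_velocity_step_le (hQ : ∀ x, ‖Q x‖ ≤ ‖x‖) (hΔt : 0 < Δt) {V V' F F' b v v' : X}
    {θ : ℝ} (hθ0 : 0 ≤ θ) (hθ1 : θ ≤ 1) (h : V' = V + (Δt * θ) • Q (F' + b)) :
    ‖V' - Q v'‖ ≤ ‖V - Q v‖ + Δt * ‖F' - F‖ + Δt * ‖(F + b) - Δt⁻¹ • (v' - v)‖ +
      Δt * (1 - θ) * ‖F + b‖ := by
  have e : V' - Q v' = (V - Q v) + (Δt * θ) • Q (F' - F) +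
      Δt • Q ((F + b) - Δt⁻¹ • (v' - v)) + (-(Δt * (1 - θ))) • Q (F + b) := by
    rw [h, map_sub Q (F + b), map_smul, map_sub Q v', smul_sub Δt (Q (F + b)),
      smul_inv_smul₀ hΔt.ne', map_sub, map_add, map_add]
    module
  rw [e]
  have h1 : 0 ≤ 1 - θ := by linarith
  refine (norm_add_le _ _).trans (add_le_add ((norm_add₃_le).trans ?_) ?_)
  · rw [norm_smul, norm_smul, Real.norm_of_nonneg hΔt.le, Real.norm_of_nonneg (by positivity)]
    gcongr
    · exact mul_le_of_le_one_right hΔt.le hθ1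
    · exact hQ _
    · exact hQ _
  · rw [norm_smul, norm_neg, Real.norm_of_nonneg (by positivity)]
    gcongr
    exact hQ _

end Steps

/-! ### Error recursion for the weak schemes. -/

section WeakSchemes

variable {d : ℕ} {ε M : ℝ} {f J : ℝ → ℝ} {ω : E d → ℝ} {D : Set (E d)} {m : Mesh d}
  {σ κ h T Δt : ℝ} {b : ℝ → L2 D} {u v : ℝ → W D} {U V : ℕ → m.FE}

theorem IsWeakSystemScheme.displacement_eq (hΔt : 0 < Δt)
    (hs : IsWeakSystemScheme D ε f J ω T Δt m b U V) {k : ℕ} (hk : (k + 1) * Δt ≤ T) :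
    m.toL2 D (U (k + 1)) = m.toL2 D (U k) + Δt • m.toL2 D (V (k + 1)) := by
  have := Mesh.toL2_eq_proj (hs.displacement k hk)
  rw [Mesh.proj_toL2, map_smul, map_sub] at this
  rw [← this, smul_inv_smul₀ hΔt.ne']
  abel

theorem IsWeakSystemScheme.velocity_eq (hd : 2 ≤ d) (hf : IsPotential f) (hε : 0 < ε)
    (hJ : IsInfluence J M) (hω : IsBoundaryFunction D ε ω) (hD : IsOpen D)
    (hL : HasLipschitzBoundary D) (hm : m.Fits D σ κ h) (hΔt : 0 < Δt)
    (hs : IsWeakSystemScheme D ε f J ω T Δt m b U V) {k : ℕ} (hk : (k + 1) * Δt ≤ T) :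
    m.toL2 D (V (k + 1)) = m.toL2 D (V k) +
      Δt • m.proj D (forceL2 ε f J ω (m.toL2 D (U k)) + b (k * Δt)) := by
  have : m.toL2 D (Δt⁻¹ • (V (k + 1) - V k)) = m.proj D (forceL2 ε f J ω (m.toL2 D (U k)) +
      m.proj D (b (k * Δt))) := by
    refine Mesh.toL2_eq_proj fun z => ?_
    rw [hs.velocity k hk z, inner_add_left, hm.integral_inner_force hd hf hε hJ hω hD hL]
  have hpp : m.proj D (m.proj D (b (k * Δt))) = m.proj D (b (k * Δt)) :=
    Submodule.starProjection_eq_self_iff.2 (Submodule.starProjection_apply_mem _ _)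
  rw [map_add, hpp, ← map_add, map_smul, map_sub] at this
  rw [← this, smul_inv_smul₀ hΔt.ne']
  abel

theorem IsWeakCentralScheme.displacement_eq (hΔt : 0 < Δt)
    (hs : IsWeakCentralScheme D ε f J ω T Δt m b U V) {k : ℕ} (hk : (k + 1) * Δt ≤ T) :
    m.toL2 D (U (k + 1)) = m.toL2 D (U k) + Δt • m.toL2 D (V (k + 1)) := by
  rw [hs.velocity k hk, map_smul, map_sub, smul_inv_smul₀ hΔt.ne']
  abel

/-- With velocities defined as difference quotients, the central difference scheme becomes a
first-order system from `k = 1` on. -/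
theorem second_difference_eq {X : Type*} [AddCommGroup X] [Module ℝ X] {U V : ℕ → X}
    (hv : ∀ k : ℕ, (k + 1) * Δt ≤ T → V (k + 1) = Δt⁻¹ • (U (k + 1) - U k)) (hΔt : 0 < Δt) {k : ℕ}
    (hk1 : 1 ≤ k) (hk : (k + 1) * Δt ≤ T) :
    (Δt ^ 2)⁻¹ • (U (k + 1) - (2 : ℝ) • U k + U (k - 1)) = Δt⁻¹ • (V (k + 1) - V k) := by
  obtain ⟨j, rfl⟩ := Nat.exists_eq_add_of_le' hk1
  rw [hv _ hk, hv j (by push_cast at hk; linarith), Nat.add_sub_cancel, ← smul_sub, smul_smul,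
    ← mul_inv, ← sq]
  congr 1
  module

/-- For `k = 0` the special first equation, multiplied by `Δt`, is a velocity step with half the
force. Otherwise the step is that of the first-order system. -/
theorem IsWeakCentralScheme.velocity_eq (hd : 2 ≤ d) (hf : IsPotential f) (hε : 0 < ε)
    (hJ : IsInfluence J M) (hω : IsBoundaryFunction D ε ω) (hD : IsOpen D)
    (hL : HasLipschitzBoundary D) (hm : m.Fits D σ κ h) (hΔt : 0 < Δt)
    (hs : IsWeakCentralScheme D ε f J ω T Δt m b U V) {k : ℕ} (hk : (k + 1) * Δt ≤ T) :
    m.toL2 D (V (k + 1)) = m.toL2 D (V k) + (Δt * if k = 0 then 1 / 2 else 1) •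
      m.proj D (forceL2 ε f J ω (m.toL2 D (U k)) + b (k * Δt)) := by
  have hpp : ∀ g, m.proj D (m.proj D g) = m.proj D g := fun g =>
    Submodule.starProjection_eq_self_iff.2 (Submodule.starProjection_apply_mem _ _)
  rcases Nat.eq_zero_or_pos k with rfl | hk1
  · have hT : Δt ≤ T := by simpa using hk
    have e : Δt⁻¹ • V (0 + 1) = (Δt ^ 2)⁻¹ • (U 1 - U 0) := by
      rw [hs.velocity 0 hk, smul_smul, ← mul_inv, ← sq]
    have : m.toL2 D (Δt⁻¹ • V (0 + 1)) = m.proj D ((1 / 2 : ℝ) • forceL2 ε f J ω (m.toL2 D (U 0)) +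
        (1 / Δt) • m.toL2 D (V 0) + (1 / 2 : ℝ) • m.proj D (b 0)) := by
      refine Mesh.toL2_eq_proj fun z => ?_
      rw [e, hs.first hT z, inner_add_left, inner_add_left, inner_smul_left, inner_smul_left,
        inner_smul_left, hm.integral_inner_force hd hf hε hJ hω hD hL]
      simp
    simp only [map_add, map_smul, hpp, Mesh.proj_toL2] at this
    have h2 := congrArg (Δt • ·) this
    simp only [smul_inv_smul₀ hΔt.ne'] at h2
    rw [h2, smul_add, smul_add, smul_smul Δt (1 / Δt), mul_one_div_cancel hΔt.ne', one_smul]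
    simp only [Nat.cast_zero, zero_mul, if_true, map_add]
    module
  · have : m.toL2 D (Δt⁻¹ • (V (k + 1) - V k)) = m.proj D (forceL2 ε f J ω (m.toL2 D (U k)) +
        m.proj D (b (k * Δt))) := by
      refine Mesh.toL2_eq_proj fun z => ?_
      rw [← second_difference_eq hs.velocity hΔt hk1 hk, hs.step k hk1 hk z, inner_add_left,
        hm.integral_inner_force hd hf hε hJ hω hD hL]
    rw [map_add, hpp, ← map_add, map_smul, map_sub] at this
    rw [← this, if_neg (by omega), mul_one, smul_inv_smul₀ hΔt.ne']
    abel

/-- The error of a time stepping scheme whose first step uses the fraction `θ` of the force. -/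
theorem norm_add_norm_le_of_velocity_eq (hd : 2 ≤ d) (hf : IsPotential f) (hε : 0 < ε)
    (hJ : IsInfluence J M) (hω : IsBoundaryFunction D ε ω) (hD : IsOpen D)
    (hT : 0 < T) (hex : IsExactSolution D ε f J ω T b u v) (hΔt : 0 < Δt) (hΔ1 : Δt < 1)
    {θ s : ℝ} (hθ0 : 0 ≤ θ) (hθ1 : θ ≤ 1)
    (hU : ∀ k : ℕ, (k + 1) * Δt ≤ T →
      m.toL2 D (U (k + 1)) = m.toL2 D (U k) + Δt • m.toL2 D (V (k + 1)))
    (hV : ∀ k : ℕ, (k + 1) * Δt ≤ T →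
      m.toL2 D (V (k + 1)) = m.toL2 D (V k) + (Δt * if k = 0 then θ else 1) •
        m.proj D (forceL2 ε f J ω (m.toL2 D (U k)) + b (k * Δt)))
    (hs : ∀ t ∈ Icc 0 T, ‖W.toL2 (u t) - m.proj D (W.toL2 (u t))‖ ≤ s)
    {k : ℕ} (hk : k * Δt ≤ T) :
    ‖m.toL2 D (U k) - m.proj D (W.toL2 (u (k * Δt)))‖ +
      ‖m.toL2 D (V k) - m.proj D (W.toL2 (v (k * Δt)))‖ ≤
      Real.exp (T * (1 + L1 d f J / ε ^ 2) * (1 / (1 - Δt))) * (initErr m u v U V +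
        (T * (Ct T u v / 2 * Δt + L1 d f J / ε ^ 2 * s) +
          Δt * (1 - θ) * supL2 T (secondDeriv T u)) / (1 - Δt)) := by
  have hL := L1_nonneg (d := d) (f := f) hJ
  have hu2 : ∀ t ∈ Icc 0 T, ‖W.toL2L D (secondDeriv T u t)‖ ≤ supL2 T (secondDeriv T u) :=
    fun t ht => norm_le_supL2 (continuousOn_secondDeriv hT hex.smooth_u) ht
  have hv2 : ∀ t ∈ Icc 0 T, ‖W.toL2L D (secondDeriv T v t)‖ ≤ supL2 T (secondDeriv T v) :=
    fun t ht => norm_le_supL2 (continuousOn_secondDeriv hT hex.smooth_v) ht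
  have hSu := supL2_nonneg T (secondDeriv T u)
  have hSv := supL2_nonneg T (secondDeriv T v)
  have hs0 : 0 ≤ s := (norm_nonneg _).trans (hs 0 ⟨le_rfl, hT.le⟩)
  have hmem : ∀ k : ℕ, (k + 1) * Δt ≤ T → (k * Δt ∈ Icc 0 T ∧ (k + 1) * Δt ∈ Icc 0 T) :=
    fun k hk => ⟨⟨by positivity, by nlinarith⟩, ⟨by positivity, hk⟩⟩
  have key := add_le_exp_mul_of_step (T := T) (L := L1 d f J / ε ^ 2)
    (a := supL2 T (secondDeriv T u) / 2 * Δt)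
    (b := L1 d f J / ε ^ 2 * s + supL2 T (secondDeriv T v) / 2 * Δt)
    (Γ := Δt * (1 - θ) * supL2 T (secondDeriv T u))
    (x := fun k => ‖m.toL2 D (U k) - m.proj D (W.toL2 (u (k * Δt)))‖)
    (y := fun k => ‖m.toL2 D (V k) - m.proj D (W.toL2 (v (k * Δt)))‖) hΔt hΔ1
    (by positivity) (by positivity) (by positivity)
    (mul_nonneg (mul_nonneg hΔt.le (by linarith)) hSu) (fun _ => norm_nonneg _)
    (fun _ => norm_nonneg _) (fun k hk => ?_) (fun k hk => ?_) hk
  · refine key.trans (le_of_eq ?_)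
    simp only [initErr, Ct, Nat.cast_zero, zero_mul]
    congr 4
    ring
  · push_cast
    refine (norm_displacement_step_le (m.norm_proj_le D) hΔt (hU k hk)
      (u := W.toL2 (u (k * Δt))) (v' := W.toL2 (v ((k + 1) * Δt)))).trans ?_
    gcongr
    have := norm_truncation_right_le hT hex.smooth_u (W.toL2L D) hu2 (hmem k hk).1.1
      (by nlinarith : (k : ℝ) * Δt < (k + 1) * Δt) hk
    rwa [hex.derivWithin_u hT (hmem k hk).2, show ((k : ℝ) + 1) * Δt - k * Δt = Δt by ring] at this
  · push_cast
    have hθ' : 0 ≤ (if k = 0 then θ else 1) ∧ (if k = 0 then θ else 1) ≤ 1 := by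
      split_ifs
      · exact ⟨hθ0, hθ1⟩
      · simp
    refine (norm_velocity_step_le (m.norm_proj_le D) hΔt hθ'.1 hθ'.2 (hV k hk)
      (v := W.toL2 (v (k * Δt))) (F := forceL2 ε f J ω (W.toL2 (u (k * Δt))))).trans ?_
    rw [← hex.motion_L2 hd hf hε hJ hω hD (hmem k hk).1]
    -- The exact force is taken at `u`, but the recursion measures the displacement against its
    -- projection; this is how the projection error `s` enters.
    have h1 : ‖forceL2 ε f J ω (m.toL2 D (U k)) - forceL2 ε f J ω (W.toL2 (u (k * Δt)))‖ ≤
        L1 d f J / ε ^ 2 * (‖m.toL2 D (U k) - m.proj D (W.toL2 (u (k * Δt)))‖ + s) := by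
      refine (norm_forceL2_sub_le hd hf hε hJ hω hD _ _).trans ?_
      gcongr
      have e : m.toL2 D (U k) - W.toL2 (u (k * Δt)) =
        (m.toL2 D (U k) - m.proj D (W.toL2 (u (k * Δt)))) -
          (W.toL2 (u (k * Δt)) - m.proj D (W.toL2 (u (k * Δt)))) := by abel
      rw [e]
      exact (norm_sub_le _ _).trans (by gcongr; exact hs _ (hmem k hk).1)
    have h2 := norm_truncation_left_le hT hex.smooth_v (W.toL2L D) hv2 (hmem k hk).1.1
      (by nlinarith : (k : ℝ) * Δt < (k + 1) * Δt) hk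
    rw [show ((k : ℝ) + 1) * Δt - k * Δt = Δt by ring] at h2
    -- Force plus load is `∂ₜv = ∂ₜₜu`, so the fraction missing at `k = 0` costs `Δt (1 - θ) sup
    -- ‖∂ₜₜu‖`, once.
    have h3 : Δt * (1 - if k = 0 then θ else 1) * ‖W.toL2 (derivWithin v (Icc 0 T) (k * Δt))‖ ≤
        if k = 0 then Δt * (1 - θ) * supL2 T (secondDeriv T u) else 0 := by
      split_ifs with hk0
      · have := hu2 _ (hmem k hk).1
        rw [hex.secondDeriv_u hT (hmem k hk).1] at this
        have h1θ : 0 ≤ 1 - θ := by linarith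
        gcongr
        exact this
      · simp
    have h4 := mul_le_mul_of_nonneg_left h1 hΔt.le
    have h5 := mul_le_mul_of_nonneg_left h2 hΔt.le
    simp only [map_sub, map_smul, W.toL2L_apply] at h5
    linarith

theorem spaceTruncation_bound (hd : 2 ≤ d) (hf : IsPotential f) (hε : 0 < ε)
    (hJ : IsInfluence J M) (hω : IsBoundaryFunction D ε ω) (hD : IsOpen D) (u : ℝ → W D) (k : ℕ) :
    MemLp (spaceTruncation m ε f J ω Δt u k) 2 (volume.restrict D) ∧
      (eLpNorm (spaceTruncation m ε f J ω Δt u k) 2 (volume.restrict D)).toReal ≤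
        L1 d f J / ε ^ 2 * ‖W.toL2 (u (k * Δt)) - m.proj D (W.toL2 (u (k * Δt)))‖ := by
  have hL := L1_nonneg (d := d) (f := f) hJ
  have h := eLpNorm_force_extend_sub_le hd hf hε hJ hω hD (m.proj D (W.toL2 (u (k * Δt))))
    (W.toL2 (u (k * Δt)))
  refine ⟨⟨?_, h.trans_lt ENNReal.ofReal_lt_top⟩, ?_⟩
  · exact ((stronglyMeasurable_force hf hε hJ hω (measurable_extend hD _)).sub
      (stronglyMeasurable_force hf hε hJ hω (measurable_extend hD _))).aestronglyMeasurable
  · rw [norm_sub_rev]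
    exact ENNReal.toReal_le_of_le_ofReal (by positivity) h

theorem truncation_le (hd : 2 ≤ d) (hf : IsPotential f) (hε : 0 < ε)
    (hJ : IsInfluence J M) (hω : IsBoundaryFunction D ε ω) (hD : IsOpen D)
    (hT : 0 < T) (hex : IsExactSolution D ε f J ω T b u v) (hΔt : 0 < Δt) {k : ℕ}
    (hk : (k + 1) * Δt ≤ T) :
    truncation m ε f J ω T Δt u v k ≤ Ct T u v * Δt +
      L1 d f J / ε ^ 2 * ‖W.toL2 (u (k * Δt)) - m.proj D (W.toL2 (u (k * Δt)))‖ := by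
  have hSu := supL2_nonneg T (secondDeriv T u)
  have hSv := supL2_nonneg T (secondDeriv T v)
  have h1 := norm_truncation_right_le hT hex.smooth_u (W.toL2L D)
    (fun t ht => norm_le_supL2 (continuousOn_secondDeriv hT hex.smooth_u) ht)
    (by positivity : 0 ≤ (k : ℝ) * Δt) (by nlinarith : (k : ℝ) * Δt < (k + 1) * Δt) hk
  have h2 := norm_truncation_left_le hT hex.smooth_v (W.toL2L D)
    (fun t ht => norm_le_supL2 (continuousOn_secondDeriv hT hex.smooth_v) ht)
    (by positivity : 0 ≤ (k : ℝ) * Δt) (by nlinarith : (k : ℝ) * Δt < (k + 1) * Δt) hk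
  rw [show ((k : ℝ) + 1) * Δt - k * Δt = Δt by ring] at h1 h2
  have h3 := (spaceTruncation_bound (m := m) (Δt := Δt) hd hf hε hJ hω hD u k).2
  rw [truncation, Ct]
  have := mul_nonneg hSu hΔt.le
  have := mul_nonneg hSv hΔt.le
  simp only [W.toL2L_apply] at h1 h2
  linarith

theorem err_le (m : Mesh d) (u v : ℝ → W D) (U V : ℕ → m.FE) (k : ℕ) {su sv : ℝ}
    (hu : ‖W.toL2 (u (k * Δt)) - m.proj D (W.toL2 (u (k * Δt)))‖ ≤ su)
    (hv : ‖W.toL2 (v (k * Δt)) - m.proj D (W.toL2 (v (k * Δt)))‖ ≤ sv) :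
    err m Δt u v U V k ≤ su + sv + (‖m.toL2 D (U k) - m.proj D (W.toL2 (u (k * Δt)))‖ +
      ‖m.toL2 D (V k) - m.proj D (W.toL2 (v (k * Δt)))‖) := by
  have h1 := norm_sub_le (m.toL2 D (U k) - m.proj D (W.toL2 (u (k * Δt))))
    (W.toL2 (u (k * Δt)) - m.proj D (W.toL2 (u (k * Δt))))
  have h2 := norm_sub_le (m.toL2 D (V k) - m.proj D (W.toL2 (v (k * Δt))))
    (W.toL2 (v (k * Δt)) - m.proj D (W.toL2 (v (k * Δt))))
  rw [sub_sub_sub_cancel_right] at h1 h2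
  rw [err]
  linarith

end WeakSchemes

end Peridynamics

namespace Peridynamics

/-! ### Stars of vertices in shape regular meshes. -/

namespace Mesh

variable {d : ℕ} {m : Mesh d} {D : Set (E d)} {σ κ h : ℝ}

open scoped Classical in
/-- The elements of the mesh that have `p` as a vertex. -/
noncomputable def star (m : Mesh d) (p : E d) : Finset (Finset (E d)) :=
  m.elems.filter (p ∈ ·)

theorem mem_star {p : E d} {s : Finset (E d)} : s ∈ m.star p ↔ s ∈ m.elems ∧ p ∈ s := by
  simp [star]

theorem exists_ne_vertex (hd0 : 0 < d) {s : Finset (E d)} (hs : s ∈ m.elems) (p : E d) :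
    ∃ q ∈ s, q ≠ p := by
  have : 1 < s.card := by rw [m.card_eq s hs]; omega
  exact Finset.exists_mem_ne this p

theorem diam_hull_pos (hd0 : 0 < d) {s : Finset (E d)} (hs : s ∈ m.elems) :
    0 < Metric.diam (hull s) := by
  obtain ⟨p, hp⟩ : s.Nonempty := Finset.card_pos.1 (by rw [m.card_eq s hs]; omega)
  obtain ⟨q, hq, hqp⟩ := exists_ne_vertex hd0 hs p
  exact (norm_pos_iff.2 (sub_ne_zero.2 hqp)).trans_le
    (norm_sub_le_diam (vertex_mem_hull hq) (vertex_mem_hull hp))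

/-- The edges at a vertex are as long as the inner diameter of the elements. -/
theorem Fits.two_mul_le_norm_sub (hm : m.Fits D σ κ h) (hσ : 0 < σ) (hd0 : 0 < d)
    {s : Finset (E d)} (hs : s ∈ m.elems) {p q : E d} (hp : p ∈ s) (hq : q ∈ s) (hqp : q ≠ p) :
    2 * (Metric.diam (hull s) / σ) ≤ ‖p - q‖ := by
  obtain ⟨z, hz⟩ := hm.shape s hs
  have h1 := abs_bary_linear_le (isSimplex hs) (div_pos (diam_hull_pos hd0 hs) hσ) hz hp (p - q)
  have h2 : (bary s p).linear (p - q) = 1 := by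
    rw [← vsub_eq_sub, AffineMap.linearMap_vsub, bary_self (isSimplex hs) hp,
      bary_ne (isSimplex hs) hp hq hqp.symm]
    simp
  rwa [h2, abs_one, mul_one] at h1

/-- The length of the common edge is at least `2/σ` times the diameter of one element and at most
the diameter of the other. -/
theorem Fits.diam_le_of_common_edge (hm : m.Fits D σ κ h) (hσ : 0 < σ) (hd0 : 0 < d)
    {s t : Finset (E d)} (hs : s ∈ m.elems) {p q : E d} (hps : p ∈ s) (hqs : q ∈ s)
    (hpt : p ∈ t) (hqt : q ∈ t) (hqp : q ≠ p) :
    Metric.diam (hull s) ≤ σ / 2 * Metric.diam (hull t) := by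
  have h1 := (hm.two_mul_le_norm_sub hσ hd0 hs hps hqs hqp).trans
    (norm_sub_le_diam (vertex_mem_hull hpt) (vertex_mem_hull hqt))
  have : 2 * (Metric.diam (hull s) / σ) = Metric.diam (hull s) / (σ / 2) := by field_simp
  rw [this, div_le_iff₀ (by positivity)] at h1
  linarith

/-- The star of an interior vertex is connected through its edges. -/
theorem exists_common_edge (hd : 2 ≤ d) {p : E d} (hp : p ∈ interior m.region)
    {A : Finset (Finset (E d))} (hA : A ⊆ m.star p) (hAn : A.Nonempty) (hAs : A ≠ m.star p) :
    ∃ s ∈ A, ∃ t ∈ m.star p, t ∉ A ∧ ∃ q, q ≠ p ∧ q ∈ s ∧ q ∈ t := by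
  by_contra! hcon
  obtain ⟨t₀, ht₀, ht₀A⟩ : ∃ t ∈ m.star p, t ∉ A := by
    by_contra! h
    exact hAs (hA.antisymm h)
  obtain ⟨s₀, hs₀⟩ := hAn
  have hs₀' := mem_star.1 (hA hs₀)
  have hpv := mem_vertices hs₀'.1 hs₀'.2
  -- For `d ≥ 2` the space without `p` is connected. It is covered by the closed cones of `A` and
  -- those of the remaining star, so a cone of each kind share a point other than `p`. Scaled
  -- towards `p`, it lies in both elements, whose common vertices therefore cannot be `p` alone.
  have hpre : IsPreconnected ({p}ᶜ : Set (E d)) :=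
    (isConnected_compl_singleton_of_one_lt_rank (by
      rw [← Module.finrank_eq_rank, finrank_euclideanSpace, Fintype.card_fin]
      exact_mod_cast (by omega : 1 < d)) p).isPreconnected
  classical
  obtain ⟨y, hyp, hy1, hy2⟩ := isPreconnected_closed_iff.1 hpre
    (⋃ s ∈ A, starCone s p) (⋃ t ∈ m.star p \ A, starCone t p)
    (A.finite_toSet.isClosed_biUnion fun s _ => isClosed_starCone s p)
    ((m.star p \ A).finite_toSet.isClosed_biUnion fun s _ => isClosed_starCone s p)
    (fun y _ => by
      obtain ⟨t, ht, hpt, hy⟩ := exists_mem_starCone hpv hp y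
      by_cases htA : t ∈ A
      · exact .inl (mem_iUnion₂.2 ⟨t, htA, hy⟩)
      · exact .inr (mem_iUnion₂.2 ⟨t, Finset.mem_sdiff.2 ⟨mem_star.2 ⟨ht, hpt⟩, htA⟩, hy⟩))
    (by
      obtain ⟨q, hq, hqp⟩ := exists_ne_vertex (by omega) hs₀'.1 p
      exact ⟨q, hqp, mem_iUnion₂.2 ⟨s₀, hs₀,
        hull_subset_starCone (isSimplex hs₀'.1) p (vertex_mem_hull hq)⟩⟩)
    (by
      have ht₀' := mem_star.1 ht₀
      obtain ⟨q, hq, hqp⟩ := exists_ne_vertex (by omega) ht₀'.1 p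
      exact ⟨q, hqp, mem_iUnion₂.2 ⟨t₀, Finset.mem_sdiff.2 ⟨ht₀, ht₀A⟩,
        hull_subset_starCone (isSimplex ht₀'.1) p (vertex_mem_hull hq)⟩⟩)
  obtain ⟨s, hsA, hys⟩ := mem_iUnion₂.1 hy1
  obtain ⟨t, ht, hyt⟩ := mem_iUnion₂.1 hy2
  obtain ⟨ht, htA⟩ := Finset.mem_sdiff.1 ht
  have hs' := mem_star.1 (hA hsA)
  have ht' := mem_star.1 ht
  have hpos : ∀ t ∈ m.elems, p ∈ t → ∀ᶠ θ in 𝓝[>] (0 : ℝ),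
      0 < bary t p (AffineMap.homothety p θ y) := fun t ht hpt => by
    have := ((continuous_bary t p).tendsto p).comp (tendsto_homothety p y)
    rw [bary_self (isSimplex ht) hpt] at this
    exact this.eventually_const_lt one_pos
  obtain ⟨θ, ⟨h1, h2⟩, hθ⟩ := (((hpos s hs'.1 hs'.2).and (hpos t ht'.1 ht'.2)).and
    self_mem_nhdsWithin).exists
  have hz1 : AffineMap.homothety p θ y ∈ hull s := mem_hull_of_mem_starCone (isSimplex hs'.1)
    ((homothety_mem_starCone_iff (isSimplex hs'.1) hs'.2 hθ).2 hys) h1.le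
  have hz2 : AffineMap.homothety p θ y ∈ hull t := mem_hull_of_mem_starCone (isSimplex ht'.1)
    ((homothety_mem_starCone_iff (isSimplex ht'.1) ht'.2 hθ).2 hyt) h2.le
  have hz : AffineMap.homothety p θ y ∈ convexHull ℝ ((s : Set (E d)) ∩ t) := by
    rw [← m.conforming s hs'.1 t ht'.1]; exact ⟨hz1, hz2⟩
  have hst : (s : Set (E d)) ∩ t ⊆ {p} := fun q hq => by
    by_contra hqp
    exact hcon s hsA t ht htA q hqp hq.1 hq.2
  have := convexHull_mono hst hz
  rw [convexHull_singleton, mem_singleton_iff, AffineMap.homothety_apply, vsub_eq_sub, vadd_eq_add,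
    add_eq_right, smul_eq_zero, sub_eq_zero] at this
  exact this.elim hθ.ne' hyp

/-- Starting from `s`, a set of elements is enlarged one by one across common edges. Each
enlargement costs at most a factor `max (σ/2) 1`, and after `N` of them the star is exhausted. -/
theorem Fits.diam_le_of_mem_star (hm : m.Fits D σ κ h) (hσ : 0 < σ) (hd : 2 ≤ d) {p : E d}
    (hp : p ∈ interior m.region) {N : ℕ} (hN : (m.star p).card ≤ N) {s t : Finset (E d)}
    (hs : s ∈ m.star p) (ht : t ∈ m.star p) :
    Metric.diam (hull t) ≤ max (σ / 2) 1 ^ N * Metric.diam (hull s) := by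
  classical
  have hq : 1 ≤ max (σ / 2) 1 := le_max_right _ _
  have hδ : 0 ≤ Metric.diam (hull s) := Metric.diam_nonneg
  have key : ∀ k : ℕ, ∃ A ⊆ m.star p, A.Nonempty ∧ (A = m.star p ∨ k < A.card) ∧
      ∀ t ∈ A, Metric.diam (hull t) ≤ max (σ / 2) 1 ^ k * Metric.diam (hull s) := by
    intro k
    induction k with
    | zero => exact ⟨{s}, by simpa using hs, by simp, by simp, by simp⟩
    | succ k ih =>
      obtain ⟨A, hA, hAn, hAk, hAd⟩ := ih
      have hmono : ∀ t ∈ A, Metric.diam (hull t) ≤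
          max (σ / 2) 1 ^ (k + 1) * Metric.diam (hull s) := fun t ht =>
        (hAd t ht).trans (mul_le_mul_of_nonneg_right (pow_le_pow_right₀ hq (by omega)) hδ)
      by_cases hAs : A = m.star p
      · exact ⟨A, hA, hAn, .inl hAs, hmono⟩
      · obtain ⟨s', hs', t', ht', ht'A, q, hqp, hqs, hqt⟩ := exists_common_edge hd hp hA hAn hAs
        refine ⟨insert t' A, Finset.insert_subset ht' hA, by simp, .inr ?_, fun r hr => ?_⟩
        · rw [Finset.card_insert_of_notMem ht'A]
          have := hAk.resolve_left hAs
          omega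
        · rcases Finset.mem_insert.1 hr with rfl | hr
          · have h1 := hm.diam_le_of_common_edge hσ (by omega) (mem_star.1 ht').1 (mem_star.1 ht').2
              hqt (mem_star.1 (hA hs')).2 hqs hqp
            have h0 : 0 ≤ Metric.diam (hull s') := Metric.diam_nonneg
            calc _ ≤ max (σ / 2) 1 * Metric.diam (hull s') :=
                  h1.trans (mul_le_mul_of_nonneg_right (le_max_left _ _) h0)
              _ ≤ max (σ / 2) 1 * (max (σ / 2) 1 ^ k * Metric.diam (hull s)) := by
                  gcongr
                  exact hAd s' hs'
              _ = _ := by ring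
          · exact hmono r hr
  obtain ⟨A, hA, -, hAk, hAd⟩ := key N
  have : A = m.star p := hAk.resolve_right fun h => by
    have := Finset.card_le_card hA
    omega
  exact hAd t (this ▸ ht)

theorem volume_closedBall_eq (x : E d) {r : ℝ} (hr : 0 ≤ r) :
    volume (Metric.closedBall x r) = ENNReal.ofReal (r ^ d) * volume (Metric.ball (0 : E d) 1) := by
  rw [Measure.addHaar_closedBall _ _ hr, finrank_euclideanSpace, Fintype.card_fin]

/-- The homothety about `p` with ratio `r / diam` maps the element into itself and into the ball of
radius `r`, and carries the inscribed ball along. -/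
theorem exists_closedBall_subset_hull_inter {s : Finset (E d)} {p z : E d} {ρ r : ℝ} (hp : p ∈ s)
    (hz : Metric.closedBall z ρ ⊆ hull s) (hr : 0 < r) (hrs : r ≤ Metric.diam (hull s)) :
    ∃ z', Metric.closedBall z' (r / Metric.diam (hull s) * ρ) ⊆ hull s ∩ Metric.closedBall p r := by
  set δ := Metric.diam (hull s)
  have hδ : 0 < δ := hr.trans_le hrs
  set θ := r / δ with hθ
  have hθ0 : 0 < θ := by positivity
  have hθ1 : θ ≤ 1 := (div_le_one hδ).2 hrs
  refine ⟨p + θ • (z - p), fun w hw => ?_⟩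
  have hx : p + θ⁻¹ • (w - p) ∈ hull s := by
    refine hz ?_
    rw [mem_closedBall_iff_norm] at hw ⊢
    have e : p + θ⁻¹ • (w - p) - z = θ⁻¹ • (w - (p + θ • (z - p))) := by
      rw [← sub_sub, smul_sub θ⁻¹ (w - p), inv_smul_smul₀ hθ0.ne']
      abel
    rw [e, norm_smul, norm_inv, Real.norm_of_nonneg hθ0.le, inv_mul_le_iff₀ hθ0]
    exact hw
  have hw' : w = p + θ • ((p + θ⁻¹ • (w - p)) - p) := by
    rw [add_sub_cancel_left, smul_inv_smul₀ hθ0.ne']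
    abel
  refine ⟨?_, ?_⟩
  · rw [hw']
    exact (convex_convexHull ℝ _).add_smul_sub_mem (vertex_mem_hull hp) hx ⟨hθ0.le, hθ1⟩
  · have h1 := norm_sub_le_diam hx (vertex_mem_hull hp)
    rw [mem_closedBall_iff_norm, hw', add_sub_cancel_left, norm_smul, Real.norm_of_nonneg hθ0.le]
    calc _ ≤ θ * δ := by gcongr
      _ = r := by rw [hθ]; field_simp

/-- Volume count: with `r` the smallest diameter in the star, each element contains a ball of radius
`r/σ` inside the ball of radius `r` about `p`, and the elements overlap in null sets. -/
theorem Fits.card_star_le (hm : m.Fits D σ κ h) (hσ : 0 < σ) (hd0 : 0 < d) (p : E d) :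
    ((m.star p).card : ℝ) ≤ σ ^ d := by
  rcases (m.star p).eq_empty_or_nonempty with he | hne
  · rw [he]; simpa using by positivity
  obtain ⟨s₀, hs₀, hmin⟩ := (m.star p).exists_min_image (fun s => Metric.diam (hull s)) hne
  set r := Metric.diam (hull s₀)
  have hr : 0 < r := diam_hull_pos hd0 (mem_star.1 hs₀).1
  have h1 : ∀ s ∈ m.star p, ENNReal.ofReal ((r / σ) ^ d) * volume (Metric.ball (0 : E d) 1) ≤
      volume (hull s ∩ Metric.closedBall p r) := by
    intro s hs
    obtain ⟨hs, hps⟩ := mem_star.1 hs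
    obtain ⟨z, hz⟩ := hm.shape s hs
    have hδ := diam_hull_pos hd0 hs
    obtain ⟨z', hz'⟩ := exists_closedBall_subset_hull_inter hps hz hr
      (hmin s (mem_star.2 ⟨hs, hps⟩))
    rw [show r / Metric.diam (hull s) * (Metric.diam (hull s) / σ) = r / σ by field_simp] at hz'
    rw [← volume_closedBall_eq z' (by positivity)]
    exact measure_mono hz'
  have h2 : ∑ s ∈ m.star p, volume (hull s ∩ Metric.closedBall p r) ≤
      volume (Metric.closedBall p r) := by
    rw [← measure_biUnion_finset₀]
    · exact measure_mono (iUnion₂_subset fun s _ => inter_subset_right)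
    · intro s hs t ht hst
      exact (aedisjoint_hull (mem_star.1 hs).1 (mem_star.1 ht).1 hst).mono inter_subset_left
        inter_subset_left
    · exact fun s _ => ((isClosed_hull s).inter Metric.isClosed_closedBall).measurableSet.nullMeasurableSet
  have h3 := (Finset.sum_le_sum h1).trans h2
  rw [Finset.sum_const, nsmul_eq_mul, volume_closedBall_eq p hr.le, ← mul_assoc] at h3
  have hb0 : volume (Metric.ball (0 : E d) 1) ≠ 0 := (Metric.measure_ball_pos _ _ one_pos).ne'
  rw [ENNReal.mul_le_mul_iff_left hb0 measure_ball_lt_top.ne, ← ENNReal.ofReal_natCast,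
    ← ENNReal.ofReal_mul (by positivity), ENNReal.ofReal_le_ofReal_iff (by positivity), div_pow,
    mul_div_assoc', div_le_iff₀ (by positivity), mul_comm] at h3
  exact le_of_mul_le_mul_left h3 (by positivity)

/-- The point lies in the cone of some element at `p`. Within this radius the coordinate of `p`
differs from `1` by less than `1/2`, so it is positive and the point is in the element. -/
theorem Fits.ball_subset_star (hm : m.Fits D σ κ h) (hσ : 0 < σ) (hd0 : 0 < d) {p : E d}
    (hpv : p ∈ m.vertices) (hp : p ∈ interior m.region) {r : ℝ}
    (hr : ∀ s ∈ m.star p, r ≤ Metric.diam (hull s) / σ) {y : E d} (hy : y ∈ Metric.ball p r) :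
    ∃ s ∈ m.star p, y ∈ hull s := by
  obtain ⟨s, hs, hps, hys⟩ := exists_mem_starCone hpv hp y
  refine ⟨s, mem_star.2 ⟨hs, hps⟩, mem_hull_of_mem_starCone (isSimplex hs) hys ?_⟩
  obtain ⟨z, hz⟩ := hm.shape s hs
  have hρ : 0 < Metric.diam (hull s) / σ := div_pos (diam_hull_pos hd0 hs) hσ
  have h1 := abs_bary_linear_le (isSimplex hs) hρ hz hps (y - p)
  have h2 : (bary s p).linear (y - p) = bary s p y - 1 := by
    rw [← vsub_eq_sub, AffineMap.linearMap_vsub, bary_self (isSimplex hs) hps]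
    rfl
  rw [mem_ball_iff_norm] at hy
  have h3 := hr s (mem_star.2 ⟨hs, hps⟩)
  rw [h2] at h1
  have h4 := neg_abs_le (bary s p y - 1)
  by_contra! hneg
  nlinarith

variable (d σ) in
/-- An interior vertex is the centre of a ball that lies in its star and has comparable volume. -/
theorem exists_star_ball (hσ : 0 < σ) (hd : 2 ≤ d) : ∃ Λ : NNReal, ∀ (m : Mesh d) (D : Set (E d))
    (κ h : ℝ), m.Fits D σ κ h → ∀ p ∈ m.vertices, p ∈ interior m.region → ∃ r > 0,
      (∀ y ∈ Metric.ball p r, ∃ s ∈ m.star p, y ∈ hull s) ∧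
      (∀ s ∈ m.star p, volume (Metric.ball p r) ≤ volume (hull s)) ∧
      ∑ s ∈ m.star p, volume (hull s) ≤ Λ * volume (Metric.ball p r) := by
  have hd0 : 0 < d := by omega
  set N := ⌈σ ^ d⌉₊ with hN
  set q := max (σ / 2) 1 ^ N with hq
  have hq0 : 0 ≤ q := by positivity
  -- The star has at most `N` elements, and each lies in the ball of radius `q σ r` about `p`, where
  -- `r` is the smallest diameter divided by `σ`.
  refine ⟨N * Real.toNNReal ((q * σ) ^ d), fun m D κ h hm p hpv hp => ?_⟩
  have hne : (m.star p).Nonempty := by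
    obtain ⟨s, hs, hps⟩ := mem_iUnion₂.1 hpv
    exact ⟨s, mem_star.2 ⟨hs, hps⟩⟩
  obtain ⟨s₀, hs₀, hmin⟩ := (m.star p).exists_min_image (fun s => Metric.diam (hull s)) hne
  have hδ : 0 < Metric.diam (hull s₀) := diam_hull_pos hd0 (mem_star.1 hs₀).1
  have hcard : (m.star p).card ≤ N := by
    have := (hm.card_star_le hσ hd0 p).trans (Nat.le_ceil _)
    exact_mod_cast this
  set r := Metric.diam (hull s₀) / σ with hr
  have hr0 : 0 < r := div_pos hδ hσ
  have hrs : ∀ s ∈ m.star p, r ≤ Metric.diam (hull s) / σ := fun s hs => by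
    have := hmin s hs
    rw [hr]
    gcongr
  refine ⟨r, hr0, fun y hy => hm.ball_subset_star hσ hd0 hpv hp hrs hy, fun s hs => ?_, ?_⟩
  · obtain ⟨z, hz⟩ := hm.shape s (mem_star.1 hs).1
    refine (measure_mono Metric.ball_subset_closedBall).trans (le_trans ?_ (measure_mono hz))
    rw [volume_closedBall_eq p hr0.le, volume_closedBall_eq z (hr0.le.trans (hrs s hs))]
    gcongr
    exact hrs s hs
  · have h1 : ∀ s ∈ m.star p, volume (hull s) ≤
        ENNReal.ofReal ((q * σ) ^ d) * volume (Metric.ball p r) := by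
      intro s hs
      have hsub : hull s ⊆ Metric.closedBall p (q * σ * r) := fun x hx => by
        rw [mem_closedBall_iff_norm]
        refine (norm_sub_le_diam hx (vertex_mem_hull (mem_star.1 hs).2)).trans
          ((hm.diam_le_of_mem_star hσ hd hp hcard hs₀ hs).trans (le_of_eq ?_))
        rw [hr, mul_assoc q, mul_div_cancel₀ _ hσ.ne']
      refine (measure_mono hsub).trans (le_of_eq ?_)
      rw [volume_closedBall_eq p (by positivity), Measure.addHaar_ball_of_pos _ _ hr0,
        finrank_euclideanSpace, Fintype.card_fin, mul_pow, ENNReal.ofReal_mul (by positivity),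
        mul_assoc]
    refine (Finset.sum_le_sum h1).trans ?_
    rw [Finset.sum_const, nsmul_eq_mul, ENNReal.coe_mul, ENNReal.coe_natCast, mul_assoc]
    gcongr
    exact le_rfl

end Mesh

end Peridynamics

namespace Peridynamics

theorem ENNReal_add_sq_le (a b : ℝ≥0∞) : (a + b) ^ 2 ≤ 2 * (a ^ 2 + b ^ 2) := by
  have := ENNReal.rpow_add_le_mul_rpow_add_rpow a b (p := 2) (by norm_num)
  norm_num at this
  exact_mod_cast this

/-! ### Inverse estimate for affine functions. -/

section Affine

variable {d : ℕ}

/-- For every `y` in `K`, the value at `x` is twice the value at the midpoint of `x` and `y` minus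
the value at `y`. Squaring and averaging over `y`, the substitution of the midpoint costs `2^d`. -/
theorem volume_mul_sq_enorm_affine_le (A : E d →ᵃ[ℝ] E d) {K : Set (E d)} (hK : Convex ℝ K)
    (hKm : MeasurableSet K) {x : E d} (hx : x ∈ K) :
    volume K * ‖A x‖ₑ ^ 2 ≤ ENNReal.ofReal (8 * 2 ^ d + 2) * ∫⁻ y in K, ‖A y‖ₑ ^ 2 := by
  have hA : Measurable fun y => ‖A y‖ₑ ^ 2 :=
    (AffineMap.continuous_of_finiteDimensional A).enorm.measurable.pow_const 2
  have hpt : ∀ y, ‖A x‖ₑ ^ 2 ≤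
      8 * ‖A (AffineMap.homothety x (1 / 2 : ℝ) y)‖ₑ ^ 2 + 2 * ‖A y‖ₑ ^ 2 := by
    intro y
    have e : A x = (2 : ℝ) • A (AffineMap.homothety x (1 / 2 : ℝ) y) - A y := by
      rw [AffineMap.homothety_eq_lineMap, AffineMap.apply_lineMap, AffineMap.lineMap_apply,
        vsub_eq_sub, vadd_eq_add]
      module
    calc ‖A x‖ₑ ^ 2 ≤ (‖(2 : ℝ) • A (AffineMap.homothety x (1 / 2 : ℝ) y)‖ₑ + ‖A y‖ₑ) ^ 2 := by
          gcongr
          conv_lhs => rw [e]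
          exact enorm_sub_le
      _ ≤ 2 * (‖(2 : ℝ) • A (AffineMap.homothety x (1 / 2 : ℝ) y)‖ₑ ^ 2 + ‖A y‖ₑ ^ 2) :=
          ENNReal_add_sq_le _ _
      _ = _ := by
          rw [enorm_smul, mul_pow, mul_add, ← mul_assoc]
          congr 2
          rw [Real.enorm_eq_ofReal (by norm_num)]
          norm_num
  have hm1 : Measurable fun y => ‖A (AffineMap.homothety x (1 / 2 : ℝ) y)‖ₑ ^ 2 :=
    hA.comp (AffineMap.continuous_of_finiteDimensional _).measurable
  calc volume K * ‖A x‖ₑ ^ 2 = ∫⁻ _ in K, ‖A x‖ₑ ^ 2 := by rw [setLIntegral_const, mul_comm]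
    _ ≤ ∫⁻ y in K, (8 * ‖A (AffineMap.homothety x (1 / 2 : ℝ) y)‖ₑ ^ 2 + 2 * ‖A y‖ₑ ^ 2) :=
        lintegral_mono fun y => hpt y
    _ = 8 * (∫⁻ y in K, ‖A (AffineMap.homothety x (1 / 2 : ℝ) y)‖ₑ ^ 2) +
          2 * ∫⁻ y in K, ‖A y‖ₑ ^ 2 := by
        rw [lintegral_add_left (by fun_prop), lintegral_const_mul _ hm1, lintegral_const_mul _ hA]
    _ ≤ 8 * (ENNReal.ofReal (2 ^ d) * ∫⁻ y in K, ‖A y‖ₑ ^ 2) + 2 * ∫⁻ y in K, ‖A y‖ₑ ^ 2 := by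
        gcongr
        have h1 := lintegral_comp_homothety (d := d) x (r := 1 / 2) (by norm_num)
          (f := K.indicator fun y => ‖A y‖ₑ ^ 2) (hA.indicator hKm)
        rw [lintegral_indicator hKm] at h1
        rw [show |((1 / 2 : ℝ) ^ d)⁻¹| = 2 ^ d by
          rw [abs_of_pos (by positivity)]; simp] at h1
        rw [← h1, ← lintegral_indicator hKm]
        refine lintegral_mono fun y => ?_
        by_cases hy : y ∈ K
        · have : AffineMap.homothety x (1 / 2 : ℝ) y ∈ K := by
            rw [AffineMap.homothety_eq_lineMap]
            exact hK.lineMap_mem hx hy ⟨by norm_num, by norm_num⟩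
          rw [indicator_of_mem hy, indicator_of_mem this]
        · simp [hy]
    _ = _ := by
        rw [← mul_assoc, ← add_mul, ENNReal.ofReal_add (by positivity) (by norm_num),
          ENNReal.ofReal_mul (by norm_num), ENNReal.ofReal_ofNat, ENNReal.ofReal_ofNat]

end Affine

/-! ### From local bounds at the vertices to `L²` bounds. -/

namespace Mesh

variable {d : ℕ} {m : Mesh d} {D : Set (E d)} {σ κ h : ℝ}

theorem sum_star_sum (m : Mesh d) (a : Finset (E d) → E d → ℝ≥0∞) [DecidableEq (E d)] :
    ∑ p ∈ m.elems.biUnion id, ∑ s ∈ m.star p, a s p = ∑ s ∈ m.elems, ∑ p ∈ s, a s p := by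
  refine Finset.sum_comm' fun p s => ?_
  rw [mem_star, Finset.mem_biUnion]
  constructor
  · rintro ⟨-, hs, hp⟩; exact ⟨hp, hs⟩
  · rintro ⟨hp, hs⟩; exact ⟨⟨s, hs, hp⟩, hs, hp⟩

theorem enorm_nodal_sq_le (a : E d → E d) {s : Finset (E d)} (hs : s ∈ m.elems) {x : E d}
    (hx : x ∈ hull s) : ‖m.nodal a x‖ₑ ^ 2 ≤ ∑ p ∈ s, ‖a p‖ₑ ^ 2 := by
  obtain ⟨q, hq, hmax⟩ := s.exists_max_image (fun p => ‖a p‖)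
    (Finset.card_pos.1 (by rw [m.card_eq s hs]; omega))
  have h1 : ‖m.nodal a x‖ ≤ ‖a q‖ := by
    rw [nodal_eq_sum a hs hx]
    refine (norm_sum_le _ _).trans ?_
    calc ∑ p ∈ s, ‖bary s p x • a p‖ ≤ ∑ p ∈ s, bary s p x * ‖a q‖ := by
          refine Finset.sum_le_sum fun p hp => ?_
          have h0 := (mem_convexHull_iff_bary (isSimplex hs)).1 hx p hp
          rw [norm_smul, Real.norm_of_nonneg h0]
          exact mul_le_mul_of_nonneg_left (hmax p hp) h0
      _ = ‖a q‖ := by rw [← Finset.sum_mul, sum_bary (isSimplex hs), one_mul]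
  calc ‖m.nodal a x‖ₑ ^ 2 ≤ ‖a q‖ₑ ^ 2 := by
        rw [← ofReal_norm, ← ofReal_norm]
        gcongr
    _ ≤ _ := Finset.single_le_sum (f := fun p => ‖a p‖ₑ ^ 2) (fun _ _ => zero_le) hq

/-- Bounds for the nodal values in terms of local quantities give a bound in `L²`. -/
theorem lintegral_nodal_sq_le (a : E d → E d) (q : Finset (E d) → ℝ≥0∞) (B : ℝ≥0∞)
    (hq : ∀ p ∈ m.vertices, (∑ s ∈ m.star p, volume (hull s)) * ‖a p‖ₑ ^ 2 ≤
      B * ∑ s ∈ m.star p, q s) :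
    ∫⁻ x, ‖m.nodal a x‖ₑ ^ 2 ≤ B * ((d + 1) * ∑ s ∈ m.elems, q s) := by
  classical
  have h0 : ∫⁻ x, ‖m.nodal a x‖ₑ ^ 2 = ∫⁻ x in m.region, ‖m.nodal a x‖ₑ ^ 2 := by
    refine (setLIntegral_eq_of_support_subset fun x hx => ?_).symm
    by_contra h
    exact hx (by simp [nodal_of_notMem a h])
  rw [h0, lintegral_region]
  calc ∑ s ∈ m.elems, ∫⁻ x in hull s, ‖m.nodal a x‖ₑ ^ 2
      ≤ ∑ s ∈ m.elems, ∑ p ∈ s, volume (hull s) * ‖a p‖ₑ ^ 2 := by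
        refine Finset.sum_le_sum fun s hs => ?_
        refine (setLIntegral_mono' (isClosed_hull s).measurableSet
          fun x hx => enorm_nodal_sq_le a hs hx).trans (le_of_eq ?_)
        rw [setLIntegral_const, mul_comm, Finset.mul_sum]
    _ = ∑ p ∈ m.elems.biUnion id, ∑ s ∈ m.star p, volume (hull s) * ‖a p‖ₑ ^ 2 :=
        (m.sum_star_sum fun s p => volume (hull s) * ‖a p‖ₑ ^ 2).symm
    _ ≤ ∑ p ∈ m.elems.biUnion id, B * ∑ s ∈ m.star p, q s := by
        refine Finset.sum_le_sum fun p hp => ?_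
        rw [← Finset.sum_mul]
        obtain ⟨s, hs, hps⟩ := Finset.mem_biUnion.1 hp
        exact hq p (mem_vertices hs hps)
    _ = B * ∑ s ∈ m.elems, ∑ p ∈ s, q s := by
        rw [← Finset.mul_sum, m.sum_star_sum fun s _ => q s]
    _ = _ := by
        congr 1
        rw [Finset.mul_sum]
        refine Finset.sum_congr rfl fun s hs => ?_
        rw [Finset.sum_const, m.card_eq s hs, nsmul_eq_mul]
        push_cast
        rfl

/-- A local bound for the difference of a finite element field and a field in `W`. -/
noncomputable def localError (hD : IsOpen D) (hm : m.Fits D σ κ h) (U : m.FE) (w : W D)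
    (s : Finset (E d)) : ℝ≥0∞ :=
  2 * (ENNReal.ofReal (8 * 2 ^ d + 2) *
      ∫⁻ y in hull s, ‖((U - hm.interp hD w : m.FE) : E d → E d) y‖ₑ ^ 2) +
    2 * (ENNReal.ofReal (4 * h ^ 2) ^ 2 * ∫⁻ y in hull s, hessN (w : Jet D) y ^ 2)

/-- The difference is split at the interpolant of `w`: the discrete part is affine on the element
and obeys the inverse estimate, the other part is the interpolation error. -/
theorem Fits.volume_mul_sq_enorm_sub_rep_le (hd : d ≤ 3) (hD : IsOpen D)
    (hL : HasLipschitzBoundary D) (hm : m.Fits D σ κ h) (U : m.FE) (w : W D) {s : Finset (E d)}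
    (hs : s ∈ m.elems) {x : E d} (hx : x ∈ hull s) :
    volume (hull s) * ‖(U : E d → E d) x - rep w x‖ₑ ^ 2 ≤ localError hD hm U w s := by
  set e : m.FE := U - hm.interp hD w
  have e1 : (U : E d → E d) x - rep w x = (e : E d → E d) x - (rep w x - m.nodal (rep w) x) := by
    simp [e, Fits.interp]
  have h1 : volume (hull s) * ‖(e : E d → E d) x‖ₑ ^ 2 ≤
      ENNReal.ofReal (8 * 2 ^ d + 2) * ∫⁻ y in hull s, ‖(e : E d → E d) y‖ₑ ^ 2 := by
    obtain ⟨A, hA⟩ := e.2.2.1 s hs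
    rw [hA x hx, setLIntegral_congr_fun (isClosed_hull s).measurableSet
      (fun y hy => by rw [hA y hy] : EqOn _ (fun y => ‖A y‖ₑ ^ 2) (hull s))]
    exact volume_mul_sq_enorm_affine_le A (convex_convexHull ℝ _) (isClosed_hull s).measurableSet hx
  have h2 : volume (hull s) * ‖rep w x - m.nodal (rep w) x‖ₑ ^ 2 ≤
      ENNReal.ofReal (4 * h ^ 2) ^ 2 * ∫⁻ y in hull s, hessN (w : Jet D) y ^ 2 := by
    refine (sq_enorm_rep_sub_nodal_le hd hD hL w hs
      ((hull_subset_region hs).trans hm.subset) hx).trans ?_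
    exact mul_le_mul_left (pow_le_pow_left' (ENNReal.ofReal_le_ofReal
      (mul_le_mul_of_nonneg_left (pow_le_pow_left₀ Metric.diam_nonneg (hm.size s hs) 2)
        (by norm_num))) 2) _
  rw [e1]
  calc _ ≤ volume (hull s) * (2 * (‖(e : E d → E d) x‖ₑ ^ 2 +
        ‖rep w x - m.nodal (rep w) x‖ₑ ^ 2)) := by
        gcongr
        exact (pow_le_pow_left' enorm_sub_le 2).trans (ENNReal_add_sq_le _ _)
    _ = 2 * (volume (hull s) * ‖(e : E d → E d) x‖ₑ ^ 2) +
        2 * (volume (hull s) * ‖rep w x - m.nodal (rep w) x‖ₑ ^ 2) := by ring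
    _ ≤ _ := by
        rw [localError]
        gcongr

theorem Fits.sum_localError_le (hD : IsOpen D) (hL : HasLipschitzBoundary D)
    (hm : m.Fits D σ κ h) (U : m.FE) (w : W D) :
    ∑ s ∈ m.elems, localError hD hm U w s ≤ ENNReal.ofReal ((16 * 2 ^ d + 4 + 32 * d ^ 4) *
      (‖m.toL2 D (U - hm.interp hD w)‖ + h ^ 2 * ‖w‖) ^ 2) := by
  set e : m.FE := U - hm.interp hD w with he
  have h1 : ∑ s ∈ m.elems, ∫⁻ y in hull s, ‖(e : E d → E d) y‖ₑ ^ 2 ≤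
      ENNReal.ofReal (‖m.toL2 D e‖ ^ 2) := by
    rw [← lintegral_region, ENNReal.ofReal_pow (norm_nonneg _), ofReal_norm_toL2 hm hD hL,
      eLpNorm_two_sq]
    exact lintegral_mono' Measure.restrict_le_self le_rfl
  have h2 : ∑ s ∈ m.elems, ∫⁻ y in hull s, hessN (w : Jet D) y ^ 2 ≤
      ENNReal.ofReal ((d ^ 2 * ‖w‖) ^ 2) := by
    rw [← lintegral_region, ENNReal.ofReal_pow (by positivity)]
    refine le_trans ?_ (pow_le_pow_left' (eLpNorm_hessN_le hD w) 2)
    rw [eLpNorm_two_sq]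
    simp only [enorm_eq_self]
    exact lintegral_mono' Measure.restrict_le_self le_rfl
  simp only [localError]
  rw [Finset.sum_add_distrib, ← Finset.mul_sum, ← Finset.mul_sum, ← Finset.mul_sum,
    ← Finset.mul_sum, ← he]
  calc _ ≤ 2 * (ENNReal.ofReal (8 * 2 ^ d + 2) * ENNReal.ofReal (‖m.toL2 D e‖ ^ 2)) +
        2 * (ENNReal.ofReal (4 * h ^ 2) ^ 2 * ENNReal.ofReal ((d ^ 2 * ‖w‖) ^ 2)) := by gcongr
    _ = ENNReal.ofReal (2 * ((8 * 2 ^ d + 2) * ‖m.toL2 D e‖ ^ 2) +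
        2 * ((4 * h ^ 2) ^ 2 * (d ^ 2 * ‖w‖) ^ 2)) := by
        rw [ENNReal.ofReal_add (p := 2 * _) (by positivity) (by positivity),
          ENNReal.ofReal_mul (p := 2) (by norm_num), ENNReal.ofReal_mul (p := 2) (by norm_num), ENNReal.ofReal_mul (p := 8 * 2 ^ d + 2)
          (by positivity), ENNReal.ofReal_mul (p := (4 * h ^ 2) ^ 2) (by positivity),
          ENNReal.ofReal_pow (p := 4 * h ^ 2) (by positivity), ENNReal.ofReal_ofNat]
    _ ≤ _ := by
        refine ENNReal.ofReal_le_ofReal ?_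
        have ha := norm_nonneg (m.toL2 D e)
        have hb : 0 ≤ h ^ 2 * ‖w‖ := by positivity
        have h3 : ‖m.toL2 D e‖ ^ 2 ≤ (‖m.toL2 D e‖ + h ^ 2 * ‖w‖) ^ 2 :=
          pow_le_pow_left₀ ha (by linarith) 2
        have h4 : (h ^ 2 * ‖w‖) ^ 2 ≤ (‖m.toL2 D e‖ + h ^ 2 * ‖w‖) ^ 2 :=
          pow_le_pow_left₀ hb (by linarith) 2
        have h5 : (0 : ℝ) ≤ 16 * 2 ^ d + 4 := by positivity
        have h6 : (0 : ℝ) ≤ 32 * d ^ 4 := by positivity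
        calc _ = (16 * 2 ^ d + 4) * ‖m.toL2 D e‖ ^ 2 + 32 * d ^ 4 * (h ^ 2 * ‖w‖) ^ 2 := by ring
          _ ≤ (16 * 2 ^ d + 4) * (‖m.toL2 D e‖ + h ^ 2 * ‖w‖) ^ 2 +
              32 * d ^ 4 * (‖m.toL2 D e‖ + h ^ 2 * ‖w‖) ^ 2 := by gcongr
          _ = _ := by ring

end Mesh

end Peridynamics

namespace Peridynamics

/-! ### Near and far bonds. -/

section Kernel

variable {d : ℕ} {ε M : ℝ} {f J : ℝ → ℝ} {ω : E d → ℝ} {D : Set (E d)}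

/-- The influence function that is `1` on `[0, 1)`. -/
noncomputable def unitInfluence : ℝ → ℝ := (Iio 1).indicator 1

theorem isInfluence_unitInfluence : IsInfluence unitInfluence 1 where
  measurable := measurable_one.indicator measurableSet_Iio
  nonneg r _ hr := by simp [unitInfluence, hr]
  le r _ hr := by simp [unitInfluence, hr]
  support r hr := by simp [unitInfluence, hr]

theorem bondKernel_le (hε : 0 < ε) (hJ : IsInfluence J M) (ξ : E d) :
    bondKernel d ε J ξ ≤ ENNReal.ofReal M * bondKernel d ε unitInfluence ξ := by
  rw [bondKernel, bondKernel, ← ENNReal.ofReal_mul hJ.bound_nonneg, ← mul_div_assoc]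
  refine ENNReal.ofReal_le_ofReal (div_le_div_of_nonneg_right ?_ (norm_nonneg _))
  have h0 : 0 ≤ ‖ξ‖ / ε := by positivity
  rcases lt_or_ge (‖ξ‖ / ε) 1 with h | h
  · simpa [unitInfluence, h] using hJ.le _ h0 h
  · simp [unitInfluence, h, hJ.support _ h]

/-- Moving a bond of length at least `r` by less than `r` less than doubles its length. So the
kernel changes at most by a factor `2` once the horizon is doubled. -/
theorem bondKernel_le_of_far (hε : 0 < ε) {r : ℝ} {ξ η : E d} (hξ : r ≤ ‖ξ‖) (hη : ‖η - ξ‖ < r) :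
    bondKernel d ε unitInfluence ξ ≤ 2 * bondKernel d (2 * ε) unitInfluence η := by
  rcases lt_or_ge (‖ξ‖ / ε) 1 with h | h
  · have h1 : ‖η‖ < 2 * ‖ξ‖ := by
      have := norm_sub_norm_le η ξ
      linarith
    have h2 : 0 < ‖η‖ := by
      have := norm_sub_norm_le ξ η
      rw [norm_sub_rev] at this
      linarith
    have h3 : ‖η‖ / (2 * ε) < 1 := by
      rw [div_lt_one (by positivity)]
      rw [div_lt_one hε] at h
      linarith
    have h4 : 0 < ‖ξ‖ := by linarith
    have e2 : ∀ a : ℝ, 2 * ENNReal.ofReal a = ENNReal.ofReal (2 * a) := fun a => by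
      rw [ENNReal.ofReal_mul (by norm_num), ENNReal.ofReal_ofNat]
    rw [bondKernel, bondKernel, e2]
    refine ENNReal.ofReal_le_ofReal ?_
    simp only [unitInfluence, indicator, mem_Iio, h, h3, if_true, Pi.one_apply]
    rw [div_le_iff₀ h4]
    field_simp
    linarith
  · have : bondKernel d ε unitInfluence ξ = 0 := by
      simp [bondKernel, isInfluence_unitInfluence.support _ h]
    rw [this]
    exact zero_le

/-- The integral against the kernel at `p` is controlled by a local bound near `p` and by
integrals against a larger kernel at all points `x` close to `p`. -/
theorem lintegral_bondKernel_le_near_far (hε : 0 < ε) {g : E d → E d} (hg : Measurable g)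
    {p x : E d} {r : ℝ} (hx : x ∈ Metric.ball p r) {S : ℝ≥0∞}
    (hS : ∀ y ∈ Metric.ball p r, ‖g y‖ₑ ≤ S) :
    ∫⁻ ξ, bondKernel d ε unitInfluence ξ * ‖g (p + ξ)‖ₑ ≤
      (∫⁻ ξ, bondKernel d ε unitInfluence ξ) * S +
        2 * ∫⁻ ξ, bondKernel d (2 * ε) unitInfluence ξ * ‖g (x + ξ)‖ₑ := by
  have hk : Measurable (bondKernel d ε unitInfluence) :=
    measurable_bondKernel isInfluence_unitInfluence
  have hk' : Measurable (bondKernel d (2 * ε) unitInfluence) :=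
    measurable_bondKernel isInfluence_unitInfluence
  have hpt : ∀ ξ, bondKernel d ε unitInfluence ξ * ‖g (p + ξ)‖ₑ ≤
      bondKernel d ε unitInfluence ξ * S +
        2 * (bondKernel d (2 * ε) unitInfluence (ξ + (p - x)) * ‖g (x + (ξ + (p - x)))‖ₑ) := by
    intro ξ
    rw [show x + (ξ + (p - x)) = p + ξ by abel]
    rcases lt_or_ge ‖ξ‖ r with h | h
    · refine le_add_right (mul_le_mul_right (hS _ ?_) _)
      simpa [mem_ball_iff_norm] using h
    · refine le_add_left ?_
      rw [← mul_assoc]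
      refine mul_le_mul_left (bondKernel_le_of_far hε h ?_) _
      rw [mem_ball_iff_norm, norm_sub_rev] at hx
      simpa using hx
  refine (lintegral_mono hpt).trans (le_of_eq ?_)
  rw [lintegral_add_left (by fun_prop), lintegral_mul_const _ hk, lintegral_const_mul _ (by fun_prop),
    lintegral_add_right_eq_self
      (fun η => bondKernel d (2 * ε) unitInfluence η * ‖g (x + η)‖ₑ) (p - x)]

theorem lintegral_bondKernel_mul_ne_top (hd : 2 ≤ d) (hε : 0 < ε) (hJ : IsInfluence J M)
    {u : E d → E d} {B : ℝ} (hB : ∀ x, ‖u x‖ ≤ B) (x : E d) :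
    ∫⁻ ξ, bondKernel d ε J ξ * ‖u (x + ξ)‖ₑ ≠ ⊤ := by
  have hk := measurable_bondKernel (d := d) (ε := ε) hJ
  refine ((lintegral_mono fun ξ => mul_le_mul_right (?_ : ‖u (x + ξ)‖ₑ ≤ ENNReal.ofReal B) _).trans_lt
    ?_).ne
  · rw [← ofReal_norm]
    exact ENNReal.ofReal_le_ofReal (hB _)
  · rw [lintegral_mul_const _ hk]
    exact ENNReal.mul_lt_top (lintegral_bondKernel_ne_top hd hε hJ).lt_top ENNReal.ofReal_lt_top

theorem exists_norm_rep_le (hd : d ≤ 3) (hD : IsOpen D) (hDb : Bornology.IsBounded D)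
    (hL : HasLipschitzBoundary D) (w : W D) : ∃ B, ∀ x, ‖rep w x‖ ≤ B :=
  (continuous_rep hd hD hL w).bounded_above_of_compact_support
    (HasCompactSupport.intro hDb.isCompact_closure
      fun _ hx => rep_of_notMem w fun h => hx (subset_closure h))

theorem Mesh.exists_norm_FE_le {m : Mesh d} (w : m.FE) : ∃ B, ∀ x, ‖(w : E d → E d) x‖ ≤ B :=
  w.2.1.bounded_above_of_compact_support (HasCompactSupport.intro m.isCompact_region w.2.2.2)

end Kernel

/-! ### The nodal interpolant of the force. -/

namespace Mesh

variable {d : ℕ} {m : Mesh d} {D : Set (E d)} {σ κ h ε M : ℝ} {f J : ℝ → ℝ} {ω : E d → ℝ}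

/-- The difference of the forces at the points of `D`. -/
noncomputable def forceError (D : Set (E d)) (ε : ℝ) (f J : ℝ → ℝ) (ω : E d → ℝ) (U w : E d → E d) :
    E d → E d :=
  D.indicator fun x => force ε f J ω U x - force ε f J ω w x

/-- A point value of the force is not controlled by `L²` norms, so the bonds of `p` are split at the
radius `r`. Short bonds see only the star, where the local error is bounded pointwise; long bonds
are compared with those of each `x` in the ball, at double horizon, and the result is averaged over
`x`. -/
theorem Fits.volume_mul_sq_enorm_forceError_le (hd2 : 2 ≤ d) (hd : d ≤ 3) (hD : IsOpen D)
    (hDb : Bornology.IsBounded D) (hL : HasLipschitzBoundary D) (hm : m.Fits D σ κ h)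
    (hf : IsPotential f) (hε : 0 < ε) (hJ : IsInfluence J M) (hω : IsBoundaryFunction D ε ω)
    (U : m.FE) (w : W D) {p : E d} {r : ℝ} (hr : 0 < r)
    (hr1 : ∀ y ∈ Metric.ball p r, ∃ s ∈ m.star p, y ∈ hull s)
    (hr2 : ∀ s ∈ m.star p, volume (Metric.ball p r) ≤ volume (hull s)) :
    volume (Metric.ball p r) * ‖force ε f J ω (U : E d → E d) p - force ε f J ω (rep w) p‖ₑ ^ 2 ≤
      8 * (ENNReal.ofReal (4 / (ε ^ (d + 1) * unitBallVolume d) * (C2 f / 2)) *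
        ENNReal.ofReal M) ^ 2 * ∑ s ∈ m.star p,
          ((∫⁻ ξ, bondKernel d ε unitInfluence ξ) ^ 2 * localError hD hm U w s +
            ∫⁻ x in hull s, (∫⁻ ξ, bondKernel d (2 * ε) unitInfluence ξ *
              ‖(U : E d → E d) (x + ξ) - rep w (x + ξ)‖ₑ) ^ 2) := by
  set g : E d → E d := fun x => (U : E d → E d) x - rep w x with hg
  have hgm : Measurable g := (U.2.1.sub (continuous_rep hd hD hL w)).measurable
  set K := ∫⁻ ξ, bondKernel d ε unitInfluence ξ with hK
  set c := ENNReal.ofReal (4 / (ε ^ (d + 1) * unitBallVolume d) * (C2 f / 2)) with hc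
  set V := volume (Metric.ball p r) with hV
  have hV0 : V ≠ 0 := (Metric.measure_ball_pos _ _ hr).ne'
  have hVt : V ≠ ⊤ := measure_ball_lt_top.ne
  set Q := ∑ s ∈ m.star p, localError hD hm U w s with hQ
  set Φ : E d → ℝ≥0∞ := fun x => ∫⁻ ξ, bondKernel d (2 * ε) unitInfluence ξ * ‖g (x + ξ)‖ₑ with hΦ
  -- A bound for the field difference on the ball, possible because every element of the star has at
  -- least the volume of the ball.
  set S : ℝ≥0∞ := (Q / V) ^ (1 / 2 : ℝ) with hS
  have hS2 : S ^ 2 = Q / V := sq_rpow_half _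
  have hgS : ∀ y ∈ Metric.ball p r, ‖g y‖ₑ ≤ S := by
    intro y hy
    obtain ⟨s, hs, hys⟩ := hr1 y hy
    rw [← ENNReal.pow_le_pow_left_iff two_ne_zero, hS2, ENNReal.le_div_iff_mul_le (.inl hV0) (.inl hVt),
      mul_comm]
    calc V * ‖g y‖ₑ ^ 2 ≤ volume (hull s) * ‖g y‖ₑ ^ 2 := mul_le_mul_left (hr2 s hs) _
      _ ≤ localError hD hm U w s :=
          hm.volume_mul_sq_enorm_sub_rep_le hd hD hL U w (mem_star.1 hs).1 hys
      _ ≤ Q := Finset.single_le_sum (f := fun s => localError hD hm U w s) (fun _ _ => zero_le) hs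
  obtain ⟨B₁, hB₁⟩ := exists_norm_FE_le U
  obtain ⟨B₂, hB₂⟩ := exists_norm_rep_le hd hD hDb hL w
  set G := force ε f J ω (U : E d → E d) p - force ε f J ω (rep w) p with hG
  have h1 : ∀ x ∈ Metric.ball p r, ‖G‖ₑ ≤ c * ENNReal.ofReal M * (2 * (K * S + Φ x)) := by
    intro x hx
    have hMk : ∀ φ : E d → ℝ≥0∞, ∫⁻ ξ, bondKernel d ε J ξ * φ ξ ≤
        ENNReal.ofReal M * ∫⁻ ξ, bondKernel d ε unitInfluence ξ * φ ξ := fun φ => by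
      rw [← lintegral_const_mul' _ _ ENNReal.ofReal_ne_top]
      refine lintegral_mono fun ξ => ?_
      simp only
      rw [← mul_assoc]
      exact mul_le_mul_left (bondKernel_le hε hJ ξ) _
    have hMk1 : ∫⁻ ξ, bondKernel d ε J ξ ≤ ENNReal.ofReal M * K := by
      simpa using hMk fun _ => 1
    refine (enorm_force_sub_le hd2 hf hε hJ hω U.2.1.measurable
      (continuous_rep hd hD hL w).measurable (lintegral_bondKernel_mul_ne_top hd2 hε hJ hB₁ p)
      (lintegral_bondKernel_mul_ne_top hd2 hε hJ hB₂ p)).trans ?_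
    rw [mul_assoc]
    refine mul_le_mul_right ?_ _
    calc _ ≤ ENNReal.ofReal M * (K * S + 2 * Φ x) + ENNReal.ofReal M * K * S := by
          refine add_le_add ((hMk _).trans (mul_le_mul_right
            (lintegral_bondKernel_le_near_far hε hgm hx hgS) _)) (mul_le_mul' hMk1 ?_)
          exact hgS p (Metric.mem_ball_self hr)
      _ = _ := by ring
  have h2 : ∀ x ∈ Metric.ball p r, ‖G‖ₑ ^ 2 ≤
      8 * (c * ENNReal.ofReal M) ^ 2 * (K ^ 2 * S ^ 2 + Φ x ^ 2) := by
    intro x hx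
    calc ‖G‖ₑ ^ 2 ≤ (c * ENNReal.ofReal M * (2 * (K * S + Φ x))) ^ 2 := by gcongr; exact h1 x hx
      _ = 4 * (c * ENNReal.ofReal M) ^ 2 * (K * S + Φ x) ^ 2 := by ring
      _ ≤ 4 * (c * ENNReal.ofReal M) ^ 2 * (2 * ((K * S) ^ 2 + Φ x ^ 2)) := by
          gcongr
          exact ENNReal_add_sq_le _ _
      _ = _ := by ring
  have hk' : Measurable (bondKernel d (2 * ε) unitInfluence) :=
    measurable_bondKernel isInfluence_unitInfluence
  have hΦm : Measurable Φ :=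
    Measurable.lintegral_prod_right' (f := fun q : E d × E d =>
      bondKernel d (2 * ε) unitInfluence q.2 * ‖g (q.1 + q.2)‖ₑ) (by fun_prop)
  calc V * ‖G‖ₑ ^ 2 = ∫⁻ _ in Metric.ball p r, ‖G‖ₑ ^ 2 := by rw [setLIntegral_const, mul_comm]
    _ ≤ ∫⁻ x in Metric.ball p r, 8 * (c * ENNReal.ofReal M) ^ 2 * (K ^ 2 * S ^ 2 + Φ x ^ 2) :=
        setLIntegral_mono' Metric.isOpen_ball.measurableSet h2
    _ = 8 * (c * ENNReal.ofReal M) ^ 2 *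
          (K ^ 2 * Q + ∫⁻ x in Metric.ball p r, Φ x ^ 2) := by
        rw [lintegral_const_mul _ (by fun_prop), lintegral_add_left measurable_const,
          setLIntegral_const, hS2, mul_assoc (K ^ 2), ENNReal.div_mul_cancel hV0 hVt]
    _ ≤ _ := by
        rw [Finset.sum_add_distrib, ← Finset.mul_sum]
        gcongr
        calc ∫⁻ x in Metric.ball p r, Φ x ^ 2 ≤ ∫⁻ x in ⋃ s ∈ m.star p, hull s, Φ x ^ 2 := by
              refine lintegral_mono_set fun y hy => ?_
              obtain ⟨s, hs, hys⟩ := hr1 y hy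
              exact mem_iUnion₂.2 ⟨s, hs, hys⟩
          _ = ∑ s ∈ m.star p, ∫⁻ x in hull s, Φ x ^ 2 :=
              lintegral_biUnion_finset₀ (fun s hs t ht hst =>
                aedisjoint_hull (mem_star.1 hs).1 (mem_star.1 ht).1 hst)
                (fun s _ => (isClosed_hull s).measurableSet.nullMeasurableSet) _

theorem Fits.sum_volume_mul_sq_enorm_forceError_le (hd2 : 2 ≤ d) (hd : d ≤ 3) (hD : IsOpen D)
    (hDb : Bornology.IsBounded D) (hL : HasLipschitzBoundary D) (hm : m.Fits D σ κ h) {Λ : NNReal}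
    (hΛ : ∀ p ∈ m.vertices, p ∈ interior m.region → ∃ r > 0,
      (∀ y ∈ Metric.ball p r, ∃ s ∈ m.star p, y ∈ hull s) ∧
      (∀ s ∈ m.star p, volume (Metric.ball p r) ≤ volume (hull s)) ∧
      ∑ s ∈ m.star p, volume (hull s) ≤ Λ * volume (Metric.ball p r))
    (hf : IsPotential f) (hε : 0 < ε) (hJ : IsInfluence J M) (hω : IsBoundaryFunction D ε ω)
    (U : m.FE) (w : W D) {p : E d} (hpv : p ∈ m.vertices) :
    (∑ s ∈ m.star p, volume (hull s)) * ‖forceError D ε f J ω U (rep w) p‖ₑ ^ 2 ≤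
      Λ * (8 * (ENNReal.ofReal (4 / (ε ^ (d + 1) * unitBallVolume d) * (C2 f / 2)) *
        ENNReal.ofReal M) ^ 2) * ∑ s ∈ m.star p,
          ((∫⁻ ξ, bondKernel d ε unitInfluence ξ) ^ 2 * localError hD hm U w s +
            ∫⁻ x in hull s, (∫⁻ ξ, bondKernel d (2 * ε) unitInfluence ξ *
              ‖(U : E d → E d) (x + ξ) - rep w (x + ξ)‖ₑ) ^ 2) := by
  by_cases hpD : p ∈ D
  · obtain ⟨r, hr, hr1, hr2, hr3⟩ := hΛ p hpv (hm.mem_interior_region_of_mem hD ⟨hpv, hpD⟩)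
    rw [forceError, indicator_of_mem hpD]
    refine (mul_le_mul_left hr3 _).trans ?_
    rw [mul_assoc, mul_assoc]
    exact mul_le_mul_right (hm.volume_mul_sq_enorm_forceError_le hd2 hd hD hDb hL hf hε hJ hω U w
      hr hr1 hr2) _
  · simp [forceError, hpD]

/-- Here `e` stands for `ε^(d-1)` and `P` for `2^(d-1)`: the powers of the horizon from the kernel
masses cancel against the prefactor of the force, leaving `M C₂ / ε²`. -/
theorem nodal_constant_eq {a B b c e I M n P w x : ℝ} {δ : ℝ} (he : e ≠ 0) (hδ : δ ≠ 0)
    (hw : w ≠ 0) :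
    a * (8 * (4 / (e * δ ^ 2 * w) * (c / 2) * M) ^ 2) * (n *
      ((e * I) ^ 2 * (B * x ^ 2) + (P * e * I * (b * x)) ^ 2)) =
    a * 8 * (2 / w * I) ^ 2 * n * (B + P ^ 2 * b ^ 2) * (M * c / δ ^ 2 * x) ^ 2 := by
  have h1 : 4 / (e * δ ^ 2 * w) * (c / 2) * M = 2 / w * (M * c / δ ^ 2) / e := by
    field_simp
    ring
  have h2 : (e * I) ^ 2 * (B * x ^ 2) + (P * e * I * (b * x)) ^ 2 =
      e ^ 2 * (I ^ 2 * x ^ 2 * (B + P ^ 2 * b ^ 2)) := by ring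
  have h3 : ∀ q : ℝ, (q / e) ^ 2 * e ^ 2 = q ^ 2 := fun q => by
    rw [div_pow, div_mul_cancel₀ _ (pow_ne_zero 2 he)]
  rw [h1, h2]
  calc _ = a * 8 * n * (I ^ 2 * x ^ 2 * (B + P ^ 2 * b ^ 2)) *
        ((2 / w * (M * c / δ ^ 2) / e) ^ 2 * e ^ 2) := by ring
    _ = _ := by rw [h3]; ring

variable (D σ κ) in
set_option maxHeartbeats 800000 in
/-- The nodal interpolant of the force is Lipschitz in `L²` on finite element fields, up to the
interpolation error. -/
theorem exists_norm_nodal_forceError_le (hd2 : 2 ≤ d) (hd : d ≤ 3) (hD : IsOpen D)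
    (hDb : Bornology.IsBounded D) (hL : HasLipschitzBoundary D) (hσ : 0 < σ) (hκ : 0 ≤ κ) :
    ∃ C > 0, ∀ (m : Mesh d) (h ε M : ℝ) (f J : ℝ → ℝ) (ω : E d → ℝ) (hm : m.Fits D σ κ h),
      IsPotential f → 0 < ε → IsInfluence J M → IsBoundaryFunction D ε ω → ∀ (U : m.FE) (w : W D),
        eLpNorm (m.nodal (forceError D ε f J ω U (rep w))) 2 volume ≤
          ENNReal.ofReal (C * (M * C2 f) / ε ^ 2 *
            (‖m.toL2 D (U - hm.interp hD w)‖ + h ^ 2 * ‖w‖)) := by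
  -- This permits the constant `1 + A` in place of `√A` when the squared estimate is undone.
  have hA1 : ∀ a : ℝ, 0 ≤ a → a ≤ (1 + a) ^ 2 := fun a ha => by nlinarith
  obtain ⟨Λ, hΛ⟩ := exists_star_ball d σ hσ hd2
  obtain ⟨C₁, hC₁, hint⟩ := exists_norm_interp_sub_le D κ (by omega) hd hD hDb hL hκ
  have hωd := unitBallVolume_pos d
  set I : ℝ := ∫ ξ in Metric.ball (0 : E d) 1, unitInfluence ‖ξ‖ / ‖ξ‖ with hI
  have hI0 : 0 ≤ I := integral_nonneg fun ξ =>
    div_nonneg (isInfluence_unitInfluence.nonneg' (norm_nonneg _)) (norm_nonneg _)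
  set A : ℝ := Λ * 8 * (2 / unitBallVolume d * I) ^ 2 * (d + 1) *
    ((16 * 2 ^ d + 4 + 32 * d ^ 4) + (2 ^ (d - 1)) ^ 2 * (1 + C₁) ^ 2) with hA
  have hA0 : 0 ≤ A := by positivity
  refine ⟨1 + A, by positivity, fun m h ε M f J ω hm hf hε hJ hω U w => ?_⟩
  have hM := hJ.bound_nonneg
  have hC2 := C2_nonneg f
  set e : m.FE := U - hm.interp hD w with he
  set X := ‖m.toL2 D e‖ + h ^ 2 * ‖w‖ with hX
  have hX0 : 0 ≤ X := by positivity
  set K := ∫⁻ ξ, bondKernel d ε unitInfluence ξ with hK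
  set K' := ∫⁻ ξ, bondKernel d (2 * ε) unitInfluence ξ with hK'
  have hKe : K = ENNReal.ofReal (ε ^ (d - 1) * I) :=
    lintegral_bondKernel hd2 hε isInfluence_unitInfluence
  have hKe' : K' = ENNReal.ofReal ((2 * ε) ^ (d - 1) * I) :=
    lintegral_bondKernel hd2 (by positivity) isInfluence_unitInfluence
  set c := ENNReal.ofReal (4 / (ε ^ (d + 1) * unitBallVolume d) * (C2 f / 2)) with hc
  set g : E d → E d := fun x => (U : E d → E d) x - rep w x with hg
  have hgm : Measurable g := (U.2.1.sub (continuous_rep hd hD hL w)).measurable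
  set Φ : E d → ℝ≥0∞ := fun x => ∫⁻ ξ, bondKernel d (2 * ε) unitInfluence ξ * ‖g (x + ξ)‖ₑ with hΦ
  have hgX : eLpNorm g 2 volume ≤ ENNReal.ofReal ((1 + C₁) * X) := by
    rw [hg, ← ofReal_norm_toL2_sub hd hm hD hL]
    refine ENNReal.ofReal_le_ofReal ?_
    have e1 : m.toL2 D U - W.toL2 w = m.toL2 D e + (m.toL2 D (hm.interp hD w) - W.toL2 w) := by
      rw [he, map_sub]; abel
    rw [e1]
    refine (norm_add_le _ _).trans ?_
    have := hint m σ h hm w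
    have h1 : 0 ≤ h ^ 2 * ‖w‖ := by positivity
    have h2 := norm_nonneg (m.toL2 D e)
    rw [hX]
    nlinarith
  have hΦX : ∫⁻ x, Φ x ^ 2 ≤ ENNReal.ofReal (((2 * ε) ^ (d - 1) * I * ((1 + C₁) * X)) ^ 2) := by
    have h1 := eLpNorm_lintegral_translate_le (d := d) (k := bondKernel d (2 * ε) unitInfluence)
      (f := fun x => ‖g x‖ₑ) (measurable_bondKernel isInfluence_unitInfluence) (by fun_prop)
    rw [eLpNorm_enorm] at h1
    have h2 := pow_le_pow_left' (h1.trans (mul_le_mul_right hgX _)) 2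
    rw [eLpNorm_two_sq, ← hK', hKe', ← ENNReal.ofReal_mul (by positivity),
      ← ENNReal.ofReal_pow (by positivity)] at h2
    simpa only [enorm_eq_self] using h2
  have key := lintegral_nodal_sq_le (m := m) (forceError D ε f J ω U (rep w))
    (fun s => K ^ 2 * localError hD hm U w s + ∫⁻ x in hull s, Φ x ^ 2)
    (Λ * (8 * (c * ENNReal.ofReal M) ^ 2)) (fun p hpv => ?_)
  · have h1 : ∑ s ∈ m.elems, (K ^ 2 * localError hD hm U w s + ∫⁻ x in hull s, Φ x ^ 2) ≤
        ENNReal.ofReal ((ε ^ (d - 1) * I) ^ 2 * ((16 * 2 ^ d + 4 + 32 * d ^ 4) * X ^ 2) +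
          ((2 * ε) ^ (d - 1) * I * ((1 + C₁) * X)) ^ 2) := by
      rw [Finset.sum_add_distrib, ← Finset.mul_sum, ← lintegral_region,
        ENNReal.ofReal_add (by positivity) (by positivity), ENNReal.ofReal_mul (by positivity), hKe,
        ← ENNReal.ofReal_pow (by positivity)]
      refine add_le_add (mul_le_mul_right (hm.sum_localError_le hD hL U w) _) (le_trans ?_ hΦX)
      exact lintegral_mono' Measure.restrict_le_self le_rfl
    have h2 := key.trans (mul_le_mul_right (mul_le_mul_right h1 _) _)
    rw [← ENNReal.pow_le_pow_left_iff two_ne_zero, eLpNorm_two_sq,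
      ← ENNReal.ofReal_pow (by positivity)]
    refine h2.trans ?_
    have e1 : ((d : ℝ≥0∞) + 1) = ENNReal.ofReal (d + 1) := by
      rw [ENNReal.ofReal_add (by positivity) one_pos.le]; simp
    have e2 : (Λ : ℝ≥0∞) = ENNReal.ofReal Λ := by simp
    have e3 : (8 : ℝ≥0∞) = ENNReal.ofReal 8 := by simp
    rw [e1, e2, e3, hc, ← ENNReal.ofReal_mul (by positivity), ← ENNReal.ofReal_pow (by positivity),
      ← ENNReal.ofReal_mul (by positivity), ← ENNReal.ofReal_mul (by positivity),
      ← ENNReal.ofReal_mul (by positivity), ← ENNReal.ofReal_mul (by positivity)]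
    refine ENNReal.ofReal_le_ofReal ?_
    have e4 : ε ^ (d + 1) = ε ^ (d - 1) * ε ^ 2 := by rw [← pow_add]; congr 1; omega
    have e5 : Λ * (8 * (4 / (ε ^ (d + 1) * unitBallVolume d) * (C2 f / 2) * M) ^ 2) * ((d + 1) *
        ((ε ^ (d - 1) * I) ^ 2 * ((16 * 2 ^ d + 4 + 32 * d ^ 4) * X ^ 2) +
          ((2 * ε) ^ (d - 1) * I * ((1 + C₁) * X)) ^ 2)) = A * (M * C2 f / ε ^ 2 * X) ^ 2 := by
      rw [hA, e4, mul_pow 2 ε]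
      exact nodal_constant_eq (by positivity) hε.ne' hωd.ne'
    rw [e5, show (1 + A) * (M * C2 f) / ε ^ 2 * X = (1 + A) * (M * C2 f / ε ^ 2 * X) by ring,
      mul_pow (1 + A)]
    exact mul_le_mul_of_nonneg_right (hA1 A hA0) (sq_nonneg _)
  · exact hm.sum_volume_mul_sq_enorm_forceError_le hd2 hd hD hDb hL (hΛ m D κ h hm) hf hε hJ hω U w
      hpv

end Mesh

end Peridynamics

namespace Peridynamics

/-! ### Linearity of the representative, and the equation of motion at points. -/

section Rep

variable {d : ℕ} {D : Set (E d)}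

/-- Two continuous fields that agree almost everywhere are equal; linearity of `rep` follows,
although it is defined through limits. -/
theorem rep_eq_of_ae (hd : d ≤ 3) (hD : IsOpen D) (hL : HasLipschitzBoundary D) (w : W D)
    {g : E d → E d} (hg : Continuous g) (h : extend (W.toL2 w) =ᵐ[volume] g) : rep w = g :=
  (Continuous.ae_eq_iff_eq volume (continuous_rep hd hD hL w) hg).1
    ((extend_ae_eq_rep hd hD hL w).symm.trans h)

theorem rep_add (hd : d ≤ 3) (hD : IsOpen D) (hL : HasLipschitzBoundary D) (w z : W D) :
    rep (w + z) = rep w + rep z := by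
  refine rep_eq_of_ae hd hD hL _ ((continuous_rep hd hD hL w).add (continuous_rep hd hD hL z)) ?_
  refine (extend_add_ae hD (W.toL2 w) (W.toL2 z)).trans ?_
  filter_upwards [extend_ae_eq_rep hd hD hL w, extend_ae_eq_rep hd hD hL z] with x h1 h2
  simp [h1, h2]

theorem rep_smul (hd : d ≤ 3) (hD : IsOpen D) (hL : HasLipschitzBoundary D) (c : ℝ) (w : W D) :
    rep (c • w) = c • rep w := by
  refine rep_eq_of_ae hd hD hL _ ((continuous_rep hd hD hL w).const_smul c) ?_
  refine extend_congr_ae hD _ ?_ fun x hx => by simp [rep_of_notMem w hx]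
  rw [W.toL2_smul]
  filter_upwards [Lp.coeFn_smul c (W.toL2 w), extend_ae_eq hD (W.toL2 w),
    ae_restrict_of_ae (extend_ae_eq_rep hd hD hL w)] with x h1 h2 h3
  rw [h1, Pi.smul_apply, Pi.smul_apply, ← h2, h3]

theorem rep_sub (hd : d ≤ 3) (hD : IsOpen D) (hL : HasLipschitzBoundary D) (w z : W D) :
    rep (w - z) = rep w - rep z := by
  have : w - z = w + (-1 : ℝ) • z := by module
  rw [this, rep_add hd hD hL, rep_smul hd hD hL]
  module

variable {ε M T : ℝ} {f J : ℝ → ℝ} {ω : E d → ℝ} {b : ℝ → L2 D} {u v : ℝ → W D}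

/-- The equation of motion holds at every point of `D` for the continuous representatives. -/
theorem IsExactSolution.motion_rep (hd2 : 2 ≤ d) (hd : d ≤ 3) (hD : IsOpen D)
    (hDb : Bornology.IsBounded D) (hL : HasLipschitzBoundary D) (hf : IsPotential f) (hε : 0 < ε)
    (hJ : IsInfluence J M) (hω : IsBoundaryFunction D ε ω)
    (hex : IsExactSolution D ε f J ω T b u v) {b' : ℝ → E d → E d}
    (hb : IsContinuousLoad D T b b') {t : ℝ} (ht : t ∈ Icc 0 T) {x : E d} (hx : x ∈ D) :
    rep (derivWithin v (Icc 0 T) t) x = force ε f J ω (rep (u t)) x + b' t x := by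
  obtain ⟨B, hB⟩ := exists_norm_rep_le hd hD hDb hL (u t)
  refine Measure.eqOn_open_of_ae_eq (μ := volume) (U := D) ?_ hD
    (continuous_rep hd hD hL _).continuousOn
    (g := fun x => force ε f J ω (rep (u t)) x + b' t x)
    ((continuous_force hd2 hf hε hJ hω (continuous_rep hd hD hL _) hB).continuousOn.add
      (hb t ht).1) hx
  have h0 := extend_ae_eq_rep hd hD hL (u t)
  filter_upwards [hex.motion t ht, (hb t ht).2, ae_restrict_of_ae h0,
    extend_ae_eq hD (W.toL2 (derivWithin v (Icc 0 T) t)),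
    ae_restrict_of_ae (extend_ae_eq_rep hd hD hL (derivWithin v (Icc 0 T) t))]
    with x h1 h2 h3 h4 h5
  rw [← h5, h4, h1, h2, force_congr_ae h0 h3]

end Rep

namespace Mesh

variable {d : ℕ} {D : Set (E d)} {m : Mesh d} {σ κ h : ℝ}

theorem FE_ext {w z : m.FE} (hwz : ∀ p ∈ m.vertices, (w : E d → E d) p = (z : E d → E d) p) :
    w = z :=
  sub_eq_zero.1 (m.FE_eq_zero (w - z) fun p hp => by simp [hwz p hp])

theorem Fits.interp_vertex (hm : m.Fits D σ κ h) (hD : IsOpen D) (w : W D) {p : E d}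
    (hp : p ∈ m.vertices) : (hm.interp hD w : E d → E d) p = rep w p :=
  nodal_vertex _ hp

/-- The finite element field that interpolates the difference of the forces at the vertices. -/
noncomputable def Fits.forceErrorFE (hm : m.Fits D σ κ h) (hD : IsOpen D) (ε : ℝ) (f J : ℝ → ℝ)
    (ω : E d → ℝ) (U w : E d → E d) : m.FE :=
  ⟨m.nodal (forceError D ε f J ω U w), hm.nodal_mem_FE hD fun _ hx => indicator_of_notMem hx _⟩

end Mesh

/-! ### Error recursion for the strong scheme. -/

section StrongScheme

variable {d : ℕ} {ε M : ℝ} {f J : ℝ → ℝ} {ω : E d → ℝ} {D : Set (E d)} {m : Mesh d}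
  {σ κ h T Δt : ℝ} {b : ℝ → L2 D} {b' : ℝ → E d → E d} {u v : ℝ → W D} {U V : ℕ → m.FE}

theorem IsStrongCentralScheme.velocity_eq (hΔt : 0 < Δt)
    (hs : IsStrongCentralScheme D ε f J ω T Δt m b' U V) {k : ℕ} (hk : (k + 1) * Δt ≤ T) {p : E d}
    (hp : p ∈ m.vertices ∩ D) :
    (V (k + 1) : E d → E d) p = (V k : E d → E d) p + (Δt * if k = 0 then 1 / 2 else 1) •
      (force ε f J ω (U k : E d → E d) p + b' (k * Δt) p) := by
  have hv : ∀ k : ℕ, (k + 1) * Δt ≤ T → (V (k + 1) : E d → E d) p =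
      Δt⁻¹ • ((U (k + 1) : E d → E d) p - (U k : E d → E d) p) := fun k hk => by
    rw [hs.velocity k hk]; rfl
  rcases Nat.eq_zero_or_pos k with rfl | hk1
  · have h1 := hs.first (by simpa using hk) p hp
    have e : (Δt ^ 2)⁻¹ • ((U 1 : E d → E d) p - (U 0 : E d → E d) p) =
        Δt⁻¹ • (V (0 + 1) : E d → E d) p := by
      rw [hv 0 hk, smul_smul, ← mul_inv, ← sq]
    rw [e] at h1
    have h2 := congrArg (Δt • ·) h1
    simp only [smul_inv_smul₀ hΔt.ne', smul_add, smul_smul Δt (1 / Δt),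
      mul_one_div_cancel hΔt.ne', one_smul] at h2
    rw [h2]
    simp only [Nat.cast_zero, zero_mul, if_true]
    module
  · have h1 := hs.step k hk1 hk p hp
    rw [second_difference_eq (U := fun k => (U k : E d → E d) p)
      (V := fun k => (V k : E d → E d) p) hv hΔt hk1 hk] at h1
    rw [← h1, if_neg (by omega), mul_one, smul_inv_smul₀ hΔt.ne']
    abel

/-- Errors are measured against nodal interpolants rather than projections, because the scheme holds
at vertices; the identity is checked there. -/
theorem IsStrongCentralScheme.displacement_error_eq (hd : d ≤ 3) (hD : IsOpen D)
    (hL : HasLipschitzBoundary D) (hm : m.Fits D σ κ h) (hΔt : 0 < Δt)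
    (hs : IsStrongCentralScheme D ε f J ω T Δt m b' U V) {k : ℕ} (hk : (k + 1) * Δt ≤ T)
    (w w' z' : W D) :
    U (k + 1) - hm.interp hD w' = (U k - hm.interp hD w) + Δt • (V (k + 1) - hm.interp hD z') +
      Δt • hm.interp hD (z' - Δt⁻¹ • (w' - w)) := by
  refine Mesh.FE_ext fun p hp => ?_
  rw [hs.velocity k hk]
  simp only [Submodule.coe_sub, Submodule.coe_add, Submodule.coe_smul, Pi.sub_apply, Pi.add_apply,
    Pi.smul_apply, hm.interp_vertex hD _ hp, rep_sub hd hD hL, rep_smul hd hD hL, smul_sub,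
    smul_inv_smul₀ hΔt.ne']
  abel

/-- At vertices in `D` the exact equation holds pointwise, so the load cancels. What remains is the
force error, the interpolated truncation error and, at `k = 0`, half of the acceleration. At the
other vertices every term is zero. -/
theorem IsStrongCentralScheme.velocity_error_eq (hd2 : 2 ≤ d) (hd : d ≤ 3) (hD : IsOpen D)
    (hDb : Bornology.IsBounded D) (hL : HasLipschitzBoundary D) (hf : IsPotential f) (hε : 0 < ε)
    (hJ : IsInfluence J M) (hω : IsBoundaryFunction D ε ω)
    (hex : IsExactSolution D ε f J ω T b u v) (hb : IsContinuousLoad D T b b')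
    (hm : m.Fits D σ κ h) (hΔt : 0 < Δt)
    (hs : IsStrongCentralScheme D ε f J ω T Δt m b' U V) {k : ℕ} (hk : (k + 1) * Δt ≤ T)
    (w' : W D) {θ : ℝ} (hθ : θ = if k = 0 then 1 / 2 else 1) :
    V (k + 1) - hm.interp hD w' = (V k - hm.interp hD (v (k * Δt))) +
      (Δt * θ) • hm.forceErrorFE hD ε f J ω (U k) (rep (u (k * Δt))) +
      Δt • hm.interp hD (derivWithin v (Icc 0 T) (k * Δt) - Δt⁻¹ • (w' - v (k * Δt))) +
      (-(Δt * (1 - θ))) • hm.interp hD (derivWithin v (Icc 0 T) (k * Δt)) := by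
  have ht : k * Δt ∈ Icc 0 T := ⟨by positivity, by nlinarith⟩
  refine Mesh.FE_ext fun p hp => ?_
  by_cases hpD : p ∈ D
  · simp only [Submodule.coe_sub, Submodule.coe_add, Submodule.coe_smul, Pi.sub_apply, Pi.add_apply,
      Pi.smul_apply, hm.interp_vertex hD _ hp, rep_sub hd hD hL, rep_smul hd hD hL, smul_sub Δt,
      smul_inv_smul₀ hΔt.ne']
    have h1 : (hm.forceErrorFE hD ε f J ω (U k) (rep (u (k * Δt))) : E d → E d) p =
        force ε f J ω (U k : E d → E d) p - force ε f J ω (rep (u (k * Δt))) p :=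
      (Mesh.nodal_vertex _ hp).trans (indicator_of_mem hpD _)
    rw [h1, hs.velocity_eq hΔt hk ⟨hp, hpD⟩, ← hθ,
      hex.motion_rep hd2 hd hD hDb hL hf hε hJ hω hb ht hpD]
    module
  · simp only [hm.FE_eq_zero_of_notMem hD hL _ hpD]

/-- Interpolation is not bounded on `L²`, so a term `h² ‖w‖₂` is added. For this reason the final
bound contains `H²` norms of second time derivatives. -/
theorem norm_toL2_interp_le {C : ℝ} (hD : IsOpen D) (hm : m.Fits D σ κ h) {w : W D}
    (hC : ‖m.toL2 D (hm.interp hD w) - W.toL2 w‖ ≤ C * h ^ 2 * ‖w‖) :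
    ‖m.toL2 D (hm.interp hD w)‖ ≤ ‖W.toL2 w‖ + C * h ^ 2 * ‖w‖ := by
  have := norm_sub_norm_le (m.toL2 D (hm.interp hD w)) (W.toL2 w)
  linarith

theorem strong_defect_le {T Δt C L H Su Sv Ru Rv xu xv : ℝ} (hT : 0 ≤ T) (hΔt : 0 ≤ Δt)
    (hΔ1 : Δt ≤ 1) (hC0 : 0 ≤ C) (hL0 : 0 ≤ L) (hH : 0 ≤ H) (hSu0 : 0 ≤ Su) (hSv0 : 0 ≤ Sv)
    (hRu0 : 0 ≤ Ru) (hRv0 : 0 ≤ Rv) (hu0 : 0 ≤ xu) (hv0 : 0 ≤ xv) :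
    T * (Su / 2 * Δt + C * H * (Ru / 2 * Δt) +
        (L * (H * xu) + (Sv / 2 * Δt + C * H * (Rv / 2 * Δt)))) +
      Δt * (1 / 2) * (Su + C * H * Ru) ≤
      (1 + T) * ((Su + Sv) * Δt + (C + L) * H * (xu + xv + Ru + Rv)) := by
  have i1 : 0 ≤ C * H := by positivity
  have i2 : 0 ≤ L * H := by positivity
  have j1 : Ru / 2 * Δt ≤ Ru / 2 := mul_le_of_le_one_right (by positivity) hΔ1
  have j2 : Rv / 2 * Δt ≤ Rv / 2 := mul_le_of_le_one_right (by positivity) hΔ1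
  have j3 : Ru * Δt ≤ Ru := mul_le_of_le_one_right hRu0 hΔ1
  set R := xu + xv + Ru + Rv with hR
  have k1 : T * (Su / 2 * Δt + C * H * (Ru / 2 * Δt) +
      (L * (H * xu) + (Sv / 2 * Δt + C * H * (Rv / 2 * Δt)))) ≤
      T * ((Su + Sv) * Δt + (C + L) * H * R) := by
    refine mul_le_mul_of_nonneg_left ?_ hT
    have l1 : C * H * (Ru / 2 * Δt) + C * H * (Rv / 2 * Δt) ≤ C * H * R := by
      rw [← mul_add]
      refine mul_le_mul_of_nonneg_left ?_ i1
      linarith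
    have l2 : L * (H * xu) ≤ L * H * R := by
      rw [← mul_assoc]
      refine mul_le_mul_of_nonneg_left ?_ i2
      linarith
    have l3 : Su / 2 * Δt + Sv / 2 * Δt ≤ (Su + Sv) * Δt := by
      rw [← add_mul]
      refine mul_le_mul_of_nonneg_right ?_ hΔt
      linarith
    linarith
  have k2 : Δt * (1 / 2) * (Su + C * H * Ru) ≤ (Su + Sv) * Δt + (C + L) * H * R := by
    have l1 : C * H * (Ru * Δt) ≤ C * H * R := by
      refine mul_le_mul_of_nonneg_left ?_ i1
      linarith
    have l2 : 0 ≤ L * H * R := by positivity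
    have l3 : 0 ≤ C * H * (Ru * Δt) := by positivity
    have l4 : 0 ≤ Su * Δt := by positivity
    have l5 : 0 ≤ Sv * Δt := by positivity
    linarith
  linarith

theorem IsStrongCentralScheme.displacement_step_le (hd : d ≤ 3) (hD : IsOpen D)
    (hL : HasLipschitzBoundary D) (hT : 0 < T)
    (hex : IsExactSolution D ε f J ω T b u v) (hm : m.Fits D σ κ h) (hΔt : 0 < Δt)
    (hs : IsStrongCentralScheme D ε f J ω T Δt m b' U V) {C : ℝ} (hC0 : 0 ≤ C)
    (hC : ∀ w : W D, ‖m.toL2 D (hm.interp hD w) - W.toL2 w‖ ≤ C * h ^ 2 * ‖w‖)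
    {k : ℕ} (hk : (k + 1) * Δt ≤ T) :
    ‖m.toL2 D (U (k + 1) - hm.interp hD (u ((k + 1) * Δt)))‖ ≤
      ‖m.toL2 D (U k - hm.interp hD (u (k * Δt)))‖ +
      Δt * ‖m.toL2 D (V (k + 1) - hm.interp hD (v ((k + 1) * Δt)))‖ +
      Δt * (supL2 T (secondDeriv T u) / 2 * Δt +
        C * h ^ 2 * (supH2 T (secondDeriv T u) / 2 * Δt)) := by
  have hcu := continuousOn_secondDeriv hT hex.smooth_u
  rw [hs.displacement_error_eq hd hD hL hm hΔt hk (u (k * Δt)) (u ((k + 1) * Δt))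
    (v ((k + 1) * Δt)), map_add, map_add, map_smul, map_smul]
  refine norm_add₃_le.trans ?_
  rw [norm_smul, norm_smul, Real.norm_of_nonneg hΔt.le]
  refine add_le_add_right (mul_le_mul_of_nonneg_left ?_ hΔt.le) _
  refine (norm_toL2_interp_le hD hm (hC _)).trans ?_
  rw [← hex.derivWithin_u hT ⟨by positivity, hk⟩]
  have hlt : (k : ℝ) * Δt < (k + 1) * Δt := by nlinarith
  have hk0 : (0 : ℝ) ≤ k * Δt := by positivity
  have t1 := norm_truncation_right_le hT hex.smooth_u (W.toL2L D)
    (fun t ht => norm_le_supL2 hcu ht) hk0 hlt hk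
  have t2 := norm_truncation_right_le hT hex.smooth_u (ContinuousLinearMap.id ℝ (W D))
    (fun t ht => norm_le_supH2 hcu ht) hk0 hlt hk
  rw [show ((k : ℝ) + 1) * Δt - k * Δt = Δt by ring] at t1 t2
  exact add_le_add t1 (mul_le_mul_of_nonneg_left t2 (by positivity))

theorem IsStrongCentralScheme.velocity_step_le (hd2 : 2 ≤ d) (hd : d ≤ 3) (hD : IsOpen D)
    (hDb : Bornology.IsBounded D) (hL : HasLipschitzBoundary D) (hf : IsPotential f) (hε : 0 < ε)
    (hJ : IsInfluence J M) (hω : IsBoundaryFunction D ε ω) (hT : 0 < T)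
    (hex : IsExactSolution D ε f J ω T b u v) (hb : IsContinuousLoad D T b b')
    (hm : m.Fits D σ κ h) (hΔt : 0 < Δt)
    (hs : IsStrongCentralScheme D ε f J ω T Δt m b' U V) {C L : ℝ} (hC0 : 0 ≤ C) (hL0 : 0 ≤ L)
    (hC : ∀ w : W D, ‖m.toL2 D (hm.interp hD w) - W.toL2 w‖ ≤ C * h ^ 2 * ‖w‖)
    (hN : ∀ (z : m.FE) (w : W D), ‖m.toL2 D (hm.forceErrorFE hD ε f J ω z (rep w))‖ ≤
      L * (‖m.toL2 D (z - hm.interp hD w)‖ + h ^ 2 * ‖w‖))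
    {k : ℕ} (hk : (k + 1) * Δt ≤ T) :
    ‖m.toL2 D (V (k + 1) - hm.interp hD (v ((k + 1) * Δt)))‖ ≤
      ‖m.toL2 D (V k - hm.interp hD (v (k * Δt)))‖ +
      Δt * (L * ‖m.toL2 D (U k - hm.interp hD (u (k * Δt)))‖) +
      Δt * (L * (h ^ 2 * supH2 T u) + (supL2 T (secondDeriv T v) / 2 * Δt +
        C * h ^ 2 * (supH2 T (secondDeriv T v) / 2 * Δt))) +
      if k = 0 then Δt * (1 / 2) * (supL2 T (secondDeriv T u) +
        C * h ^ 2 * supH2 T (secondDeriv T u)) else 0 := by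
  have hcu := continuousOn_secondDeriv hT hex.smooth_u
  have hcv := continuousOn_secondDeriv hT hex.smooth_v
  have hlt : (k : ℝ) * Δt < (k + 1) * Δt := by nlinarith
  have hmem : (k : ℝ) * Δt ∈ Icc 0 T := ⟨by positivity, hlt.le.trans hk⟩
  obtain ⟨θ, hθ⟩ : ∃ θ : ℝ, θ = if k = 0 then 1 / 2 else 1 := ⟨_, rfl⟩
  have hθ0 : 0 ≤ θ := by rw [hθ]; split_ifs <;> norm_num
  have hθ1 : θ ≤ 1 := by rw [hθ]; split_ifs <;> norm_num
  have hθ1' : 0 ≤ 1 - θ := by linarith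
  rw [hs.velocity_error_eq hd2 hd hD hDb hL hf hε hJ hω hex hb hm hΔt hk (v ((k + 1) * Δt)) hθ,
    map_add, map_add, map_add, map_smul, map_smul, map_smul]
  refine (norm_add_le _ _).trans (add_le_add (norm_add₃_le.trans ?_) ?_)
  · rw [norm_smul, norm_smul, Real.norm_of_nonneg hΔt.le,
      Real.norm_of_nonneg (mul_nonneg hΔt.le hθ0), add_assoc, add_assoc]
    refine add_le_add_right ?_ _
    have t1 := norm_truncation_left_le hT hex.smooth_v (W.toL2L D)
      (fun t ht => norm_le_supL2 hcv ht) hmem.1 hlt hk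
    have t2 := norm_truncation_left_le hT hex.smooth_v (ContinuousLinearMap.id ℝ (W D))
      (fun t ht => norm_le_supH2 hcv ht) hmem.1 hlt hk
    rw [show ((k : ℝ) + 1) * Δt - k * Δt = Δt by ring] at t1 t2
    have t3 := norm_toL2_interp_le hD hm
      (hC (derivWithin v (Icc 0 T) (k * Δt) - Δt⁻¹ • (v ((k + 1) * Δt) - v (k * Δt))))
    have t4 := mul_le_mul_of_nonneg_left
      (t3.trans (add_le_add t1 (mul_le_mul_of_nonneg_left t2 (by positivity)))) hΔt.le
    have t5 := hN (U k) (u (k * Δt))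
    have t6 := mul_le_mul_of_nonneg_left (mul_le_mul_of_nonneg_left
      (norm_le_supH2 hex.smooth_u.continuousOn hmem) (sq_nonneg h)) hL0
    rw [mul_add] at t5
    have t7 := mul_le_mul (mul_le_of_le_one_right hΔt.le hθ1) (t5.trans (add_le_add_right t6 _))
      (norm_nonneg _) hΔt.le
    refine (add_le_add t7 t4).trans (le_of_eq ?_)
    ring
  · rw [norm_smul, norm_neg, Real.norm_of_nonneg (mul_nonneg hΔt.le hθ1')]
    split_ifs with hk0
    · have hθ2 : θ = 1 / 2 := by rw [hθ, if_pos hk0]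
      rw [hθ2, show (1 : ℝ) - 1 / 2 = 1 / 2 by norm_num]
      refine mul_le_mul_of_nonneg_left ?_ (by positivity)
      refine (norm_toL2_interp_le hD hm (hC _)).trans ?_
      rw [← hex.secondDeriv_u hT hmem]
      exact add_le_add (norm_le_supL2 hcu hmem)
        (mul_le_mul_of_nonneg_left (norm_le_supH2 hcu hmem) (by positivity))
    · have hθ2 : θ = 1 := by rw [hθ, if_neg hk0]
      simp [hθ2]

/-- The nodal errors of the strong central difference scheme. -/
theorem IsStrongCentralScheme.norm_add_norm_le (hd2 : 2 ≤ d) (hd : d ≤ 3) (hD : IsOpen D)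
    (hDb : Bornology.IsBounded D) (hL : HasLipschitzBoundary D) (hf : IsPotential f) (hε : 0 < ε)
    (hJ : IsInfluence J M) (hω : IsBoundaryFunction D ε ω) (hT : 0 < T)
    (hex : IsExactSolution D ε f J ω T b u v) (hb : IsContinuousLoad D T b b')
    (hm : m.Fits D σ κ h) (hΔt : 0 < Δt) (hΔ1 : Δt < 1)
    (hs : IsStrongCentralScheme D ε f J ω T Δt m b' U V) {C L : ℝ} (hC0 : 0 ≤ C) (hL0 : 0 ≤ L)
    (hC : ∀ w : W D, ‖m.toL2 D (hm.interp hD w) - W.toL2 w‖ ≤ C * h ^ 2 * ‖w‖)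
    (hN : ∀ (z : m.FE) (w : W D), ‖m.toL2 D (hm.forceErrorFE hD ε f J ω z (rep w))‖ ≤
      L * (‖m.toL2 D (z - hm.interp hD w)‖ + h ^ 2 * ‖w‖))
    {k : ℕ} (hk : k * Δt ≤ T) :
    ‖m.toL2 D (U k - hm.interp hD (u (k * Δt)))‖ +
      ‖m.toL2 D (V k - hm.interp hD (v (k * Δt)))‖ ≤
      Real.exp (T * (1 + L) * (1 / (1 - Δt))) *
        (‖m.toL2 D (U 0 - hm.interp hD (u 0))‖ + ‖m.toL2 D (V 0 - hm.interp hD (v 0))‖ +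
        (1 + T) / (1 - Δt) * (Ct T u v * Δt + (C + L) * h ^ 2 * solutionH2 T u v)) := by
  have hx := fun (k : ℕ) hk =>
    hs.displacement_step_le hd hD hL hT hex hm hΔt hC0 hC (k := k) hk
  have hy := fun (k : ℕ) hk =>
    hs.velocity_step_le hd2 hd hD hDb hL hf hε hJ hω hT hex hb hm hΔt hC0 hL0 hC hN (k := k) hk
  have hSu0 := supL2_nonneg T (secondDeriv T u)
  have hSv0 := supL2_nonneg T (secondDeriv T v)
  have hRu0 := supH2_nonneg T (secondDeriv T u)
  have hRv0 := supH2_nonneg T (secondDeriv T v)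
  have hu0 := supH2_nonneg T u
  have hv0 := supH2_nonneg T v
  rw [Ct, solutionH2]
  generalize supL2 T (secondDeriv T u) = Su at *
  generalize supL2 T (secondDeriv T v) = Sv at *
  generalize supH2 T (secondDeriv T u) = Ru at *
  generalize supH2 T (secondDeriv T v) = Rv at *
  generalize supH2 T u = xu at *
  generalize supH2 T v = xv at *
  have h1 : 0 < 1 - Δt := by linarith
  refine (add_le_exp_mul_of_step (T := T) (L := L)
    (a := Su / 2 * Δt + C * h ^ 2 * (Ru / 2 * Δt))
    (b := L * (h ^ 2 * xu) + (Sv / 2 * Δt + C * h ^ 2 * (Rv / 2 * Δt)))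
    (Γ := Δt * (1 / 2) * (Su + C * h ^ 2 * Ru))
    (x := fun k => ‖m.toL2 D (U k - hm.interp hD (u (k * Δt)))‖)
    (y := fun k => ‖m.toL2 D (V k - hm.interp hD (v (k * Δt)))‖) hΔt hΔ1
    hL0 (by positivity) (by positivity) (by positivity) (fun _ => norm_nonneg _)
    (fun _ => norm_nonneg _) (fun k hk => ?_) (fun k hk => ?_) hk).trans
    (mul_le_mul_of_nonneg_left ?_ (Real.exp_pos _).le)
  · simp only [Nat.cast_add, Nat.cast_one]
    exact hx k hk
  · simp only [Nat.cast_add, Nat.cast_one]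
    exact hy k hk
  · simp only [Nat.cast_zero, zero_mul]
    refine add_le_add_right ?_ _
    rw [div_mul_eq_mul_div (1 + T)]
    exact div_le_div_of_nonneg_right (strong_defect_le hT.le hΔt.le hΔ1.le hC0 hL0 (sq_nonneg h)
      hSu0 hSv0 hRu0 hRv0 hu0 hv0) h1.le

end StrongScheme

end Peridynamics

namespace Peridynamics

/-! ### The error bounds of the three schemes. -/

section ErrorBounds

variable {d : ℕ} {ε M c : ℝ} {f J : ℝ → ℝ} {ω : E d → ℝ} {D : Set (E d)} {m : Mesh d}
  {σ κ h T Δt : ℝ} {b : ℝ → L2 D} {b' : ℝ → E d → E d} {u v : ℝ → W D} {U V : ℕ → m.FE}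

theorem le_mul_supH2 (hc : 0 ≤ c) (hp : ∀ w : W D, ‖W.toL2 w - m.proj D (W.toL2 w)‖ ≤ c * h ^ 2 * ‖w‖)
    {w : ℝ → W D} (hw : ContinuousOn w (Icc 0 T)) {t : ℝ} (ht : t ∈ Icc 0 T) :
    ‖W.toL2 (w t) - m.proj D (W.toL2 (w t))‖ ≤ c * h ^ 2 * supH2 T w :=
  (hp _).trans (mul_le_mul_of_nonneg_left (norm_le_supH2 hw ht) (by positivity))

theorem consistency (hd : 2 ≤ d) (hf : IsPotential f) (hε : 0 < ε) (hJ : IsInfluence J M)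
    (hω : IsBoundaryFunction D ε ω) (hD : IsOpen D) (hT : 0 < T)
    (hex : IsExactSolution D ε f J ω T b u v) (hc : 0 ≤ c)
    (hp : ∀ w : W D, ‖W.toL2 w - m.proj D (W.toL2 w)‖ ≤ c * h ^ 2 * ‖w‖) (hΔt : 0 < Δt) {k : ℕ}
    (hk : (k + 1) * Δt ≤ T) :
    MemLp (spaceTruncation m ε f J ω Δt u k) 2 (volume.restrict D) ∧
      truncation m ε f J ω T Δt u v k ≤ Ct T u v * Δt + Cs c T f J u * (h ^ 2 / ε ^ 2) := by
  refine ⟨(spaceTruncation_bound hd hf hε hJ hω hD u k).1,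
    (truncation_le hd hf hε hJ hω hD hT hex hΔt hk).trans (add_le_add_right ?_ _)⟩
  have hL := L1_nonneg (d := d) (f := f) hJ
  have h1 := le_mul_supH2 hc hp hex.smooth_u.continuousOn (t := k * Δt)
    ⟨by positivity, by nlinarith⟩
  refine (mul_le_mul_of_nonneg_left h1 (by positivity)).trans (le_of_eq ?_)
  rw [Cs]
  ring

theorem IsWeakSystemScheme.err_le (hd : 2 ≤ d) (hf : IsPotential f) (hε : 0 < ε)
    (hJ : IsInfluence J M) (hω : IsBoundaryFunction D ε ω) (hD : IsOpen D)
    (hL : HasLipschitzBoundary D) (hT : 0 < T) (hex : IsExactSolution D ε f J ω T b u v)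
    (hm : m.Fits D σ κ h) (hc : 0 ≤ c)
    (hp : ∀ w : W D, ‖W.toL2 w - m.proj D (W.toL2 w)‖ ≤ c * h ^ 2 * ‖w‖) (hΔt : 0 < Δt)
    (hΔ1 : Δt < 1) (hs : IsWeakSystemScheme D ε f J ω T Δt m b U V) {k : ℕ} (hk : k * Δt ≤ T) :
    err m Δt u v U V k ≤ Cp c T u v * h ^ 2 +
      Real.exp (T * (1 + L1 d f J / ε ^ 2) * (1 / (1 - Δt))) *
        (initErr m u v U V + T / (1 - Δt) * (Ct T u v * Δt + Cs c T f J u * (h ^ 2 / ε ^ 2))) := by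
  have hkm : (k : ℝ) * Δt ∈ Icc 0 T := ⟨by positivity, hk⟩
  have h1 := norm_add_norm_le_of_velocity_eq hd hf hε hJ hω hD hT hex hΔt hΔ1 zero_le_one le_rfl
    (fun k hk => hs.displacement_eq hΔt hk)
    (fun k hk => by simpa using hs.velocity_eq hd hf hε hJ hω hD hL hm hΔt hk)
    (fun t ht => le_mul_supH2 hc hp hex.smooth_u.continuousOn ht) hk
  refine (Peridynamics.err_le m u v U V k (le_mul_supH2 hc hp hex.smooth_u.continuousOn hkm)
    (le_mul_supH2 hc hp hex.smooth_v.continuousOn hkm)).trans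
    (add_le_add (le_of_eq ?_) (h1.trans (mul_le_mul_of_nonneg_left (add_le_add_right ?_ _)
      (Real.exp_pos _).le)))
  · rw [Cp]; ring
  · rw [div_mul_eq_mul_div T]
    refine div_le_div_of_nonneg_right ?_ (by linarith)
    have hCt : 0 ≤ Ct T u v := add_nonneg (supL2_nonneg _ _) (supL2_nonneg _ _)
    have e : L1 d f J / ε ^ 2 * (c * h ^ 2 * supH2 T u) = Cs c T f J u * (h ^ 2 / ε ^ 2) := by
      rw [Cs]; ring
    rw [e, sub_self, mul_zero, zero_mul, add_zero]
    refine mul_le_mul_of_nonneg_left (add_le_add_left ?_ _) hT.le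
    nlinarith [mul_nonneg hCt hΔt.le]

/-- The truncation errors use only `T/2` of `C_t Δt`, and the shortened first step at most another
half; together they stay within `max T 1`. -/
theorem IsWeakCentralScheme.err_le (hd : 2 ≤ d) (hf : IsPotential f) (hε : 0 < ε)
    (hJ : IsInfluence J M) (hω : IsBoundaryFunction D ε ω) (hD : IsOpen D)
    (hL : HasLipschitzBoundary D) (hT : 0 < T) (hex : IsExactSolution D ε f J ω T b u v)
    (hm : m.Fits D σ κ h) (hc : 0 ≤ c)
    (hp : ∀ w : W D, ‖W.toL2 w - m.proj D (W.toL2 w)‖ ≤ c * h ^ 2 * ‖w‖) (hΔt : 0 < Δt)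
    (hΔ1 : Δt < 1) (hs : IsWeakCentralScheme D ε f J ω T Δt m b U V) {k : ℕ} (hk : k * Δt ≤ T) :
    err m Δt u v U V k ≤ Cp c T u v * h ^ 2 +
      Real.exp (T * (1 + L1 d f J / ε ^ 2) * (1 / (1 - Δt))) *
        (initErr m u v U V + 1 / (1 - Δt) *
          (max T 1 * (Ct T u v * Δt) + T * (Cs c T f J u * (h ^ 2 / ε ^ 2)))) := by
  have hkm : (k : ℝ) * Δt ∈ Icc 0 T := ⟨by positivity, hk⟩
  have h1 := norm_add_norm_le_of_velocity_eq (θ := 1 / 2) hd hf hε hJ hω hD hT hex hΔt hΔ1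
    (by norm_num) (by norm_num) (fun k hk => hs.displacement_eq hΔt hk)
    (fun k hk => hs.velocity_eq hd hf hε hJ hω hD hL hm hΔt hk)
    (fun t ht => le_mul_supH2 hc hp hex.smooth_u.continuousOn ht) hk
  refine (Peridynamics.err_le m u v U V k (le_mul_supH2 hc hp hex.smooth_u.continuousOn hkm)
    (le_mul_supH2 hc hp hex.smooth_v.continuousOn hkm)).trans
    (add_le_add (le_of_eq ?_) (h1.trans (mul_le_mul_of_nonneg_left (add_le_add_right ?_ _)
      (Real.exp_pos _).le)))
  · rw [Cp]; ring
  · rw [one_div_mul_eq_div]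
    refine div_le_div_of_nonneg_right ?_ (by linarith)
    have hv := supL2_nonneg T (secondDeriv T v)
    have hCt : 0 ≤ Ct T u v * Δt :=
      mul_nonneg (add_nonneg (supL2_nonneg _ _) (supL2_nonneg _ _)) hΔt.le
    have hu : supL2 T (secondDeriv T u) * Δt ≤ Ct T u v * Δt :=
      mul_le_mul_of_nonneg_right (by rw [Ct]; linarith) hΔt.le
    have e : L1 d f J / ε ^ 2 * (c * h ^ 2 * supH2 T u) = Cs c T f J u * (h ^ 2 / ε ^ 2) := by
      rw [Cs]; ring
    rw [e]
    have h2 := mul_le_mul_of_nonneg_right (le_max_left T 1) hCt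
    have h3 := mul_le_mul_of_nonneg_right (le_max_right T 1) hCt
    linarith

theorem supH2_add_le_solutionH2 : supH2 T u + supH2 T v ≤ solutionH2 T u v := by
  have := supH2_nonneg T (secondDeriv T u)
  have := supH2_nonneg T (secondDeriv T v)
  rw [solutionH2]; linarith

/-- Here `H` is `h²` and `q` is `h²/ε²`. Of the four multiples of `C₁`, two exchange projection and
interpolation in the initial error, one comes from the interpolated defects, one from the return to
the exact solution; `C₂` comes from the force. -/
theorem strong_error_arith {X X' A R Y q H L N C₁ C₂ su sv I₀ x₀ x : ℝ} (hC₁ : 0 ≤ C₁)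
    (hC₂ : 0 ≤ C₂) (hc : 1 + 4 * C₁ + C₂ ≤ c) (hN : 0 ≤ N) (hu : 0 ≤ su) (hv : 0 ≤ sv)
    (hR : su + sv ≤ R) (hI : 0 ≤ I₀) (hY : 0 ≤ Y) (hH : 0 ≤ H) (hq : H ≤ q)
    (hLq : L * H = C₂ * N * q) (hX' : 0 ≤ X') (hXX : X' ≤ X) (hX1 : 1 ≤ X) (hA : 1 ≤ A)
    (h0 : x₀ ≤ I₀ + 2 * (C₁ * H * su + C₁ * H * sv))
    (hx : x ≤ X' * (x₀ + A * (Y + (C₁ + L) * H * R))) :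
    x + (C₁ * H * su + C₁ * H * sv) ≤ c * (X * (I₀ + A * (Y + (1 + N) * R * q))) := by
  have hR0 : 0 ≤ R := by linarith
  have hq0 : 0 ≤ q := by linarith
  have hC1H : C₁ * H * (su + sv) ≤ C₁ * q * R := by gcongr
  have hRq : 0 ≤ R * q := mul_nonneg hR0 hq0
  have hCq : 0 ≤ C₁ * (R * q) := mul_nonneg hC₁ hRq
  have s1 : x₀ ≤ I₀ + 2 * (C₁ * (R * q)) := by linarith
  have s2 : (C₁ + L) * H * R ≤ C₁ * (R * q) + C₂ * N * (R * q) := by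
    have : C₁ * H * R ≤ C₁ * q * R := by gcongr
    have e : L * H * R = C₂ * N * (R * q) := by rw [hLq]; ring
    linarith
  have hc0 : 1 ≤ c := by linarith
  have s3 : 4 * (C₁ * (R * q)) + C₂ * N * (R * q) ≤ c * ((1 + N) * R * q) := by
    have hN0 : 0 ≤ N * (R * q) := mul_nonneg hN hRq
    have h1 : (4 * C₁) * (R * q) ≤ c * (R * q) := mul_le_mul_of_nonneg_right (by linarith) hRq
    have h2 : C₂ * (N * (R * q)) ≤ c * (N * (R * q)) :=
      mul_le_mul_of_nonneg_right (by linarith) hN0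
    linarith
  have s4 : I₀ ≤ c * I₀ := le_mul_of_one_le_left hI hc0
  have s5 : Y ≤ c * Y := le_mul_of_one_le_left hY hc0
  have hinner : 0 ≤ I₀ + 2 * (C₁ * (R * q)) + A * (Y + (C₁ * (R * q) + C₂ * N * (R * q))) := by
    positivity
  have s6 : X' * (x₀ + A * (Y + (C₁ + L) * H * R)) ≤
      X * (I₀ + 2 * (C₁ * (R * q)) + A * (Y + (C₁ * (R * q) + C₂ * N * (R * q)))) :=
    (mul_le_mul_of_nonneg_left (add_le_add s1 (mul_le_mul_of_nonneg_left
      (add_le_add_right s2 _) (by linarith))) hX').trans (mul_le_mul_of_nonneg_right hXX hinner)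
  have s7 : C₁ * (R * q) ≤ X * (C₁ * (R * q)) := le_mul_of_one_le_left hCq hX1
  have s8 : 3 * (C₁ * (R * q)) ≤ A * (3 * (C₁ * (R * q))) :=
    le_mul_of_one_le_left (by linarith) hA
  have s9 := mul_le_mul_of_nonneg_left (add_le_add s5 s3) (by linarith : 0 ≤ A)
  have s10 : I₀ + 2 * (C₁ * (R * q)) + A * (Y + (C₁ * (R * q) + C₂ * N * (R * q))) +
      C₁ * (R * q) ≤ c * (I₀ + A * (Y + (1 + N) * R * q)) := by linarith
  have s11 := mul_le_mul_of_nonneg_left s10 (by linarith : 0 ≤ X)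
  linarith

theorem IsStrongCentralScheme.err_le (hd2 : 2 ≤ d) (hd : d ≤ 3) (hD : IsOpen D)
    (hDb : Bornology.IsBounded D) (hL : HasLipschitzBoundary D) (hf : IsPotential f) (hε : 0 < ε)
    (hε1 : ε < 1) (hJ : IsInfluence J M) (hω : IsBoundaryFunction D ε ω) (hT : 0 < T)
    (hex : IsExactSolution D ε f J ω T b u v) (hb : IsContinuousLoad D T b b')
    (hm : m.Fits D σ κ h) (hΔt : 0 < Δt) (hΔ1 : Δt < 1)
    (hs : IsStrongCentralScheme D ε f J ω T Δt m b' U V) {C₁ C₂ : ℝ} (hC₁ : 0 ≤ C₁) (hC₂ : 0 ≤ C₂)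
    (hC : ∀ w : W D, ‖m.toL2 D (hm.interp hD w) - W.toL2 w‖ ≤ C₁ * h ^ 2 * ‖w‖)
    (hN : ∀ (z : m.FE) (w : W D), ‖m.toL2 D (hm.forceErrorFE hD ε f J ω z (rep w))‖ ≤
      C₂ * (M * C2 f) / ε ^ 2 * (‖m.toL2 D (z - hm.interp hD w)‖ + h ^ 2 * ‖w‖))
    (hc : 1 + 4 * C₁ + C₂ ≤ c) {k : ℕ} (hk : k * Δt ≤ T) :
    err m Δt u v U V k ≤
      c * (Real.exp (T * (1 + c * (M * C2 f) / ε ^ 2) * (1 / (1 - Δt))) *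
        (initErr m u v U V + (1 + T) / (1 - Δt) *
          (Ct T u v * Δt + (1 + M * C2 f) * solutionH2 T u v * (h ^ 2 / ε ^ 2)))) := by
  have hMC : 0 ≤ M * C2 f := mul_nonneg hJ.bound_nonneg (C2_nonneg f)
  have h1Δ : 0 < 1 - Δt := by linarith
  have hkm : (k : ℝ) * Δt ∈ Icc 0 T := ⟨by positivity, hk⟩
  have h0m : (0 : ℝ) ∈ Icc 0 T := ⟨le_rfl, hT.le⟩
  have hCt : 0 ≤ Ct T u v * Δt :=
    mul_nonneg (add_nonneg (supL2_nonneg _ _) (supL2_nonneg _ _)) hΔt.le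
  have hu0 := supH2_nonneg T u
  have hv0 := supH2_nonneg T v
  have hR := supH2_add_le_solutionH2 (T := T) (u := u) (v := v)
  have hI : 0 ≤ initErr m u v U V := add_nonneg (norm_nonneg _) (norm_nonneg _)
  have hCu : ∀ {w : ℝ → W D}, ContDiffOn ℝ 2 w (Icc 0 T) → ∀ {t : ℝ}, t ∈ Icc 0 T →
      ‖m.toL2 D (hm.interp hD (w t)) - W.toL2 (w t)‖ ≤ C₁ * h ^ 2 * supH2 T w := fun hw _ ht =>
    (hC _).trans (mul_le_mul_of_nonneg_left (norm_le_supH2 hw.continuousOn ht) (by positivity))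
  -- The initial error refers to the projection and the recursion to the interpolant. Both are
  -- within `C₁ h² ‖w‖₂` of the field, hence the factor `2`.
  have init : ∀ {w : ℝ → W D}, ContDiffOn ℝ 2 w (Icc 0 T) → ∀ z : m.FE,
      ‖m.toL2 D (z - hm.interp hD (w 0))‖ ≤
        ‖m.toL2 D z - m.proj D (W.toL2 (w 0))‖ + 2 * (C₁ * h ^ 2 * supH2 T w) := fun {w} hw z => by
    have e : m.toL2 D (z - hm.interp hD (w 0)) = (m.toL2 D z - m.proj D (W.toL2 (w 0))) -
        (W.toL2 (w 0) - m.proj D (W.toL2 (w 0))) -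
        (m.toL2 D (hm.interp hD (w 0)) - W.toL2 (w 0)) := by
      rw [map_sub]; abel
    have h1 := m.norm_sub_proj_le D (W.toL2 (w 0)) (hm.interp hD (w 0))
    have h2 := hCu hw h0m
    rw [e]
    refine (norm_sub_le _ _).trans ?_
    linarith [norm_sub_le (m.toL2 D z - m.proj D (W.toL2 (w 0)))
      (W.toL2 (w 0) - m.proj D (W.toL2 (w 0)))]
  have fin : ∀ {w : ℝ → W D}, ContDiffOn ℝ 2 w (Icc 0 T) → ∀ z : m.FE,
      ‖m.toL2 D z - W.toL2 (w (k * Δt))‖ ≤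
        ‖m.toL2 D (z - hm.interp hD (w (k * Δt)))‖ + C₁ * h ^ 2 * supH2 T w := fun {w} hw z => by
    refine le_trans ?_ (add_le_add_right (hCu hw hkm) _)
    rw [map_sub]
    exact norm_sub_le_norm_sub_add_norm_sub _ _ _
  have key := hs.norm_add_norm_le hd2 hd hD hDb hL hf hε hJ hω hT hex hb hm hΔt hΔ1 hC₁
    (by positivity) hC hN hk
  have iu := init hex.smooth_u (U 0)
  have iv := init hex.smooth_v (V 0)
  have fu := fin hex.smooth_u (U k)
  have fv := fin hex.smooth_v (V k)
  have hexp : Real.exp (T * (1 + C₂ * (M * C2 f) / ε ^ 2) * (1 / (1 - Δt))) ≤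
      Real.exp (T * (1 + c * (M * C2 f) / ε ^ 2) * (1 / (1 - Δt))) := by
    have : C₂ ≤ c := by linarith
    gcongr
  have hX0 := (Real.exp_pos (T * (1 + C₂ * (M * C2 f) / ε ^ 2) * (1 / (1 - Δt)))).le
  have hX1 : 1 ≤ Real.exp (T * (1 + c * (M * C2 f) / ε ^ 2) * (1 / (1 - Δt))) := by
    have : 0 ≤ c := by linarith
    exact Real.one_le_exp (by positivity)
  have hA : 1 ≤ (1 + T) / (1 - Δt) := by
    rw [le_div_iff₀ h1Δ]; linarith
  -- Here `ε < 1` is used, to merge the interpolation errors with the force error.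
  have hq : h ^ 2 ≤ h ^ 2 / ε ^ 2 :=
    le_div_self (sq_nonneg h) (by positivity) (by nlinarith)
  have hLq : C₂ * (M * C2 f) / ε ^ 2 * h ^ 2 = C₂ * (M * C2 f) * (h ^ 2 / ε ^ 2) := by ring
  have hh := sq_nonneg h
  have hX := strong_error_arith hC₁ hC₂ hc hMC hu0 hv0 hR hI hCt (sq_nonneg h) hq hLq hX0 hexp hX1 hA
    (by rw [initErr]; linarith) key
  refine le_trans ?_ hX
  rw [err]
  linarith

end ErrorBounds

/-! ### Order of convergence for vanishing initial error. -/

section Order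

variable {d : ℕ} {ε M T : ℝ} {f J : ℝ → ℝ} {ω : E d → ℝ} {D : Set (E d)} {b : ℝ → L2 D}
  {u v : ℝ → W D}

theorem derivWithin_eq_zero_of_eqOn_zero {w : ℝ → W D} (hw : ∀ t ∈ Icc 0 T, w t = 0) {t : ℝ}
    (ht : t ∈ Icc 0 T) : derivWithin w (Icc 0 T) t = 0 := by
  rw [derivWithin_congr (f := fun _ => (0 : W D)) hw (hw t ht)]
  simp

theorem supH2_eq_zero_of_eqOn_zero {w : ℝ → W D} (hw : ∀ t ∈ Icc 0 T, w t = 0) :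
    supH2 T w = 0 := by
  rw [supH2]
  refine (iSup_congr fun t : Icc (0 : ℝ) T => ?_).trans (Real.iSup_const_zero)
  rw [hw t t.2, norm_zero]

/-- The `H²` size of a solution is controlled by that of its displacement, with a constant that
may depend on the solution. -/
theorem IsExactSolution.exists_solutionH2_le (hT : 0 < T)
    (hex : IsExactSolution D ε f J ω T b u v) :
    ∃ K : ℝ, 0 ≤ K ∧ solutionH2 T u v ≤ K * supH2 T u := by
  have hR : 0 ≤ solutionH2 T u v :=
    (add_nonneg (supH2_nonneg T u) (supH2_nonneg T v)).trans supH2_add_le_solutionH2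
  -- If `sup ‖u‖₂ = 0`, the displacement vanishes on `[0, T]`, and so do `v` and all time
  -- derivatives; otherwise the quotient serves as constant.
  rcases (supH2_nonneg T u).eq_or_lt with h0 | h0
  · have hu : ∀ t ∈ Icc 0 T, u t = 0 := fun t ht =>
      norm_eq_zero.1 (le_antisymm ((norm_le_supH2 hex.smooth_u.continuousOn ht).trans h0.ge)
        (norm_nonneg _))
    have hv : ∀ t ∈ Icc 0 T, v t = 0 := fun t ht => by
      rw [← hex.derivWithin_u hT ht]
      exact derivWithin_eq_zero_of_eqOn_zero hu ht
    have h2 : ∀ {w : ℝ → W D}, (∀ t ∈ Icc 0 T, w t = 0) → supH2 T (secondDeriv T w) = 0 :=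
      fun hw => by
        rw [secondDeriv_eq]
        exact supH2_eq_zero_of_eqOn_zero fun t ht => derivWithin_eq_zero_of_eqOn_zero
          (fun t ht => derivWithin_eq_zero_of_eqOn_zero hw ht) ht
    refine ⟨0, le_rfl, ?_⟩
    rw [solutionH2, h2 hu, h2 hv, supH2_eq_zero_of_eqOn_zero hu, supH2_eq_zero_of_eqOn_zero hv,
      mul_zero, add_zero, add_zero, add_zero]
  · exact ⟨solutionH2 T u v / supH2 T u, div_nonneg hR h0.le, (div_mul_cancel₀ _ h0.ne').ge⟩

/-- The convergence order for vanishing initial error, from the bounds for the three schemes. -/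
theorem IsExactSolution.exists_order_bound (hε : 0 < ε) (hε1 : ε < 1) (hJ : IsInfluence J M)
    (hT : 0 < T) (hex : IsExactSolution D ε f J ω T b u v) (hL1 : 0 < L1 d f J) {c : ℝ} (hc : 0 < c)
    {δ : ℝ} (hδ : δ < 1) :
    ∃ K : ℝ, ∀ h Δt e : ℝ, 0 < Δt → Δt ≤ δ →
      (e ≤ Cp c T u v * h ^ 2 + Real.exp (T * (1 + L1 d f J / ε ^ 2) * (1 / (1 - Δt))) *
          (T / (1 - Δt) * (Ct T u v * Δt + Cs c T f J u * (h ^ 2 / ε ^ 2))) ∨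
        e ≤ Cp c T u v * h ^ 2 + Real.exp (T * (1 + L1 d f J / ε ^ 2) * (1 / (1 - Δt))) *
          (1 / (1 - Δt) * (max T 1 * (Ct T u v * Δt) + T * (Cs c T f J u * (h ^ 2 / ε ^ 2)))) ∨
        e ≤ c * (Real.exp (T * (1 + c * (M * C2 f) / ε ^ 2) * (1 / (1 - Δt))) *
          ((1 + T) / (1 - Δt) *
            (Ct T u v * Δt + (1 + M * C2 f) * solutionH2 T u v * (h ^ 2 / ε ^ 2))))) →
      e ≤ K * (Ct T u v * Δt + Cs c T f J u * (h ^ 2 / ε ^ 2)) := by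
  obtain ⟨K₀, hK₀, hK⟩ := hex.exists_solutionH2_le hT
  have hMC : 0 ≤ M * C2 f := mul_nonneg hJ.bound_nonneg (C2_nonneg f)
  have hCt : 0 ≤ Ct T u v := add_nonneg (supL2_nonneg _ _) (supL2_nonneg _ _)
  have hu0 := supH2_nonneg T u
  have hv0 := supH2_nonneg T v
  have hR := supH2_add_le_solutionH2 (T := T) (u := u) (v := v)
  have hδ' : 0 < 1 - δ := by linarith
  set ρ := 1 / (1 - δ) with hρ
  -- Conversion factor from the `H²` size of the solution to `C_s`; it is finite because `L₁ > 0`.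
  set κ := K₀ / (L1 d f J * c) with hκ
  have hκ0 : 0 ≤ κ := by positivity
  -- The terms cover, in this order, the projection error, the propagated error of both weak
  -- schemes, and the strong scheme; all contributions are nonnegative, so one sum serves the three
  -- cases. The bound `Δt ≤ δ` has replaced `1/(1 - Δt)` by `ρ`.
  refine ⟨c * κ + Real.exp (T * (1 + L1 d f J / ε ^ 2) * ρ) * (ρ * (max T 1 + T)) +
    c * (Real.exp (T * (1 + c * (M * C2 f) / ε ^ 2) * ρ) *
      ((1 + T) * ρ * (1 + (1 + M * C2 f) * κ))), fun h Δt e hΔt hΔδ he => ?_⟩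
  have h1Δ : 0 < 1 - Δt := by linarith
  have hρ0 : 0 ≤ ρ := by positivity
  have hr : 1 / (1 - Δt) ≤ ρ := one_div_le_one_div_of_le hδ' (by linarith)
  have hr0 : 0 ≤ 1 / (1 - Δt) := by positivity
  have hq : h ^ 2 ≤ h ^ 2 / ε ^ 2 :=
    le_div_self (sq_nonneg h) (by positivity) (by nlinarith)
  have hq0 : 0 ≤ h ^ 2 / ε ^ 2 := by positivity
  have hY1 : 0 ≤ Ct T u v * Δt := by positivity
  have hY2 : 0 ≤ Cs c T f J u * (h ^ 2 / ε ^ 2) := by unfold Cs; positivity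
  have hRq : solutionH2 T u v * (h ^ 2 / ε ^ 2) ≤ κ * (Cs c T f J u * (h ^ 2 / ε ^ 2)) := by
    refine (mul_le_mul_of_nonneg_right hK hq0).trans (le_of_eq ?_)
    rw [hκ, Cs]
    field_simp
  set Y := Ct T u v * Δt + Cs c T f J u * (h ^ 2 / ε ^ 2) with hY
  have hY0 : 0 ≤ Y := add_nonneg hY1 hY2
  have hRY : solutionH2 T u v * (h ^ 2 / ε ^ 2) ≤ κ * Y :=
    hRq.trans (mul_le_mul_of_nonneg_left (by linarith) hκ0)
  have hCp : Cp c T u v * h ^ 2 ≤ c * κ * Y := by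
    rw [Cp, mul_assoc, mul_assoc]
    refine mul_le_mul_of_nonneg_left (le_trans ?_ hRY) hc.le
    exact mul_le_mul hR hq (sq_nonneg h) (by linarith)
  have hm0 : 0 ≤ max T 1 := hT.le.trans (le_max_left _ _)
  have hcase : ∀ {a z B : ℝ}, 0 ≤ a → 0 ≤ z → z ≤ ρ * (B * Y) →
      Real.exp (T * (1 + a) * (1 / (1 - Δt))) * z ≤ Real.exp (T * (1 + a) * ρ) * (ρ * B) * Y := by
    intro a z B ha hz hB
    rw [mul_assoc (Real.exp _), mul_assoc ρ]
    refine mul_le_mul ?_ hB hz (Real.exp_pos _).le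
    exact Real.exp_le_exp.2 (mul_le_mul_of_nonneg_left hr (by positivity))
  have hS1 : 0 ≤ c * κ * Y := by positivity
  have hS2 : 0 ≤ Real.exp (T * (1 + L1 d f J / ε ^ 2) * ρ) * (ρ * (max T 1 + T)) * Y := by
    positivity
  have hS3 : 0 ≤ c * (Real.exp (T * (1 + c * (M * C2 f) / ε ^ 2) * ρ) *
      ((1 + T) * ρ * (1 + (1 + M * C2 f) * κ))) * Y := by positivity
  have hTY : 0 ≤ T * Y := by positivity
  have hmY : 0 ≤ max T 1 * Y := by positivity
  rw [add_mul, add_mul]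
  rcases he with he | he | he
  · have := hcase (a := L1 d f J / ε ^ 2) (z := T / (1 - Δt) * Y) (B := max T 1 + T)
      (by positivity) (by positivity) (by
        rw [div_eq_mul_one_div, mul_comm T, mul_assoc]
        exact mul_le_mul hr (by linarith) hTY hρ0)
    linarith
  · have := hcase (a := L1 d f J / ε ^ 2) (B := max T 1 + T)
      (z := 1 / (1 - Δt) * (max T 1 * (Ct T u v * Δt) + T * (Cs c T f J u * (h ^ 2 / ε ^ 2))))
      (by positivity) (by positivity) (by
        refine mul_le_mul hr ?_ (by positivity) hρ0
        rw [add_mul]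
        exact add_le_add (mul_le_mul_of_nonneg_left (by linarith) hm0)
          (mul_le_mul_of_nonneg_left (by linarith) hT.le))
    linarith
  · have hR0 : 0 ≤ solutionH2 T u v := by linarith
    have h1 : Ct T u v * Δt + (1 + M * C2 f) * solutionH2 T u v * (h ^ 2 / ε ^ 2) ≤
        (1 + (1 + M * C2 f) * κ) * Y := by
      have := mul_le_mul_of_nonneg_left hRY (by linarith : 0 ≤ 1 + M * C2 f)
      linarith
    have := hcase (a := c * (M * C2 f) / ε ^ 2) (B := (1 + T) * (1 + (1 + M * C2 f) * κ))
      (z := (1 + T) / (1 - Δt) *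
        (Ct T u v * Δt + (1 + M * C2 f) * solutionH2 T u v * (h ^ 2 / ε ^ 2)))
      (by positivity) (by positivity) (by
        rw [div_eq_mul_one_div, mul_comm (1 + T), mul_assoc _ (1 + T), mul_assoc (1 + T)]
        exact mul_le_mul hr (mul_le_mul_of_nonneg_left h1 (add_nonneg zero_le_one hT.le))
          (by positivity) hρ0)
    have := mul_le_mul_of_nonneg_left this hc.le
    linarith

end Order

end Peridynamics

/-! ### Assembly of the theorem. -/

theorem mainTheorem1 {d : ℕ} (hd : d = 2 ∨ d = 3) (D : Set (E d)) (hD : IsOpen D)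
    (hDb : Bornology.IsBounded D) (hDL : HasLipschitzBoundary D)
    (σ κ : ℝ) (hσ : 0 < σ) (hκ : 0 ≤ κ) :
    ∃ c : ℝ, 0 < c ∧
      ∀ (ε : ℝ), 0 < ε → ε < 1 →
      ∀ (f J : ℝ → ℝ) (M : ℝ) (ω : E d → ℝ), IsPotential f → IsInfluence J M →
        IsBoundaryFunction D ε ω →
      ∀ (T : ℝ), 0 < T →
      ∀ (b : ℝ → L2 D) (u v : ℝ → W D), IsExactSolution D ε f J ω T b u v →
      -- consistency
      (∀ (h Δt : ℝ) (m : Mesh d), 0 < h → 0 < Δt → m.Fits D σ κ h →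
        ∀ k : ℕ, (k + 1) * Δt ≤ T →
          MemLp (spaceTruncation m ε f J ω Δt u k) 2 (volume.restrict D) ∧
          truncation m ε f J ω T Δt u v k ≤ Ct T u v * Δt + Cs c T f J u * (h ^ 2 / ε ^ 2)) ∧
      -- error bound for the weak form, as a first-order system
      (∀ (h Δt : ℝ) (m : Mesh d) (U V : ℕ → m.FE), 0 < h → 0 < Δt → Δt < 1 → m.Fits D σ κ h →
        IsWeakSystemScheme D ε f J ω T Δt m b U V →
        ∀ k : ℕ, k * Δt ≤ T →
          err m Δt u v U V k ≤ Cp c T u v * h ^ 2 +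
            Real.exp (T * (1 + L1 d f J / ε ^ 2) * (1 / (1 - Δt))) *
              (initErr m u v U V +
                T / (1 - Δt) * (Ct T u v * Δt + Cs c T f J u * (h ^ 2 / ε ^ 2)))) ∧
      -- error bound for the weak form, as a central difference scheme
      (∀ (h Δt : ℝ) (m : Mesh d) (U V : ℕ → m.FE), 0 < h → 0 < Δt → Δt < 1 → m.Fits D σ κ h →
        IsWeakCentralScheme D ε f J ω T Δt m b U V →
        ∀ k : ℕ, k * Δt ≤ T →
          err m Δt u v U V k ≤ Cp c T u v * h ^ 2 +
            Real.exp (T * (1 + L1 d f J / ε ^ 2) * (1 / (1 - Δt))) *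
              (initErr m u v U V +
                1 / (1 - Δt) *
                  (max T 1 * (Ct T u v * Δt) + T * (Cs c T f J u * (h ^ 2 / ε ^ 2))))) ∧
      -- the same rate for the strong form
      (∀ (h Δt : ℝ) (m : Mesh d) (U V : ℕ → m.FE) (b' : ℝ → E d → E d),
        0 < h → 0 < Δt → Δt < 1 → m.Fits D σ κ h → IsContinuousLoad D T b b' →
        IsStrongCentralScheme D ε f J ω T Δt m b' U V →
        ∀ k : ℕ, k * Δt ≤ T →
          err m Δt u v U V k ≤
            c * (Real.exp (T * (1 + c * (M * C2 f) / ε ^ 2) * (1 / (1 - Δt))) *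
              (initErr m u v U V +
                (1 + T) / (1 - Δt) *
                  (Ct T u v * Δt + (1 + M * C2 f) * solutionH2 T u v * (h ^ 2 / ε ^ 2))))) ∧
      -- the order of the error when the initial error vanishes
      (0 < L1 d f J → ∀ δ : ℝ, δ < 1 → ∃ K : ℝ,
        ∀ (h Δt : ℝ) (m : Mesh d) (U V : ℕ → m.FE), 0 < h → 0 < Δt → Δt ≤ δ →
          m.Fits D σ κ h →
          (IsWeakSystemScheme D ε f J ω T Δt m b U V ∨
            IsWeakCentralScheme D ε f J ω T Δt m b U V ∨
            ∃ b' : ℝ → E d → E d, IsContinuousLoad D T b b' ∧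
              IsStrongCentralScheme D ε f J ω T Δt m b' U V) →
          initErr m u v U V = 0 →
          ∀ k : ℕ, k * Δt ≤ T →
            err m Δt u v U V k ≤ K * (Ct T u v * Δt + Cs c T f J u * (h ^ 2 / ε ^ 2))) := by
  have hd2 : 2 ≤ d := by omega
  have hd3 : d ≤ 3 := by omega
  obtain ⟨C₁, hC₁, hint⟩ :=
    Mesh.exists_norm_interp_sub_le D κ (by omega : 0 < d) hd3 hD hDb hDL hκ
  obtain ⟨C₂, hC₂, hforce⟩ :=
    Mesh.exists_norm_nodal_forceError_le D σ κ hd2 hd3 hD hDb hDL hσ hκ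
  -- One constant for all parts: it dominates `C₁`, as the projection error requires, and is the
  -- combination needed for the strong scheme. Both `C₁` and `C₂` were fixed before `ε`, the
  -- material data and the mesh.
  obtain ⟨c, hc⟩ : ∃ c, c = 1 + 4 * C₁ + C₂ := ⟨_, rfl⟩
  have hc0 : 0 < c := by rw [hc]; positivity
  have hp : ∀ {m : Mesh d} {h : ℝ}, m.Fits D σ κ h → ∀ w : W D,
      ‖W.toL2 w - m.proj D (W.toL2 w)‖ ≤ c * h ^ 2 * ‖w‖ := fun {m h} hm w => by
    refine (m.norm_sub_proj_le D (W.toL2 w) (hm.interp hD w)).trans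
      ((hint m σ h hm w).trans ?_)
    have : C₁ ≤ c := by linarith
    gcongr
  refine ⟨c, hc0, fun ε hε hε1 f J M ω hf hJ hω T hT b u v hex => ?_⟩
  have hA := fun {h Δt : ℝ} {m : Mesh d} {U V : ℕ → m.FE} (hΔt : 0 < Δt) (hΔ1 : Δt < 1)
    (hm : m.Fits D σ κ h) (hs : IsWeakSystemScheme D ε f J ω T Δt m b U V) {k : ℕ}
    (hk : k * Δt ≤ T) => hs.err_le hd2 hf hε hJ hω hD hDL hT hex hm hc0.le (hp hm) hΔt hΔ1 hk
  have hB := fun {h Δt : ℝ} {m : Mesh d} {U V : ℕ → m.FE} (hΔt : 0 < Δt) (hΔ1 : Δt < 1)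
    (hm : m.Fits D σ κ h) (hs : IsWeakCentralScheme D ε f J ω T Δt m b U V) {k : ℕ}
    (hk : k * Δt ≤ T) => hs.err_le hd2 hf hε hJ hω hD hDL hT hex hm hc0.le (hp hm) hΔt hΔ1 hk
  have hC := fun {h Δt : ℝ} {m : Mesh d} {U V : ℕ → m.FE} {b' : ℝ → E d → E d} (hΔt : 0 < Δt)
    (hΔ1 : Δt < 1) (hm : m.Fits D σ κ h) (hb : IsContinuousLoad D T b b')
    (hs : IsStrongCentralScheme D ε f J ω T Δt m b' U V) {k : ℕ} (hk : k * Δt ≤ T) =>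
    hs.err_le hd2 hd3 hD hDb hDL hf hε hε1 hJ hω hT hex hb hm hΔt hΔ1 hC₁.le hC₂.le
      (hint m σ h hm) (fun z w => by
        have hMC : 0 ≤ M * C2 f := mul_nonneg hJ.bound_nonneg (C2_nonneg f)
        rw [← ENNReal.ofReal_le_ofReal_iff (by positivity), Mesh.ofReal_norm_toL2 hm hD hDL]
        exact hforce m h ε M f J ω hm hf hε hJ hω z w) hc.ge hk
  refine ⟨fun h Δt m _ hΔt hm k hk => consistency hd2 hf hε hJ hω hD hT hex hc0.le (hp hm) hΔt hk,
    fun h Δt m U V _ hΔt hΔ1 hm hs k hk => hA hΔt hΔ1 hm hs hk,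
    fun h Δt m U V _ hΔt hΔ1 hm hs k hk => hB hΔt hΔ1 hm hs hk,
    fun h Δt m U V b' _ hΔt hΔ1 hm hb hs k hk => hC hΔt hΔ1 hm hb hs hk,
    fun hL1 δ hδ => ?_⟩
  obtain ⟨K, hK⟩ := hex.exists_order_bound hε hε1 hJ hT hL1 hc0 hδ
  refine ⟨K, fun h Δt m U V _ hΔt hΔδ hm hs he k hk => hK h Δt _ hΔt hΔδ ?_⟩
  have hΔ1 : Δt < 1 := hΔδ.trans_lt hδ
  rcases hs with hs | hs | ⟨b', hb, hs⟩
  · exact Or.inl (by simpa only [he, zero_add] using hA hΔt hΔ1 hm hs hk)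
  · exact Or.inr (Or.inl (by simpa only [he, zero_add] using hB hΔt hΔ1 hm hs hk))
  · exact Or.inr (Or.inr (by simpa only [he, zero_add] using hC hΔt hΔ1 hm hb hs hk))
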